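/- **Setting.** Let $G_1,G_2$ be Hausdorff, locally compact, second countable topological groups (for example Lie groups, or finite discrete groups) forming a strict 2-group, i.e. a crossed module: there are a continuous homomorphism $t:G_2\to G_1$ and a (jointly) continuous action $\rhd$ of $G_1$ on $G_2$ by automorphisms with $t(u\rhd y)=u\,t(y)\,u^{-1}$ and $t(y)\rhd y'=y\,y'\,y^{-1}$. Let $\mu_1,\mu_2$ be bi-invariant Haar measures on $G_1,G_2$, with $\mu_2$ invariant under the action of $G_1$, and put $V_{G_i}=\mu_i(G_i)\in(0,\infty]$. **Diagrams.** Let $\partial\Delta$ be the boundary of the 5-simplex with vertex set $\{0,\dots,5\}$. A simplex is named by the vertices it omits: the 4-simplex $s$ omits $s$; the tetrahedron $\{s,r\}$, the triangle $\{s,r,q\}$ and the edge $\{s,r,q,p\}$ omit the listed vertices. A diagram is a set $T$ of 4-simplices, $0<|T|=k<6$, glued along all their common tetrahedra; a simplex of the diagram is *bulk* if all the vertices it omits lie in $T$, and *boundary* otherwise. The complement $T^c$ has the same boundary, and $T\leftrightarrow T^c$ is the Pachner move $(1,5)$, $(2,4)$ or $(3,3)$. **Field theory.** The variables of the 4-simplex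 $s$ are $X_{s;r,q}\in G_2$ with $X_{s;q,r}=X_{s;r,q}^{-1}$ (10 of them), $h_{s;r}\in G_1$ (5), $u_{s;r;q}\in G_1$ (20), and $Y_{s;r;q,p}\in G_2$ with $Y_{s;r;p,q}=Y_{s;r;q,p}^{-1}$ (30), for distinct indices $s,r,q,p$. The kinetic kernel of a bulk tetrahedron $\{s,r\}$, $s<r$, and the vertex kernel of a 4-simplex $s$ are $$\mathcal K_{s,r}=\prod_{q\ne s,r}\delta_{G_1}\big(u_{s;r;q}^{-1}u_{r;s;q}\big)\prod_{q<p,\ q,p\neq s,r}\delta_{G_2}\big(Y_{s;r;q,p}^{-1}Y_{r;s;q,p}\big),$$ $$\mathcal V_s=\prod_{a<b}\delta_{G_1}\big(t(X_{s;b,a})h_{s;a}u_{s;a;b}u_{s;b;a}^{-1}h_{s;b}^{-1}\big)\prod_{a<b<c}\delta_{G_2}\big((h_{s;a}\rhd Y_{s;a;c,b})X_{s;a,b}(h_{s;b}\rhd Y_{s;b;a,c})X_{s;b,c}(h_{s;c}\rhd Y_{s;c;b,a})X_{s;c,a}\big),$$ where $a,b,c\neq s$. The boundary data of $T$ are the $u,Y$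 on its boundary tetrahedra, regarded as unordered pairs $\{s,r\}$, so that $T$ and $T^c$ have the same space of boundary data. For a measurable functional $F\ge 0$ of the boundary data the Feynman integral is $$Z_T(F)=\int[dX][dh][du][dY]\ F\prod_{\{s,r\}\subset T}\mathcal K_{s,r}\prod_{s\in T}\mathcal V_s .$$ **Amplitude.** The amplitude $\mathcal A_T(F)$ is the reduced form of this integral: the $u,Y$ on bulk tetrahedra are integrated out, and $h_{s;r},h_{r;s}$ on a bulk tetrahedron are fused to $h_{s,r}=h_{s;r}h_{r;s}^{-1}=h_{r,s}^{-1}$. Its variables are all $X_{s;r,q}$, one $h$ for each bulk and one for each boundary tetrahedron, and the boundary $u,Y$. Its integrand is $F$ times one delta function for each triangle and one for each edge of the diagram. * For a triangle $\{s,r,q\}$, $s<r<q$, it is $\delta_{G_1}(w)$, where $w=c_s\,\ell_{s,r}\,c_r\,\ell_{r,q}\,c_q\,\ell_{q,s}$ with $c_s=t(X_{s;q,r})$, $c_r=t(X_{r;s,q})$, $c_q=t(X_{q;r,s})$ (each being $1$ if the 4-simplex is not in $T$) and, with $z$ the third index, $\ell_{x,y}=h_{x,y}$ if $x,y\in T$;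 $\ell_{x,y}=h_{x;y}u_{x;y;z}$ if only $x\in T$; $\ell_{x,y}=(h_{y;x}u_{y;x;z})^{-1}$ if only $y\in T$; $\ell_{x,y}=1$ otherwise. * For an edge, let $s$ be the smallest of its four indices that lies in $T$, and $r<q<p$ the other three. It carries $\delta_{G_2}\big(S_{r;p,q}X_{s;r,q}S_{q;r,p}X_{s;q,p}S_{p;q,r}X_{s;p,r}\big)$, where $S_{a;b,c}=h_{s;a}\rhd Y_{s;a;b,c}$ if $a\notin T$, and $S_{a;b,c}=h_{s,a}\rhd\big(X_{a;s,b}\,O_{a;b;s,c}\,X_{a;b,c}\,O_{a;c;b,s}\,X_{a;c,s}\big)$ if $a\in T$, with $O_{a;b;x,y}=1$ if $b\in T$ and $O_{a;b;x,y}=h_{a;b}\rhd Y_{a;b;x,y}$ if $b\notin T$. **Delta functions.** An integral of delta functions means the integral against the measure that is the vague limit of the measures obtained by replacing $\delta_{G_i}$ with $\mathbf 1_{U_i}/\mu_i(U_i)$, as the measurable neighbourhoods $U_i$ of $1$ shrink to $1$. Redundant delta functions, which would give factors $\delta(1)$, are omitted: one chooses a reference 4-simplex $m\in T$, and for each bulk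 triangle and each bulk edge of $T$ that is not in $m$ the delta function is omitted (in $Z_T$: the delta function of this triangle or edge in the vertex kernel of its smallest index). For finite groups with counting measures one may also omit nothing. In what follows any of these admissible choices is made, independently for $T$ and for $T^c$. **Theorem.** 1. For every diagram $T$ and every admissible choice the limit measures defining $Z_T$ and $\mathcal A_T$ exist and are unique, and for all measurable $F\ge0$ $$Z_T(F)=V_{G_1}^{\binom k2+\binom k3}\,V_{G_2}^{\binom k3(6-k)+3\binom k4}\,\mathcal A_T(F),\qquad k=|T|.$$ 2. Wherever the arguments of all the delta functions that are kept equal $1$, the arguments of the omitted ones equal $1$ too. 3. For finite groups with counting measures and nothing omitted, $Z_T(F)$ and $\mathcal A_T(F)$ are the sums over all variables of $F$ times the product of Kronecker deltas. 4. The amplitudes are topological invariants: for all admissible choices and all measurable functionals $F\ge0$ of the boundary data (in particular $F=1$), in $[0,\infty]$, * $(1,5)$ move: $\mathcal A_T(F)=V_{G_1}^{4}V_{G_2}^{36}\,\mathcal A_{T^c}(F)$ if $|T|=5$; * $(2,4)$ move: $\mathcal A_T(F)=V_{G_1}^{2}V_{G_2}^{19}\,\mathcal A_{T^c}(F)$ if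 $|T|=4$; * $(3,3)$ move: $\mathcal A_T(F)=\mathcal A_{T^c}(F)$ if $|T|=3$. -/

import Mathlib

open MeasureTheory Filter Topology

noncomputable section

namespace TwoGFT

/-- A strict 2-group, presented as a crossed module. -/
structure CrossedModule (G₁ G₂ : Type*) [Group G₁] [Group G₂] where
  /-- the homomorphism `t` -/
  t : G₂ →* G₁
  /-- the action of `G₁` on `G₂` by automorphisms -/
  act : G₁ →* MulAut G₂
  equivariant : ∀ (u : G₁) (y : G₂), t (act u y) = u * t y * u⁻¹
  peiffer : ∀ y y' : G₂, act (t y) y' = y * y' * y⁻¹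

/-! ### Combinatorics

All triangulations are subcomplexes of the boundary of the 5-simplex with vertex set `Fin 6`.
A simplex is named by the set of vertices that it *omits*: the 4-simplex `s` omits `s`, the
tetrahedron `{s, r}` omits `s` and `r`, the triangle `{s, r, q}` and the edge `{s, r, q, p}` likewise.
So the tetrahedra of the 4-simplex `s` are labelled by the five indices `r ≠ s`, and its tetrahedra
`r` and `q` share the triangle `{s, r, q}`.

A diagram is a set `T` of 4-simplices, `0 < #T < 6`, glued along all common tetrahedra; this is a
4-ball, and the complement of `T` is the other side of a Pachner move. -/

/-- Pairs (4-simplex of `T`, tetrahedron of it). -/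
def allTets (T : Finset (Fin 6)) : Finset (Fin 6 × Fin 6) :=
  Finset.univ.filter fun p => p.1 ∈ T ∧ p.2 ≠ p.1

/-- The boundary tetrahedra of `T`, each lying in a unique 4-simplex of `T`. -/
def boundaryTets (T : Finset (Fin 6)) : Finset (Fin 6 × Fin 6) :=
  Finset.univ.filter fun p => p.1 ∈ T ∧ p.2 ∉ T

/-- The bulk tetrahedra of `T`, that is, the propagators of the diagram. -/
def bulkTets (T : Finset (Fin 6)) : Finset (Fin 6 × Fin 6) :=
  Finset.univ.filter fun p => p.1 ∈ T ∧ p.2 ∈ T ∧ p.1 < p.2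

/-- Labels of the fused gauge wedges `X_{s;r,q}` (4-simplex `s`, tetrahedra `r < q` of it). -/
abbrev FaceIx (T : Finset (Fin 6)) : Type :=
  {p : Fin 6 × Fin 6 × Fin 6 // p.1 ∈ T ∧ p.2.1 ≠ p.1 ∧ p.2.2 ≠ p.1 ∧ p.2.1 < p.2.2}

/-- Labels of links attached to a family `A` of tetrahedra. -/
abbrev TetIx (A : Finset (Fin 6 × Fin 6)) : Type := {p : Fin 6 × Fin 6 // p ∈ A}

/-- Labels of the variables `u_{s;r;q}`: tetrahedron `(s, r) ∈ A`, and its triangle `{s, r, q}`. -/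
abbrev TriIx (A : Finset (Fin 6 × Fin 6)) : Type :=
  {p : Fin 6 × Fin 6 × Fin 6 // (p.1, p.2.1) ∈ A ∧ p.2.2 ≠ p.1 ∧ p.2.2 ≠ p.2.1}

/-- Labels of the variables `Y_{s;r;q,p}`: tetrahedron `(s, r) ∈ A`, and two triangles
`{s, r, q}`, `{s, r, p}` of it, `q < p`. -/
abbrev EdgeIx (A : Finset (Fin 6 × Fin 6)) : Type :=
  {p : Fin 6 × Fin 6 × Fin 6 × Fin 6 // (p.1, p.2.1) ∈ A ∧
    p.2.2.1 ≠ p.1 ∧ p.2.2.1 ≠ p.2.1 ∧ p.2.2.2 ≠ p.1 ∧ p.2.2.2 ≠ p.2.1 ∧ p.2.2.1 < p.2.2.2}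

section Variables

variable {G₁ G₂ : Type*} [Group G₁] [Group G₂]

/-- `X_{s;r,q}` for all `r ≠ q`, with `X_{s;q,r} = X_{s;r,q}⁻¹`. -/
def wedgeX {T : Finset (Fin 6)} (x : FaceIx T → G₂) (s r q : Fin 6) : G₂ :=
  if H : s ∈ T ∧ r ≠ s ∧ q ≠ s ∧ r < q then x ⟨(s, r, q), H⟩
  else if H : s ∈ T ∧ q ≠ s ∧ r ≠ s ∧ q < r then (x ⟨(s, q, r), H⟩)⁻¹
  else 1

/-- `h_{s;r}`. -/
def linkH {A : Finset (Fin 6 × Fin 6)} (h : TetIx A → G₁) (s r : Fin 6) : G₁ :=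
  if H : (s, r) ∈ A then h ⟨(s, r), H⟩ else 1

/-- The composed bulk link `h_{s,r}`, with `h_{r,s} = h_{s,r}⁻¹`. -/
def bulkH {T : Finset (Fin 6)} (h : TetIx (bulkTets T) → G₁) (s r : Fin 6) : G₁ :=
  linkH h s r * (linkH h r s)⁻¹

/-- `u_{s;r;q}`. -/
def linkU {A : Finset (Fin 6 × Fin 6)} (u : TriIx A → G₁) (s r q : Fin 6) : G₁ :=
  if H : (s, r) ∈ A ∧ q ≠ s ∧ q ≠ r then u ⟨(s, r, q), H⟩ else 1

/-- `Y_{s;r;q,p}` for all `q ≠ p`, with `Y_{s;r;p,q} = Y_{s;r;q,p}⁻¹`. -/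
def wedgeY {A : Finset (Fin 6 × Fin 6)} (y : EdgeIx A → G₂) (s r q p : Fin 6) : G₂ :=
  if H : (s, r) ∈ A ∧ q ≠ s ∧ q ≠ r ∧ p ≠ s ∧ p ≠ r ∧ q < p then y ⟨(s, r, q, p), H⟩
  else if H : (s, r) ∈ A ∧ p ≠ s ∧ p ≠ r ∧ q ≠ s ∧ q ≠ r ∧ p < q then (y ⟨(s, r, p, q), H⟩)⁻¹
  else 1

end Variables

/-- Data `(u, Y)` on a family of tetrahedra: the tetrahedron omitting `s, r`, its triangle omitting
also `q`, and its edge omitting also `q, p`. -/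
abbrev BoundaryData (G₁ G₂ : Type*) : Type _ :=
  (Fin 6 → Fin 6 → Fin 6 → G₁) × (Fin 6 → Fin 6 → Fin 6 → Fin 6 → G₂)

/-- Restriction of `(u, Y)` to the boundary tetrahedra of `T`. A boundary tetrahedron is an
unordered pair `{s, r}`, so that `T` and its complement have the same boundary data; the entries
that do not belong to a boundary tetrahedron are set to `1`. -/
def restrictBoundary {G₁ G₂ : Type*} [Group G₁] [Group G₂] (T : Finset (Fin 6))
    (u : Fin 6 → Fin 6 → Fin 6 → G₁) (Y : Fin 6 → Fin 6 → Fin 6 → Fin 6 → G₂) :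
    BoundaryData G₁ G₂ :=
  (fun s r q => if s ∈ T ∧ r ∉ T then u s r q else if r ∈ T ∧ s ∉ T then u r s q else 1,
   fun s r q p => if s ∈ T ∧ r ∉ T then Y s r q p else if r ∈ T ∧ s ∉ T then Y r s q p else 1)

/-! ### Redundant delta functions

For Lie groups the redundant delta functions, which would contribute `δ(1)`, are omitted. Given a
reference 4-simplex `m ∈ T`, these are the ones of the bulk triangles and of the bulk edges that are
not in `m`. With `m = none` no delta function is omitted. -/

/-- The triangle or edge omitting the vertices in `S` is a bulk one and does not lie in the
reference 4-simplex. -/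
def Redundant (T : Finset (Fin 6)) (m : Option (Fin 6)) (S : Finset (Fin 6)) : Prop :=
  S ⊆ T ∧ ∃ i, m = some i ∧ i ∉ S

instance (T : Finset (Fin 6)) (m : Option (Fin 6)) (S : Finset (Fin 6)) :
    Decidable (Redundant T m S) := by
  unfold Redundant; infer_instance

/-- The triangles of the 4-simplex `s` whose delta function is kept in the vertex kernel of `s`;
these are all ten, except that for each redundant bulk triangle `{s, a, b}` the delta function is
omitted in one of the three 4-simplices around it, the first one. -/
def vertexLinks (T : Finset (Fin 6)) (m : Option (Fin 6)) (s : Fin 6) :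
    Finset (Fin 6 × Fin 6) :=
  Finset.univ.filter fun p => p.1 ≠ s ∧ p.2 ≠ s ∧ p.1 < p.2 ∧
    ¬ (Redundant T m {s, p.1, p.2} ∧ s < p.1)

/-- The edges of the 4-simplex `s` whose delta function is kept in the vertex kernel of `s`;
these are all ten, except that for each redundant bulk edge `{s, a, b, c}` the delta function is
omitted in one of the four 4-simplices around it, the first one. -/
def vertexWedges (T : Finset (Fin 6)) (m : Option (Fin 6)) (s : Fin 6) :
    Finset (Fin 6 × Fin 6 × Fin 6) :=
  Finset.univ.filter fun p => p.1 ≠ s ∧ p.2.1 ≠ s ∧ p.2.2 ≠ s ∧ p.1 < p.2.1 ∧ p.2.1 < p.2.2 ∧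
    ¬ (Redundant T m {s, p.1, p.2.1, p.2.2} ∧ s < p.1)

section Kernels

variable {G₁ G₂ : Type*} [Group G₁] [Group G₂] (𝒢 : CrossedModule G₁ G₂)

/-- Argument of the `G₁` delta function of the 4-simplex `s` at the triangle shared by the
tetrahedra `a` and `b`: `t(X_{b,a}) h_a u_{a;b} u_{b;a}⁻¹ h_b⁻¹`. -/
def vertexLinkWord (X : Fin 6 → Fin 6 → Fin 6 → G₂) (h : Fin 6 → Fin 6 → G₁)
    (u : Fin 6 → Fin 6 → Fin 6 → G₁) (s a b : Fin 6) : G₁ :=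
  𝒢.t (X s b a) * h s a * u s a b * (u s b a)⁻¹ * (h s b)⁻¹

/-- Argument of the `G₂` delta function of the 4-simplex `s` at the edge shared by the tetrahedra
`a`, `b`, `c`:
`(h_a ▷ Y_{a;c,b}) X_{a,b} (h_b ▷ Y_{b;a,c}) X_{b,c} (h_c ▷ Y_{c;b,a}) X_{c,a}`. -/
def vertexWedgeWord (X : Fin 6 → Fin 6 → Fin 6 → G₂) (h : Fin 6 → Fin 6 → G₁)
    (Y : Fin 6 → Fin 6 → Fin 6 → Fin 6 → G₂) (s a b c : Fin 6) : G₂ :=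
  𝒢.act (h s a) (Y s a c b) * X s a b * 𝒢.act (h s b) (Y s b a c) * X s b c *
    𝒢.act (h s c) (Y s c b a) * X s c a

/-- The kernel of the interaction term, for delta functions `δ₁`, `δ₂`. -/
def vertexKernel (T : Finset (Fin 6)) (m : Option (Fin 6)) (δ₁ : G₁ → ℝ) (δ₂ : G₂ → ℝ)
    (X : Fin 6 → Fin 6 → Fin 6 → G₂) (h : Fin 6 → Fin 6 → G₁)
    (u : Fin 6 → Fin 6 → Fin 6 → G₁) (Y : Fin 6 → Fin 6 → Fin 6 → Fin 6 → G₂) (s : Fin 6) : ℝ :=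
  (∏ p ∈ vertexLinks T m s, δ₁ (vertexLinkWord 𝒢 X h u s p.1 p.2)) *
    ∏ p ∈ vertexWedges T m s, δ₂ (vertexWedgeWord 𝒢 X h Y s p.1 p.2.1 p.2.2)

/-- The kinetic kernel, identifying the data of the tetrahedron `{s, r}` as seen from the
4-simplices `s` and `r`. -/
def propagatorKernel (δ₁ : G₁ → ℝ) (δ₂ : G₂ → ℝ)
    (u : Fin 6 → Fin 6 → Fin 6 → G₁) (Y : Fin 6 → Fin 6 → Fin 6 → Fin 6 → G₂) (s r : Fin 6) : ℝ :=
  (∏ q ∈ Finset.univ.filter (fun q : Fin 6 => q ≠ s ∧ q ≠ r), δ₁ ((u s r q)⁻¹ * u r s q)) *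
    ∏ p ∈ Finset.univ.filter (fun p : Fin 6 × Fin 6 =>
        p.1 ≠ s ∧ p.1 ≠ r ∧ p.2 ≠ s ∧ p.2 ≠ r ∧ p.1 < p.2),
      δ₂ ((Y s r p.1 p.2)⁻¹ * Y r s p.1 p.2)

/-- All variables `(X, h, u, Y)` of a Feynman diagram, for each 4-simplex 10 + 5 + 20 + 30. -/
abbrev FeynmanConfig (G₁ G₂ : Type*) (T : Finset (Fin 6)) : Type _ :=
  (FaceIx T → G₂) × (TetIx (allTets T) → G₁) × (TriIx (allTets T) → G₁) ×
    (EdgeIx (allTets T) → G₂)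

/-- The integrand of the Feynman diagram: the product of the kinetic kernels over the bulk
tetrahedra and of the vertex kernels over the 4-simplices. -/
def feynmanDensity (T : Finset (Fin 6)) (m : Option (Fin 6)) (δ₁ : G₁ → ℝ) (δ₂ : G₂ → ℝ)
    (c : FeynmanConfig G₁ G₂ T) : ℝ :=
  (∏ p ∈ bulkTets T, propagatorKernel δ₁ δ₂ (linkU c.2.2.1) (wedgeY c.2.2.2) p.1 p.2) *
    ∏ s ∈ T, vertexKernel 𝒢 T m δ₁ δ₂ (wedgeX c.1) (linkH c.2.1) (linkU c.2.2.1)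
      (wedgeY c.2.2.2) s

/-- The boundary data of a configuration. -/
def feynmanBoundary {T : Finset (Fin 6)} (c : FeynmanConfig G₁ G₂ T) : BoundaryData G₁ G₂ :=
  restrictBoundary T (linkU c.2.2.1) (wedgeY c.2.2.2)

/-! ### The reduced form of the amplitudes

The `u`, `Y` on bulk tetrahedra are integrated out, and the half links `h_{s;r}`, `h_{r;s}` of a bulk
tetrahedron are fused to `h_{s,r} = h_{s;r} h_{r;s}⁻¹`. One delta function remains for each triangle
and for each edge. -/

/-- The variables: all `X_{s;r,q}`; one link for each bulk tetrahedron and one for each boundary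
tetrahedron; `u` and `Y` on boundary tetrahedra. -/
abbrev ReducedConfig (G₁ G₂ : Type*) (T : Finset (Fin 6)) : Type _ :=
  (FaceIx T → G₂) × (TetIx (bulkTets T) → G₁) × (TetIx (boundaryTets T) → G₁) ×
    (TriIx (boundaryTets T) → G₁) × (EdgeIx (boundaryTets T) → G₂)

variable (T : Finset (Fin 6)) (c : ReducedConfig G₁ G₂ T)

/-- The part of the closed path around a triangle inside the 4-simplex `s`, between the
tetrahedra `q` and `r`. -/
def cornerLink (s r q : Fin 6) : G₁ := if s ∈ T then 𝒢.t (wedgeX c.1 s q r) else 1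

/-- The part of the closed path around the triangle `{s, r, q}` that goes from the 4-simplex `s` to
`r`. If only one of them is in `T`, the path ends at, or starts from, the triangle. -/
def crossLink (s r q : Fin 6) : G₁ :=
  if s ∈ T ∧ r ∈ T then bulkH c.2.1 s r
  else if s ∈ T then linkH c.2.2.1 s r * linkU c.2.2.2.1 s r q
  else if r ∈ T then (linkH c.2.2.1 r s * linkU c.2.2.2.1 r s q)⁻¹
  else 1

/-- The argument of the `G₁` delta function of the triangle `{s, r, q}`. If the triangle is in three
4-simplices of `T`, this is `t(X_{s;q,r}) h_{s,r} t(X_{r;s,q}) h_{r,q} t(X_{q;r,s}) h_{q,s}`. -/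
def triangleWord (s r q : Fin 6) : G₁ :=
  cornerLink 𝒢 T c s r q * crossLink T c s r q * cornerLink 𝒢 T c r q s * crossLink T c r q s *
    cornerLink 𝒢 T c q s r * crossLink T c q s r

/-- `h_{s;r} ▷ Y_{s;r;q,p}`, if the tetrahedron `{s, r}` is on the boundary; the contributions of
bulk tetrahedra have dropped out. -/
def outerWedge (s r q p : Fin 6) : G₂ :=
  if r ∈ T then 1 else 𝒢.act (linkH c.2.2.1 s r) (wedgeY c.2.2.2.2 s r q p)

/-- The surface attached to the 4-simplex `s` at its tetrahedron `r`, for the edge `{s, r, q, p}`: the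
boundary wedge `h_{s;r} ▷ Y_{s;r;p,q}`, or, if `r ∈ T`, the wedges of the 4-simplex `r` that
replace it. -/
def sideWedge (s r p q : Fin 6) : G₂ :=
  if r ∈ T then
    𝒢.act (bulkH c.2.1 s r)
      (wedgeX c.1 r s p * outerWedge 𝒢 T c r p s q * wedgeX c.1 r p q *
        outerWedge 𝒢 T c r q p s * wedgeX c.1 r q s)
  else outerWedge 𝒢 T c s r p q

/-- The argument of the `G₂` delta function of the edge `{s, r, q, p}`, based at the 4-simplex
`s`. -/
def edgeWord (s r q p : Fin 6) : G₂ :=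
  sideWedge 𝒢 T c s r p q * wedgeX c.1 s r q * sideWedge 𝒢 T c s q r p * wedgeX c.1 s q p *
    sideWedge 𝒢 T c s p q r * wedgeX c.1 s p r

/-- The triangles of the diagram whose delta function is kept. -/
def keptTriangles (T : Finset (Fin 6)) (m : Option (Fin 6)) : Finset (Fin 6 × Fin 6 × Fin 6) :=
  Finset.univ.filter fun p => p.1 < p.2.1 ∧ p.2.1 < p.2.2 ∧
    (p.1 ∈ T ∨ p.2.1 ∈ T ∨ p.2.2 ∈ T) ∧ ¬ Redundant T m {p.1, p.2.1, p.2.2}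

/-- The edges of the diagram whose delta function is kept. The first entry is the base, the first
of the 4-simplices of `T` around the edge. -/
def keptEdges (T : Finset (Fin 6)) (m : Option (Fin 6)) :
    Finset (Fin 6 × Fin 6 × Fin 6 × Fin 6) :=
  Finset.univ.filter fun p => p.2.1 < p.2.2.1 ∧ p.2.2.1 < p.2.2.2 ∧
    p.2.1 ≠ p.1 ∧ p.2.2.1 ≠ p.1 ∧ p.2.2.2 ≠ p.1 ∧
    p.1 ∈ T ∧ (p.2.1 ∈ T → p.1 < p.2.1) ∧ (p.2.2.1 ∈ T → p.1 < p.2.2.1) ∧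
    (p.2.2.2 ∈ T → p.1 < p.2.2.2) ∧ ¬ Redundant T m {p.1, p.2.1, p.2.2.1, p.2.2.2}

/-- The integrand of the reduced amplitude. -/
def reducedDensity (m : Option (Fin 6)) (δ₁ : G₁ → ℝ) (δ₂ : G₂ → ℝ)
    (c : ReducedConfig G₁ G₂ T) : ℝ :=
  (∏ p ∈ keptTriangles T m, δ₁ (triangleWord 𝒢 T c p.1 p.2.1 p.2.2)) *
    ∏ p ∈ keptEdges T m, δ₂ (edgeWord 𝒢 T c p.1 p.2.1 p.2.2.1 p.2.2.2)

/-- The boundary data of a configuration. -/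
def reducedBoundary {T : Finset (Fin 6)} (c : ReducedConfig G₁ G₂ T) : BoundaryData G₁ G₂ :=
  restrictBoundary T (linkU c.2.2.2.1) (wedgeY c.2.2.2.2)

end Kernels

/-! ### Integrals with delta functions -/

/-- The Kronecker delta at `1`. -/
def kronecker {G : Type*} [Group G] (g : G) : ℝ := Set.indicator {1} (fun _ => 1) g

section Delta

variable {G : Type*} [Group G] [TopologicalSpace G] [MeasurableSpace G]

/-- The normalised indicator function of `U`, an approximation of the delta function at `1` when
`U` is a small neighbourhood of `1`. -/
def nascentDelta (μ : Measure G) (U : Set G) (g : G) : ℝ :=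
  U.indicator (fun _ => (μ.real U)⁻¹) g

variable (G) in
/-- Measurable neighbourhoods of `1`, shrinking to `1`. -/
def shrinking : Filter (Set G) :=
  (𝓝 (1 : G)).smallSets ⊓ 𝓟 {U | U ∈ 𝓝 (1 : G) ∧ MeasurableSet U}

end Delta

section Amplitudes

variable {G₁ G₂ : Type*} [Group G₁] [TopologicalSpace G₁] [MeasurableSpace G₁]
  [Group G₂] [TopologicalSpace G₂] [MeasurableSpace G₂] (μ₁ : Measure G₁) (μ₂ : Measure G₂)

/-- `ν` is the measure `ρ(δ_{G₁}, δ_{G₂}) dx`: the vague limit of `ρ(δ₁, δ₂) dx` as `δ₁`, `δ₂` tend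
to the delta functions at `1` with respect to `μ₁`, `μ₂`. -/
def IsDeltaMeasure {M : Type*} [TopologicalSpace M] [MeasurableSpace M] (vol : Measure M)
    (ρ : (G₁ → ℝ) → (G₂ → ℝ) → M → ℝ) (ν : Measure M) : Prop :=
  IsFiniteMeasureOnCompacts ν ∧
    ∀ φ : M → ℝ, Continuous φ → HasCompactSupport φ →
      Tendsto
        (fun U : Set G₁ × Set G₂ =>
          ∫ x, φ x * ρ (nascentDelta μ₁ U.1) (nascentDelta μ₂ U.2) x ∂vol)
        (shrinking G₁ ×ˢ shrinking G₂) (𝓝 (∫ x, φ x ∂ν))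

open Classical in
/-- The measure `ρ(δ_{G₁}, δ_{G₂}) dx` (zero, if there is none). -/
def deltaMeasure {M : Type*} [TopologicalSpace M] [MeasurableSpace M] (vol : Measure M)
    (ρ : (G₁ → ℝ) → (G₂ → ℝ) → M → ℝ) : Measure M :=
  if h : ∃ ν, IsDeltaMeasure μ₁ μ₂ vol ρ ν then h.choose else 0

/-- The product measure `[dX][dh][du][dY]`. -/
def feynmanVolume (T : Finset (Fin 6)) : Measure (FeynmanConfig G₁ G₂ T) :=
  (Measure.pi fun _ => μ₂).prod ((Measure.pi fun _ => μ₁).prod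
    ((Measure.pi fun _ => μ₁).prod (Measure.pi fun _ => μ₂)))

/-- The product measure `[dX][dh][du][dY]` on the reduced variables. -/
def reducedVolume (T : Finset (Fin 6)) : Measure (ReducedConfig G₁ G₂ T) :=
  (Measure.pi fun _ => μ₂).prod ((Measure.pi fun _ => μ₁).prod ((Measure.pi fun _ => μ₁).prod
    ((Measure.pi fun _ => μ₁).prod (Measure.pi fun _ => μ₂))))

variable (𝒢 : CrossedModule G₁ G₂) (T : Finset (Fin 6)) (m : Option (Fin 6))

/-- The Feynman integral of the diagram `T` with a functional `F` of the boundary data inserted: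
`∫ [dX][dh][du][dY] ∏ 𝒦 ∏ 𝒱 · F`. -/
def feynmanIntegral (F : BoundaryData G₁ G₂ → ENNReal) : ENNReal :=
  ∫⁻ c, F (feynmanBoundary c)
    ∂(deltaMeasure μ₁ μ₂ (feynmanVolume μ₁ μ₂ T) (feynmanDensity 𝒢 T m))

/-- The amplitude `𝒜_T` of the diagram `T` with a functional `F` of the boundary data inserted. -/
def amplitude (F : BoundaryData G₁ G₂ → ENNReal) : ENNReal :=
  ∫⁻ c, F (reducedBoundary c)
    ∂(deltaMeasure μ₁ μ₂ (reducedVolume μ₁ μ₂ T) (reducedDensity 𝒢 T m))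

/-- Either the redundant delta functions are omitted with respect to a 4-simplex of the diagram, or
the groups are finite with counting measures and no delta function is omitted. -/
def Admissible (T : Finset (Fin 6)) : Option (Fin 6) → Prop
  | some i => i ∈ T
  | none => Finite G₁ ∧ Finite G₂ ∧ μ₁ = Measure.count ∧ μ₂ = Measure.count

end Amplitudes

end TwoGFT

end

set_option linter.unusedSectionVars false
set_option linter.style.haveILetI false

noncomputable section

namespace TwoGFT

/-! ### Haar measures on unimodular groups -/

/-! The proof rests on good coordinates. For a reference 4-simplex `m ∈ T` there is a
measure-preserving homeomorphism from the space of variables to a product of copies of `G₁` and `G₂`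
under which the arguments of all kept delta functions are coordinates (`exists_redChart`,
`exists_feynChart`). In such a chart the vague limit exists and is the product measure with point
masses at `1` in these coordinates (`isDeltaMeasure_of_chart`); it is unique because a Radon measure
is determined by compactly supported continuous functions. Two such integrals are compared by
matching the coordinates that matter for the boundary data; every unconstrained coordinate without a
partner contributes a factor of total volume (`lintegral_chart_eq`).

The charts are triangular (`isVolumeHomeo_of_triangular`). Each delta function is assigned one
variable that occurs in its argument exactly once. All other variables in the argument get lower
rank, so the argument is, with these as parameters, a translate, inverse or `G₁`-image of that
variable, and all of these maps preserve Haar measure.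

The geometry is carried by the crossed module. Transport all surfaces to `m` along the links
`h_{m,s}`. The triangles `{m,r,q}` say that the remaining bulk transports are `t` of explicit
elements `eta r q` of `G₂`; by the Peiffer identity they then act by conjugation, and an edge
condition becomes an equation between words in `G₂`. Each bulk triangle has a surface word `loop`.
It is trivial by construction if the triangle contains `m`, and the kept edge `{m,s,r,q}` makes it
trivial for `{s,r,q}` (`flat_of_triFlat`). Conversely, triviality of all loops gives every bulk
triangle and bulk edge condition, so the omitted delta functions have argument `1` on the support of
the others.

For the invariance, the conditions on boundary triangles and boundary edges are rewritten with the
surfaces `theta`. Each `theta` is attached to a triangle with vertices on both sides of the cut, and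
it absorbs the bulk wedges. In this form the equations do not distinguish the sides of the cut
(`Flat.rimU_eq`, `Flat.edge_three`, `Flat.edge_two`, collected in `Flat.rimFlat`). They are solved
for some of the `u`, `Y` in terms of independent variables, which are coordinates of the chart.
Hence the amplitudes of `T` and of its complement are powers of the volumes times one and the same
integral (`amplitude_eq_rim`). The remaining free coordinates are the `k - 1` links at `m` and the
wedges `X` of rank zero; counting them for `k` and `6 - k` gives the exponents of the moves.

For the Feynman integral, the vertex and kinetic delta functions around a triangle or an edge
telescope: granted all but one of them, the last vertex condition is the condition of the reduced
amplitude (`Glued.triangleWord`, `Glued.edgeWord_iff`). The charts of the two integrals therefore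
match on the support (`redCoord_fuse`), and the unmatched free variables are counted. For finite
groups and counting measures the approximate delta functions are eventually Kronecker deltas, whose
product is unchanged when redundant factors are added. -/

lemma regular_of_secondCountable {X : Type*} [TopologicalSpace X] [T2Space X]
    [LocallyCompactSpace X] [SecondCountableTopology X] [MeasurableSpace X] [BorelSpace X]
    (μ : Measure X) [IsFiniteMeasureOnCompacts μ] : μ.Regular := by
  -- Any compatible metric will do: it makes the regularity results for measures on metric spaces
  -- applicable.
  letI := TopologicalSpace.metrizableSpaceMetric X
  infer_instance

/-- Right invariance of `μ` makes the inverted measure left invariant, hence a multiple `c • μ` by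
uniqueness of Haar measure. Inverting twice gives `c ^ 2 = 1`. -/
lemma isInvInvariant_of_unimodular {G : Type*} [Group G] [TopologicalSpace G]
    [IsTopologicalGroup G] [LocallyCompactSpace G] [MeasurableSpace G] [BorelSpace G]
    (μ : Measure G) [μ.IsHaarMeasure] [μ.IsMulRightInvariant] [μ.Regular] :
    μ.IsInvInvariant := by
  constructor
  let c : ENNReal := Measure.haarScalarFactor μ.inv μ
  have hc : μ.inv = c • μ := Measure.isMulLeftInvariant_eq_smul_of_regular μ.inv μ
  have : Measure.map Inv.inv (Measure.map Inv.inv μ) = c ^ 2 • μ := by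
    rw [← Measure.inv_def μ, hc, Measure.map_smul, ← Measure.inv_def μ, hc, smul_smul, pow_two]
  have μeq : μ = c ^ 2 • μ := by
    rw [Measure.map_map continuous_inv.measurable continuous_inv.measurable] at this
    simpa only [inv_involutive, Function.Involutive.comp_self, Measure.map_id]
  -- A compact set with nonempty interior has positive finite measure, so the scalar can be
  -- cancelled.
  have K : TopologicalSpace.PositiveCompacts G := Classical.arbitrary _
  have : c ^ 2 * μ K = 1 ^ 2 * μ K := by
    conv_rhs => rw [μeq]
    simp
  have : c ^ 2 = 1 ^ 2 :=
    (ENNReal.mul_left_inj (Measure.measure_pos_of_nonempty_interior _ K.interior_nonempty).ne'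
          K.isCompact.measure_lt_top.ne).1 this
  have : c = 1 := (ENNReal.pow_right_strictMono two_ne_zero).injective this
  rw [hc, this, one_smul]

/-! ### Triangular changes of variables -/

section Triangular

variable {ι₁ ι₂ G₁ G₂ : Type*} [TopologicalSpace G₁] [TopologicalSpace G₂]
  (rk₁ : ι₁ → ℕ) (rk₂ : ι₂ → ℕ)

/-- Two points agree in all coordinates of rank less than `n`. -/
def AgreeBelow (n : ℕ) (x y : (ι₁ → G₁) × (ι₂ → G₂)) : Prop :=
  (∀ j, rk₁ j < n → x.1 j = y.1 j) ∧ ∀ j, rk₂ j < n → x.2 j = y.2 j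

/-- A continuous function of the coordinates of rank less than `n`. -/
structure Dep (n : ℕ) {A : Type*} [TopologicalSpace A] (w : (ι₁ → G₁) × (ι₂ → G₂) → A) :
    Prop where
  continuous : Continuous w
  congr : ∀ x y, AgreeBelow rk₁ rk₂ n x y → w x = w y

/-- A function which, with the coordinates of rank less than `n` as parameters, is a
measure-preserving homeomorphic function of the further coordinate `π`. -/
def Lin {G : Type*} [TopologicalSpace G] [MeasurableSpace G] (μ : Measure G) (n : ℕ)
    (π w : (ι₁ → G₁) × (ι₂ → G₂) → G) : Prop :=
  ∃ f k : (ι₁ → G₁) × (ι₂ → G₂) → G → G, (∀ x, w x = f x (π x)) ∧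
    Continuous (Function.uncurry f) ∧ Continuous (Function.uncurry k) ∧
    (∀ x g, k x (f x g) = g) ∧ (∀ x g, f x (k x g) = g) ∧
    (∀ x, MeasurePreserving (f x) μ μ) ∧
    (∀ x y, AgreeBelow rk₁ rk₂ n x y → f x = f y)

variable {rk₁ rk₂}

section DepLemmas

variable {n : ℕ} {A : Type*} [TopologicalSpace A]

lemma dep_const (a : A) : Dep (G₁ := G₁) (G₂ := G₂) rk₁ rk₂ n fun _ => a :=
  ⟨continuous_const, fun _ _ _ => rfl⟩

lemma dep_fst {j : ι₁} (h : rk₁ j < n) : Dep (G₁ := G₁) (G₂ := G₂) rk₁ rk₂ n fun x => x.1 j :=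
  ⟨by fun_prop, fun _ _ H => H.1 j h⟩

lemma dep_snd {j : ι₂} (h : rk₂ j < n) : Dep (G₁ := G₁) (G₂ := G₂) rk₁ rk₂ n fun x => x.2 j :=
  ⟨by fun_prop, fun _ _ H => H.2 j h⟩

lemma Dep.mul [Mul A] [ContinuousMul A] {v w : (ι₁ → G₁) × (ι₂ → G₂) → A}
    (hv : Dep rk₁ rk₂ n v) (hw : Dep rk₁ rk₂ n w) : Dep rk₁ rk₂ n fun x => v x * w x :=
  ⟨hv.1.mul hw.1, fun x y H => by simp only [hv.2 x y H, hw.2 x y H]⟩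

lemma Dep.inv [Inv A] [ContinuousInv A] {w : (ι₁ → G₁) × (ι₂ → G₂) → A}
    (hw : Dep rk₁ rk₂ n w) : Dep rk₁ rk₂ n fun x => (w x)⁻¹ :=
  ⟨hw.1.inv, fun x y H => by simp only [hw.2 x y H]⟩

lemma Dep.comp {B : Type*} [TopologicalSpace B] {f : A → B} (hf : Continuous f)
    {w : (ι₁ → G₁) × (ι₂ → G₂) → A} (hw : Dep rk₁ rk₂ n w) : Dep rk₁ rk₂ n fun x => f (w x) :=
  ⟨hf.comp hw.1, fun x y H => by simp only [hw.2 x y H]⟩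

lemma Dep.comp₂ {B C : Type*} [TopologicalSpace B] [TopologicalSpace C] {f : A → B → C}
    (hf : Continuous fun p : A × B => f p.1 p.2)
    {v : (ι₁ → G₁) × (ι₂ → G₂) → A} {w : (ι₁ → G₁) × (ι₂ → G₂) → B}
    (hv : Dep rk₁ rk₂ n v) (hw : Dep rk₁ rk₂ n w) : Dep rk₁ rk₂ n fun x => f (v x) (w x) :=
  ⟨hf.comp (hv.1.prodMk hw.1), fun x y H => by simp only [hv.2 x y H, hw.2 x y H]⟩

end DepLemmas

section LinLemmas

variable {n : ℕ} {G : Type*} [TopologicalSpace G] [MeasurableSpace G] {μ : Measure G}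
  {π v w : (ι₁ → G₁) × (ι₂ → G₂) → G}

lemma lin_self : Lin rk₁ rk₂ μ n π π :=
  ⟨fun _ g => g, fun _ g => g, fun _ => rfl, continuous_snd, continuous_snd, fun _ _ => rfl,
    fun _ _ => rfl, fun _ => MeasurePreserving.id μ, fun _ _ _ => rfl⟩

variable [BorelSpace G] [Group G] [IsTopologicalGroup G]

/-- The class `Lin` is closed under the operations from which the arguments of delta functions are
built: translations by lower-rank coefficients, inversion, and the action of lower-rank elements.
Each is a measure-preserving homeomorphism of the group, continuous jointly with its coefficients.
-/
lemma Lin.mul_left [μ.IsMulLeftInvariant] (hv : Dep rk₁ rk₂ n v) (hw : Lin rk₁ rk₂ μ n π w) :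
    Lin rk₁ rk₂ μ n π fun x => v x * w x := by
  obtain ⟨f, k, h, hf, hk, hkf, hfk, hm, hd⟩ := hw
  refine ⟨fun x g => v x * f x g, fun x g => k x ((v x)⁻¹ * g), fun x => by simp only [h], ?_, ?_,
    fun x g => by simp [hkf], fun x g => by simp [hfk],
    fun x => (measurePreserving_mul_left μ (v x)).comp (hm x), fun x y H => ?_⟩
  · exact (hv.1.comp continuous_fst).mul hf
  · exact hk.comp (continuous_fst.prodMk ((hv.1.comp continuous_fst).inv.mul continuous_snd))
  · simp only [hv.2 x y H, hd x y H]

lemma Lin.mul_right [μ.IsMulRightInvariant] (hw : Lin rk₁ rk₂ μ n π w) (hv : Dep rk₁ rk₂ n v) :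
    Lin rk₁ rk₂ μ n π fun x => w x * v x := by
  obtain ⟨f, k, h, hf, hk, hkf, hfk, hm, hd⟩ := hw
  refine ⟨fun x g => f x g * v x, fun x g => k x (g * (v x)⁻¹), fun x => by simp only [h], ?_, ?_,
    fun x g => by simp [hkf], fun x g => by simp [hfk],
    fun x => (measurePreserving_mul_right μ (v x)).comp (hm x), fun x y H => ?_⟩
  · exact hf.mul (hv.1.comp continuous_fst)
  · exact hk.comp (continuous_fst.prodMk (continuous_snd.mul (hv.1.comp continuous_fst).inv))
  · simp only [hv.2 x y H, hd x y H]

lemma Lin.inv [μ.IsInvInvariant] (hw : Lin rk₁ rk₂ μ n π w) :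
    Lin rk₁ rk₂ μ n π fun x => (w x)⁻¹ := by
  obtain ⟨f, k, h, hf, hk, hkf, hfk, hm, hd⟩ := hw
  refine ⟨fun x g => (f x g)⁻¹, fun x g => k x g⁻¹, fun x => by simp only [h], ?_, ?_,
    fun x g => by simp [hkf], fun x g => by simp [hfk],
    fun x => (Measure.measurePreserving_inv μ).comp (hm x), fun x y H => ?_⟩
  · exact hf.inv
  · exact hk.comp (continuous_fst.prodMk continuous_snd.inv)
  · simp only [hd x y H]

lemma Lin.act {H : Type*} [Group H] [TopologicalSpace H] [IsTopologicalGroup H]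
    {act : H →* MulAut G} (hact : Continuous fun p : H × G => act p.1 p.2)
    (hμ : ∀ a, MeasurePreserving (fun y => act a y) μ μ)
    {a : (ι₁ → G₁) × (ι₂ → G₂) → H} (ha : Dep rk₁ rk₂ n a) (hw : Lin rk₁ rk₂ μ n π w) :
    Lin rk₁ rk₂ μ n π fun x => act (a x) (w x) := by
  obtain ⟨f, k, h, hf, hk, hkf, hfk, hm, hd⟩ := hw
  refine ⟨fun x g => act (a x) (f x g), fun x g => k x (act (a x)⁻¹ g), fun x => by simp only [h], ?_, ?_,
    fun x g => by simp [hkf], fun x g => by simp [hfk],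
    fun x => (hμ (a x)).comp (hm x), fun x y H => ?_⟩
  · exact hact.comp ((ha.1.comp continuous_fst).prodMk hf)
  · exact hk.comp (continuous_fst.prodMk
      (hact.comp ((ha.1.comp continuous_fst).inv.prodMk continuous_snd)))
  · simp only [ha.2 x y H, hd x y H]

end LinLemmas

end Triangular

/-! ### Measure-preserving shears -/

/-- Fubini: if the `i`-th coordinate is integrated first, the other coordinates, and with them `f
x`, are fixed, and the inner integral is invariant under `f x`. -/
lemma measurePreserving_pi_update {ι : Type*} [Fintype ι] [DecidableEq ι] {G : Type*}
    [MeasurableSpace G] (ν : ι → Measure G) [∀ i, SigmaFinite (ν i)] (i : ι)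
    (f : (ι → G) → G → G) (hf : Measurable (Function.uncurry f))
    (hi : ∀ x g, f (Function.update x i g) = f x)
    (hm : ∀ x, MeasurePreserving (f x) (ν i) (ν i)) :
    MeasurePreserving (fun x => Function.update x i (f x (x i))) (Measure.pi ν)
      (Measure.pi ν) := by
  have hmeas : Measurable fun x : ι → G => Function.update x i (f x (x i)) := by
    refine measurable_pi_iff.2 fun j => ?_
    by_cases h : j = i
    · subst h
      simp only [Function.update_self]
      exact hf.comp (measurable_id.prodMk (measurable_pi_apply j))
    · simpa [Function.update_of_ne h] using measurable_pi_apply j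
  refine ⟨hmeas, Measure.ext_of_lintegral _ fun F hF => ?_⟩
  rw [lintegral_map hF hmeas]
  -- Iterated marginals are evaluated at a base point, which has to exist.
  rcases isEmpty_or_nonempty (ι → G) with hE | ⟨⟨x₀⟩⟩
  · simp [Measure.eq_zero_of_isEmpty]
  have key : ∀ H : (ι → G) → ENNReal, Measurable H → ∫⁻ x, H x ∂(Measure.pi ν) =
      (∫⋯∫⁻_(Finset.univ.erase i), (∫⋯∫⁻_{i}, H ∂ν) ∂ν) x₀ := by
    intro H hH
    rw [lintegral_eq_lmarginal_univ x₀, ← Finset.insert_erase (Finset.mem_univ i),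
      lmarginal_insert' _ hH (Finset.notMem_erase _ _)]
    simp only [lmarginal_singleton, Finset.insert_erase (Finset.mem_univ i)]
  rw [key (fun x => F (Function.update x i (f x (x i)))) (hF.comp hmeas), key _ hF]
  congr 1
  funext x
  simp only [lmarginal_singleton]
  simp only [Function.update_self, Function.update_idem, hi]
  exact (hm x).lintegral_comp (hF.comp (measurable_update x))

section Shear

variable {ι₁ ι₂ G₁ G₂ : Type*} [Fintype ι₁] [Fintype ι₂] [DecidableEq ι₁] [DecidableEq ι₂]
  [TopologicalSpace G₁] [TopologicalSpace G₂] [SecondCountableTopology G₁]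
  [SecondCountableTopology G₂] [MeasurableSpace G₁] [MeasurableSpace G₂] [BorelSpace G₁]
  [BorelSpace G₂] (μ₁ : Measure G₁) (μ₂ : Measure G₂) [SigmaFinite μ₁] [SigmaFinite μ₂]

/-- The map is a measure-preserving homeomorphism. -/
def IsVolumeHomeo (Θ : (ι₁ → G₁) × (ι₂ → G₂) → (ι₁ → G₁) × (ι₂ → G₂)) : Prop :=
  ∃ E : ((ι₁ → G₁) × (ι₂ → G₂)) ≃ₜ ((ι₁ → G₁) × (ι₂ → G₂)), ⇑E = Θ ∧
    MeasurePreserving E ((Measure.pi fun _ => μ₁).prod (Measure.pi fun _ => μ₂))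
      ((Measure.pi fun _ => μ₁).prod (Measure.pi fun _ => μ₂))

variable {μ₁ μ₂}

lemma IsVolumeHomeo.comp {Θ Θ' : (ι₁ → G₁) × (ι₂ → G₂) → (ι₁ → G₁) × (ι₂ → G₂)}
    (h : IsVolumeHomeo μ₁ μ₂ Θ) (h' : IsVolumeHomeo μ₁ μ₂ Θ') :
    IsVolumeHomeo μ₁ μ₂ (Θ ∘ Θ') := by
  obtain ⟨E, rfl, hE⟩ := h
  obtain ⟨E', rfl, hE'⟩ := h'
  exact ⟨E'.trans E, rfl, hE.comp hE'⟩

/-- The coefficients have rank below that of `i`, so they do not involve the coordinate `i` itself.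
The update therefore leaves them unchanged and is inverted by updating the same coordinate with `k`.
-/
lemma isVolumeHomeo_update_fst {rk₁ : ι₁ → ℕ} {rk₂ : ι₂ → ℕ} (i : ι₁)
    {w : (ι₁ → G₁) × (ι₂ → G₂) → G₁} (h : Lin rk₁ rk₂ μ₁ (rk₁ i) (fun x => x.1 i) w) :
    IsVolumeHomeo μ₁ μ₂ fun x => (Function.update x.1 i (w x), x.2) := by
  obtain ⟨f, k, hw, hf, hk, hkf, hfk, hm, hd⟩ := h
  have hu : ∀ x g, f (Function.update x.1 i g, x.2) = f x := fun x g => hd _ _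
    ⟨fun j hj => Function.update_of_ne (by rintro rfl; exact lt_irrefl _ hj) _ _, fun j _ => rfl⟩
  -- The function `k` inherits independence of the coordinate `i` from `f`, being its inverse.
  have hku : ∀ x g, k (Function.update x.1 i g, x.2) = k x := fun x g => by
    funext a
    obtain ⟨b, rfl⟩ : ∃ b, f x b = a := ⟨k x a, hfk _ _⟩
    rw [hkf, ← hu x g, hkf]
  have hfc : Continuous fun x : (ι₁ → G₁) × (ι₂ → G₂) => f x (x.1 i) :=
    hf.comp (continuous_id.prodMk (by fun_prop))
  have hkc : Continuous fun x : (ι₁ → G₁) × (ι₂ → G₂) => k x (x.1 i) :=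
    hk.comp (continuous_id.prodMk (by fun_prop))
  let E : ((ι₁ → G₁) × (ι₂ → G₂)) ≃ₜ ((ι₁ → G₁) × (ι₂ → G₂)) :=
    { toFun := fun x => (Function.update x.1 i (w x), x.2)
      invFun := fun x => (Function.update x.1 i (k x (x.1 i)), x.2)
      left_inv := fun x => by
        ext1
        · simp only [hw, hku x, Function.update_self, hkf, Function.update_idem,
            Function.update_eq_self]
        · rfl
      right_inv := fun x => by
        ext1
        · simp only [hw, hu x, Function.update_self, hfk, Function.update_idem,
            Function.update_eq_self]
        · rfl
      continuous_toFun := by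
        simp only [hw]
        exact (continuous_fst.update i hfc).prodMk continuous_snd
      continuous_invFun := (continuous_fst.update i hkc).prodMk continuous_snd }
  refine ⟨E, rfl, ?_⟩
  have hmeas : Measurable fun x : (ι₂ → G₂) × (ι₁ → G₁) =>
      Function.update x.2 i (f (x.2, x.1) (x.2 i)) :=
    (continuous_snd.update i (hfc.comp (continuous_snd.prodMk continuous_fst))).measurable
  -- The coefficients also depend on the `G₂` coordinates. These are taken as the base of a skew
  -- product, hence the swap before and after.
  have h1 := (MeasurePreserving.id (Measure.pi fun _ : ι₂ => μ₂)).skew_product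
    (g := fun y x => Function.update x i (f (x, y) (x i)))
    (μc := Measure.pi fun _ : ι₁ => μ₁) (μd := Measure.pi fun _ : ι₁ => μ₁) hmeas
    (Eventually.of_forall fun y => (measurePreserving_pi_update (fun _ => μ₁) i
      (fun x => f (x, y)) (hf.comp (g := Function.uncurry f)
        (f := fun p : (ι₁ → G₁) × G₁ => ((p.1, y), p.2)) (by fun_prop)).measurable
        (fun x g => hu (x, y) g) fun x => hm _).map_eq)
  have h2 := (Measure.measurePreserving_swap (μ := Measure.pi fun _ : ι₂ => μ₂)
    (ν := Measure.pi fun _ : ι₁ => μ₁)).comp (h1.comp Measure.measurePreserving_swap)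
  convert h2 using 1
  funext x
  simp [E, hw]

/-- The same statement with the roles of the two groups exchanged. -/
lemma isVolumeHomeo_update_snd {rk₁ : ι₁ → ℕ} {rk₂ : ι₂ → ℕ} (i : ι₂)
    {w : (ι₁ → G₁) × (ι₂ → G₂) → G₂} (h : Lin rk₁ rk₂ μ₂ (rk₂ i) (fun x => x.2 i) w) :
    IsVolumeHomeo μ₁ μ₂ fun x => (x.1, Function.update x.2 i (w x)) := by
  obtain ⟨f, k, hw, hf, hk, hkf, hfk, hm, hd⟩ := h
  have h' : Lin rk₂ rk₁ μ₂ (rk₂ i) (fun x : (ι₂ → G₂) × (ι₁ → G₁) => x.1 i) fun x => w x.swap :=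
    ⟨fun x => f x.swap, fun x => k x.swap, fun x => hw _,
      hf.comp (g := Function.uncurry f)
        (f := fun p : ((ι₂ → G₂) × (ι₁ → G₁)) × G₂ => (p.1.swap, p.2))
        ((continuous_swap.comp continuous_fst).prodMk continuous_snd),
      hk.comp (g := Function.uncurry k)
        (f := fun p : ((ι₂ → G₂) × (ι₁ → G₁)) × G₂ => (p.1.swap, p.2))
        ((continuous_swap.comp continuous_fst).prodMk continuous_snd),
      fun x => hkf _, fun x => hfk _, fun x => hm _, fun x y H => hd _ _ ⟨H.2, H.1⟩⟩
  obtain ⟨E, hE, hEm⟩ := isVolumeHomeo_update_fst (μ₁ := μ₂) (μ₂ := μ₁) i h'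
  refine ⟨((Homeomorph.prodComm _ _).trans E).trans (Homeomorph.prodComm _ _), ?_,
    Measure.measurePreserving_swap.comp (hEm.comp Measure.measurePreserving_swap)⟩
  funext x
  simp [hE]

/-- A map each of whose components is, up to coefficients that only involve coordinates of lower
rank, a measure-preserving homeomorphism of the same coordinate. -/
theorem isVolumeHomeo_of_triangular {rk₁ : ι₁ → ℕ} {rk₂ : ι₂ → ℕ}
    {Θ : (ι₁ → G₁) × (ι₂ → G₂) → (ι₁ → G₁) × (ι₂ → G₂)}
    (h₁ : ∀ i, Lin rk₁ rk₂ μ₁ (rk₁ i) (fun x => x.1 i) fun x => (Θ x).1 i)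
    (h₂ : ∀ i, Lin rk₁ rk₂ μ₂ (rk₂ i) (fun x => x.2 i) fun x => (Θ x).2 i) :
    IsVolumeHomeo μ₁ μ₂ Θ := by
  let P : Finset (ι₁ ⊕ ι₂) → (ι₁ → G₁) × (ι₂ → G₂) → (ι₁ → G₁) × (ι₂ → G₂) := fun S x =>
    (fun i => if Sum.inl i ∈ S then (Θ x).1 i else x.1 i,
      fun i => if Sum.inr i ∈ S then (Θ x).2 i else x.2 i)
  have main : ∀ S, IsVolumeHomeo μ₁ μ₂ (P S) := by
    intro S
    -- The inserted coordinate has the smallest rank so far: coordinates are replaced in order of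
    -- decreasing rank. When one of them is replaced, the coordinates in its coefficients still have
    -- their original values.
    refine Finset.induction_on_min_value (Sum.elim rk₁ rk₂) S ?_ ?_
    · exact ⟨Homeomorph.refl _, by funext x; simp [P], MeasurePreserving.id _⟩
    · intro a S ha hmin ih
      have hag : ∀ x, AgreeBelow rk₁ rk₂ (Sum.elim rk₁ rk₂ a) (P S x) x := fun x =>
        ⟨fun j hj => if_neg fun hjS => (hmin (.inl j) hjS).not_gt hj,
          fun j hj => if_neg fun hjS => (hmin (.inr j) hjS).not_gt hj⟩
      cases a with
      | inl i =>
        have := (isVolumeHomeo_update_fst (μ₂ := μ₂) i (h₁ i)).comp ih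
        convert this using 1
        funext x
        obtain ⟨f, k, hw, -, -, -, -, -, hd⟩ := h₁ i
        ext j
        · by_cases hj : j = i
          · subst hj
            simp only [P, Function.comp, Finset.mem_insert, true_or, if_true,
              Function.update_self]
            have e := hd _ _ (hag x)
            have h₃ := hw x
            have h₄ := hw (P S x)
            simp only [e] at h₃ h₄
            rw [h₃]
            refine Eq.trans ?_ h₄.symm
            simp [P, ha]
          · simp [P, hj]
        · simp [P]
      | inr i =>
        have := (isVolumeHomeo_update_snd (μ₁ := μ₁) i (h₂ i)).comp ih
        convert this using 1
        funext x
        obtain ⟨f, k, hw, -, -, -, -, -, hd⟩ := h₂ i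
        ext j
        · simp [P]
        · by_cases hj : j = i
          · subst hj
            simp only [P, Function.comp, Finset.mem_insert, true_or, if_true,
              Function.update_self]
            have e := hd _ _ (hag x)
            have h₃ := hw x
            have h₄ := hw (P S x)
            simp only [e] at h₃ h₄
            rw [h₃]
            refine Eq.trans ?_ h₄.symm
            simp [P, ha]
          · simp [P, hj]
  convert main Finset.univ using 1
  funext x
  simp [P]

end Shear

/-! ### Delta measures -/

lemma eventually_shrinking {G : Type*} [Group G] [TopologicalSpace G] [MeasurableSpace G]
    {V : Set G} (hV : V ∈ 𝓝 (1 : G)) :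
    ∀ᶠ U in shrinking G, U ⊆ V ∧ U ∈ 𝓝 (1 : G) ∧ MeasurableSet U := by
  refine Filter.Eventually.and ?_ ?_
  · exact (eventually_smallSets_subset.2 hV).filter_mono inf_le_left
  · exact mem_inf_of_right (mem_principal_self _)

/-- Limits along this filter are unique only because it is nontrivial; open neighbourhoods are
measurable and arbitrarily small. -/
instance shrinking_neBot {G : Type*} [Group G] [TopologicalSpace G] [MeasurableSpace G]
    [OpensMeasurableSpace G] : (shrinking G).NeBot := by
  refine inf_principal_neBot_iff.2 fun S hS => ?_
  obtain ⟨t, ht, hS⟩ := (eventually_smallSets.1 hS)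
  obtain ⟨u, hu, huo, h1⟩ := mem_nhds_iff.1 ht
  exact ⟨u, hS u hu, huo.mem_nhds h1, huo.measurableSet⟩

/-! ### Product measures with point masses in some coordinates -/

section Constrained

variable {ι : Type*} [Fintype ι] [DecidableEq ι] {G : Type*} [Group G]
  [MeasurableSpace G] (μ : Measure G) (D : Finset ι)

/-- The point mass at `1` for coordinates in `D`, and `μ` for the others. -/
def coordMeasure (i : ι) : Measure G := if i ∈ D then Measure.dirac 1 else μ

instance [SigmaFinite μ] (i : ι) : SigmaFinite (coordMeasure μ D i) := by
  unfold coordMeasure; split_ifs <;> infer_instance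

instance [TopologicalSpace G] [IsLocallyFiniteMeasure μ] (i : ι) :
    IsLocallyFiniteMeasure (coordMeasure μ D i) := by
  unfold coordMeasure; split_ifs <;> infer_instance

lemma coordMeasure_of_mem {i : ι} (h : i ∈ D) : coordMeasure μ D i = Measure.dirac 1 := if_pos h

lemma coordMeasure_of_notMem {i : ι} (h : i ∉ D) : coordMeasure μ D i = μ := if_neg h

lemma pi_dirac {κ : Type*} [Fintype κ] :
    Measure.pi (fun _ : κ => (Measure.dirac 1 : Measure G)) = Measure.dirac 1 := by
  classical
  refine Measure.pi_eq fun s hs => ?_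
  rw [Measure.dirac_apply' _ (MeasurableSet.univ_pi hs)]
  simp_rw [Measure.dirac_apply' _ (hs _)]
  by_cases h : ∀ i, (1 : G) ∈ s i
  · rw [Set.indicator_of_mem (by simpa using h)]
    simp [h]
  · push Not at h
    obtain ⟨i, hi⟩ := h
    rw [Set.indicator_of_notMem (fun h' : (1 : κ → G) ∈ Set.univ.pi s => hi (h' i (Set.mem_univ i))),
      Finset.prod_eq_zero (Finset.mem_univ i)]
    simp [hi]

lemma ae_coordMeasure [MeasurableSingletonClass G] [SigmaFinite μ] :
    ∀ᵐ z ∂(Measure.pi (coordMeasure μ D)), ∀ i ∈ D, z i = 1 := by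
  rw [ae_all_iff]
  intro i
  by_cases hi : i ∈ D
  · have := (Measure.quasiMeasurePreserving_eval (coordMeasure μ D) i).ae
      (p := fun g => g = 1) (by rw [coordMeasure_of_mem _ _ hi, ae_dirac_eq]; rfl)
    filter_upwards [this] with z hz _ using hz
  · simp [hi]

/-- The marginal of a product measure along an injection of the index types. -/
lemma map_comp_pi {κ : Type*} [Fintype κ] (ν : ι → Measure G) [∀ i, SigmaFinite (ν i)]
    (a : κ → ι) (ha : Function.Injective a) :
    (Measure.pi ν).map (fun z => z ∘ a) =
      (∏ i with i ∉ Set.range a, ν i Set.univ) • Measure.pi fun k => ν (a k) := by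
  classical
  let p : ι → Prop := fun i => i ∈ Set.range a
  let e : {i // p i} ≃ κ := (Equiv.ofInjective a ha).symm
  have h1 := measurePreserving_piEquivPiSubtypeProd ν p
  have h2 := measurePreserving_piCongrLeft (fun k => ν (a k)) e
  have hcomp : (fun z : ι → G => z ∘ a) =
      (MeasurableEquiv.piCongrLeft (fun _ : κ => G) e) ∘ Prod.fst ∘
        (MeasurableEquiv.piEquivPiSubtypeProd (fun _ : ι => G) p) := by
    funext z k
    obtain ⟨i, rfl⟩ := e.surjective k
    have : a (e i) = i := by
      have := Equiv.apply_ofInjective_symm ha i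
      simpa [e] using this
    simp only [Function.comp]
    rw [this]
    change _ = (Equiv.piCongrLeft (fun _ : κ => G) e) _ (e i)
    rw [Equiv.piCongrLeft_apply_apply]
    rfl
  have hae : (fun i : {i // p i} => ν (a (e i))) = fun i : {i // p i} => ν i.1 := by
    funext i
    have := Equiv.apply_ofInjective_symm ha i
    congr 1
  rw [hae] at h2
  rw [hcomp, ← Measure.map_map (MeasurableEquiv.measurable _)
      (measurable_fst.comp (MeasurableEquiv.measurable _)),
    ← Measure.map_map measurable_fst (MeasurableEquiv.measurable _), h1.map_eq,
    Measure.map_fst_prod, Measure.map_smul, Measure.pi_univ]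
  refine congrArg₂ (· • ·) ?_ (Eq.trans ?_ h2.map_eq)
  · exact (Finset.prod_subtype (Finset.univ.filter fun i => i ∉ Set.range a)
      (p := fun i => ¬ p i) (fun i => by simp only [Finset.mem_filter_univ, p])
      fun i => ν i Set.univ).symm
  · congr!

/-- A forgotten coordinate contributes its total mass, which is `1` for a point mass and the volume
of the group otherwise. -/
lemma prod_coordMeasure_univ {κ : Type*} (a : κ → ι) [DecidablePred (· ∈ Set.range a)] :
    ∏ i with i ∉ Set.range a, coordMeasure μ D i Set.univ =
      μ Set.univ ^ (Finset.univ.filter fun i => i ∉ D ∧ i ∉ Set.range a).card := by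
  have : ∀ i, coordMeasure μ D i Set.univ = if i ∉ D then μ Set.univ else 1 := by
    intro i
    unfold coordMeasure
    split_ifs <;> simp_all
  simp only [this]
  rw [← Finset.prod_filter, Finset.prod_const, Finset.filter_filter]
  congr 2
  ext i
  simp [and_comm]

lemma coordMeasure_comp {κ : Type*} [DecidableEq κ] {C : Finset κ} {a : κ → ι}
    (h : ∀ k, a k ∈ D ↔ k ∈ C) : (fun k => coordMeasure μ D (a k)) = coordMeasure μ C := by
  funext k
  simp only [coordMeasure, h]

end Constrained

lemma card_filter_of_iff {α : Type*} [Fintype α] {P : α → Prop} [DecidablePred P] {s : Finset α}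
    (h : ∀ i, P i ↔ i ∈ s) : (Finset.univ.filter P).card = s.card :=
  congrArg Finset.card (Finset.ext fun i => (Finset.mem_filter_univ i).trans (h i))

/-! ### Uniqueness and approximation of delta measures -/

section DeltaLimit

variable {G₁ G₂ : Type*} [Group G₁] [TopologicalSpace G₁] [IsTopologicalGroup G₁] [T2Space G₁]
  [LocallyCompactSpace G₁] [SecondCountableTopology G₁] [MeasurableSpace G₁] [BorelSpace G₁]
  [Group G₂] [TopologicalSpace G₂] [IsTopologicalGroup G₂] [T2Space G₂]
  [LocallyCompactSpace G₂] [SecondCountableTopology G₂] [MeasurableSpace G₂] [BorelSpace G₂]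
  (μ₁ : Measure G₁) [μ₁.IsHaarMeasure] (μ₂ : Measure G₂) [μ₂.IsHaarMeasure]

/-- Delta functions are unique. -/
lemma IsDeltaMeasure.unique {M : Type*} [TopologicalSpace M] [T2Space M] [LocallyCompactSpace M]
    [SecondCountableTopology M] [MeasurableSpace M] [BorelSpace M] {vol : Measure M}
    {ρ : (G₁ → ℝ) → (G₂ → ℝ) → M → ℝ} {ν ν' : Measure M}
    (h : IsDeltaMeasure μ₁ μ₂ vol ρ ν) (h' : IsDeltaMeasure μ₁ μ₂ vol ρ ν') : ν = ν' := by
  have := h.1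
  have := h'.1
  -- Regularity is what lets the integrals of compactly supported continuous functions determine the
  -- measure.
  have := regular_of_secondCountable ν
  have := regular_of_secondCountable ν'
  exact Measure.ext_of_integral_eq_on_compactlySupported fun f =>
    tendsto_nhds_unique (h.2 f f.continuous f.hasCompactSupport)
      (h'.2 f f.continuous f.hasCompactSupport)

/-- All factors use the same neighbourhood, so their product is a normalised indicator function of a
cube. -/
lemma prod_nascentDelta {κ G : Type*} [Fintype κ] [Group G] [MeasurableSpace G] (μ : Measure G)
    (U : Set G) (w : κ → G) : ∏ i, nascentDelta μ U (w i) =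
      (Set.univ.pi fun _ : κ => U).indicator (fun _ => ∏ _i : κ, (μ.real U)⁻¹) w := by
  classical
  unfold nascentDelta
  by_cases h : ∀ i, w i ∈ U
  · rw [Set.indicator_of_mem (by simpa using h)]
    exact Finset.prod_congr rfl fun i _ => Set.indicator_of_mem (h i) _
  · rw [Set.indicator_of_notMem (by simpa using h)]
    push Not at h
    obtain ⟨i, hi⟩ := h
    exact Finset.prod_eq_zero (Finset.mem_univ i) (Set.indicator_of_notMem hi _)

lemma eventually_shrinking_real {G : Type*} [Group G] [TopologicalSpace G] [MeasurableSpace G]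
    [BorelSpace G] [LocallyCompactSpace G] [IsTopologicalGroup G] (μ : Measure G)
    [μ.IsHaarMeasure] :
    ∀ᶠ U in shrinking G, μ U ≠ ⊤ ∧ μ U ≠ 0 ∧ MeasurableSet U := by
  obtain ⟨V, hV, hVf⟩ := μ.finiteAt_nhds 1
  filter_upwards [eventually_shrinking hV] with U hU
  exact ⟨((measure_mono hU.1).trans_lt hVf).ne, (Measure.measure_pos_of_mem_nhds μ hU.2.1).ne', hU.2.2⟩

variable {κ₁ κ₂ : Type*} [Fintype κ₁] [Fintype κ₂]

/-- The integral is the mean of `Φ` over a box that shrinks to `1`. Where `Φ` is within `ε / 2` of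
`Φ 1`, so is its mean, because closed balls are convex. -/
lemma tendsto_integral_nascentDelta {Φ : (κ₁ → G₁) × (κ₂ → G₂) → ℝ} (hΦ : Continuous Φ) :
    Tendsto (fun U : Set G₁ × Set G₂ => ∫ w, ((∏ i, nascentDelta μ₁ U.1 (w.1 i)) *
        ∏ i, nascentDelta μ₂ U.2 (w.2 i)) * Φ w
        ∂((Measure.pi fun _ => μ₁).prod (Measure.pi fun _ => μ₂)))
      (shrinking G₁ ×ˢ shrinking G₂) (𝓝 (Φ 1)) := by
  rw [Metric.tendsto_nhds]
  intro ε hε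
  have hV : {w | dist (Φ w) (Φ 1) < ε / 2} ∈ 𝓝 (1 : (κ₁ → G₁) × (κ₂ → G₂)) :=
    hΦ.continuousAt.eventually (Metric.ball_mem_nhds _ (half_pos hε))
  have h1 : (1 : (κ₁ → G₁) × (κ₂ → G₂)) = (1, 1) := rfl
  rw [h1, nhds_prod_eq, Filter.mem_prod_iff] at hV
  obtain ⟨V₁, hV₁, V₂, hV₂, hV⟩ := hV
  rw [nhds_pi, Filter.mem_pi] at hV₁ hV₂
  obtain ⟨I₁, hI₁, t₁, ht₁, hV₁⟩ := hV₁
  obtain ⟨I₂, hI₂, t₂, ht₂, hV₂⟩ := hV₂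
  -- The coordinates are finitely many, so a single neighbourhood of `1` serves for all of them.
  have hT₁ : (⋂ i, t₁ i) ∈ 𝓝 (1 : G₁) := (Filter.iInter_mem).2 ht₁
  have hT₂ : (⋂ i, t₂ i) ∈ 𝓝 (1 : G₂) := (Filter.iInter_mem).2 ht₂
  filter_upwards [((eventually_shrinking hT₁).and (eventually_shrinking_real μ₁)).prod_mk
    ((eventually_shrinking hT₂).and (eventually_shrinking_real μ₂))]
  rintro ⟨U₁, U₂⟩ ⟨⟨hU₁, hf₁, hp₁, hm₁⟩, ⟨hU₂, hf₂, hp₂, hm₂⟩⟩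
  dsimp only at hU₁ hU₂ hf₁ hf₂ hp₁ hp₂ hm₁ hm₂
  set vol := (Measure.pi fun _ : κ₁ => μ₁).prod (Measure.pi fun _ : κ₂ => μ₂)
  set box : Set ((κ₁ → G₁) × (κ₂ → G₂)) := (Set.univ.pi fun _ => U₁) ×ˢ (Set.univ.pi fun _ => U₂)
  have hbox : MeasurableSet box :=
    (MeasurableSet.univ_pi fun _ => hm₁).prod (MeasurableSet.univ_pi fun _ => hm₂)
  have hvol : vol box = (∏ _i : κ₁, μ₁ U₁) * ∏ _i : κ₂, μ₂ U₂ := by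
    simp only [vol, box, Measure.prod_prod, Measure.pi_pi]
  have hreal : vol.real box = (∏ _i : κ₁, μ₁.real U₁) * ∏ _i : κ₂, μ₂.real U₂ := by
    simp only [measureReal_def, hvol, ENNReal.toReal_mul, ENNReal.toReal_prod]
  have hfin : vol box ≠ ⊤ := by
    rw [hvol]
    exact ENNReal.mul_ne_top (ENNReal.prod_ne_top fun _ _ => hf₁)
      (ENNReal.prod_ne_top fun _ _ => hf₂)
  have hpos : vol box ≠ 0 := by
    rw [hvol]
    exact mul_ne_zero (Finset.prod_ne_zero_iff.2 fun _ _ => hp₁)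
      (Finset.prod_ne_zero_iff.2 fun _ _ => hp₂)
  have hmem : ∀ w ∈ box, Φ w ∈ Metric.closedBall (Φ 1) (ε / 2) := by
    intro w hw
    have : w ∈ V₁ ×ˢ V₂ → _ := fun h => le_of_lt (Set.mem_ofPred.1 (hV h))
    refine this (Set.mk_mem_prod (hV₁ fun i _ => ?_) (hV₂ fun i _ => ?_))
    · exact Set.mem_iInter.1 (hU₁.1 (hw.1 i (Set.mem_univ i))) i
    · exact Set.mem_iInter.1 (hU₂.1 (hw.2 i (Set.mem_univ i))) i
  have hint : IntegrableOn Φ box vol := by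
    refine Measure.integrableOn_of_bounded (M := ‖Φ 1‖ + ε / 2) hfin
      hΦ.measurable.aestronglyMeasurable ?_
    refine (ae_restrict_iff' hbox).2 (Eventually.of_forall fun w hw => ?_)
    have := hmem w hw
    rw [mem_closedBall_iff_norm] at this
    linarith [norm_le_norm_add_norm_sub' (Φ w) (Φ 1)]
  -- The box has finite positive volume, so the average is a genuine one and stays in the closed
  -- convex ball.
  have havg := Convex.set_average_mem (convex_closedBall (Φ 1) (ε / 2)) Metric.isClosed_closedBall
    hpos hfin ((ae_restrict_iff' hbox).2 (Eventually.of_forall hmem)) hint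
  rw [setAverage_eq, ← integral_indicator hbox, ← integral_smul] at havg
  have : ∀ w : (κ₁ → G₁) × (κ₂ → G₂), ((∏ i, nascentDelta μ₁ U₁ (w.1 i)) *
      ∏ i, nascentDelta μ₂ U₂ (w.2 i)) * Φ w = (vol.real box)⁻¹ • box.indicator Φ w := by
    intro w
    rw [prod_nascentDelta, prod_nascentDelta]
    by_cases hw : w ∈ box
    · rw [Set.indicator_of_mem hw, Set.indicator_of_mem hw.1, Set.indicator_of_mem hw.2,
        smul_eq_mul, hreal, mul_inv, Finset.prod_inv_distrib, Finset.prod_inv_distrib]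
    · rw [Set.indicator_of_notMem hw, smul_zero]
      by_cases h₁ : w.1 ∈ Set.univ.pi fun _ => U₁
      · rw [Set.indicator_of_notMem (s := Set.univ.pi fun _ => U₂) fun h₂ => hw ⟨h₁, h₂⟩]
        simp
      · rw [Set.indicator_of_notMem h₁]
        simp
  simp only [this]
  exact lt_of_le_of_lt havg (half_lt_self hε)

/-! ### Delta measures and their comparison in charts -/

section Elimination

variable {ι₁ ι₂ : Type*} [Fintype ι₁] [Fintype ι₂] [DecidableEq ι₁] [DecidableEq ι₂]
  (D₁ : Finset ι₁) (D₂ : Finset ι₂)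

/-- Separates the coordinates in `D₁`, `D₂` from the other ones. -/
def splitHomeo (G₁ G₂ : Type*) [TopologicalSpace G₁] [TopologicalSpace G₂] :
    ((ι₁ → G₁) × (ι₂ → G₂)) ≃ₜ
      (({i // i ∈ D₁} → G₁) × ({i // i ∈ D₂} → G₂)) ×
        (({i // i ∉ D₁} → G₁) × ({i // i ∉ D₂} → G₂)) :=
  ((Homeomorph.piEquivPiSubtypeProd (· ∈ D₁) fun _ => G₁).prodCongr
    (Homeomorph.piEquivPiSubtypeProd (· ∈ D₂) fun _ => G₂)).trans
    (Homeomorph.prodProdProdComm _ _ _ _)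

lemma measurePreserving_prodProdProdComm {A B C D : Type*} [MeasurableSpace A]
    [MeasurableSpace B] [MeasurableSpace C] [MeasurableSpace D] (a : Measure A) (b : Measure B)
    (c : Measure C) (d : Measure D) [SFinite a] [SFinite b] [SFinite c] [SFinite d] :
    MeasurePreserving (fun x : (A × B) × C × D => ((x.1.1, x.2.1), (x.1.2, x.2.2)))
      ((a.prod b).prod (c.prod d)) ((a.prod c).prod (b.prod d)) := by
  have h1 := measurePreserving_prodAssoc a b (c.prod d)
  have h2 := (MeasurePreserving.id a).prod
    ((measurePreserving_prodAssoc b c d).symm MeasurableEquiv.prodAssoc)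
  have h3 := (MeasurePreserving.id a).prod
    ((Measure.measurePreserving_swap (μ := b) (ν := c)).prod (MeasurePreserving.id d))
  have h4 := (MeasurePreserving.id a).prod (measurePreserving_prodAssoc c b d)
  have h5 := (measurePreserving_prodAssoc a c (b.prod d)).symm MeasurableEquiv.prodAssoc
  exact h5.comp (h4.comp (h3.comp (h2.comp h1)))

lemma measurePreserving_splitHomeo (ν₁ : ι₁ → Measure G₁) (ν₂ : ι₂ → Measure G₂)
    [∀ i, SigmaFinite (ν₁ i)] [∀ i, SigmaFinite (ν₂ i)] :
    MeasurePreserving (splitHomeo D₁ D₂ G₁ G₂) ((Measure.pi ν₁).prod (Measure.pi ν₂))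
      (((Measure.pi fun i : {i // i ∈ D₁} => ν₁ i).prod
          (Measure.pi fun i : {i // i ∈ D₂} => ν₂ i)).prod
        ((Measure.pi fun i : {i // i ∉ D₁} => ν₁ i).prod
          (Measure.pi fun i : {i // i ∉ D₂} => ν₂ i))) := by
  have h1 := (measurePreserving_piEquivPiSubtypeProd ν₁ (· ∈ D₁)).prod
    (measurePreserving_piEquivPiSubtypeProd ν₂ (· ∈ D₂))
  have h2 := (measurePreserving_prodProdProdComm _ _ _ _).comp h1
  convert h2 using 1
  · rfl
  · congr!

/-- If suitable coordinates of a volume-preserving chart are the arguments of the delta functions,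
the delta measure is the product measure of the other coordinates. -/
theorem isDeltaMeasure_of_chart {M : Type*} [TopologicalSpace M] [MeasurableSpace M]
    [BorelSpace M] {vol : Measure M} {ρ : (G₁ → ℝ) → (G₂ → ℝ) → M → ℝ}
    (E : M ≃ₜ (ι₁ → G₁) × (ι₂ → G₂))
    (hE : MeasurePreserving E vol ((Measure.pi fun _ => μ₁).prod (Measure.pi fun _ => μ₂)))
    (hρ : ∀ δ₁ δ₂ x, ρ δ₁ δ₂ x =
      (∏ i ∈ D₁, δ₁ ((E x).1 i)) * ∏ i ∈ D₂, δ₂ ((E x).2 i)) :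
    IsDeltaMeasure μ₁ μ₂ vol ρ (((Measure.pi (coordMeasure μ₁ D₁)).prod
      (Measure.pi (coordMeasure μ₂ D₂))).map E.symm) := by
  refine ⟨Measure.IsFiniteMeasureOnCompacts.map _ E.symm, fun φ hφ hφc => ?_⟩
  set S := splitHomeo D₁ D₂ G₁ G₂
  let N := ({i // i ∉ D₁} → G₁) × ({i // i ∉ D₂} → G₂)
  let W := ({i // i ∈ D₁} → G₁) × ({i // i ∈ D₂} → G₂)
  let volN : Measure N := (Measure.pi fun _ => μ₁).prod (Measure.pi fun _ => μ₂)
  let volW : Measure W := (Measure.pi fun _ => μ₁).prod (Measure.pi fun _ => μ₂)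
  let ψ : W × N → ℝ := fun p => φ (E.symm (S.symm p))
  have hψ : Continuous ψ := by fun_prop
  have hψc : HasCompactSupport ψ := hφc.comp_homeomorph (S.symm.trans E.symm)
  -- The test function with the unconstrained coordinates integrated out. It is continuous because
  -- the test function has compact support; only the dependence on the constrained coordinates is
  -- left for the limit.
  let Φ : W → ℝ := fun w => ∫ n, ψ (w, n) ∂volN
  have hΦ : Continuous Φ := by
    rw [← continuousOn_univ]
    refine continuousOn_integral_of_compact_support (k := Prod.snd '' tsupport ψ)
      (f := fun w n => ψ (w, n)) (hψc.isCompact.image continuous_snd) hψ.continuousOn ?_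
    intro w n _ hn
    by_contra h
    exact hn ⟨(w, n), subset_tsupport _ h, rfl⟩
  have hlim := tendsto_integral_nascentDelta μ₁ μ₂ hΦ
  have hright : ∫ x, φ x ∂(((Measure.pi (coordMeasure μ₁ D₁)).prod
      (Measure.pi (coordMeasure μ₂ D₂))).map E.symm) = Φ 1 := by
    rw [E.symm.measurableEmbedding.integral_map]
    have hS : MeasurePreserving S _ _ :=
      measurePreserving_splitHomeo D₁ D₂ (coordMeasure μ₁ D₁) (coordMeasure μ₂ D₂)
    have h1 : (fun i : {i // i ∈ D₁} => coordMeasure μ₁ D₁ i) = fun _ => Measure.dirac 1 :=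
      funext fun i => coordMeasure_of_mem _ _ i.2
    have h2 : (fun i : {i // i ∈ D₂} => coordMeasure μ₂ D₂ i) = fun _ => Measure.dirac 1 :=
      funext fun i => coordMeasure_of_mem _ _ i.2
    have h3 : (fun i : {i // i ∉ D₁} => coordMeasure μ₁ D₁ i) = fun _ => μ₁ :=
      funext fun i => coordMeasure_of_notMem _ _ i.2
    have h4 : (fun i : {i // i ∉ D₂} => coordMeasure μ₂ D₂ i) = fun _ => μ₂ :=
      funext fun i => coordMeasure_of_notMem _ _ i.2
    -- In the split coordinates the candidate measure is a point mass at `1` times the volume of the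
    -- free coordinates, so it integrates the test function to `Φ 1`.
    rw [h1, h2, h3, h4, pi_dirac, pi_dirac, Measure.dirac_prod_dirac, Measure.dirac_prod] at hS
    have h5 : ∀ z, φ (E.symm z) = ψ (S z) := fun z => by simp [ψ]
    simp only [h5]
    rw [hS.integral_comp S.measurableEmbedding, integral_map (by fun_prop)
      hψ.measurable.aestronglyMeasurable]
    rfl
  rw [hright]
  refine hlim.congr' ?_
  filter_upwards [(eventually_shrinking_real μ₁).prod_mk (eventually_shrinking_real μ₂)]
  rintro ⟨U₁, U₂⟩ ⟨⟨-, -, hm₁⟩, ⟨-, -, hm₂⟩⟩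
  dsimp only at hm₁ hm₂ ⊢
  let nd : W → ℝ := fun w => (∏ i, nascentDelta μ₁ U₁ (w.1 i)) * ∏ i, nascentDelta μ₂ U₂ (w.2 i)
  have hS : MeasurePreserving S _ (volW.prod volN) :=
    measurePreserving_splitHomeo D₁ D₂ (fun _ => μ₁) (fun _ => μ₂)
  have h5 : ∀ x, φ x * ρ (nascentDelta μ₁ U₁) (nascentDelta μ₂ U₂) x =
      (fun p : W × N => nd p.1 * ψ p) (S (E x)) := by
    intro x
    simp only [hρ, ψ, nd, Homeomorph.symm_apply_apply]
    rw [mul_comm, ← Finset.prod_coe_sort D₁, ← Finset.prod_coe_sort D₂]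
    rfl
  simp only [h5]
  have hnd : Measurable nd := by
    simp only [nd, prod_nascentDelta]
    refine Measurable.mul ?_ ?_
    · exact (measurable_const.indicator (MeasurableSet.univ_pi fun _ => hm₁)).comp measurable_fst
    · exact (measurable_const.indicator (MeasurableSet.univ_pi fun _ => hm₂)).comp measurable_snd
  -- For fixed neighbourhoods the approximate delta functions are bounded, and the test function is
  -- integrable, so Fubini applies.
  have hint : Integrable (fun p : W × N => nd p.1 * ψ p) (volW.prod volN) := by
    refine Integrable.bdd_mul (c := (∏ _i : {i // i ∈ D₁}, ‖(μ₁.real U₁)⁻¹‖) *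
      ∏ _i : {i // i ∈ D₂}, ‖(μ₂.real U₂)⁻¹‖) (hψ.integrable_of_hasCompactSupport hψc)
      (hnd.comp measurable_fst).aestronglyMeasurable (Eventually.of_forall fun p => ?_)
    simp only [nd, norm_mul, norm_prod]
    refine mul_le_mul ?_ ?_ (by positivity) (by positivity)
    · exact Finset.prod_le_prod (fun _ _ => norm_nonneg _) fun i _ =>
        norm_indicator_le_norm_self _ _
    · exact Finset.prod_le_prod (fun _ _ => norm_nonneg _) fun i _ =>
        norm_indicator_le_norm_self _ _
  rw [hE.integral_comp E.measurableEmbedding fun z => (fun p : W × N => nd p.1 * ψ p) (S z),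
    hS.integral_comp S.measurableEmbedding (fun p => nd p.1 * ψ p)]
  refine Eq.trans ?_ (integral_prod _ hint).symm
  exact integral_congr_ae (Eventually.of_forall fun w => (integral_const_mul _ _).symm)

/-- Comparison of the integrals of two systems of constraints, given as point masses in charts. -/
theorem lintegral_chart_eq {κ₁ κ₂ : Type*} [Fintype κ₁] [Fintype κ₂] [DecidableEq κ₁]
    [DecidableEq κ₂] (C₁ : Finset κ₁) (C₂ : Finset κ₂) {M M' B : Type*} [TopologicalSpace M]
    [MeasurableSpace M] [BorelSpace M] [TopologicalSpace M'] [MeasurableSpace M'] [BorelSpace M']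
    [MeasurableSpace B] (E : M ≃ₜ (ι₁ → G₁) × (ι₂ → G₂)) (E' : M' ≃ₜ (κ₁ → G₁) × (κ₂ → G₂))
    (a₁ : κ₁ → ι₁) (a₂ : κ₂ → ι₂) (ha₁ : Function.Injective a₁) (ha₂ : Function.Injective a₂)
    (hC₁ : ∀ k, a₁ k ∈ D₁ ↔ k ∈ C₁) (hC₂ : ∀ k, a₂ k ∈ D₂ ↔ k ∈ C₂) {L₁ : Finset ι₁} {L₂ : Finset ι₂}
    (hL₁ : ∀ i, (i ∉ D₁ ∧ i ∉ Set.range a₁) ↔ i ∈ L₁)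
    (hL₂ : ∀ i, (i ∉ D₂ ∧ i ∉ Set.range a₂) ↔ i ∈ L₂) (f : M → M')
    (hf : ∀ x, (∀ i ∈ D₁, (E x).1 i = 1) → (∀ i ∈ D₂, (E x).2 i = 1) →
      E' (f x) = ((E x).1 ∘ a₁, (E x).2 ∘ a₂))
    (b : M → B) (b' : M' → B) (hb' : Measurable b')
    (hb : ∀ x, (∀ i ∈ D₁, (E x).1 i = 1) → (∀ i ∈ D₂, (E x).2 i = 1) → b' (f x) = b x)
    (F : B → ENNReal) (hF : Measurable F) :
    ∫⁻ x, F (b x) ∂(((Measure.pi (coordMeasure μ₁ D₁)).prod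
        (Measure.pi (coordMeasure μ₂ D₂))).map E.symm) =
      μ₁ Set.univ ^ L₁.card * μ₂ Set.univ ^ L₂.card *
      ∫⁻ x, F (b' x) ∂(((Measure.pi (coordMeasure μ₁ C₁)).prod
        (Measure.pi (coordMeasure μ₂ C₂))).map E'.symm) := by
  classical
  rw [E.symm.measurableEmbedding.lintegral_map, E'.symm.measurableEmbedding.lintegral_map]
  set H : (κ₁ → G₁) × (κ₂ → G₂) → ENNReal := fun y => F (b' (E'.symm y))
  have hH : Measurable H := hF.comp (hb'.comp E'.symm.continuous.measurable)
  -- The constraints hold almost everywhere for the measure with point masses. That is why `f`, `b`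
  -- and `b'` need to match only on the set where the constrained coordinates are `1`.
  have h1 : ∀ᵐ z ∂((Measure.pi (coordMeasure μ₁ D₁)).prod (Measure.pi (coordMeasure μ₂ D₂))),
      F (b (E.symm z)) = H (Prod.map (fun y => y ∘ a₁) (fun y => y ∘ a₂) z) := by
    have e1 := Measure.quasiMeasurePreserving_fst (μ := Measure.pi (coordMeasure μ₁ D₁))
      (ν := Measure.pi (coordMeasure μ₂ D₂)) |>.ae (ae_coordMeasure μ₁ D₁)
    have e2 := Measure.quasiMeasurePreserving_snd (μ := Measure.pi (coordMeasure μ₁ D₁))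
      (ν := Measure.pi (coordMeasure μ₂ D₂)) |>.ae (ae_coordMeasure μ₂ D₂)
    filter_upwards [e1, e2] with z hz₁ hz₂
    have h₁ : ∀ i ∈ D₁, (E (E.symm z)).1 i = 1 := by simpa using hz₁
    have h₂ : ∀ i ∈ D₂, (E (E.symm z)).2 i = 1 := by simpa using hz₂
    have := hf (E.symm z) h₁ h₂
    simp only [Homeomorph.apply_symm_apply] at this
    rw [← hb _ h₁ h₂]
    simp only [H, Prod.map]
    rw [← this, Homeomorph.symm_apply_apply]
  have hm₁ : Measurable fun y : ι₁ → G₁ => y ∘ a₁ := by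
    exact measurable_pi_iff.2 fun k => measurable_pi_apply _
  have hm₂ : Measurable fun y : ι₂ → G₂ => y ∘ a₂ := by
    exact measurable_pi_iff.2 fun k => measurable_pi_apply _
  -- After the change to `H` only the coordinates in the ranges of `a₁`, `a₂` matter. The marginal
  -- on them keeps the type of each coordinate, and the forgotten ones give the powers of the
  -- volumes.
  rw [lintegral_congr_ae h1, ← lintegral_map hH (hm₁.prodMap hm₂),
    ← Measure.map_prod_map _ _ hm₁ hm₂, map_comp_pi _ a₁ ha₁, map_comp_pi _ a₂ ha₂,
    prod_coordMeasure_univ, prod_coordMeasure_univ, card_filter_of_iff hL₁,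
    card_filter_of_iff hL₂, coordMeasure_comp _ _ hC₁,
    coordMeasure_comp _ _ hC₂, Measure.prod_smul_left, Measure.prod_smul_right,
    lintegral_smul_measure, lintegral_smul_measure, smul_eq_mul, smul_eq_mul, mul_assoc]

end Elimination

end DeltaLimit

/-! ### Symmetries of the words -/

section Words

variable {G₁ G₂ : Type*} [Group G₁] [Group G₂]

lemma wedgeX_swap {T : Finset (Fin 6)} (x : FaceIx T → G₂) (s r q : Fin 6) :
    wedgeX x s q r = (wedgeX x s r q)⁻¹ := by
  unfold wedgeX
  by_cases h1 : s ∈ T ∧ r ≠ s ∧ q ≠ s ∧ r < q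
  · rw [dif_pos h1, dif_neg (fun h => absurd h.2.2.2 h1.2.2.2.not_gt), dif_pos h1]
  · rw [dif_neg h1]
    by_cases h2 : s ∈ T ∧ q ≠ s ∧ r ≠ s ∧ q < r
    · rw [dif_pos h2, dif_neg h1, dif_pos h2, inv_inv]
    · rw [dif_neg h2, dif_neg h1, dif_neg h2, inv_one]

lemma wedgeX_self {T : Finset (Fin 6)} (x : FaceIx T → G₂) (s r : Fin 6) :
    wedgeX x s r r = 1 := by
  simp [wedgeX]

lemma wedgeX_left {T : Finset (Fin 6)} (x : FaceIx T → G₂) (s r : Fin 6) :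
    wedgeX x s s r = 1 := by
  simp [wedgeX]

lemma wedgeX_right {T : Finset (Fin 6)} (x : FaceIx T → G₂) (s r : Fin 6) :
    wedgeX x s r s = 1 := by
  simp [wedgeX]

lemma wedgeY_swap {A : Finset (Fin 6 × Fin 6)} (y : EdgeIx A → G₂) (s r q p : Fin 6) :
    wedgeY y s r p q = (wedgeY y s r q p)⁻¹ := by
  unfold wedgeY
  by_cases h1 : (s, r) ∈ A ∧ q ≠ s ∧ q ≠ r ∧ p ≠ s ∧ p ≠ r ∧ q < p
  · rw [dif_pos h1, dif_neg (fun h => absurd h.2.2.2.2.2 h1.2.2.2.2.2.not_gt), dif_pos h1]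
  · rw [dif_neg h1]
    by_cases h2 : (s, r) ∈ A ∧ p ≠ s ∧ p ≠ r ∧ q ≠ s ∧ q ≠ r ∧ p < q
    · rw [dif_pos h2, dif_neg h1, dif_pos h2, inv_inv]
    · rw [dif_neg h2, dif_neg h1, dif_neg h2, inv_one]

lemma bulkH_swap {T : Finset (Fin 6)} (h : TetIx (bulkTets T) → G₁) (s r : Fin 6) :
    bulkH h r s = (bulkH h s r)⁻¹ := by
  simp [bulkH]

lemma bulkH_self {T : Finset (Fin 6)} (h : TetIx (bulkTets T) → G₁) (s : Fin 6) :
    bulkH h s s = 1 := by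
  simp [bulkH]

variable (𝒢 : CrossedModule G₁ G₂) (T : Finset (Fin 6)) (c : ReducedConfig G₁ G₂ T)

lemma cornerLink_swap (s r q : Fin 6) :
    cornerLink 𝒢 T c s q r = (cornerLink 𝒢 T c s r q)⁻¹ := by
  unfold cornerLink
  split_ifs
  · rw [wedgeX_swap, map_inv]
  · simp

lemma crossLink_swap (s r q : Fin 6) : crossLink T c r s q = (crossLink T c s r q)⁻¹ := by
  unfold crossLink
  by_cases hs : s ∈ T <;> by_cases hr : r ∈ T <;> simp [hs, hr, bulkH_swap c.2.1 r s]

/-- A rotation of the indices conjugates the word of a closed path; a reflection inverts and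
conjugates it. So triviality does not depend on the order of the indices, here and for the edge
words below. -/
lemma triangleWord_rotate {s r q : Fin 6} (h : triangleWord 𝒢 T c s r q = 1) :
    triangleWord 𝒢 T c r q s = 1 := by
  have : triangleWord 𝒢 T c r q s = (cornerLink 𝒢 T c s r q * crossLink T c s r q)⁻¹ *
      triangleWord 𝒢 T c s r q * (cornerLink 𝒢 T c s r q * crossLink T c s r q) := by
    unfold triangleWord; group
  rw [this, h]; group

lemma triangleWord_swap {s r q : Fin 6} (h : triangleWord 𝒢 T c s r q = 1) :
    triangleWord 𝒢 T c s q r = 1 := by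
  have : triangleWord 𝒢 T c s q r = (cornerLink 𝒢 T c s r q)⁻¹ *
      (triangleWord 𝒢 T c s r q)⁻¹ * cornerLink 𝒢 T c s r q := by
    unfold triangleWord
    rw [cornerLink_swap 𝒢 T c s r q, cornerLink_swap 𝒢 T c q s r, cornerLink_swap 𝒢 T c r q s,
      crossLink_swap T c s r q, crossLink_swap T c r q s, crossLink_swap T c q s r]
    group
  rw [this, h]; group

lemma outerWedge_swap (s r q p : Fin 6) :
    outerWedge 𝒢 T c s r p q = (outerWedge 𝒢 T c s r q p)⁻¹ := by
  unfold outerWedge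
  split_ifs
  · simp
  · rw [wedgeY_swap, map_inv]

lemma sideWedge_swap (s r p q : Fin 6) :
    sideWedge 𝒢 T c s r q p = (sideWedge 𝒢 T c s r p q)⁻¹ := by
  unfold sideWedge
  split_ifs
  · rw [← map_inv, wedgeX_swap c.1 r s q, wedgeX_swap c.1 r p q, wedgeX_swap c.1 r p s,
      outerWedge_swap 𝒢 T c r q s p, outerWedge_swap 𝒢 T c r p s q]
    congr 1
    group
  · exact outerWedge_swap _ _ _ _ _ _ _

lemma edgeWord_rotate {s r q p : Fin 6} (h : edgeWord 𝒢 T c s r q p = 1) :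
    edgeWord 𝒢 T c s q p r = 1 := by
  have : edgeWord 𝒢 T c s q p r = (sideWedge 𝒢 T c s r p q * wedgeX c.1 s r q)⁻¹ *
      edgeWord 𝒢 T c s r q p * (sideWedge 𝒢 T c s r p q * wedgeX c.1 s r q) := by
    unfold edgeWord; group
  rw [this, h]; group

lemma edgeWord_swap {s r q p : Fin 6} (h : edgeWord 𝒢 T c s r q p = 1) :
    edgeWord 𝒢 T c s r p q = 1 := by
  have : edgeWord 𝒢 T c s r p q = (sideWedge 𝒢 T c s r p q)⁻¹ *
      (edgeWord 𝒢 T c s r q p)⁻¹ * sideWedge 𝒢 T c s r p q := by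
    unfold edgeWord
    rw [sideWedge_swap 𝒢 T c s r p q, sideWedge_swap 𝒢 T c s p q r, sideWedge_swap 𝒢 T c s q r p,
      wedgeX_swap c.1 s p r, wedgeX_swap c.1 s q p, wedgeX_swap c.1 s r q]
    group
  rw [this, h]; group

/-- The arguments of the kept delta functions of the triangles are `1`. -/
def TriFlat (m : Option (Fin 6)) : Prop :=
  ∀ s r q : Fin 6, s ≠ r → r ≠ q → s ≠ q → (s ∈ T ∨ r ∈ T ∨ q ∈ T) → ¬ Redundant T m {s, r, q} →
    triangleWord 𝒢 T c s r q = 1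

/-- The arguments of the kept delta functions of the edges are `1`. -/
def EdgeFlat (m : Option (Fin 6)) : Prop :=
  ∀ s r q p : Fin 6, s ≠ r → s ≠ q → s ≠ p → r ≠ q → r ≠ p → q ≠ p → s ∈ T →
    (r ∈ T → s < r) → (q ∈ T → s < q) → (p ∈ T → s < p) → ¬ Redundant T m {s, r, q, p} →
    edgeWord 𝒢 T c s r q p = 1

/-- A rotation and a transposition generate all permutations of three indices, so the increasing
order suffices. The equality of sets transports conditions that depend only on the set of omitted
vertices, such as redundancy. -/
lemma triple_induction {P : Fin 6 → Fin 6 → Fin 6 → Prop}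
    (rot : ∀ s r q, P s r q → P r q s) (swap : ∀ s r q, P s r q → P s q r)
    {s r q : Fin 6} (hsr : s ≠ r) (hrq : r ≠ q) (hsq : s ≠ q)
    (h : ∀ a b c, a < b → b < c → ({a, b, c} : Finset (Fin 6)) = {s, r, q} → P a b c) :
    P s r q := by
  rcases lt_or_gt_of_ne hsr with h1 | h1 <;> rcases lt_or_gt_of_ne hrq with h2 | h2 <;>
    rcases lt_or_gt_of_ne hsq with h3 | h3
  · exact h _ _ _ h1 h2 rfl
  · exact absurd (h1.trans h2) h3.not_gt
  · exact swap _ _ _ (h _ _ _ h3 h2 (by ext x; simp; tauto))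
  · exact rot _ _ _ (h _ _ _ h3 h1 (by ext x; simp; tauto))
  · exact rot _ _ _ (swap _ _ _ (rot _ _ _ (rot _ _ _ (h _ _ _ h1 h3 (by ext x; simp; tauto)))))
  · exact rot _ _ _ (rot _ _ _ (h _ _ _ h2 h3 (by ext x; simp; tauto)))
  · exact absurd (h2.trans h1) h3.not_gt
  · exact rot _ _ _ (swap _ _ _ (h _ _ _ h2 h1 (by ext x; simp; tauto)))

lemma triFlat_iff {m : Option (Fin 6)} : TriFlat 𝒢 T c m ↔
    ∀ p ∈ keptTriangles T m, triangleWord 𝒢 T c p.1 p.2.1 p.2.2 = 1 := by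
  constructor
  · rintro h ⟨s, r, q⟩ hp
    simp only [keptTriangles, Finset.mem_filter_univ] at hp
    exact h s r q hp.1.ne hp.2.1.ne (hp.1.trans hp.2.1).ne hp.2.2.1 hp.2.2.2
  · intro h s r q hsr hrq hsq hT hm
    refine triple_induction (P := fun s r q => triangleWord 𝒢 T c s r q = 1)
      (fun _ _ _ => triangleWord_rotate 𝒢 T c) (fun _ _ _ => triangleWord_swap 𝒢 T c) hsr hrq hsq
      fun a b d hab hbd he => h (a, b, d) ?_
    simp only [keptTriangles, Finset.mem_filter_univ]
    refine ⟨hab, hbd, ?_, by rwa [he]⟩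
    by_contra hn
    have : ∀ x ∈ ({s, r, q} : Finset (Fin 6)), x ∉ T := by
      rw [← he]; simp; tauto
    simp at this; tauto

lemma edgeFlat_iff {m : Option (Fin 6)} : EdgeFlat 𝒢 T c m ↔
    ∀ p ∈ keptEdges T m, edgeWord 𝒢 T c p.1 p.2.1 p.2.2.1 p.2.2.2 = 1 := by
  constructor
  · rintro h ⟨s, r, q, p⟩ hp
    simp only [keptEdges, Finset.mem_filter_univ] at hp
    obtain ⟨h1, h2, h3, h4, h5, h6, h7, h8, h9, h10⟩ := hp
    exact h s r q p h3.symm h4.symm h5.symm h1.ne (h1.trans h2).ne h2.ne h6 h7 h8 h9 h10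
  · intro h s r q p hsr hsq hsp hrq hrp hqp hs hr hq hp hm
    refine triple_induction (P := fun r q p => edgeWord 𝒢 T c s r q p = 1)
      (fun _ _ _ => edgeWord_rotate 𝒢 T c) (fun _ _ _ => edgeWord_swap 𝒢 T c) hrq hqp hrp
      fun a b d hab hbd he => h (s, a, b, d) ?_
    have hne : ∀ x ∈ ({a, b, d} : Finset (Fin 6)), x ≠ s ∧ (x ∈ T → s < x) := by
      rw [he]; simp; tauto
    simp only [keptEdges, Finset.mem_filter_univ]
    refine ⟨hab, hbd, (hne a (by simp)).1, (hne b (by simp)).1, (hne d (by simp)).1, hs,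
      (hne a (by simp)).2, (hne b (by simp)).2, (hne d (by simp)).2, ?_⟩
    have : ({s, a, b, d} : Finset (Fin 6)) = {s, r, q, p} := by
      rw [show ({s, a, b, d} : Finset (Fin 6)) = insert s {a, b, d} from rfl, he]
    rwa [this]

/-! ### Trivialisation with respect to a reference 4-simplex -/

variable (m : Fin 6)

/-- Parallel transport from the 4-simplex `s` to the reference 4-simplex. -/
def gauge (s : Fin 6) : G₁ := bulkH c.2.1 m s

/-- `X_{s;r,q}`, transported to the reference 4-simplex. -/
def gX (s r q : Fin 6) : G₂ := 𝒢.act (gauge T c m s) (wedgeX c.1 s r q)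

/-- If the triangles are flat, the transport `h_{r,q}` is `t` of this element. -/
def eta (r q : Fin 6) : G₂ := gX 𝒢 T c m r q m * gX 𝒢 T c m m r q * gX 𝒢 T c m q m r

/-- Transport from the boundary tetrahedron `{s, r}` to the reference 4-simplex. -/
def gaugeH (s r : Fin 6) : G₁ := gauge T c m s * linkH c.2.2.1 s r

/-- `Y_{s;r;q,p}`, transported to the reference 4-simplex. -/
def gY (s r q p : Fin 6) : G₂ := 𝒢.act (gaugeH T c m s r) (wedgeY c.2.2.2.2 s r q p)

/-- The transported contribution of a tetrahedron to an edge, `1` for bulk tetrahedra. -/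
def gO (s r q p : Fin 6) : G₂ := if r ∈ T then 1 else gY 𝒢 T c m s r q p

/-- The surface attached to the boundary triangle `{a, b, c}`, where `a` and `b`, `c` are on
different sides. -/
def theta (a b d : Fin 6) : G₂ :=
  if a ∈ T then gX 𝒢 T c m a b d else gX 𝒢 T c m b a d * eta 𝒢 T c m b d * gX 𝒢 T c m d b a

lemma gauge_self : gauge T c m m = 1 := bulkH_self _ _

lemma gX_swap (s r q : Fin 6) : gX 𝒢 T c m s q r = (gX 𝒢 T c m s r q)⁻¹ := by
  simp [gX, wedgeX_swap c.1 s r q]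

lemma eta_swap (r q : Fin 6) : eta 𝒢 T c m q r = (eta 𝒢 T c m r q)⁻¹ := by
  simp only [eta, mul_inv_rev, ← gX_swap, mul_assoc]

lemma eta_left (q : Fin 6) : eta 𝒢 T c m m q = 1 := by
  simp [eta, gX, wedgeX_left, wedgeX_self, wedgeX_right]

lemma eta_right (q : Fin 6) : eta 𝒢 T c m q m = 1 := by
  simp [eta, gX, wedgeX_left, wedgeX_self, wedgeX_right]

lemma eta_self (q : Fin 6) : eta 𝒢 T c m q q = 1 := by
  simp [eta, gX, wedgeX_left, wedgeX_self, wedgeX_right]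

lemma theta_swap (a b d : Fin 6) : theta 𝒢 T c m a d b = (theta 𝒢 T c m a b d)⁻¹ := by
  unfold theta
  split_ifs
  · exact gX_swap _ _ _ _ _ _ _
  · rw [gX_swap 𝒢 T c m d b a, gX_swap 𝒢 T c m b a d, eta_swap 𝒢 T c m b d]
    group

lemma t_gX (s r q : Fin 6) : 𝒢.t (gX 𝒢 T c m s r q) =
    gauge T c m s * 𝒢.t (wedgeX c.1 s r q) * (gauge T c m s)⁻¹ :=
  𝒢.equivariant _ _

/-- The surface of the three corners of a bulk triangle. -/
def loop (s r q : Fin 6) : G₂ :=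
  gX 𝒢 T c m s r q * eta 𝒢 T c m s q * gX 𝒢 T c m q s r * eta 𝒢 T c m q r *
    gX 𝒢 T c m r q s * eta 𝒢 T c m r s

lemma loop_rotate (s r q : Fin 6) (h : loop 𝒢 T c m s r q = 1) : loop 𝒢 T c m r q s = 1 := by
  have : loop 𝒢 T c m r q s = (gX 𝒢 T c m r q s * eta 𝒢 T c m r s) * loop 𝒢 T c m s r q *
      (gX 𝒢 T c m r q s * eta 𝒢 T c m r s)⁻¹ := by
    unfold loop; group
  rw [this, h]; group

lemma loop_swap (s r q : Fin 6) (h : loop 𝒢 T c m s r q = 1) : loop 𝒢 T c m s q r = 1 := by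
  have : loop 𝒢 T c m s q r = (gX 𝒢 T c m s r q)⁻¹ * (loop 𝒢 T c m s r q)⁻¹ *
      gX 𝒢 T c m s r q := by
    unfold loop
    rw [gX_swap 𝒢 T c m s r q, gX_swap 𝒢 T c m r q s, gX_swap 𝒢 T c m q s r,
      eta_swap 𝒢 T c m r s, eta_swap 𝒢 T c m q r, eta_swap 𝒢 T c m s q]
    group
  rw [this, h]; group

/-- The element `eta r q` is defined as the surface of the triangle `{m, r, q}`, so that all loops
through `m` cancel identically. -/
lemma loop_ref (r q : Fin 6) : loop 𝒢 T c m m r q = 1 := by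
  unfold loop
  rw [eta_left, eta_right, eta, gX_swap 𝒢 T c m q m r, gX_swap 𝒢 T c m r q m,
    gX_swap 𝒢 T c m m r q]
  group

end Words

/-! ### Triviality of the bulk loops -/

section Flat

variable {G₁ G₂ : Type*} [Group G₁] [Group G₂] (𝒢 : CrossedModule G₁ G₂)
  (T : Finset (Fin 6)) (c : ReducedConfig G₁ G₂ T) (m : Fin 6)

lemma redundant_some {S : Finset (Fin 6)} : Redundant T (some m) S ↔ S ⊆ T ∧ m ∉ S := by
  simp [Redundant]

lemma crossLink_bulk {s r : Fin 6} (hs : s ∈ T) (hr : r ∈ T) (q : Fin 6) :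
    crossLink T c s r q = bulkH c.2.1 s r := by
  simp [crossLink, hs, hr]

/-- In the configuration `c`, the transport between 4-simplices of the diagram is `t` of `eta`. -/
def BulkFlat : Prop :=
  ∀ r ∈ T, ∀ q ∈ T, gauge T c m r * bulkH c.2.1 r q = 𝒢.t (eta 𝒢 T c m r q) * gauge T c m q

lemma triangleWord_bulk {s r q : Fin 6} (hs : s ∈ T) (hr : r ∈ T) (hq : q ∈ T) :
    triangleWord 𝒢 T c s r q = 𝒢.t (wedgeX c.1 s q r) * bulkH c.2.1 s r *
      𝒢.t (wedgeX c.1 r s q) * bulkH c.2.1 r q * 𝒢.t (wedgeX c.1 q r s) * bulkH c.2.1 q s := by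
  simp only [triangleWord, crossLink_bulk T c hs hr, crossLink_bulk T c hr hq,
    crossLink_bulk T c hq hs, cornerLink, hs, hr, hq, if_true]

/-- The triangle `{m, r, q}` is never redundant, and its word can be solved for the link `h_{r,q}`.
When two of the indices coincide, both sides agree by the normalisation of `eta`. -/
lemma bulkFlat_of_triFlat (hm : m ∈ T) (h : TriFlat 𝒢 T c (some m)) : BulkFlat 𝒢 T c m := by
  intro r hr q hq
  by_cases hrm : r = m
  · subst hrm; rw [eta_left, gauge_self, map_one]; simp [gauge]
  by_cases hqm : q = m
  · subst hqm; rw [eta_right, gauge_self, map_one, gauge, bulkH_swap c.2.1 r q]; simp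
  by_cases hrq : r = q
  · subst hrq; rw [eta_self, bulkH_self]; simp
  have := h m r q (Ne.symm hrm) hrq (Ne.symm hqm) (Or.inl hm) (by simp [redundant_some])
  rw [triangleWord_bulk 𝒢 T c hm hr hq, wedgeX_swap, map_inv, bulkH_swap c.2.1 m q] at this
  rw [eta, map_mul, map_mul, t_gX, t_gX, t_gX, gauge_self, wedgeX_swap c.1 r m q,
    wedgeX_swap c.1 q r m]
  simp only [gauge, map_inv] at this ⊢
  rw [← mul_inv_eq_one] at this ⊢
  generalize bulkH c.2.1 m r = a at *
  generalize bulkH c.2.1 m q = b at *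
  generalize bulkH c.2.1 r q = d at *
  generalize 𝒢.t (wedgeX c.1 m r q) = x at *
  generalize 𝒢.t (wedgeX c.1 r m q) = y at *
  generalize 𝒢.t (wedgeX c.1 q r m) = z at *
  -- This is the triangle word up to cyclic order and conjugation, solved for the transport of `d`.
  have h2 : a * d * b⁻¹ = a * y⁻¹ * a⁻¹ * x * b * z⁻¹ * b⁻¹ := by
    rw [← mul_inv_eq_one] 
    have h3 : x⁻¹ * a * y * d * z * b⁻¹ = 1 := by rw [← this]; group
    have : a * d * b⁻¹ * (a * y⁻¹ * a⁻¹ * x * b * z⁻¹ * b⁻¹)⁻¹ =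
      (a * y⁻¹ * a⁻¹ * x) * (x⁻¹ * a * y * d * z * b⁻¹) * (a * y⁻¹ * a⁻¹ * x)⁻¹ := by group
    rw [this, h3]; group
  have h3 : a * d = a * y⁻¹ * a⁻¹ * x * b * z⁻¹ := by
    rw [mul_inv_eq_iff_eq_mul] at h2
    rw [h2]; group
  rw [h3]; group

variable {𝒢 T c m}

/-- By the Peiffer identity `t (eta)` acts as conjugation by `eta`. After transport to `m` the bulk
links thus disappear from the edge words in favour of elements of `G₂`. -/
lemma BulkFlat.act_gauge (hB : BulkFlat 𝒢 T c m) {s r : Fin 6} (hs : s ∈ T) (hr : r ∈ T)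
    (y : G₂) : 𝒢.act (gauge T c m s) (𝒢.act (bulkH c.2.1 s r) y) =
      eta 𝒢 T c m s r * 𝒢.act (gauge T c m r) y * (eta 𝒢 T c m s r)⁻¹ := by
  rw [← MulAut.mul_apply, ← map_mul, hB s hs r hr, map_mul, MulAut.mul_apply, 𝒢.peiffer]

lemma act_gauge_outerWedge (s r q p : Fin 6) :
    𝒢.act (gauge T c m s) (outerWedge 𝒢 T c s r q p) = gO 𝒢 T c m s r q p := by
  unfold outerWedge gO
  split_ifs
  · simp
  · rw [← MulAut.mul_apply, ← map_mul]; rfl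

lemma BulkFlat.act_gauge_sideWedge (hB : BulkFlat 𝒢 T c m) {s r : Fin 6} (hs : s ∈ T)
    (hr : r ∈ T) (p q : Fin 6) : 𝒢.act (gauge T c m s) (sideWedge 𝒢 T c s r p q) =
      eta 𝒢 T c m s r * (gX 𝒢 T c m r s p * gO 𝒢 T c m r p s q * gX 𝒢 T c m r p q *
        gO 𝒢 T c m r q p s * gX 𝒢 T c m r q s) * eta 𝒢 T c m r s := by
  rw [sideWedge, if_pos hr, hB.act_gauge hs hr, eta_swap 𝒢 T c m s r]
  simp only [map_mul, act_gauge_outerWedge]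
  rfl

lemma act_gauge_sideWedge_of_notMem {s r : Fin 6} (hr : r ∉ T) (p q : Fin 6) :
    𝒢.act (gauge T c m s) (sideWedge 𝒢 T c s r p q) = gY 𝒢 T c m s r p q := by
  rw [sideWedge, if_neg hr, act_gauge_outerWedge, gO, if_neg hr]

/-- The transport to `m` acts by an automorphism, so triviality of the word can be tested in the
reference 4-simplex. -/
lemma edgeWord_eq_one_iff (s r q p : Fin 6) : edgeWord 𝒢 T c s r q p = 1 ↔
    𝒢.act (gauge T c m s) (sideWedge 𝒢 T c s r p q) * gX 𝒢 T c m s r q *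
      𝒢.act (gauge T c m s) (sideWedge 𝒢 T c s q r p) * gX 𝒢 T c m s q p *
      𝒢.act (gauge T c m s) (sideWedge 𝒢 T c s p q r) * gX 𝒢 T c m s p r = 1 := by
  rw [← (𝒢.act (gauge T c m s)).map_eq_one_iff]
  simp only [edgeWord, map_mul]
  rfl

lemma BulkFlat.edgeWord_bulk (hB : BulkFlat 𝒢 T c m) {s r q p : Fin 6} (hs : s ∈ T) (hr : r ∈ T)
    (hq : q ∈ T) (hp : p ∈ T) : edgeWord 𝒢 T c s r q p = 1 ↔
      eta 𝒢 T c m s r * (gX 𝒢 T c m r s p * gX 𝒢 T c m r p q * gX 𝒢 T c m r q s) *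
        eta 𝒢 T c m r s * gX 𝒢 T c m s r q *
        (eta 𝒢 T c m s q * (gX 𝒢 T c m q s r * gX 𝒢 T c m q r p * gX 𝒢 T c m q p s) *
        eta 𝒢 T c m q s) * gX 𝒢 T c m s q p *
        (eta 𝒢 T c m s p * (gX 𝒢 T c m p s q * gX 𝒢 T c m p q r * gX 𝒢 T c m p r s) *
        eta 𝒢 T c m p s) * gX 𝒢 T c m s p r = 1 := by
  rw [edgeWord_eq_one_iff (m := m), hB.act_gauge_sideWedge hs hr, hB.act_gauge_sideWedge hs hq,
    hB.act_gauge_sideWedge hs hp]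
  simp only [gO, hr, hq, hp, if_true, mul_one]

lemma loop_rotate_iff {s r q : Fin 6} : loop 𝒢 T c m r q s = 1 ↔ loop 𝒢 T c m s r q = 1 :=
  ⟨fun h => loop_rotate _ _ _ _ _ _ _ (loop_rotate _ _ _ _ _ _ _ h), loop_rotate _ _ _ _ _ _ _⟩

lemma loop_swap_iff {s r q : Fin 6} : loop 𝒢 T c m s q r = 1 ↔ loop 𝒢 T c m s r q = 1 :=
  ⟨loop_swap _ _ _ _ _ _ _, loop_swap _ _ _ _ _ _ _⟩

lemma gX_eq_of_loop {s r q : Fin 6} (h : loop 𝒢 T c m s r q = 1) : gX 𝒢 T c m s r q =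
    eta 𝒢 T c m s r * (gX 𝒢 T c m r q s)⁻¹ * (eta 𝒢 T c m q r)⁻¹ * (gX 𝒢 T c m q s r)⁻¹ *
      (eta 𝒢 T c m s q)⁻¹ := by
  rw [loop, eta_swap 𝒢 T c m s r, mul_inv_eq_one] at h
  rw [← h]
  simp [mul_assoc]

lemma bracket_eq_iff (s r q : Fin 6) :
    gX 𝒢 T c m r q s * eta 𝒢 T c m r s * gX 𝒢 T c m s r q * eta 𝒢 T c m s q *
      gX 𝒢 T c m q s r = eta 𝒢 T c m r q ↔ loop 𝒢 T c m s r q = 1 := by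
  rw [← loop_rotate_iff, loop, eta_swap 𝒢 T c m r q, mul_inv_eq_one]

/-- Four triangles meet a bulk edge, one for each triple of its four indices. The loops of two of
them eliminate `X_{s;r,q}` and `X_{s;p,r}` from the edge word. What is left is the loop `r p q` with
`eta q p` replaced by the bracket of `bracket_eq_iff`, which equals `eta q p` exactly if the loop `s
q p` is trivial. So, given those two, the edge condition ties the remaining two loops together. -/
lemma BulkFlat.edgeWord_bulk_iff (hB : BulkFlat 𝒢 T c m) {s r q p : Fin 6} (hs : s ∈ T)
    (hr : r ∈ T) (hq : q ∈ T) (hp : p ∈ T) (h₁ : loop 𝒢 T c m s r q = 1)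
    (h₂ : loop 𝒢 T c m s p r = 1) : edgeWord 𝒢 T c s r q p = 1 ↔
      gX 𝒢 T c m r p q * eta 𝒢 T c m r q * gX 𝒢 T c m q r p *
        (gX 𝒢 T c m q p s * eta 𝒢 T c m q s * gX 𝒢 T c m s q p * eta 𝒢 T c m s p *
          gX 𝒢 T c m p s q) * gX 𝒢 T c m p q r * eta 𝒢 T c m p r = 1 := by
  rw [hB.edgeWord_bulk hs hr hq hp, gX_eq_of_loop h₁, gX_eq_of_loop h₂,
    ← conj_eq_one_iff (a := (eta 𝒢 T c m s r * gX 𝒢 T c m r s p)⁻¹),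
    eta_swap 𝒢 T c m s r, eta_swap 𝒢 T c m s q, eta_swap 𝒢 T c m s p, eta_swap 𝒢 T c m r q,
    eta_swap 𝒢 T c m r p]
  refine Eq.congr_left ?_
  group

lemma BulkFlat.edgeWord_of_loop (hB : BulkFlat 𝒢 T c m) {s r q p : Fin 6} (hs : s ∈ T)
    (hr : r ∈ T) (hq : q ∈ T) (hp : p ∈ T) (h₁ : loop 𝒢 T c m s r q = 1)
    (h₂ : loop 𝒢 T c m s p r = 1) (h₃ : loop 𝒢 T c m s q p = 1) (h₄ : loop 𝒢 T c m r p q = 1) :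
    edgeWord 𝒢 T c s r q p = 1 := by
  rw [hB.edgeWord_bulk_iff hs hr hq hp h₁ h₂, (bracket_eq_iff _ _ _).2 h₃]
  rw [← loop_swap_iff, loop_swap_iff] at h₄
  exact h₄

lemma BulkFlat.loop_opposite (hB : BulkFlat 𝒢 T c m) {s r q p : Fin 6} (hs : s ∈ T)
    (hr : r ∈ T) (hq : q ∈ T) (hp : p ∈ T) (h₁ : loop 𝒢 T c m s r q = 1)
    (h₂ : loop 𝒢 T c m s p r = 1) (h₃ : loop 𝒢 T c m s q p = 1)
    (h : edgeWord 𝒢 T c s r q p = 1) : loop 𝒢 T c m r p q = 1 := by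
  rwa [hB.edgeWord_bulk_iff hs hr hq hp h₁ h₂, (bracket_eq_iff _ _ _).2 h₃] at h

lemma BulkFlat.loop_adjacent (hB : BulkFlat 𝒢 T c m) {s r q p : Fin 6} (hs : s ∈ T)
    (hr : r ∈ T) (hq : q ∈ T) (hp : p ∈ T) (h₁ : loop 𝒢 T c m s r q = 1)
    (h₂ : loop 𝒢 T c m s p r = 1) (h₄ : loop 𝒢 T c m r p q = 1)
    (h : edgeWord 𝒢 T c s r q p = 1) : loop 𝒢 T c m s q p = 1 := by
  rw [hB.edgeWord_bulk_iff hs hr hq hp h₁ h₂, ← h₄, loop] at h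
  rw [← bracket_eq_iff]
  simpa only [mul_left_inj, mul_right_inj] using h

variable (𝒢 T c m)

/-- The relations on the bulk which follow from the kept delta functions. -/
structure Flat : Prop where
  bulk : BulkFlat 𝒢 T c m
  loop : ∀ s ∈ T, ∀ r ∈ T, ∀ q ∈ T, s ≠ r → r ≠ q → s ≠ q → loop 𝒢 T c m s r q = 1

variable {𝒢 T c m}

/-- The edge `{m, s, r, q}` is kept and relates the loop `s r q` to three loops through `m`, which
are trivial identically. Its word is based at the least index: if that is `m`, the loop `s r q` is
the opposite one, otherwise it is adjacent to the base. -/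
lemma flat_of_triFlat (hm : m ∈ T) (h₁ : TriFlat 𝒢 T c (some m)) (h₂ : EdgeFlat 𝒢 T c (some m)) :
    Flat 𝒢 T c m := by
  have hB := bulkFlat_of_triFlat 𝒢 T c m hm h₁
  have hm1 : ∀ r q, TwoGFT.loop 𝒢 T c m m r q = 1 := loop_ref 𝒢 T c m
  have hm2 : ∀ r q, TwoGFT.loop 𝒢 T c m r q m = 1 := fun r q => loop_rotate _ _ _ _ _ _ _ (hm1 r q)
  have hm3 : ∀ r q, TwoGFT.loop 𝒢 T c m q m r = 1 := fun r q => loop_rotate _ _ _ _ _ _ _ (hm2 r q)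
  refine ⟨hB, fun s hs r hr q hq hsr hrq hsq => ?_⟩
  by_cases hsm : s = m
  · subst hsm; exact hm1 _ _
  by_cases hrm : r = m
  · subst hrm; exact hm3 _ _
  by_cases hqm : q = m
  · subst hqm; exact hm2 _ _
  -- The case of a base `a ≠ m`. Rotations of the loop bring the least of the three indices to the
  -- front.
  have key : ∀ a b d, a ∈ T → b ∈ T → d ∈ T → a ≠ m → b ≠ m → d ≠ m → a ≠ b → b ≠ d → a ≠ d →
      a < m → a < b → a < d → TwoGFT.loop 𝒢 T c m a b d = 1 := by
    intro a b d ha hb hd ham hbm hdm hab hbd had h1 h2 h3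
    refine hB.loop_adjacent ha hm hb hd (hm3 _ _) (hm2 _ _) (hm1 _ _) ?_
    exact h₂ a m b d ham hab had (Ne.symm hbm) (Ne.symm hdm) hbd ha (fun _ => h1) (fun _ => h2)
      (fun _ => h3) (by simp [redundant_some])
  by_cases h0 : m < s ∧ m < r ∧ m < q
  · rw [← loop_swap_iff]
    refine hB.loop_opposite hm hs hr hq (hm1 _ _) (hm1 _ _) (hm1 _ _) ?_
    exact h₂ m s r q (Ne.symm hsm) (Ne.symm hrm) (Ne.symm hqm) hsr hsq hrq hm (fun _ => h0.1)
      (fun _ => h0.2.1) (fun _ => h0.2.2) (by simp [redundant_some])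
  · by_cases h1 : s < m ∧ s < r ∧ s < q
    · exact key s r q hs hr hq hsm hrm hqm hsr hrq hsq h1.1 h1.2.1 h1.2.2
    by_cases h2 : r < m ∧ r < s ∧ r < q
    · rw [← loop_rotate_iff]
      exact key r q s hr hq hs hrm hqm hsm hrq hsq.symm hsr.symm h2.1 h2.2.2 h2.2.1
    · rw [← loop_rotate_iff, ← loop_rotate_iff]
      refine key q s r hq hs hr hqm hsm hrm hsq.symm hsr hrq.symm ?_ ?_ ?_ <;> omega

namespace Flat

/-- The homomorphism `t` sends `eta` to a transport and the loop to a conjugate of the triangle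
word, so the `G₁` condition follows from the `G₂` condition. -/
lemma triangleWord_bulk (hF : Flat 𝒢 T c m) {s r q : Fin 6} (hs : s ∈ T) (hr : r ∈ T)
    (hq : q ∈ T) (hsr : s ≠ r) (hrq : r ≠ q) (hsq : s ≠ q) : triangleWord 𝒢 T c s r q = 1 := by
  have h := congrArg 𝒢.t (hF.loop s hs q hq r hr hsq hrq.symm hsr)
  rw [TwoGFT.triangleWord_bulk 𝒢 T c hs hr hq,
    ← conj_eq_one_iff (a := gauge T c m s)]
  rw [map_one, TwoGFT.loop] at h
  refine Eq.trans ?_ h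
  simp only [map_mul, t_gX, ← mul_inv_eq_of_eq_mul (hF.bulk s hs r hr),
    ← mul_inv_eq_of_eq_mul (hF.bulk r hr q hq), ← mul_inv_eq_of_eq_mul (hF.bulk q hq s hs)]
  group

lemma edgeWord_bulk (hF : Flat 𝒢 T c m) {s r q p : Fin 6} (hs : s ∈ T) (hr : r ∈ T)
    (hq : q ∈ T) (hp : p ∈ T) (hsr : s ≠ r) (hsq : s ≠ q) (hsp : s ≠ p) (hrq : r ≠ q)
    (hrp : r ≠ p) (hqp : q ≠ p) : edgeWord 𝒢 T c s r q p = 1 :=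
  hF.bulk.edgeWord_of_loop hs hr hq hp (hF.loop s hs r hr q hq hsr hrq hsq)
    (hF.loop s hs p hp r hr hsp hrp.symm hsr) (hF.loop s hs q hq p hp hsq hqp hsp)
    (hF.loop r hr p hp q hq hrp hqp.symm hrq)

/-- A redundant triangle lies in the bulk, where flatness already gives its condition. The same
reason applies to the edges. -/
lemma triFlat_none (hF : Flat 𝒢 T c m) (h : TriFlat 𝒢 T c (some m)) : TriFlat 𝒢 T c none := by
  intro s r q hsr hrq hsq hT _
  by_cases hR : Redundant T (some m) {s, r, q}
  · have := hR.1
    simp only [Finset.insert_subset_iff, Finset.singleton_subset_iff] at this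
    exact hF.triangleWord_bulk this.1 this.2.1 this.2.2 hsr hrq hsq
  · exact h s r q hsr hrq hsq hT hR

lemma edgeFlat_none (hF : Flat 𝒢 T c m) (h : EdgeFlat 𝒢 T c (some m)) : EdgeFlat 𝒢 T c none := by
  intro s r q p hsr hsq hsp hrq hrp hqp hs h1 h2 h3 _
  by_cases hR : Redundant T (some m) {s, r, q, p}
  · have := hR.1
    simp only [Finset.insert_subset_iff, Finset.singleton_subset_iff] at this
    exact hF.edgeWord_bulk this.1 this.2.1 this.2.2.1 this.2.2.2 hsr hsq hsp hrq hrp hqp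
  · exact h s r q p hsr hsq hsp hrq hrp hqp hs h1 h2 h3 hR

end Flat

/-! ### The relations on the boundary -/

variable (𝒢 T c m)

/-- `h u` for the boundary tetrahedron `{a, b}` and its triangle `{a, b, d}`, transported to the
reference 4-simplex. -/
def rimU (a b d : Fin 6) : G₁ :=
  if a ∈ T then gaugeH T c m a b * linkU c.2.2.2.1 a b d
  else gaugeH T c m b a * linkU c.2.2.2.1 b a d

/-- `h ▷ Y` for the boundary tetrahedron `{a, b}`, transported to the reference 4-simplex. -/
def rimY (a b q p : Fin 6) : G₂ := if a ∈ T then gY 𝒢 T c m a b q p else gY 𝒢 T c m b a q p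

lemma gY_swap (s r q p : Fin 6) : gY 𝒢 T c m s r p q = (gY 𝒢 T c m s r q p)⁻¹ := by
  rw [gY, wedgeY_swap, map_inv]; rfl

lemma rimY_swap (a b q p : Fin 6) : rimY 𝒢 T c m a b p q = (rimY 𝒢 T c m a b q p)⁻¹ := by
  unfold rimY; split_ifs <;> exact gY_swap ..

lemma rimU_comm {a b : Fin 6} (h : ¬ (a ∈ T ↔ b ∈ T)) (d : Fin 6) :
    rimU T c m b a d = rimU T c m a b d := by
  unfold rimU; split_ifs <;> tauto

lemma rimY_comm {a b : Fin 6} (h : ¬ (a ∈ T ↔ b ∈ T)) (q p : Fin 6) :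
    rimY 𝒢 T c m b a q p = rimY 𝒢 T c m a b q p := by
  unfold rimY; split_ifs <;> tauto

variable {𝒢 T c m}

/-- The index `a` is alone on its side of the cut. If `a ∈ T`, the triangle is in one 4-simplex of
`T`. Otherwise it is in two, and the link between them is `t` of `eta`. The definition of `theta`
absorbs the difference, so both sides of the cut give the same equation. -/
lemma Flat.rimU_eq (hF : Flat 𝒢 T c m) {a b d : Fin 6} (hab : ¬ (a ∈ T ↔ b ∈ T))
    (had : ¬ (a ∈ T ↔ d ∈ T)) (hbd : b ≠ d) (h : TriFlat 𝒢 T c none) :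
    rimU T c m a b d = 𝒢.t (theta 𝒢 T c m a b d) * rimU T c m a d b := by
  have hab' : a ≠ b := by rintro rfl; exact hab Iff.rfl
  have had' : a ≠ d := by rintro rfl; exact had Iff.rfl
  have hn : ∀ S, ¬ Redundant T none S := fun S h => by simp [Redundant] at h
  by_cases ha : a ∈ T
  · have hb : b ∉ T := by tauto
    have hd : d ∉ T := by tauto
    have := h a b d hab' hbd had' (Or.inl ha) (hn _)
    simp only [triangleWord, cornerLink, crossLink, ha, hb, hd, if_true, if_false, and_false,
      and_true, mul_one] at this
    simp only [rimU, theta, ha, if_true, t_gX, gaugeH]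
    have h' : linkH c.2.2.1 a b * linkU c.2.2.2.1 a b d =
        𝒢.t (wedgeX c.1 a b d) * (linkH c.2.2.1 a d * linkU c.2.2.2.1 a d b) := by
      rw [mul_inv_eq_one] at this
      rw [← this, wedgeX_swap c.1 a b d, map_inv, mul_inv_cancel_left]
    rw [mul_assoc, h']
    group
  · have hb : b ∈ T := by tauto
    have hd : d ∈ T := by tauto
    have := h b d a hbd had'.symm hab'.symm (Or.inl hb) (hn _)
    simp only [triangleWord, cornerLink, crossLink, ha, hb, hd, if_true, if_false, and_false,
      and_true, and_self, mul_one] at this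
    simp only [rimU, theta, ha, if_false, map_mul, t_gX, gaugeH,
      ← mul_inv_eq_of_eq_mul (hF.bulk b hb d hd)]
    rw [mul_inv_eq_one] at this
    rw [mul_assoc, ← this]
    group

/-- Edges with one index on one side of the cut and three on the other. If `a ∈ T` the edge lies in
one 4-simplex of `T` and the relation is its word. If `a ∉ T` it lies in three, and the wedges of
these combine to `theta` once their bulk loop is known to be trivial. -/
lemma Flat.edge_three (hF : Flat 𝒢 T c m) {a b d e : Fin 6} (hab : ¬ (a ∈ T ↔ b ∈ T))
    (had : ¬ (a ∈ T ↔ d ∈ T)) (hae : ¬ (a ∈ T ↔ e ∈ T)) (hbd : b ≠ d) (hde : d ≠ e) (hbe : b ≠ e)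
    (h : EdgeFlat 𝒢 T c none) :
    rimY 𝒢 T c m a b e d * theta 𝒢 T c m a b d * rimY 𝒢 T c m a d b e * theta 𝒢 T c m a d e *
      rimY 𝒢 T c m a e d b * theta 𝒢 T c m a e b = 1 := by
  have hn : ∀ S, ¬ Redundant T none S := fun S h => by simp [Redundant] at h
  have hab' : a ≠ b := by rintro rfl; exact hab Iff.rfl
  have had' : a ≠ d := by rintro rfl; exact had Iff.rfl
  have hae' : a ≠ e := by rintro rfl; exact hae Iff.rfl
  by_cases ha : a ∈ T
  · have hb : b ∉ T := by tauto
    have hd : d ∉ T := by tauto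
    have he : e ∉ T := by tauto
    have := h a b d e hab' had' hae' hbd hbe hde ha (by tauto) (by tauto) (by tauto) (hn _)
    rw [edgeWord_eq_one_iff (m := m), act_gauge_sideWedge_of_notMem hb,
      act_gauge_sideWedge_of_notMem hd, act_gauge_sideWedge_of_notMem he] at this
    simpa only [rimY, theta, ha, if_true] using this
  · have hb : b ∈ T := by tauto
    have hd : d ∈ T := by tauto
    have he : e ∈ T := by tauto
    -- The word of the edge is based at its least index in `T`, taken to be `b`. The other orders
    -- follow by conjugation, as the relation is cyclic in `b`, `d`, `e`.
    have key : ∀ b d e : Fin 6, b ∈ T → d ∈ T → e ∈ T → a ≠ b → a ≠ d → a ≠ e → b ≠ d → d ≠ e →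
        b ≠ e → b < d → b < e → gY 𝒢 T c m b a e d * theta 𝒢 T c m a b d * gY 𝒢 T c m d a b e *
          theta 𝒢 T c m a d e * gY 𝒢 T c m e a d b * theta 𝒢 T c m a e b = 1 := by
      intro b d e hb hd he hab' had' hae' hbd hde hbe h1 h2
      have := h b d e a hbd hbe hab'.symm hde had'.symm hae'.symm hb (fun _ => h1) (fun _ => h2)
        (by tauto) (hn _)
      rw [edgeWord_eq_one_iff (m := m), hF.bulk.act_gauge_sideWedge hb hd,
        hF.bulk.act_gauge_sideWedge hb he, act_gauge_sideWedge_of_notMem ha] at this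
      simp only [gO, ha, hd, he, if_true, if_false] at this
      simp only [theta, ha, if_false]
      -- The wedge of `b` between the two bulk tetrahedra does not occur in the relation; the
      -- trivial loop replaces it by wedges of `d` and `e`.
      rw [gX_eq_of_loop (hF.loop b hb d hd e he hbd hde hbe)] at this
      rw [← conj_eq_one_iff (a := gY 𝒢 T c m b a e d * gX 𝒢 T c m b a d)] at this
      refine Eq.trans ?_ this
      rw [eta_swap 𝒢 T c m b d, eta_swap 𝒢 T c m b e, eta_swap 𝒢 T c m d e]
      group
    simp only [rimY, ha, if_false]
    have last (h1 : e < b) (h2 : e < d) : gY 𝒢 T c m b a e d * theta 𝒢 T c m a b d *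
        gY 𝒢 T c m d a b e * theta 𝒢 T c m a d e * gY 𝒢 T c m e a d b *
        theta 𝒢 T c m a e b = 1 := by
      have := key e b d he hb hd hae' hab' had' hbe.symm hbd hde.symm h1 h2
      rw [← conj_eq_one_iff (a := gY 𝒢 T c m b a e d * theta 𝒢 T c m a b d * gY 𝒢 T c m d a b e *
        theta 𝒢 T c m a d e)] at this
      rw [← this]
      group
    rcases lt_or_gt_of_ne hbd with h1 | h1
    · rcases lt_or_gt_of_ne hbe with h2 | h2
      · exact key b d e hb hd he hab' had' hae' hbd hde hbe h1 h2
      · exact last h2 (h2.trans h1)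
    · rcases lt_or_gt_of_ne hde with h2 | h2
      · have := key d e b hd he hb had' hae' hab' hde hbe.symm hbd.symm h2 h1
        rw [← conj_eq_one_iff (a := gY 𝒢 T c m b a e d * theta 𝒢 T c m a b d)] at this
        rw [← this]
        group
      · exact last (h2.trans h1) h2

lemma Flat.edge_two_of_lt (hF : Flat 𝒢 T c m) {s r q p : Fin 6} (hs : s ∈ T) (hr : r ∈ T)
    (hq : q ∉ T) (hp : p ∉ T) (hsr : s < r) (hqp : q ≠ p) (h : EdgeFlat 𝒢 T c none) :
    theta 𝒢 T c m p s r * rimY 𝒢 T c m r p s q * theta 𝒢 T c m r p q * rimY 𝒢 T c m r q p s *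
      theta 𝒢 T c m q r s * rimY 𝒢 T c m s q r p * theta 𝒢 T c m s q p *
      rimY 𝒢 T c m s p q r = 1 := by
  have hn : ∀ S, ¬ Redundant T none S := fun S h => by simp [Redundant] at h
  have := h s r q p hsr.ne (by rintro rfl; tauto) (by rintro rfl; tauto) (by rintro rfl; tauto)
    (by rintro rfl; tauto) hqp hs (fun _ => hsr) (by tauto) (by tauto) (hn _)
  rw [edgeWord_eq_one_iff (m := m), hF.bulk.act_gauge_sideWedge hs hr,
    act_gauge_sideWedge_of_notMem hq, act_gauge_sideWedge_of_notMem hp] at this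
  simp only [gO, hq, hp, if_false] at this
  simp only [rimY, theta, hs, hr, hq, hp, if_false, if_true]
  rw [← conj_eq_one_iff (a := gX 𝒢 T c m s p r)] at this
  refine Eq.trans ?_ this
  group

lemma Flat.edge_two_of_mem (hF : Flat 𝒢 T c m) {s r q p : Fin 6} (hs : s ∈ T) (hr : r ∈ T)
    (hq : q ∉ T) (hp : p ∉ T) (hsr : s ≠ r) (hqp : q ≠ p) (h : EdgeFlat 𝒢 T c none) :
    theta 𝒢 T c m p s r * rimY 𝒢 T c m r p s q * theta 𝒢 T c m r p q * rimY 𝒢 T c m r q p s *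
      theta 𝒢 T c m q r s * rimY 𝒢 T c m s q r p * theta 𝒢 T c m s q p *
      rimY 𝒢 T c m s p q r = 1 := by
  rcases lt_or_gt_of_ne hsr with h1 | h1
  · exact hF.edge_two_of_lt hs hr hq hp h1 hqp h
  · have := hF.edge_two_of_lt hr hs hp hq h1 hqp.symm h
    rw [← conj_eq_one_iff (a := theta 𝒢 T c m p s r * rimY 𝒢 T c m r p s q *
      theta 𝒢 T c m r p q * rimY 𝒢 T c m r q p s)] at this
    rw [← this]
    group

/-- Edges with two indices on each side. Exchange of the sides turns the relation into a conjugate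
of its inverse, so it can be read off from whichever pair lies in `T`. -/
lemma Flat.edge_two (hF : Flat 𝒢 T c m) {s r q p : Fin 6} (hsr : s ∈ T ↔ r ∈ T)
    (hqp : q ∈ T ↔ p ∈ T) (hsq : ¬ (s ∈ T ↔ q ∈ T)) (hsr' : s ≠ r) (hqp' : q ≠ p)
    (h : EdgeFlat 𝒢 T c none) :
    theta 𝒢 T c m p s r * rimY 𝒢 T c m r p s q * theta 𝒢 T c m r p q * rimY 𝒢 T c m r q p s *
      theta 𝒢 T c m q r s * rimY 𝒢 T c m s q r p * theta 𝒢 T c m s q p *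
      rimY 𝒢 T c m s p q r = 1 := by
  by_cases hs : s ∈ T
  · exact hF.edge_two_of_mem hs (hsr.1 hs) (by tauto) (by tauto) hsr' hqp' h
  · have := hF.edge_two_of_mem (s := q) (r := p) (q := s) (p := r) (by tauto) (by tauto) hs
      (by tauto) hqp' hsr' h
    rw [← inv_eq_one, ← conj_eq_one_iff (a := theta 𝒢 T c m p s r * rimY 𝒢 T c m r p s q *
      theta 𝒢 T c m r p q),
      rimY_comm 𝒢 T c m (a := r) (b := p) (by tauto),
      rimY_comm 𝒢 T c m (a := s) (b := p) (by tauto),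
      rimY_comm 𝒢 T c m (a := r) (b := q) (by tauto),
      rimY_comm 𝒢 T c m (a := s) (b := q) (by tauto), rimY_swap 𝒢 T c m r p s q,
      rimY_swap 𝒢 T c m r q p s, rimY_swap 𝒢 T c m s q r p, rimY_swap 𝒢 T c m s p q r,
      theta_swap 𝒢 T c m r p q, theta_swap 𝒢 T c m q r s, theta_swap 𝒢 T c m s q p,
      theta_swap 𝒢 T c m p s r] at this
    rw [← this]
    group

end Flat

/-! ### Fusing the half links -/

section Fuse

variable {G₁ G₂ : Type*} [Group G₁] [Group G₂] (𝒢 : CrossedModule G₁ G₂)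
  {T : Finset (Fin 6)} (c : FeynmanConfig G₁ G₂ T)

/-- The variables of the reduced amplitude. -/
def fuse : ReducedConfig G₁ G₂ T :=
  (c.1, fun i => linkH c.2.1 i.1.1 i.1.2 * (linkH c.2.1 i.1.2 i.1.1)⁻¹,
    fun i => linkH c.2.1 i.1.1 i.1.2, fun i => linkU c.2.2.1 i.1.1 i.1.2.1 i.1.2.2,
    fun i => wedgeY c.2.2.2 i.1.1 i.1.2.1 i.1.2.2.1 i.1.2.2.2)

lemma bulkH_fuse {s r : Fin 6} (hs : s ∈ T) (hr : r ∈ T) (hsr : s ≠ r) :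
    bulkH (fuse c).2.1 s r = linkH c.2.1 s r * (linkH c.2.1 r s)⁻¹ := by
  have key : ∀ s r : Fin 6, s ∈ T → r ∈ T → s < r →
      bulkH (fuse c).2.1 s r = linkH c.2.1 s r * (linkH c.2.1 r s)⁻¹ := by
    intro s r hs hr h
    simp [bulkH, linkH, fuse, bulkTets, hs, hr, h, h.not_gt]
  rcases lt_or_gt_of_ne hsr with h | h
  · exact key s r hs hr h
  · rw [bulkH_swap, key r s hr hs h, mul_inv_rev, inv_inv]

lemma linkH_fuse {s r : Fin 6} (hs : s ∈ T) (hr : r ∉ T) :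
    linkH (fuse c).2.2.1 s r = linkH c.2.1 s r := by
  have : r ≠ s := by rintro rfl; exact hr hs
  simp [linkH, fuse, boundaryTets, allTets, hs, hr, this]

lemma linkU_fuse {s r : Fin 6} (hs : s ∈ T) (hr : r ∉ T) (q : Fin 6) :
    linkU (fuse c).2.2.2.1 s r q = linkU c.2.2.1 s r q := by
  have : r ≠ s := by rintro rfl; exact hr hs
  by_cases h : q ≠ s ∧ q ≠ r
  · simp [linkU, fuse, boundaryTets, allTets, hs, hr, this, h]
  · rw [linkU, dif_neg (fun H => h H.2), linkU, dif_neg (fun H => h H.2)]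

lemma wedgeY_fuse {s r : Fin 6} (hs : s ∈ T) (hr : r ∉ T) (q p : Fin 6) :
    wedgeY (fuse c).2.2.2.2 s r q p = wedgeY c.2.2.2 s r q p := by
  have : r ≠ s := by rintro rfl; exact hr hs
  have key : ∀ q p : Fin 6, q < p →
      wedgeY (fuse c).2.2.2.2 s r q p = wedgeY c.2.2.2 s r q p := by
    intro q p hqp
    by_cases h : q ≠ s ∧ q ≠ r ∧ p ≠ s ∧ p ≠ r
    · simp [wedgeY, fuse, boundaryTets, allTets, hs, hr, this, h, hqp]
    · rw [wedgeY, dif_neg (by tauto), dif_neg (by tauto), wedgeY, dif_neg (by tauto),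
        dif_neg (by tauto)]
  rcases lt_trichotomy q p with h | rfl | h
  · exact key q p h
  · simp [wedgeY]
  · rw [wedgeY_swap, key p q h, wedgeY_swap c.2.2.2 s r p q]

lemma reducedBoundary_fuse : reducedBoundary (fuse c) = feynmanBoundary c := by
  unfold reducedBoundary feynmanBoundary restrictBoundary
  congr 1
  · funext s r q
    split_ifs with h1 h2
    · exact linkU_fuse c h1.1 h1.2 q
    · exact linkU_fuse c h2.1 h2.2 q
    · rfl
  · funext s r q p
    split_ifs with h1 h2
    · exact wedgeY_fuse c h1.1 h1.2 q p
    · exact wedgeY_fuse c h2.1 h2.2 q p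
    · rfl

/-- The half link and the link of a triangle inside a tetrahedron of the 4-simplex `s`. -/
def halfLink (s r q : Fin 6) : G₁ := if s ∈ T then linkH c.2.1 s r * linkU c.2.2.1 s r q else 1

/-- The argument of the delta function of the triangle `{s, a, b}` in the vertex kernel of `s`. -/
abbrev lWord (s a b : Fin 6) : G₁ :=
  vertexLinkWord 𝒢 (wedgeX c.1) (linkH c.2.1) (linkU c.2.2.1) s a b

/-- The argument of the delta function of the edge `{s, a, b, d}` in the vertex kernel of `s`. -/
abbrev wWord (s a b d : Fin 6) : G₂ :=
  vertexWedgeWord 𝒢 (wedgeX c.1) (linkH c.2.1) (wedgeY c.2.2.2) s a b d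

variable {𝒢 c}

lemma lWord_swap {s a b : Fin 6} (h : lWord 𝒢 c s a b = 1) : lWord 𝒢 c s b a = 1 := by
  have : lWord 𝒢 c s b a =
      (𝒢.t (wedgeX c.1 s b a))⁻¹ * (lWord 𝒢 c s a b)⁻¹ * 𝒢.t (wedgeX c.1 s b a) := by
    simp only [lWord, vertexLinkWord, wedgeX_swap c.1 s b a, map_inv]
    group
  rw [this, h]; group

lemma wWord_rotate {s a b d : Fin 6} (h : wWord 𝒢 c s a b d = 1) : wWord 𝒢 c s b d a = 1 := by
  have : wWord 𝒢 c s b d a = (𝒢.act (linkH c.2.1 s a) (wedgeY c.2.2.2 s a d b) *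
      wedgeX c.1 s a b)⁻¹ * wWord 𝒢 c s a b d *
      (𝒢.act (linkH c.2.1 s a) (wedgeY c.2.2.2 s a d b) * wedgeX c.1 s a b) := by
    simp only [wWord, vertexWedgeWord]
    group
  rw [this, h]; group

lemma wWord_swap {s a b d : Fin 6} (h : wWord 𝒢 c s a b d = 1) : wWord 𝒢 c s a d b = 1 := by
  have : wWord 𝒢 c s a d b = (𝒢.act (linkH c.2.1 s a) (wedgeY c.2.2.2 s a d b))⁻¹ *
      (wWord 𝒢 c s a b d)⁻¹ * 𝒢.act (linkH c.2.1 s a) (wedgeY c.2.2.2 s a d b) := by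
    simp only [wWord, vertexWedgeWord]
    rw [wedgeY_swap c.2.2.2 s a d b, wedgeY_swap c.2.2.2 s d b a, wedgeY_swap c.2.2.2 s b a d,
      wedgeX_swap c.1 s d a, wedgeX_swap c.1 s b d, wedgeX_swap c.1 s a b]
    simp only [map_inv]
    group
  rw [this, h]; group

variable (c) in
/-- The data of bulk tetrahedra agree on both sides. -/
structure Glued : Prop where
  u : ∀ s ∈ T, ∀ r ∈ T, s ≠ r → ∀ q, q ≠ s → q ≠ r → linkU c.2.2.1 s r q = linkU c.2.2.1 r s q
  y : ∀ s ∈ T, ∀ r ∈ T, s ≠ r → ∀ q p, q ≠ s → q ≠ r → p ≠ s → p ≠ r →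
    wedgeY c.2.2.2 s r q p = wedgeY c.2.2.2 r s q p

/-- The common value of `u` on the two sides of a bulk tetrahedron cancels in the quotient of half
links, which is therefore the fused link. -/
lemma Glued.crossLink (h : Glued c) {s r q : Fin 6} (hsr : s ≠ r) (hqs : q ≠ s) (hqr : q ≠ r) :
    crossLink T (fuse c) s r q = halfLink c s r q * (halfLink c r s q)⁻¹ := by
  unfold TwoGFT.crossLink halfLink
  by_cases hs : s ∈ T <;> by_cases hr : r ∈ T <;> simp only [hs, hr, and_self, if_true, if_false,
    and_false, inv_one, mul_one, one_mul, and_true]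
  · rw [bulkH_fuse c hs hr hsr, h.u s hs r hr hsr q hqs hqr]; group
  · rw [linkH_fuse c hs hr, linkU_fuse c hs hr]
  · rw [linkH_fuse c hr hs, linkU_fuse c hr hs]

/-- The vertex condition says that the corner of a 4-simplex is also a quotient of half links. This
is what makes the path around a triangle telescope. -/
lemma cornerLink_fuse {s r q : Fin 6} (h : s ∈ T → lWord 𝒢 c s r q = 1) :
    cornerLink 𝒢 T (fuse c) s r q = halfLink c s q r * (halfLink c s r q)⁻¹ := by
  unfold cornerLink halfLink
  split_ifs with hs
  · have := h hs
    simp only [lWord, vertexLinkWord, mul_assoc] at this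
    rw [mul_eq_one_iff_eq_inv] at this
    change 𝒢.t (wedgeX c.1 s q r) = _
    rw [this]; group
  · simp

/-- Around a triangle, the delta function of the amplitude is that of one of the vertex kernels. -/
lemma Glued.triangleWord (h : Glued c) {s r q : Fin 6} (hsr : s ≠ r) (hrq : r ≠ q) (hsq : s ≠ q)
    (hs : s ∈ T) (h₁ : r ∈ T → lWord 𝒢 c r s q = 1) (h₂ : q ∈ T → lWord 𝒢 c q s r = 1) :
    triangleWord 𝒢 T (fuse c) s r q = lWord 𝒢 c s r q := by
  have h₁' : r ∈ T → lWord 𝒢 c r q s = 1 := fun hr => lWord_swap (h₁ hr)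
  -- All links, and the corners at `r` and `q`, are quotients of half links. The product telescopes
  -- to the half links of `s` and its own corner.
  rw [TwoGFT.triangleWord, h.crossLink hsr hsq.symm hrq.symm, h.crossLink hrq hsr hsq,
    h.crossLink hsq.symm hrq hsr.symm, cornerLink_fuse h₁', cornerLink_fuse h₂]
  simp only [cornerLink, halfLink, hs, if_true, lWord, vertexLinkWord]
  change 𝒢.t (wedgeX c.1 s q r) * _ * _ * _ * _ * _ = _
  group

/-- `h ▷ Y` for a tetrahedron of the 4-simplex `r`. -/
def halfWedge (𝒢 : CrossedModule G₁ G₂) (c : FeynmanConfig G₁ G₂ T) (r q p s : Fin 6) : G₂ :=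
  𝒢.act (linkH c.2.1 r q) (wedgeY c.2.2.2 r q p s)

lemma halfWedge_swap (r q p s : Fin 6) : halfWedge 𝒢 c r q s p = (halfWedge 𝒢 c r q p s)⁻¹ := by
  rw [halfWedge, wedgeY_swap, map_inv]; rfl

lemma outerWedge_fuse {s r : Fin 6} (hs : s ∈ T) (q p : Fin 6) :
    outerWedge 𝒢 T (fuse c) s r q p = if r ∈ T then 1 else halfWedge 𝒢 c s r q p := by
  unfold outerWedge halfWedge
  split_ifs with hr
  · rfl
  · rw [linkH_fuse c hs hr, wedgeY_fuse c hs hr]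

lemma Glued.halfWedge (h : Glued c) {s r q p : Fin 6} (hsr : s ≠ r) (hqs : q ≠ s) (hqr : q ≠ r)
    (hps : p ≠ s) (hpr : p ≠ r) (hs : s ∈ T) (hr : r ∈ T) : halfWedge 𝒢 c s r q p =
      𝒢.act (bulkH (fuse c).2.1 s r) (halfWedge 𝒢 c r s q p) := by
  rw [TwoGFT.halfWedge, TwoGFT.halfWedge, bulkH_fuse c hs hr hsr, h.y s hs r hr hsr q p hqs hqr hps hpr,
    ← MulAut.mul_apply, ← map_mul, inv_mul_cancel_right]

/-- The contributions of a bulk tetrahedron to a bulk triangle cancel. -/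
lemma Glued.cancel (h : Glued c) {s r q p : Fin 6} (hrq : r ≠ q) (hqp : q ≠ p)
    (hrp : r ≠ p) (hsr : s ≠ r) (hsq : s ≠ q) (hs : s ∈ T) (hr : r ∈ T) (hq : q ∈ T)
    (ht : TwoGFT.triangleWord 𝒢 T (fuse c) s r q = 1) :
    𝒢.act (bulkH (fuse c).2.1 s r) (TwoGFT.halfWedge 𝒢 c r q p s) *
        𝒢.act (bulkH (fuse c).2.1 s r) (wedgeX c.1 r q s) * wedgeX c.1 s r q *
        𝒢.act (bulkH (fuse c).2.1 s q) (wedgeX c.1 q s r) *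
        𝒢.act (bulkH (fuse c).2.1 s q) (TwoGFT.halfWedge 𝒢 c q r s p) =
      𝒢.act (bulkH (fuse c).2.1 s r) (wedgeX c.1 r q s) * wedgeX c.1 s r q *
        𝒢.act (bulkH (fuse c).2.1 s q) (wedgeX c.1 q s r) := by
  rw [h.halfWedge hrq.symm hsq hsr hqp.symm hrp.symm hq hr, halfWedge_swap r q p s, map_inv,
    map_inv, ← MulAut.mul_apply, ← map_mul 𝒢.act]
  rw [triangleWord_bulk 𝒢 T _ hs hr hq] at ht
  change 𝒢.t (wedgeX c.1 s q r) * _ * 𝒢.t (wedgeX c.1 r s q) * _ * 𝒢.t (wedgeX c.1 q r s) * _ = 1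
    at ht
  -- The triangle condition: the two ways of transporting from `r` to `s`, directly or through `q`,
  -- differ by `t` of the surface between them.
  have key : 𝒢.t (𝒢.act (bulkH (fuse c).2.1 s r) (wedgeX c.1 r q s) * wedgeX c.1 s r q *
      𝒢.act (bulkH (fuse c).2.1 s q) (wedgeX c.1 q s r)) *
      (bulkH (fuse c).2.1 s q * bulkH (fuse c).2.1 q r) = bulkH (fuse c).2.1 s r := by
    rw [map_mul, map_mul, 𝒢.equivariant, 𝒢.equivariant, wedgeX_swap c.1 r s q,
      wedgeX_swap c.1 s q r, wedgeX_swap c.1 q r s, bulkH_swap _ r q, map_inv, map_inv, map_inv]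
    rw [bulkH_swap _ s q] at ht
    generalize bulkH (fuse c).2.1 s r = a at *
    generalize bulkH (fuse c).2.1 s q = b at *
    generalize bulkH (fuse c).2.1 r q = d at *
    generalize 𝒢.t (wedgeX c.1 s q r) = x at *
    generalize 𝒢.t (wedgeX c.1 r s q) = y at *
    generalize 𝒢.t (wedgeX c.1 q r s) = z at *
    have : b = x * a * y * d * z := by rw [mul_inv_eq_one] at ht; exact ht.symm
    subst this
    group
  set A := 𝒢.act (bulkH (fuse c).2.1 s r) (wedgeX c.1 r q s) * wedgeX c.1 s r q *
      𝒢.act (bulkH (fuse c).2.1 s q) (wedgeX c.1 q s r) with hA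
  -- By the Peiffer identity that surface conjugates one transport of the half wedge into the other,
  -- so the half wedge moves through the surface and meets its inverse.
  have h2 : 𝒢.act (bulkH (fuse c).2.1 s r) (TwoGFT.halfWedge 𝒢 c r q p s) =
      A * 𝒢.act (bulkH (fuse c).2.1 s q * bulkH (fuse c).2.1 q r)
        (TwoGFT.halfWedge 𝒢 c r q p s) * A⁻¹ := by
    rw [← key, map_mul, MulAut.mul_apply, 𝒢.peiffer]
  rw [h2, hA]
  group

/-- The half wedge of the Feynman integral and the side wedge of the amplitude share the form `P * a
* M * b * Q` and differ only in `a` and `b`, the contributions of tetrahedra of the 4-simplex `r`.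
For a bulk tetrahedron this contribution is `1` in the amplitude; for a boundary one it is the same
in both. -/
lemma Glued.exists_sideWedge_eq (h : Glued c) {s r p q : Fin 6} (hsr : s ≠ r) (hsp : s ≠ p)
    (hsq : s ≠ q) (hrp : r ≠ p) (hrq : r ≠ q) (hs : s ∈ T)
    (hw : r ∈ T → wWord 𝒢 c r s p q = 1) :
    ∃ P a M b Q a' b' : G₂, TwoGFT.halfWedge 𝒢 c s r p q = P * a * M * b * Q ∧
      sideWedge 𝒢 T (fuse c) s r p q = P * a' * M * b' * Q ∧
      (r ∈ T → P = 𝒢.act (bulkH (fuse c).2.1 s r) (wedgeX c.1 r s p) ∧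
        Q = 𝒢.act (bulkH (fuse c).2.1 s r) (wedgeX c.1 r q s) ∧
        (p ∈ T → a = 𝒢.act (bulkH (fuse c).2.1 s r) (TwoGFT.halfWedge 𝒢 c r p s q) ∧ a' = 1) ∧
        (q ∈ T → b = 𝒢.act (bulkH (fuse c).2.1 s r) (TwoGFT.halfWedge 𝒢 c r q p s) ∧ b' = 1)) ∧
      (p ∉ T ∨ r ∉ T → a = a') ∧ (q ∉ T ∨ r ∉ T → b = b') := by
  by_cases hr : r ∈ T
  · refine ⟨𝒢.act (bulkH (fuse c).2.1 s r) (wedgeX c.1 r s p),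
      𝒢.act (bulkH (fuse c).2.1 s r) (TwoGFT.halfWedge 𝒢 c r p s q),
      𝒢.act (bulkH (fuse c).2.1 s r) (wedgeX c.1 r p q),
      𝒢.act (bulkH (fuse c).2.1 s r) (TwoGFT.halfWedge 𝒢 c r q p s),
      𝒢.act (bulkH (fuse c).2.1 s r) (wedgeX c.1 r q s),
      𝒢.act (bulkH (fuse c).2.1 s r) (outerWedge 𝒢 T (fuse c) r p s q),
      𝒢.act (bulkH (fuse c).2.1 s r) (outerWedge 𝒢 T (fuse c) r q p s), ?_, ?_,
      fun _ => ⟨rfl, rfl, fun h => ⟨rfl, ?_⟩, fun h => ⟨rfl, ?_⟩⟩, ?_, ?_⟩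
    · rw [h.halfWedge hsr hsp.symm hrp.symm hsq.symm hrq.symm hs hr, halfWedge_swap r s q p]
      simp only [← map_mul]
      congr 1
      rw [inv_eq_iff_mul_eq_one, ← hw hr]
      simp only [wWord, vertexWedgeWord, TwoGFT.halfWedge, mul_assoc]
    · rw [sideWedge, if_pos hr]
      simp only [map_mul]
      rfl
    · rw [outerWedge, if_pos h, map_one]
    · rw [outerWedge, if_pos h, map_one]
    · intro h
      rw [outerWedge_fuse hr, if_neg (h.resolve_right (not_not_intro hr))]
    · intro h
      rw [outerWedge_fuse hr, if_neg (h.resolve_right (not_not_intro hr))]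
  · refine ⟨1, 1, TwoGFT.halfWedge 𝒢 c s r p q, 1, 1, 1, 1, by group, ?_, fun h => absurd h hr,
      fun _ => rfl, fun _ => rfl⟩
    rw [sideWedge, if_neg hr, outerWedge_fuse hs, if_neg hr]
    group

/-- Around an edge, the delta function of the amplitude is that of one of the vertex kernels. -/
lemma Glued.edgeWord_iff (h : Glued c) {s r q p : Fin 6} (hsr : s ≠ r) (hsq : s ≠ q) (hsp : s ≠ p)
    (hrq : r ≠ q) (hrp : r ≠ p) (hqp : q ≠ p) (hs : s ∈ T)
    (hr : r ∈ T → wWord 𝒢 c r s p q = 1) (hq : q ∈ T → wWord 𝒢 c q s r p = 1)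
    (hp : p ∈ T → wWord 𝒢 c p s q r = 1)
    (hrq' : r ∈ T → q ∈ T → TwoGFT.triangleWord 𝒢 T (fuse c) s r q = 1)
    (hqp' : q ∈ T → p ∈ T → TwoGFT.triangleWord 𝒢 T (fuse c) s q p = 1)
    (hpr' : p ∈ T → r ∈ T → TwoGFT.triangleWord 𝒢 T (fuse c) s p r = 1) :
    edgeWord 𝒢 T (fuse c) s r q p = 1 ↔ wWord 𝒢 c s r q p = 1 := by
  obtain ⟨P, a, M, b, Q, a', b', h1, h1', k1, l1, m1⟩ := h.exists_sideWedge_eq hsr hsp hsq hrp hrq hs hr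
  obtain ⟨P₂, a₂, M₂, b₂, Q₂, a₂', b₂', h2, h2', k2, l2, m2⟩ :=
    h.exists_sideWedge_eq hsq hsr hsp hrq.symm hqp hs hq
  obtain ⟨P₃, a₃, M₃, b₃, Q₃, a₃', b₃', h3, h3', k3, l3, m3⟩ :=
    h.exists_sideWedge_eq hsp hsq hsr hqp.symm hrp.symm hs hp
  -- The factors `b` and `a₂` come from the same tetrahedron `{r, q}`, seen from `r` and from `q`.
  -- If it is in the bulk, they cancel against each other across the triangle `{s, r, q}`; otherwise
  -- they are not changed.
  have c1 : b * Q * wedgeX c.1 s r q * P₂ * a₂ = b' * Q * wedgeX c.1 s r q * P₂ * a₂' := by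
    by_cases hr : r ∈ T
    · by_cases hq : q ∈ T
      · rw [((k1 hr).2.2.2 hq).1, ((k1 hr).2.2.2 hq).2, ((k2 hq).2.2.1 hr).1,
          ((k2 hq).2.2.1 hr).2, (k1 hr).2.1, (k2 hq).1, one_mul, mul_one]
        exact h.cancel hrq hqp hrp hsr hsq hs hr hq (hrq' hr hq)
      · rw [m1 (Or.inl hq), l2 (Or.inr hq)]
    · rw [m1 (Or.inr hr), l2 (Or.inl hr)]
  have c2 : b₂ * Q₂ * wedgeX c.1 s q p * P₃ * a₃ = b₂' * Q₂ * wedgeX c.1 s q p * P₃ * a₃' := by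
    by_cases hr : q ∈ T
    · by_cases hq : p ∈ T
      · rw [((k2 hr).2.2.2 hq).1, ((k2 hr).2.2.2 hq).2, ((k3 hq).2.2.1 hr).1,
          ((k3 hq).2.2.1 hr).2, (k2 hr).2.1, (k3 hq).1, one_mul, mul_one]
        exact h.cancel hqp hrp.symm hrq.symm hsq hsp hs hr hq (hqp' hr hq)
      · rw [m2 (Or.inl hq), l3 (Or.inr hq)]
    · rw [m2 (Or.inr hr), l3 (Or.inl hr)]
  have c3 : b₃ * Q₃ * wedgeX c.1 s p r * P * a = b₃' * Q₃ * wedgeX c.1 s p r * P * a' := by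
    by_cases hr : p ∈ T
    · by_cases hq : r ∈ T
      · rw [((k3 hr).2.2.2 hq).1, ((k3 hr).2.2.2 hq).2, ((k1 hq).2.2.1 hr).1,
          ((k1 hq).2.2.1 hr).2, (k3 hr).2.1, (k1 hq).1, one_mul, mul_one]
        exact h.cancel hrp.symm hrq hqp.symm hsp hsr hs hr hq (hpr' hr hq)
      · rw [m3 (Or.inl hq), l1 (Or.inr hq)]
    · rw [m3 (Or.inr hr), l1 (Or.inl hr)]
  have e1 : wWord 𝒢 c s r q p = (P * a) * (M * (b * Q * wedgeX c.1 s r q * P₂ * a₂) * M₂ *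
      (b₂ * Q₂ * wedgeX c.1 s q p * P₃ * a₃) * M₃ * (b₃ * Q₃ * wedgeX c.1 s p r * P * a)) *
      (P * a)⁻¹ := by
    change TwoGFT.halfWedge 𝒢 c s r p q * _ * TwoGFT.halfWedge 𝒢 c s q r p * _ *
      TwoGFT.halfWedge 𝒢 c s p q r * _ = _
    rw [h1, h2, h3]
    group
  have e2 : edgeWord 𝒢 T (fuse c) s r q p = (P * a') * (M * (b' * Q * wedgeX c.1 s r q * P₂ * a₂') *
      M₂ * (b₂' * Q₂ * wedgeX c.1 s q p * P₃ * a₃') * M₃ *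
      (b₃' * Q₃ * wedgeX c.1 s p r * P * a')) * (P * a')⁻¹ := by
    rw [edgeWord, h1', h2', h3']
    change _ * wedgeX c.1 s r q * _ * wedgeX c.1 s q p * _ * wedgeX c.1 s p r = _
    group
  rw [e1, e2, c1, c2, c3, conj_eq_one_iff, conj_eq_one_iff]

end Fuse

/-! ### Flatness of Feynman configurations and of their reductions -/

section FeynFlat

variable {G₁ G₂ : Type*} [Group G₁] [Group G₂] (𝒢 : CrossedModule G₁ G₂)
  {T : Finset (Fin 6)} (c : FeynmanConfig G₁ G₂ T)

/-- The arguments of the kept delta functions of the Feynman integral are `1`. -/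
structure FeynFlat (m : Option (Fin 6)) : Prop where
  glued : Glued c
  link : ∀ s ∈ T, ∀ a b, a ≠ s → b ≠ s → a ≠ b → ¬ (Redundant T m {s, a, b} ∧ s < a ∧ s < b) →
    lWord 𝒢 c s a b = 1
  wedge : ∀ s ∈ T, ∀ a b d, a ≠ s → b ≠ s → d ≠ s → a ≠ b → b ≠ d → a ≠ d →
    ¬ (Redundant T m {s, a, b, d} ∧ s < a ∧ s < b ∧ s < d) → wWord 𝒢 c s a b d = 1

variable {𝒢 c}

/-- Around a kept triangle all vertex conditions are available, so the telescoping can start at any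
4-simplex of `T` that contains the triangle. -/
lemma FeynFlat.triFlat {m : Option (Fin 6)} (h : FeynFlat 𝒢 c m) : TriFlat 𝒢 T (fuse c) m := by
  have key : ∀ s r q : Fin 6, s ≠ r → r ≠ q → s ≠ q → s ∈ T → ¬ Redundant T m {s, r, q} →
      triangleWord 𝒢 T (fuse c) s r q = 1 := by
    intro s r q hsr hrq hsq hs hm
    rw [h.glued.triangleWord hsr hrq hsq hs (fun hr => h.link r hr s q hsr hrq.symm hsq ?_)
      fun hq => h.link q hq s r hsq hrq hsr ?_]
    · exact h.link s hs r q hsr.symm hsq.symm hrq fun H => hm H.1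
    · rintro ⟨H, -⟩
      exact hm (by rwa [show ({s, r, q} : Finset (Fin 6)) = {r, s, q} by grind])
    · rintro ⟨H, -⟩
      exact hm (by rwa [show ({s, r, q} : Finset (Fin 6)) = {q, s, r} by grind])
  intro s r q hsr hrq hsq hT hm
  rcases hT with hs | hr | hq
  · exact key s r q hsr hrq hsq hs hm
  · exact triangleWord_rotate _ _ _ (triangleWord_rotate _ _ _ (key r q s hrq hsq.symm hsr.symm hr
      (by rwa [show ({r, q, s} : Finset (Fin 6)) = {s, r, q} by grind])))
  · exact triangleWord_rotate _ _ _ (key q s r hsq.symm hsr hrq.symm hq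
      (by rwa [show ({q, s, r} : Finset (Fin 6)) = {s, r, q} by grind]))

/-- The comparison uses the vertex conditions at the 4-simplices other than the base `s`. By `hm`
they are all kept: around a redundant edge only the one at the least index is missing, and then that
index is `s`. -/
lemma FeynFlat.edgeWord {m : Option (Fin 6)} (h : FeynFlat 𝒢 c m) {s r q p : Fin 6} (hsr : s ≠ r)
    (hsq : s ≠ q) (hsp : s ≠ p) (hrq : r ≠ q) (hrp : r ≠ p) (hqp : q ≠ p) (hs : s ∈ T)
    (hm : ¬ (Redundant T m {s, r, q, p} ∧ ¬ (s < r ∧ s < q ∧ s < p)))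
    (hrq' : r ∈ T → q ∈ T → triangleWord 𝒢 T (fuse c) s r q = 1)
    (hqp' : q ∈ T → p ∈ T → triangleWord 𝒢 T (fuse c) s q p = 1)
    (hpr' : p ∈ T → r ∈ T → triangleWord 𝒢 T (fuse c) s p r = 1) :
    edgeWord 𝒢 T (fuse c) s r q p = 1 ↔ wWord 𝒢 c s r q p = 1 := by
  refine h.glued.edgeWord_iff hsr hsq hsp hrq hrp hqp hs
    (fun hr => h.wedge r hr s p q hsr hrp.symm hrq.symm hsp hqp.symm hsq ?_)
    (fun hq => h.wedge q hq s r p hsq hrq hqp.symm hsr hrp hsp ?_)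
    (fun hp => h.wedge p hp s q r hsp hqp hrp hsq hrq.symm hsr ?_) hrq' hqp' hpr'
  · rintro ⟨H, h1, -⟩
    exact hm ⟨by rwa [show ({s, r, q, p} : Finset (Fin 6)) = {r, s, p, q} by grind],
      fun h2 => h1.not_gt h2.1⟩
  · rintro ⟨H, h1, -⟩
    exact hm ⟨by rwa [show ({s, r, q, p} : Finset (Fin 6)) = {q, s, r, p} by grind],
      fun h2 => h1.not_gt h2.2.1⟩
  · rintro ⟨H, h1, -⟩
    exact hm ⟨by rwa [show ({s, r, q, p} : Finset (Fin 6)) = {p, s, q, r} by grind],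
      fun h2 => h1.not_gt h2.2.2⟩

/-- With the edge words based at `m`, regardless of the order of the indices, the wanted loop is
always the opposite one. -/
lemma flat_of_edgeWord {T : Finset (Fin 6)} {c : ReducedConfig G₁ G₂ T} {m : Fin 6}
    (hm : m ∈ T) (hB : BulkFlat 𝒢 T c m)
    (h : ∀ s ∈ T, ∀ r ∈ T, ∀ q ∈ T, s ≠ r → r ≠ q → s ≠ q → m ≠ s → m ≠ r → m ≠ q →
      edgeWord 𝒢 T c m s r q = 1) : Flat 𝒢 T c m := by
  refine ⟨hB, fun s hs r hr q hq hsr hrq hsq => ?_⟩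
  have hm1 : ∀ r q, loop 𝒢 T c m m r q = 1 := loop_ref 𝒢 T c m
  by_cases hsm : m = s
  · subst hsm; exact hm1 _ _
  by_cases hrm : m = r
  · subst hrm; rw [← loop_rotate_iff]; exact hm1 _ _
  by_cases hqm : m = q
  · subst hqm; rw [← loop_rotate_iff, ← loop_rotate_iff]; exact hm1 _ _
  rw [← loop_swap_iff]
  exact hB.loop_opposite hm hs hr hq (hm1 _ _) (hm1 _ _) (hm1 _ _)
    (h s hs r hr q hq hsr hrq hsq hsm hrm hqm)

lemma FeynFlat.flat {m : Fin 6} (hm : m ∈ T) (h : FeynFlat 𝒢 c (some m)) :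
    Flat 𝒢 T (fuse c) m := by
  refine flat_of_edgeWord hm (bulkFlat_of_triFlat 𝒢 T _ m hm h.triFlat)
    fun s hs r hr q hq hsr hrq hsq hms hmr hmq => ?_
  have ht : ∀ a b, m ≠ a → m ≠ b → a ≠ b → triangleWord 𝒢 T (fuse c) m a b = 1 :=
    fun a b ha hb hab => h.triFlat m a b ha hab hb (Or.inl hm) (by simp [redundant_some])
  rw [h.edgeWord hms hmr hmq hsr hsq hrq hm (by simp [redundant_some])
    (fun _ _ => ht _ _ hms hmr hsr) (fun _ _ => ht _ _ hmr hmq hrq)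
    (fun _ _ => ht _ _ hmq hms hsq.symm)]
  exact h.wedge m hm s r q hms.symm hmr.symm hmq.symm hsr hrq hsq (by simp [redundant_some])

lemma FeynFlat.edgeFlat {m : Fin 6} (hm : m ∈ T) (h : FeynFlat 𝒢 c (some m)) :
    EdgeFlat 𝒢 T (fuse c) (some m) := by
  intro s r q p hsr hsq hsp hrq hrp hqp hs _ _ _ hR
  have hF := h.flat hm
  rw [h.edgeWord hsr hsq hsp hrq hrp hqp hs (fun H => hR H.1)
    (fun hr hq => hF.triangleWord_bulk hs hr hq hsr hrq hsq)
    (fun hq hp => hF.triangleWord_bulk hs hq hp hsq hqp hsp)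
    (fun hp hr => hF.triangleWord_bulk hs hp hr hsp hrp.symm hsr)]
  exact h.wedge s hs r q p hsr.symm hsq.symm hsp.symm hrq hqp hrp (fun H => hR H.1)

/-- The arguments of the omitted delta functions are `1` as well. -/
lemma FeynFlat.none {m : Fin 6} (hm : m ∈ T) (h : FeynFlat 𝒢 c (some m)) :
    FeynFlat 𝒢 c none := by
  have hF := h.flat hm
  refine ⟨h.glued, fun s hs a b has hbs hab _ => ?_, fun s hs a b d has hbs hds hab hbd had _ => ?_⟩
  -- The omitted vertex condition is at the least index `s`. The conditions at the other two
  -- 4-simplices are kept and identify its word with the triangle word, which is trivial by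
  -- flatness.
  · by_cases hR : Redundant T (some m) {s, a, b} ∧ s < a ∧ s < b
    · obtain ⟨hR, hsa, hsb⟩ := hR
      have hT := ((redundant_some T m).1 hR).1
      simp only [Finset.insert_subset_iff, Finset.singleton_subset_iff] at hT
      rw [← h.glued.triangleWord hsa.ne hab hsb.ne hs
        (fun ha => h.link a ha s b hsa.ne hab.symm hsb.ne fun H => H.2.1.not_gt hsa)
        fun hb => h.link b hb s a hsb.ne hab hsa.ne fun H => H.2.1.not_gt hsb]
      exact hF.triangleWord_bulk hs hT.2.1 hT.2.2 hsa.ne hab hsb.ne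
    · exact h.link s hs a b has hbs hab hR
  · by_cases hR : Redundant T (some m) {s, a, b, d} ∧ s < a ∧ s < b ∧ s < d
    · obtain ⟨hR, hsa⟩ := hR
      have hT := ((redundant_some T m).1 hR).1
      simp only [Finset.insert_subset_iff, Finset.singleton_subset_iff] at hT
      rw [← h.edgeWord has.symm hbs.symm hds.symm hab had hbd hs (fun H => H.2 hsa)
        (fun ha hb => hF.triangleWord_bulk hs ha hb has.symm hab hbs.symm)
        (fun ha hb => hF.triangleWord_bulk hs ha hb hbs.symm hbd hds.symm)
        (fun ha hb => hF.triangleWord_bulk hs ha hb hds.symm had.symm has.symm)]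
      exact hF.edgeWord_bulk hs hT.2.1 hT.2.2.1 hT.2.2.2 has.symm hbs.symm hds.symm hab had hbd
    · exact h.wedge s hs a b d has hbs hds hab hbd had hR

end FeynFlat

/-! ### Sorting indices -/

/-- The indices in increasing order. -/
def sorted (a b c : Fin 6) : Fin 6 × Fin 6 × Fin 6 :=
  if a < b then if b < c then (a, b, c) else if a < c then (a, c, b) else (c, a, b)
  else if a < c then (b, a, c) else if b < c then (b, c, a) else (c, b, a)

/-- The triples are equal up to a permutation. -/
def Perm3 (a b c i j k : Fin 6) : Prop :=
  (i = a ∧ j = b ∧ k = c) ∨ (i = a ∧ j = c ∧ k = b) ∨ (i = b ∧ j = a ∧ k = c) ∨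
    (i = b ∧ j = c ∧ k = a) ∨ (i = c ∧ j = a ∧ k = b) ∨ (i = c ∧ j = b ∧ k = a)

lemma exists_sorted {a b c : Fin 6} (hab : a ≠ b) (hbc : b ≠ c) (hac : a ≠ c) :
    ∃ i j k, i < j ∧ j < k ∧ Perm3 a b c i j k ∧ sorted a b c = (i, j, k) := by
  unfold Perm3 sorted
  split_ifs
  · exact ⟨a, b, c, by omega, by omega, by simp, rfl⟩
  · exact ⟨a, c, b, by omega, by omega, by simp, rfl⟩
  · exact ⟨c, a, b, by omega, by omega, by simp, rfl⟩
  · exact ⟨b, a, c, by omega, by omega, by simp, rfl⟩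
  · exact ⟨b, c, a, by omega, by omega, by simp, rfl⟩
  · exact ⟨c, b, a, by omega, by omega, by simp, rfl⟩

lemma Perm3.sorted_eq {a b c i j k : Fin 6} (h : Perm3 a b c i j k) (hij : i < j) (hjk : j < k) :
    sorted a b c = (i, j, k) := by
  unfold Perm3 at h
  obtain ⟨i', j', k', h1, h2, h3, h4⟩ := exists_sorted (a := a) (b := b) (c := c)
    (by omega) (by omega) (by omega)
  rw [h4]
  unfold Perm3 at h3
  have : i = i' ∧ j = j' ∧ k = k' := by omega
  rw [this.1, this.2.1, this.2.2]

/-! ### Products over the kept triangles and edges -/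

/-- A kept bulk triangle contains `m` and is labelled by the other two indices, that is, by a bulk
tetrahedron. A boundary triangle is labelled by its first index inside `T`, its first index outside
and the remaining one. These labels name the variables `h` and `u` that the delta functions will
determine. -/
lemma prod_keptTriangles {T : Finset (Fin 6)} {m : Fin 6} (hm : m ∈ T)
    (f : Fin 6 × Fin 6 × Fin 6 → ℝ) :
    ∏ p ∈ keptTriangles T (some m), f p =
      (∏ p ∈ (bulkTets T).filter (fun p => p.1 ≠ m ∧ p.2 ≠ m),
        f (sorted m p.1 p.2)) *
      ∏ p ∈ Finset.univ.filter (fun p : Fin 6 × Fin 6 × Fin 6 => p.1 ∈ T ∧ p.2.1 ∉ T ∧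
        p.2.2 ≠ p.1 ∧ p.2.2 ≠ p.2.1 ∧ (p.2.2 ∈ T → p.1 < p.2.2) ∧ (p.2.2 ∉ T → p.2.1 < p.2.2)),
        f (sorted p.1 p.2.1 p.2.2) := by
  classical
  rw [← Finset.prod_filter_mul_prod_filter_not (keptTriangles T (some m))
    (fun p => p.1 ∈ T ∧ p.2.1 ∈ T ∧ p.2.2 ∈ T)]
  congr 1
  · refine (Finset.prod_bij (fun p _ => sorted m p.1 p.2) ?_ ?_ ?_ ?_).symm
    · rintro ⟨r, q⟩ hp
      simp only [bulkTets, Finset.mem_filter, Finset.mem_univ, true_and] at hp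
      obtain ⟨i, j, k, hij, hjk, hP, hs⟩ := exists_sorted (a := m) (b := r) (c := q)
        (by omega) (by omega) (by omega)
      simp only [hs, keptTriangles, Finset.mem_filter, Finset.mem_univ, true_and, redundant_some,
        Finset.insert_subset_iff, Finset.singleton_subset_iff, Finset.mem_insert,
        Finset.mem_singleton]
      unfold Perm3 at hP
      grind
    · rintro ⟨r, q⟩ hp ⟨r', q'⟩ hp' h
      simp only [bulkTets, Finset.mem_filter, Finset.mem_univ, true_and] at hp hp'
      obtain ⟨i, j, k, hij, hjk, hP, hs⟩ := exists_sorted (a := m) (b := r) (c := q)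
        (by omega) (by omega) (by omega)
      obtain ⟨i', j', k', hij', hjk', hP', hs'⟩ := exists_sorted (a := m) (b := r') (c := q')
        (by omega) (by omega) (by omega)
      simp only [hs, hs', Prod.mk.injEq] at h ⊢
      unfold Perm3 at hP hP'
      omega
    · rintro ⟨i, j, k⟩ hp
      simp only [keptTriangles, Finset.mem_filter, Finset.mem_univ, true_and,
        redundant_some, Finset.insert_subset_iff, Finset.singleton_subset_iff, Finset.mem_insert,
        Finset.mem_singleton] at hp
      have hmem : m = i ∨ m = j ∨ m = k := by grind
      obtain ⟨r, q, hrq, hP⟩ : ∃ r q, r < q ∧ Perm3 m r q i j k := by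
        unfold Perm3
        rcases hmem with h | h | h
        · exact ⟨j, k, by omega, by omega⟩
        · exact ⟨i, k, by omega, by omega⟩
        · exact ⟨i, j, by omega, by omega⟩
      refine ⟨(r, q), ?_, hP.sorted_eq hp.1.1 hp.1.2.1⟩
      simp only [bulkTets, Finset.mem_filter, Finset.mem_univ, true_and]
      unfold Perm3 at hP
      grind
    · intros; rfl
  · refine (Finset.prod_bij (fun p _ => sorted p.1 p.2.1 p.2.2)
      ?_ ?_ ?_ ?_).symm
    · rintro ⟨s, r, q⟩ hp
      simp only [Finset.mem_filter, Finset.mem_univ, true_and] at hp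
      have hsr : s ≠ r := by grind
      obtain ⟨i, j, k, hij, hjk, hP, hs⟩ := exists_sorted (a := s) (b := r) (c := q)
        (by omega) (by omega) (by omega)
      simp only [hs, keptTriangles, Finset.mem_filter, Finset.mem_univ, true_and, redundant_some,
        Finset.insert_subset_iff, Finset.singleton_subset_iff, Finset.mem_insert,
        Finset.mem_singleton]
      unfold Perm3 at hP
      grind
    · rintro ⟨s, r, q⟩ hp ⟨s', r', q'⟩ hp' h
      simp only [Finset.mem_filter, Finset.mem_univ, true_and] at hp hp'
      have hsr : s ≠ r := by grind
      have hsr' : s' ≠ r' := by grind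
      obtain ⟨i, j, k, hij, hjk, hP, hs⟩ := exists_sorted (a := s) (b := r) (c := q)
        (by omega) (by omega) (by omega)
      obtain ⟨i', j', k', hij', hjk', hP', hs'⟩ := exists_sorted (a := s') (b := r') (c := q')
        (by omega) (by omega) (by omega)
      simp only [hs, hs', Prod.mk.injEq] at h ⊢
      unfold Perm3 at hP hP'
      grind
    · rintro ⟨i, j, k⟩ hp
      simp only [keptTriangles, Finset.mem_filter, Finset.mem_univ, true_and,
        redundant_some, Finset.insert_subset_iff, Finset.singleton_subset_iff, Finset.mem_insert,
        Finset.mem_singleton] at hp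
      -- A boundary triangle has indices on both sides; the increasing order shows which of them
      -- come first on their side.
      obtain ⟨s, r, q, hP, h⟩ : ∃ s r q, Perm3 s r q i j k ∧ s ∈ T ∧ r ∉ T ∧
          q ≠ s ∧ q ≠ r ∧ (q ∈ T → s < q) ∧ (q ∉ T → r < q) := by
        unfold Perm3
        by_cases hi : i ∈ T <;> by_cases hj : j ∈ T <;> by_cases hk : k ∈ T
        · tauto
        · exact ⟨i, k, j, by grind⟩
        · exact ⟨i, j, k, by grind⟩
        · exact ⟨i, j, k, by grind⟩
        · exact ⟨j, i, k, by grind⟩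
        · exact ⟨j, i, k, by grind⟩
        · exact ⟨k, i, j, by grind⟩
        · tauto
      exact ⟨(s, r, q), by simpa using h, hP.sorted_eq hp.1.1 hp.1.2.1⟩
    · intros; rfl

/-- The edges of the reference 4-simplex in the bulk correspond to variables `X`, the other edges
to variables `Y`. -/
lemma prod_keptEdges {T : Finset (Fin 6)} {m : Fin 6} (hm : m ∈ T)
    (f : Fin 6 × Fin 6 × Fin 6 × Fin 6 → ℝ) :
    ∏ p ∈ keptEdges T (some m), f p =
      (∏ p ∈ Finset.univ.filter (fun p : Fin 6 × Fin 6 × Fin 6 => p.1 ∈ T ∧ p.2.1 ∈ T ∧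
        p.2.2 ∈ T ∧ p.1 ≠ m ∧ p.2.1 ≠ m ∧ p.2.2 ≠ m ∧ p.1 < p.2.1 ∧ p.2.1 < p.2.2),
        f (if m < p.1 then (m, sorted p.1 p.2.1 p.2.2) else (p.1, sorted m p.2.1 p.2.2))) *
      ∏ p ∈ Finset.univ.filter (fun p : Fin 6 × Fin 6 × Fin 6 × Fin 6 => p.1 ∈ T ∧ p.2.1 ∉ T ∧
        p.2.2.1 ≠ p.1 ∧ p.2.2.1 ≠ p.2.1 ∧ p.2.2.2 ≠ p.1 ∧ p.2.2.2 ≠ p.2.1 ∧ p.2.2.1 < p.2.2.2 ∧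
        (p.2.2.1 ∈ T → p.1 < p.2.2.1) ∧ (p.2.2.1 ∉ T → p.2.1 < p.2.2.1) ∧
        (p.2.2.2 ∈ T → p.1 < p.2.2.2) ∧ (p.2.2.2 ∉ T → p.2.1 < p.2.2.2)),
        f (p.1, sorted p.2.1 p.2.2.1 p.2.2.2) := by
  classical
  rw [← Finset.prod_filter_mul_prod_filter_not (keptEdges T (some m))
    (fun p => p.2.1 ∈ T ∧ p.2.2.1 ∈ T ∧ p.2.2.2 ∈ T)]
  congr 1
  · refine (Finset.prod_bij (fun p _ => if m < p.1 then (m, sorted p.1 p.2.1 p.2.2)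
      else (p.1, sorted m p.2.1 p.2.2)) ?_ ?_ ?_ ?_).symm
    · rintro ⟨s, r, q⟩ hp
      simp only [Finset.mem_filter, Finset.mem_univ, true_and] at hp
      split_ifs with hms
      · rw [show sorted s r q = (s, r, q) from Perm3.sorted_eq (by simp [Perm3])
          (by omega) (by omega)]
        simp only [keptEdges, Finset.mem_filter, Finset.mem_univ, true_and, redundant_some,
          Finset.insert_subset_iff, Finset.singleton_subset_iff, Finset.mem_insert,
          Finset.mem_singleton]
        grind
      · obtain ⟨i, j, k, hij, hjk, hP, hs⟩ := exists_sorted (a := m) (b := r) (c := q)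
          (by omega) (by omega) (by omega)
        simp only [hs, keptEdges, Finset.mem_filter, Finset.mem_univ, true_and, redundant_some,
          Finset.insert_subset_iff, Finset.singleton_subset_iff, Finset.mem_insert,
          Finset.mem_singleton]
        unfold Perm3 at hP
        rcases hP with hP | hP | hP | hP | hP | hP <;> grind
    · rintro ⟨s, r, q⟩ hp ⟨s', r', q'⟩ hp' h
      simp only [Finset.mem_filter, Finset.mem_univ, true_and] at hp hp'
      obtain ⟨i, j, k, hij, hjk, hP, hs⟩ := exists_sorted (a := m) (b := r) (c := q)
        (by omega) (by omega) (by omega)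
      obtain ⟨i', j', k', hij', hjk', hP', hs'⟩ := exists_sorted (a := m) (b := r') (c := q')
        (by omega) (by omega) (by omega)
      rw [hs, hs', show sorted s r q = (s, r, q) from Perm3.sorted_eq (by simp [Perm3])
          (by omega) (by omega), show sorted s' r' q' = (s', r', q') from
          Perm3.sorted_eq (by simp [Perm3]) (by omega) (by omega)] at h
      unfold Perm3 at hP hP'
      split_ifs at h <;> simp only [Prod.mk.injEq] at h ⊢ <;> omega
    · rintro ⟨b, i, j, k⟩ hp
      simp only [keptEdges, Finset.mem_filter, Finset.mem_univ, true_and, redundant_some,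
        Finset.insert_subset_iff, Finset.singleton_subset_iff, Finset.mem_insert,
        Finset.mem_singleton] at hp
      by_cases hb : b = m
      · refine ⟨(i, j, k), ?_, ?_⟩
        · simp only [Finset.mem_filter, Finset.mem_univ, true_and]
          grind
        · rw [if_pos (by grind), show sorted i j k = (i, j, k) from
            Perm3.sorted_eq (by simp [Perm3]) (by omega) (by omega), hb]
      · have hmem : m = i ∨ m = j ∨ m = k := by grind
        obtain ⟨r, q, hrq, hP⟩ : ∃ r q, r < q ∧ Perm3 m r q i j k := by
          unfold Perm3
          rcases hmem with h | h | h
          · exact ⟨j, k, by omega, by omega⟩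
          · exact ⟨i, k, by omega, by omega⟩
          · exact ⟨i, j, by omega, by omega⟩
        refine ⟨(b, r, q), ?_, ?_⟩
        · simp only [Finset.mem_filter, Finset.mem_univ, true_and]
          unfold Perm3 at hP
          grind
        · rw [if_neg (by grind), hP.sorted_eq hp.1.1 hp.1.2.1]
    · intros; rfl
  · refine (Finset.prod_bij (fun p _ => (p.1, sorted p.2.1 p.2.2.1 p.2.2.2)) ?_ ?_ ?_ ?_).symm
    · rintro ⟨s, r, q, p⟩ hp
      simp only [Finset.mem_filter, Finset.mem_univ, true_and] at hp
      have hsr : s ≠ r := by grind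
      obtain ⟨i, j, k, hij, hjk, hP, hs⟩ := exists_sorted (a := r) (b := q) (c := p)
        (by omega) (by omega) (by omega)
      simp only [hs, keptEdges, Finset.mem_filter, Finset.mem_univ, true_and, redundant_some,
        Finset.insert_subset_iff, Finset.singleton_subset_iff, Finset.mem_insert,
        Finset.mem_singleton]
      unfold Perm3 at hP
      rcases hP with hP | hP | hP | hP | hP | hP <;> grind
    · rintro ⟨s, r, q, p⟩ hp ⟨s', r', q', p'⟩ hp' h
      simp only [Finset.mem_filter, Finset.mem_univ, true_and] at hp hp'
      have hsr : s ≠ r := by grind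
      have hsr' : s' ≠ r' := by grind
      obtain ⟨i, j, k, hij, hjk, hP, hs⟩ := exists_sorted (a := r) (b := q) (c := p)
        (by omega) (by omega) (by omega)
      obtain ⟨i', j', k', hij', hjk', hP', hs'⟩ := exists_sorted (a := r') (b := q') (c := p')
        (by omega) (by omega) (by omega)
      simp only [hs, hs', Prod.mk.injEq] at h ⊢
      unfold Perm3 at hP hP'
      grind
    · rintro ⟨s, i, j, k⟩ hp
      simp only [keptEdges, Finset.mem_filter, Finset.mem_univ, true_and, redundant_some,
        Finset.insert_subset_iff, Finset.singleton_subset_iff, Finset.mem_insert,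
        Finset.mem_singleton] at hp
      obtain ⟨r, q, p, hP, h⟩ : ∃ r q p, Perm3 r q p i j k ∧ r ∉ T ∧
          q < p ∧ (q ∉ T → r < q) ∧ (p ∉ T → r < p) := by
        unfold Perm3
        by_cases hi : i ∈ T
        · by_cases hj : j ∈ T
          · exact ⟨k, i, j, by grind⟩
          · exact ⟨j, i, k, by grind⟩
        · exact ⟨i, j, k, by grind⟩
      refine ⟨(s, r, q, p), ?_, by rw [hP.sorted_eq hp.1.1 hp.1.2.1]⟩
      simp only [Finset.mem_filter, Finset.mem_univ, true_and]
      unfold Perm3 at hP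
      rcases hP with hP | hP | hP | hP | hP | hP <;> grind
    · intros; rfl

/-! ### Products over the delta functions of the Feynman integral -/

/-- The 4-simplex `s` is the base of the triangle `{s, a, b}`: the first one around it, except that
the reference 4-simplex is not chosen for bulk triangles. -/
def Base3 (T : Finset (Fin 6)) (m s a b : Fin 6) : Prop :=
  s ∈ T ∧ (a ∈ T → b ∈ T → s ≠ m) ∧ (a ∈ T → s < a ∨ (b ∈ T ∧ a = m)) ∧
    (b ∈ T → s < b ∨ (a ∈ T ∧ b = m))

/-- The 4-simplex `s` is the base of the edge `{s, a, b, d}`. -/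
def Base4 (T : Finset (Fin 6)) (m s a b d : Fin 6) : Prop :=
  s ∈ T ∧ (a ∈ T → b ∈ T → d ∈ T → s ≠ m) ∧ (a ∈ T → s < a ∨ (b ∈ T ∧ d ∈ T ∧ a = m)) ∧
    (b ∈ T → s < b ∨ (a ∈ T ∧ d ∈ T ∧ b = m)) ∧ (d ∈ T → s < d ∨ (a ∈ T ∧ b ∈ T ∧ d = m))

/-- The variable `u_{s;a;b}` is determined by the kinetic kernel. -/
def KinU (T : Finset (Fin 6)) (m s a b : Fin 6) : Prop :=
  a ∈ T ∧ (Base3 T m s a b ∨ (¬ Base3 T m a s b ∧ a < s))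

/-- The variable `u_{s;a;b}` is determined by the vertex kernel. -/
def VertU (T : Finset (Fin 6)) (m s a b : Fin 6) : Prop :=
  Base3 T m a s b ∨ (Base3 T m s a b ∧ a ∉ T ∧ (b ∉ T → a < b))

/-- The variable `Y_{s;a;b,d}` is determined by the kinetic kernel. -/
def KinY (T : Finset (Fin 6)) (m s a b d : Fin 6) : Prop :=
  a ∈ T ∧ (Base4 T m s a b d ∨ (¬ Base4 T m a s b d ∧ a < s))

/-- The variable `Y_{s;a;b,d}` is determined by the vertex kernel. -/
def VertY (T : Finset (Fin 6)) (m s a b d : Fin 6) : Prop :=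
  Base4 T m a s b d ∨ (Base4 T m s a b d ∧ a ∉ T ∧ (b ∉ T → a < b) ∧ (d ∉ T → a < d))

instance (T : Finset (Fin 6)) (m s a b : Fin 6) : Decidable (Base3 T m s a b) := by
  unfold Base3; infer_instance

instance (T : Finset (Fin 6)) (m s a b d : Fin 6) : Decidable (Base4 T m s a b d) := by
  unfold Base4; infer_instance

instance (T : Finset (Fin 6)) (m s a b : Fin 6) : Decidable (KinU T m s a b) := by
  unfold KinU; infer_instance

instance (T : Finset (Fin 6)) (m s a b : Fin 6) : Decidable (VertU T m s a b) := by
  unfold VertU; infer_instance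

instance (T : Finset (Fin 6)) (m s a b d : Fin 6) : Decidable (KinY T m s a b d) := by
  unfold KinY; infer_instance

instance (T : Finset (Fin 6)) (m s a b d : Fin 6) : Decidable (VertY T m s a b d) := by
  unfold VertY; infer_instance

/-- Of the two copies of `u` on a bulk tetrahedron exactly one satisfies `KinU`: the copy of the
base if the base is one of the two 4-simplices, and otherwise the copy of the larger index. -/
lemma prod_kinU {T : Finset (Fin 6)} (m : Fin 6) (f : Fin 6 → Fin 6 → Fin 6 → ℝ) :
    ∏ p ∈ bulkTets T, ∏ q ∈ Finset.univ.filter (fun q : Fin 6 => q ≠ p.1 ∧ q ≠ p.2), f p.1 p.2 q =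
      ∏ p ∈ Finset.univ.filter (fun p : Fin 6 × Fin 6 × Fin 6 => p.1 ∈ T ∧ p.2.1 ≠ p.1 ∧
        p.2.2 ≠ p.1 ∧ p.2.2 ≠ p.2.1 ∧ KinU T m p.1 p.2.1 p.2.2),
        f (min p.1 p.2.1) (max p.1 p.2.1) p.2.2 := by
  rw [Finset.prod_sigma']
  refine (Finset.prod_bij (fun p _ => ⟨(min p.1 p.2.1, max p.1 p.2.1), p.2.2⟩) ?_ ?_ ?_ ?_).symm
  · rintro ⟨s, a, b⟩ hp
    simp only [Finset.mem_filter, Finset.mem_univ, true_and, Finset.mem_sigma, bulkTets] at hp ⊢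
    simp only [KinU] at hp ⊢
    grind
  · rintro ⟨s, a, b⟩ hp ⟨s', a', b'⟩ hp' h
    simp only [Finset.mem_filter, Finset.mem_univ, true_and] at hp hp'
    simp only [KinU, Base3] at hp hp'
    simp only [Sigma.mk.injEq, Prod.mk.injEq, heq_eq_eq] at h ⊢
    grind
  · rintro ⟨⟨s, a⟩, b⟩ hp
    simp only [Finset.mem_filter, Finset.mem_univ, true_and, Finset.mem_sigma, bulkTets] at hp
    by_cases hB : Base3 T m s a b
    · refine ⟨(s, a, b), ?_, by simp [hp.1.2.2.le]⟩
      simp only [Finset.mem_filter, Finset.mem_univ, true_and]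
      simp only [KinU]
      grind
    · refine ⟨(a, s, b), ?_, by simp [hp.1.2.2.le]⟩
      simp only [Finset.mem_filter, Finset.mem_univ, true_and]
      simp only [KinU]
      grind
  · intros; rfl

lemma prod_kinY {T : Finset (Fin 6)} (m : Fin 6) (f : Fin 6 → Fin 6 → Fin 6 → Fin 6 → ℝ) :
    ∏ p ∈ bulkTets T, ∏ q ∈ Finset.univ.filter (fun q : Fin 6 × Fin 6 =>
        q.1 ≠ p.1 ∧ q.1 ≠ p.2 ∧ q.2 ≠ p.1 ∧ q.2 ≠ p.2 ∧ q.1 < q.2), f p.1 p.2 q.1 q.2 =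
      ∏ p ∈ Finset.univ.filter (fun p : Fin 6 × Fin 6 × Fin 6 × Fin 6 => p.1 ∈ T ∧ p.2.1 ≠ p.1 ∧
        p.2.2.1 ≠ p.1 ∧ p.2.2.1 ≠ p.2.1 ∧ p.2.2.2 ≠ p.1 ∧ p.2.2.2 ≠ p.2.1 ∧ p.2.2.1 < p.2.2.2 ∧
        KinY T m p.1 p.2.1 p.2.2.1 p.2.2.2),
        f (min p.1 p.2.1) (max p.1 p.2.1) p.2.2.1 p.2.2.2 := by
  rw [Finset.prod_sigma']
  refine (Finset.prod_bij (fun p _ => ⟨(min p.1 p.2.1, max p.1 p.2.1), p.2.2⟩) ?_ ?_ ?_ ?_).symm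
  · rintro ⟨s, a, b, d⟩ hp
    simp only [Finset.mem_filter, Finset.mem_univ, true_and, Finset.mem_sigma, bulkTets] at hp ⊢
    simp only [KinY] at hp ⊢
    grind
  · rintro ⟨s, a, b, d⟩ hp ⟨s', a', b', d'⟩ hp' h
    simp only [Finset.mem_filter, Finset.mem_univ, true_and] at hp hp'
    simp only [KinY, Base4] at hp hp'
    simp only [Sigma.mk.injEq, Prod.mk.injEq, heq_eq_eq] at h ⊢
    grind
  · rintro ⟨⟨s, a⟩, b, d⟩ hp
    simp only [Finset.mem_filter, Finset.mem_univ, true_and, Finset.mem_sigma, bulkTets] at hp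
    by_cases hB : Base4 T m s a b d
    · refine ⟨(s, a, b, d), ?_, by simp [hp.1.2.2.le]⟩
      simp only [Finset.mem_filter, Finset.mem_univ, true_and]
      simp only [KinY]
      grind
    · refine ⟨(a, s, b, d), ?_, by simp [hp.1.2.2.le]⟩
      simp only [Finset.mem_filter, Finset.mem_univ, true_and]
      simp only [KinY]
      grind
  · intros; rfl

/-- A kept vertex condition at the base of a bulk triangle belongs to a triangle through `m`, since
for the others it is the omitted one; it will determine a half link. All other kept vertex
conditions determine a variable `u`. -/
lemma prod_vertexLinks {T : Finset (Fin 6)} {m : Fin 6} (hm : m ∈ T)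
    (f : Fin 6 → Fin 6 → Fin 6 → ℝ) :
    ∏ s ∈ T, ∏ p ∈ vertexLinks T (some m) s, f s p.1 p.2 =
      (∏ p ∈ Finset.univ.filter (fun p : Fin 6 × Fin 6 => p.1 ∈ T ∧ p.2 ∈ T ∧ p.1 ≠ m ∧ p.2 ≠ m ∧
        p.1 < p.2), f p.1 (min m p.2) (max m p.2)) *
      ∏ p ∈ Finset.univ.filter (fun p : Fin 6 × Fin 6 × Fin 6 => p.1 ∈ T ∧ p.2.1 ≠ p.1 ∧
        p.2.2 ≠ p.1 ∧ p.2.2 ≠ p.2.1 ∧ VertU T m p.1 p.2.1 p.2.2),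
        f p.1 (min p.2.1 p.2.2) (max p.2.1 p.2.2) := by
  classical
  rw [Finset.prod_sigma', ← Finset.prod_filter_mul_prod_filter_not _
    (fun p : (_ : Fin 6) × Fin 6 × Fin 6 =>
      p.2.1 ∈ T ∧ p.2.2 ∈ T ∧ Base3 T m p.1 p.2.1 p.2.2)]
  congr 1
  · refine (Finset.prod_bij (fun p _ => ⟨p.1, (min m p.2, max m p.2)⟩) ?_ ?_ ?_ ?_).symm
    · rintro ⟨s, a⟩ hp
      simp only [Finset.mem_filter, Finset.mem_univ, true_and, Finset.mem_sigma, vertexLinks, redundant_some, Finset.insert_subset_iff, Finset.singleton_subset_iff, Finset.mem_insert, Finset.mem_singleton] at hp ⊢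
      simp only [Base3] at hp ⊢
      grind
    · rintro ⟨s, a⟩ hp ⟨s', a'⟩ hp' h
      simp only [Finset.mem_filter, Finset.mem_univ, true_and] at hp hp'
      simp only [Sigma.mk.injEq, Prod.mk.injEq, heq_eq_eq] at h ⊢
      grind
    · rintro ⟨s, a, b⟩ hp
      simp only [Finset.mem_filter, Finset.mem_univ, true_and, Finset.mem_sigma, vertexLinks, redundant_some, Finset.insert_subset_iff, Finset.singleton_subset_iff, Finset.mem_insert, Finset.mem_singleton] at hp
      simp only [Base3] at hp
      by_cases ha : a = m
      · refine ⟨(s, b), ?_, by simp [← ha, hp.1.2.2.2.1.le]⟩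
        simp only [Finset.mem_filter, Finset.mem_univ, true_and]
        grind
      · have hb : b = m := by grind
        refine ⟨(s, a), ?_, by simp [← hb, hp.1.2.2.2.1.le]⟩
        simp only [Finset.mem_filter, Finset.mem_univ, true_and]
        grind
    · intros; rfl
  · refine (Finset.prod_bij (fun p _ => ⟨p.1, (min p.2.1 p.2.2, max p.2.1 p.2.2)⟩)
      ?_ ?_ ?_ ?_).symm
    · rintro ⟨s, a, b⟩ hp
      simp only [Finset.mem_filter, Finset.mem_univ, true_and, Finset.mem_sigma, vertexLinks, redundant_some, Finset.insert_subset_iff, Finset.singleton_subset_iff, Finset.mem_insert, Finset.mem_singleton] at hp ⊢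
      simp only [Base3, VertU] at hp ⊢
      rcases lt_or_gt_of_ne hp.2.2.2.1 with h | h
      · rw [min_eq_right h.le, max_eq_left h.le]; grind
      · rw [min_eq_left h.le, max_eq_right h.le]; grind
    · rintro ⟨s, a, b⟩ hp ⟨s', a', b'⟩ hp' h
      simp only [Finset.mem_filter, Finset.mem_univ, true_and] at hp hp'
      simp only [VertU, Base3] at hp hp'
      simp only [Sigma.mk.injEq, Prod.mk.injEq, heq_eq_eq] at h ⊢
      grind
    · rintro ⟨s, a, b⟩ hp
      simp only [Finset.mem_filter, Finset.mem_univ, true_and, Finset.mem_sigma, vertexLinks,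
        redundant_some, Finset.insert_subset_iff, Finset.singleton_subset_iff, Finset.mem_insert,
        Finset.mem_singleton] at hp
      by_cases hB : VertU T m s a b
      · refine ⟨(s, a, b), ?_, by simp [hp.1.2.2.2.1.le]⟩
        simp only [Finset.mem_filter, Finset.mem_univ, true_and]
        grind
      · refine ⟨(s, b, a), ?_, by simp [hp.1.2.2.2.1.le]⟩
        simp only [Finset.mem_filter, Finset.mem_univ, true_and]
        simp only [VertU, Base3] at hB hp ⊢
        grind
    · intros; rfl

/-- As for the triangles: at the base of a bulk edge the kept condition belongs to an edge through
`m` and determines an `X`; all the others determine a `Y`. -/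
lemma prod_vertexWedges {T : Finset (Fin 6)} {m : Fin 6} (hm : m ∈ T)
    (f : Fin 6 → Fin 6 × Fin 6 × Fin 6 → ℝ) :
    ∏ s ∈ T, ∏ p ∈ vertexWedges T (some m) s, f s p =
      (∏ p ∈ Finset.univ.filter (fun p : Fin 6 × Fin 6 × Fin 6 => p.1 ∈ T ∧ p.2.1 ∈ T ∧
        p.2.2 ∈ T ∧ p.1 ≠ m ∧ p.2.1 ≠ m ∧ p.2.2 ≠ m ∧ p.1 < p.2.1 ∧ p.2.1 < p.2.2),
        f p.1 (sorted m p.2.1 p.2.2)) *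
      ∏ p ∈ Finset.univ.filter (fun p : Fin 6 × Fin 6 × Fin 6 × Fin 6 => p.1 ∈ T ∧ p.2.1 ≠ p.1 ∧
        p.2.2.1 ≠ p.1 ∧ p.2.2.1 ≠ p.2.1 ∧ p.2.2.2 ≠ p.1 ∧ p.2.2.2 ≠ p.2.1 ∧ p.2.2.1 < p.2.2.2 ∧
        VertY T m p.1 p.2.1 p.2.2.1 p.2.2.2), f p.1 (sorted p.2.1 p.2.2.1 p.2.2.2) := by
  classical
  rw [Finset.prod_sigma', ← Finset.prod_filter_mul_prod_filter_not _
    (fun p : (_ : Fin 6) × Fin 6 × Fin 6 × Fin 6 =>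
      p.2.1 ∈ T ∧ p.2.2.1 ∈ T ∧ p.2.2.2 ∈ T ∧ Base4 T m p.1 p.2.1 p.2.2.1 p.2.2.2)]
  congr 1
  · refine (Finset.prod_bij (fun p _ => ⟨p.1, sorted m p.2.1 p.2.2⟩) ?_ ?_ ?_ ?_).symm
    · rintro ⟨s, r, q⟩ hp
      simp only [Finset.mem_filter, Finset.mem_univ, true_and] at hp
      obtain ⟨i, j, k, hij, hjk, hP, hs⟩ := exists_sorted (a := m) (b := r) (c := q)
        (by omega) (by omega) (by omega)
      simp only [hs, Finset.mem_filter, Finset.mem_univ, true_and, Finset.mem_sigma, vertexWedges,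
        redundant_some, Finset.insert_subset_iff, Finset.singleton_subset_iff, Finset.mem_insert,
        Finset.mem_singleton]
      simp only [Base4]
      rcases hP with hP | hP | hP | hP | hP | hP <;> grind
    · rintro ⟨s, r, q⟩ hp ⟨s', r', q'⟩ hp' h
      simp only [Finset.mem_filter, Finset.mem_univ, true_and] at hp hp'
      obtain ⟨i, j, k, hij, hjk, hP, hs⟩ := exists_sorted (a := m) (b := r) (c := q)
        (by omega) (by omega) (by omega)
      obtain ⟨i', j', k', hij', hjk', hP', hs'⟩ := exists_sorted (a := m) (b := r') (c := q')
        (by omega) (by omega) (by omega)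
      simp only [hs, hs', Sigma.mk.injEq, Prod.mk.injEq, heq_eq_eq] at h ⊢
      unfold Perm3 at hP hP'
      omega
    · rintro ⟨s, i, j, k⟩ hp
      simp only [Finset.mem_filter, Finset.mem_univ, true_and, Finset.mem_sigma, vertexWedges,
        redundant_some, Finset.insert_subset_iff, Finset.singleton_subset_iff, Finset.mem_insert,
        Finset.mem_singleton] at hp
      simp only [Base4] at hp
      have hmem : m = i ∨ m = j ∨ m = k := by grind
      obtain ⟨r, q, hrq, hP⟩ : ∃ r q, r < q ∧ Perm3 m r q i j k := by
        unfold Perm3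
        rcases hmem with h | h | h
        · exact ⟨j, k, by omega, by omega⟩
        · exact ⟨i, k, by omega, by omega⟩
        · exact ⟨i, j, by omega, by omega⟩
      refine ⟨(s, r, q), ?_, by rw [hP.sorted_eq (by omega) (by omega)]⟩
      simp only [Finset.mem_filter, Finset.mem_univ, true_and]
      rcases hP with hP | hP | hP | hP | hP | hP <;> grind
    · intros; rfl
  · refine (Finset.prod_bij (fun p _ => ⟨p.1, sorted p.2.1 p.2.2.1 p.2.2.2⟩) ?_ ?_ ?_ ?_).symm
    · rintro ⟨s, r, q, p⟩ hp
      simp only [Finset.mem_filter, Finset.mem_univ, true_and] at hp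
      obtain ⟨i, j, k, hij, hjk, hP, hs⟩ := exists_sorted (a := r) (b := q) (c := p)
        (by grind) (by grind) (by grind)
      simp only [hs, Finset.mem_filter, Finset.mem_univ, true_and, Finset.mem_sigma, vertexWedges,
        redundant_some, Finset.insert_subset_iff, Finset.singleton_subset_iff, Finset.mem_insert,
        Finset.mem_singleton]
      simp only [VertY, Base4] at hp ⊢
      rcases hP with hP | hP | hP | hP | hP | hP <;> grind
    · rintro ⟨s, r, q, p⟩ hp ⟨s', r', q', p'⟩ hp' h
      simp only [Finset.mem_filter, Finset.mem_univ, true_and] at hp hp'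
      obtain ⟨i, j, k, hij, hjk, hP, hs⟩ := exists_sorted (a := r) (b := q) (c := p)
        (by grind) (by grind) (by grind)
      obtain ⟨i', j', k', hij', hjk', hP', hs'⟩ := exists_sorted (a := r') (b := q') (c := p')
        (by grind) (by grind) (by grind)
      simp only [hs, hs', Sigma.mk.injEq, Prod.mk.injEq, heq_eq_eq] at h ⊢
      simp only [VertY, Base4] at hp hp'
      obtain ⟨rfl, rfl, rfl, rfl⟩ := h
      rcases hP with ⟨rfl, rfl, rfl⟩ | ⟨rfl, rfl, rfl⟩ | ⟨rfl, rfl, rfl⟩ | ⟨rfl, rfl, rfl⟩ |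
        ⟨rfl, rfl, rfl⟩ | ⟨rfl, rfl, rfl⟩ <;>
      rcases hP' with ⟨rfl, rfl, rfl⟩ | ⟨rfl, rfl, rfl⟩ | ⟨rfl, rfl, rfl⟩ | ⟨rfl, rfl, rfl⟩ |
        ⟨rfl, rfl, rfl⟩ | ⟨rfl, rfl, rfl⟩ <;> grind
    · rintro ⟨s, i, j, k⟩ hp
      simp only [Finset.mem_filter, Finset.mem_univ, true_and, Finset.mem_sigma, vertexWedges,
        redundant_some, Finset.insert_subset_iff, Finset.singleton_subset_iff, Finset.mem_insert,
        Finset.mem_singleton] at hp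
      -- Outside the base conditions of bulk edges, the distinguished tetrahedron is that of the
      -- base, or, at the base itself, the first one on the boundary.
      obtain ⟨r, q, p, hP, hqp, h⟩ : ∃ r q p, Perm3 r q p i j k ∧ q < p ∧ VertY T m s r q p := by
        unfold Perm3
        by_cases h1 : VertY T m s i j k
        · exact ⟨i, j, k, by grind⟩
        by_cases h2 : VertY T m s j i k
        · exact ⟨j, i, k, by grind⟩
        · refine ⟨k, i, j, by simp, by omega, ?_⟩
          simp only [VertY, Base4] at h1 h2 hp ⊢
          by_cases hi : i ∈ T <;> by_cases hj : j ∈ T <;> by_cases hk : k ∈ T <;> grind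
      refine ⟨(s, r, q, p), ?_, by rw [hP.sorted_eq (by omega) (by omega)]⟩
      simp only [Finset.mem_filter, Finset.mem_univ, true_and]
      rcases hP with hP | hP | hP | hP | hP | hP <;> grind
    · intros; rfl

/-! ### Words in the variables as functions of one variable -/

lemma perm3_sorted {a b c : Fin 6} (hab : a ≠ b) (hbc : b ≠ c) (hac : a ≠ c) :
    Perm3 a b c (sorted a b c).1 (sorted a b c).2.1 (sorted a b c).2.2 := by
  obtain ⟨i, j, k, -, -, h, h'⟩ := exists_sorted hab hbc hac
  rwa [h']

lemma Perm3.rotate {a b c i j k : Fin 6} (h : Perm3 a b c i j k) : Perm3 b c a i j k := by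
  unfold Perm3 at *; tauto

section Lin

variable {ι₁ ι₂ G₁ G₂ : Type*} {rk₁ : ι₁ → ℕ} {rk₂ : ι₂ → ℕ} {n : ℕ}
  [Group G₁] [TopologicalSpace G₁] [IsTopologicalGroup G₁]
  [Group G₂] [TopologicalSpace G₂] [IsTopologicalGroup G₂]

lemma Dep.of_inv {G : Type*} [TopologicalSpace G] [Group G] [IsTopologicalGroup G]
    {v w : (ι₁ → G₁) × (ι₂ → G₂) → G} (hv : Dep rk₁ rk₂ n v) (h : ∀ x, w x = (v x)⁻¹) :
    Dep rk₁ rk₂ n w := by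
  rw [show w = fun x => (v x)⁻¹ from funext h]; exact hv.inv

section Six

variable {G : Type*} [TopologicalSpace G] [MeasurableSpace G] [BorelSpace G] [Group G]
  [IsTopologicalGroup G] {μ : Measure G} [μ.IsMulLeftInvariant] [μ.IsMulRightInvariant]
  {π a b c d e f : (ι₁ → G₁) × (ι₂ → G₂) → G}

lemma Lin.of_inv [μ.IsInvInvariant] {v w : (ι₁ → G₁) × (ι₂ → G₂) → G}
    (hv : Lin rk₁ rk₂ μ n π v) (h : ∀ x, w x = (v x)⁻¹) : Lin rk₁ rk₂ μ n π w := by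
  rw [show w = fun x => (v x)⁻¹ from funext h]; exact hv.inv

/-- Triangle and edge words have six factors. One statement for each position of the factor that
contains the new variable. -/
lemma Lin.mul_six₁ (ha : Lin rk₁ rk₂ μ n π a) (hb : Dep rk₁ rk₂ n b) (hc : Dep rk₁ rk₂ n c)
    (hd : Dep rk₁ rk₂ n d) (he : Dep rk₁ rk₂ n e) (hf : Dep rk₁ rk₂ n f) :
    Lin rk₁ rk₂ μ n π fun x => a x * b x * c x * d x * e x * f x :=
  ((((ha.mul_right hb).mul_right hc).mul_right hd).mul_right he).mul_right hf

lemma Lin.mul_six₂ (ha : Dep rk₁ rk₂ n a) (hb : Lin rk₁ rk₂ μ n π b) (hc : Dep rk₁ rk₂ n c)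
    (hd : Dep rk₁ rk₂ n d) (he : Dep rk₁ rk₂ n e) (hf : Dep rk₁ rk₂ n f) :
    Lin rk₁ rk₂ μ n π fun x => a x * b x * c x * d x * e x * f x :=
  ((((Lin.mul_left ha hb).mul_right hc).mul_right hd).mul_right he).mul_right hf

lemma Lin.mul_six₃ (ha : Dep rk₁ rk₂ n a) (hb : Dep rk₁ rk₂ n b) (hc : Lin rk₁ rk₂ μ n π c)
    (hd : Dep rk₁ rk₂ n d) (he : Dep rk₁ rk₂ n e) (hf : Dep rk₁ rk₂ n f) :
    Lin rk₁ rk₂ μ n π fun x => a x * b x * c x * d x * e x * f x :=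
  (((Lin.mul_left (ha.mul hb) hc).mul_right hd).mul_right he).mul_right hf

lemma Lin.mul_six₄ (ha : Dep rk₁ rk₂ n a) (hb : Dep rk₁ rk₂ n b) (hc : Dep rk₁ rk₂ n c)
    (hd : Lin rk₁ rk₂ μ n π d) (he : Dep rk₁ rk₂ n e) (hf : Dep rk₁ rk₂ n f) :
    Lin rk₁ rk₂ μ n π fun x => a x * b x * c x * d x * e x * f x :=
  ((Lin.mul_left ((ha.mul hb).mul hc) hd).mul_right he).mul_right hf

lemma Lin.mul_six₅ (ha : Dep rk₁ rk₂ n a) (hb : Dep rk₁ rk₂ n b) (hc : Dep rk₁ rk₂ n c)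
    (hd : Dep rk₁ rk₂ n d) (he : Lin rk₁ rk₂ μ n π e) (hf : Dep rk₁ rk₂ n f) :
    Lin rk₁ rk₂ μ n π fun x => a x * b x * c x * d x * e x * f x :=
  (Lin.mul_left (((ha.mul hb).mul hc).mul hd) he).mul_right hf

lemma Lin.mul_six₆ (ha : Dep rk₁ rk₂ n a) (hb : Dep rk₁ rk₂ n b) (hc : Dep rk₁ rk₂ n c)
    (hd : Dep rk₁ rk₂ n d) (he : Dep rk₁ rk₂ n e) (hf : Lin rk₁ rk₂ μ n π f) :
    Lin rk₁ rk₂ μ n π fun x => a x * b x * c x * d x * e x * f x :=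
  Lin.mul_left ((((ha.mul hb).mul hc).mul hd).mul he) hf

end Six

variable {T : Finset (Fin 6)} {A : Finset (Fin 6 × Fin 6)}

lemma dep_wedgeX {v : FaceIx T → ι₂} {s r q : Fin 6}
    (h : ∀ p : FaceIx T, p.1 = (s, r, q) ∨ p.1 = (s, q, r) → rk₂ (v p) < n) :
    Dep (G₁ := G₁) (G₂ := G₂) rk₁ rk₂ n fun x => wedgeX (fun p => x.2 (v p)) s r q := by
  unfold wedgeX
  split_ifs
  · exact dep_snd (h _ (Or.inl rfl))
  · exact (dep_snd (h _ (Or.inr rfl))).inv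
  · exact dep_const 1

lemma dep_linkH {v : TetIx A → ι₁} {s r : Fin 6}
    (h : ∀ p : TetIx A, p.1 = (s, r) → rk₁ (v p) < n) :
    Dep (G₁ := G₁) (G₂ := G₂) rk₁ rk₂ n fun x => linkH (fun p => x.1 (v p)) s r := by
  unfold linkH
  split_ifs
  · exact dep_fst (h _ rfl)
  · exact dep_const 1

lemma dep_linkU {v : TriIx A → ι₁} {s r q : Fin 6}
    (h : ∀ p : TriIx A, p.1 = (s, r, q) → rk₁ (v p) < n) :
    Dep (G₁ := G₁) (G₂ := G₂) rk₁ rk₂ n fun x => linkU (fun p => x.1 (v p)) s r q := by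
  unfold linkU
  split_ifs
  · exact dep_fst (h _ rfl)
  · exact dep_const 1

lemma dep_wedgeY {v : EdgeIx A → ι₂} {s r q p : Fin 6}
    (h : ∀ i : EdgeIx A, i.1 = (s, r, q, p) ∨ i.1 = (s, r, p, q) → rk₂ (v i) < n) :
    Dep (G₁ := G₁) (G₂ := G₂) rk₁ rk₂ n fun x => wedgeY (fun p => x.2 (v p)) s r q p := by
  unfold wedgeY
  split_ifs
  · exact dep_snd (h _ (Or.inl rfl))
  · exact (dep_snd (h _ (Or.inr rfl))).inv
  · exact dep_const 1

section Words

variable [MeasurableSpace G₁] [BorelSpace G₁] [MeasurableSpace G₂] [BorelSpace G₂]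
  {μ₁ : Measure G₁} [μ₁.IsMulLeftInvariant] [μ₁.IsMulRightInvariant] [μ₁.IsInvInvariant]
  {μ₂ : Measure G₂} [μ₂.IsMulLeftInvariant] [μ₂.IsMulRightInvariant] [μ₂.IsInvInvariant]

lemma lin_wedgeX {v : FaceIx T → ι₂} {p : FaceIx T} {r q : Fin 6}
    (h : (r = p.1.2.1 ∧ q = p.1.2.2) ∨ (r = p.1.2.2 ∧ q = p.1.2.1)) :
    Lin rk₁ rk₂ μ₂ n (fun x : (ι₁ → G₁) × (ι₂ → G₂) => x.2 (v p))
      fun x => wedgeX (fun p => x.2 (v p)) p.1.1 r q := by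
  have key : ∀ x : (ι₁ → G₁) × (ι₂ → G₂),
      wedgeX (fun p => x.2 (v p)) p.1.1 p.1.2.1 p.1.2.2 = x.2 (v p) := fun x => by
    unfold wedgeX; rw [dif_pos p.2]
  rcases h with ⟨rfl, rfl⟩ | ⟨rfl, rfl⟩
  · simp only [key]; exact lin_self
  · exact lin_self.of_inv fun x => by rw [wedgeX_swap, key]

variable {𝒢 : CrossedModule G₁ G₂} {cfg : (ι₁ → G₁) × (ι₂ → G₂) → ReducedConfig G₁ G₂ T}
  {π₁ : (ι₁ → G₁) × (ι₂ → G₂) → G₁} {π₂ : (ι₁ → G₁) × (ι₂ → G₂) → G₂}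

/-- Each order of the indices puts the variable link, or its inverse, at one of the even positions
of the word. -/
lemma lin_triangleWord {s r q i j k : Fin 6}
    (hL : Lin rk₁ rk₂ μ₁ n π₁ fun x => crossLink T (cfg x) s r q)
    (h₂ : Dep rk₁ rk₂ n fun x => crossLink T (cfg x) r q s)
    (h₃ : Dep rk₁ rk₂ n fun x => crossLink T (cfg x) q s r)
    (c₁ : Dep rk₁ rk₂ n fun x => cornerLink 𝒢 T (cfg x) s r q)
    (c₂ : Dep rk₁ rk₂ n fun x => cornerLink 𝒢 T (cfg x) r q s)
    (c₃ : Dep rk₁ rk₂ n fun x => cornerLink 𝒢 T (cfg x) q s r) (h : Perm3 s r q i j k) :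
    Lin rk₁ rk₂ μ₁ n π₁ fun x => triangleWord 𝒢 T (cfg x) i j k := by
  have hL' : Lin rk₁ rk₂ μ₁ n π₁ fun x => crossLink T (cfg x) r s q :=
    hL.of_inv fun x => crossLink_swap _ _ _ _ _
  have h₂' : Dep rk₁ rk₂ n fun x => crossLink T (cfg x) q r s :=
    h₂.of_inv fun x => crossLink_swap _ _ _ _ _
  have h₃' : Dep rk₁ rk₂ n fun x => crossLink T (cfg x) s q r :=
    h₃.of_inv fun x => crossLink_swap _ _ _ _ _
  have c₁' : Dep rk₁ rk₂ n fun x => cornerLink 𝒢 T (cfg x) s q r :=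
    c₁.of_inv fun x => cornerLink_swap _ _ _ _ _ _
  have c₂' : Dep rk₁ rk₂ n fun x => cornerLink 𝒢 T (cfg x) r s q :=
    c₂.of_inv fun x => cornerLink_swap _ _ _ _ _ _
  have c₃' : Dep rk₁ rk₂ n fun x => cornerLink 𝒢 T (cfg x) q r s :=
    c₃.of_inv fun x => cornerLink_swap _ _ _ _ _ _
  rcases h with ⟨rfl, rfl, rfl⟩ | ⟨rfl, rfl, rfl⟩ | ⟨rfl, rfl, rfl⟩ | ⟨rfl, rfl, rfl⟩ |
    ⟨rfl, rfl, rfl⟩ | ⟨rfl, rfl, rfl⟩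
  · exact Lin.mul_six₂ c₁ hL c₂ h₂ c₃ h₃
  · exact Lin.mul_six₆ c₁' h₃' c₃' h₂' c₂' hL'
  · exact Lin.mul_six₂ c₂' hL' c₁' h₃' c₃' h₂'
  · exact Lin.mul_six₆ c₂ h₂ c₃ h₃ c₁ hL
  · exact Lin.mul_six₄ c₃ h₃ c₁ hL c₂ h₂
  · exact Lin.mul_six₄ c₃' h₂' c₂' hL' c₁' h₃'

section Hexagon

variable {S : Fin 6 → Fin 6 → Fin 6 → (ι₁ → G₁) × (ι₂ → G₂) → G₂}
  {X : Fin 6 → Fin 6 → (ι₁ → G₁) × (ι₂ → G₂) → G₂} {a b d i j k : Fin 6}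

/-- The word of an edge, as a function of the contribution of one of the tetrahedra. -/
lemma lin_hexagon_side (hS : ∀ a b d x, S a b d x = (S a d b x)⁻¹)
    (hX : ∀ a b x, X a b x = (X b a x)⁻¹) (hL : Lin rk₁ rk₂ μ₂ n π₂ (S a b d))
    (h₂ : Dep rk₁ rk₂ n (S b d a)) (h₃ : Dep rk₁ rk₂ n (S d a b)) (c₁ : Dep rk₁ rk₂ n (X a b))
    (c₂ : Dep rk₁ rk₂ n (X b d)) (c₃ : Dep rk₁ rk₂ n (X d a)) (h : Perm3 a b d i j k) :
    Lin rk₁ rk₂ μ₂ n π₂ fun x =>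
      S i k j x * X i j x * S j i k x * X j k x * S k j i x * X k i x := by
  have hL' : Lin rk₁ rk₂ μ₂ n π₂ (S a d b) := hL.of_inv fun x => hS _ _ _ _
  have h₂' : Dep rk₁ rk₂ n (S b a d) := h₂.of_inv fun x => hS _ _ _ _
  have h₃' : Dep rk₁ rk₂ n (S d b a) := h₃.of_inv fun x => hS _ _ _ _
  have c₁' : Dep rk₁ rk₂ n (X b a) := c₁.of_inv fun x => hX _ _ _
  have c₂' : Dep rk₁ rk₂ n (X d b) := c₂.of_inv fun x => hX _ _ _
  have c₃' : Dep rk₁ rk₂ n (X a d) := c₃.of_inv fun x => hX _ _ _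
  rcases h with ⟨rfl, rfl, rfl⟩ | ⟨rfl, rfl, rfl⟩ | ⟨rfl, rfl, rfl⟩ | ⟨rfl, rfl, rfl⟩ |
    ⟨rfl, rfl, rfl⟩ | ⟨rfl, rfl, rfl⟩
  · exact Lin.mul_six₁ hL' c₁ h₂' c₂ h₃' c₃
  · exact Lin.mul_six₁ hL c₃' h₃ c₂' h₂ c₁'
  · exact Lin.mul_six₃ h₂ c₁' hL c₃' h₃ c₂'
  · exact Lin.mul_six₅ h₂' c₂ h₃' c₃ hL' c₁
  · exact Lin.mul_six₃ h₃' c₃ hL' c₁ h₂' c₂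
  · exact Lin.mul_six₅ h₃ c₂' h₂ c₁' hL c₃'

/-- The word of an edge, as a function of one of the wedges `X`. -/
lemma lin_hexagon_wedge (hS : ∀ a b d x, S a b d x = (S a d b x)⁻¹)
    (hX : ∀ a b x, X a b x = (X b a x)⁻¹) (h₁ : Dep rk₁ rk₂ n (S a b d))
    (h₂ : Dep rk₁ rk₂ n (S b d a)) (h₃ : Dep rk₁ rk₂ n (S d a b))
    (hL : Lin rk₁ rk₂ μ₂ n π₂ (X a b))
    (c₂ : Dep rk₁ rk₂ n (X b d)) (c₃ : Dep rk₁ rk₂ n (X d a)) (h : Perm3 a b d i j k) :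
    Lin rk₁ rk₂ μ₂ n π₂ fun x =>
      S i k j x * X i j x * S j i k x * X j k x * S k j i x * X k i x := by
  have h₁' : Dep rk₁ rk₂ n (S a d b) := h₁.of_inv fun x => hS _ _ _ _
  have h₂' : Dep rk₁ rk₂ n (S b a d) := h₂.of_inv fun x => hS _ _ _ _
  have h₃' : Dep rk₁ rk₂ n (S d b a) := h₃.of_inv fun x => hS _ _ _ _
  have hL' : Lin rk₁ rk₂ μ₂ n π₂ (X b a) := hL.of_inv fun x => hX _ _ _
  have c₂' : Dep rk₁ rk₂ n (X d b) := c₂.of_inv fun x => hX _ _ _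
  have c₃' : Dep rk₁ rk₂ n (X a d) := c₃.of_inv fun x => hX _ _ _
  rcases h with ⟨rfl, rfl, rfl⟩ | ⟨rfl, rfl, rfl⟩ | ⟨rfl, rfl, rfl⟩ | ⟨rfl, rfl, rfl⟩ |
    ⟨rfl, rfl, rfl⟩ | ⟨rfl, rfl, rfl⟩
  · exact Lin.mul_six₂ h₁' hL h₂' c₂ h₃' c₃
  · exact Lin.mul_six₆ h₁ c₃' h₃ c₂' h₂ hL'
  · exact Lin.mul_six₂ h₂ hL' h₁ c₃' h₃ c₂'
  · exact Lin.mul_six₆ h₂' c₂ h₃' c₃ h₁' hL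
  · exact Lin.mul_six₄ h₃' c₃ h₁' hL h₂' c₂
  · exact Lin.mul_six₄ h₃ c₂' h₂ hL' h₁ c₃'

end Hexagon

lemma lin_edgeWord_side {s a b d i j k : Fin 6}
    (hL : Lin rk₁ rk₂ μ₂ n π₂ fun x => sideWedge 𝒢 T (cfg x) s a b d)
    (h₂ : Dep rk₁ rk₂ n fun x => sideWedge 𝒢 T (cfg x) s b d a)
    (h₃ : Dep rk₁ rk₂ n fun x => sideWedge 𝒢 T (cfg x) s d a b)
    (c₁ : Dep rk₁ rk₂ n fun x => wedgeX (cfg x).1 s a b)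
    (c₂ : Dep rk₁ rk₂ n fun x => wedgeX (cfg x).1 s b d)
    (c₃ : Dep rk₁ rk₂ n fun x => wedgeX (cfg x).1 s d a) (h : Perm3 a b d i j k) :
    Lin rk₁ rk₂ μ₂ n π₂ fun x => edgeWord 𝒢 T (cfg x) s i j k :=
  lin_hexagon_side (S := fun a b d x => sideWedge 𝒢 T (cfg x) s a b d)
    (X := fun a b x => wedgeX (cfg x).1 s a b) (fun _ _ _ _ => sideWedge_swap _ _ _ _ _ _ _)
    (fun _ _ _ => wedgeX_swap _ _ _ _) hL h₂ h₃ c₁ c₂ c₃ h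

lemma lin_edgeWord_wedge {s a b d i j k : Fin 6}
    (h₁ : Dep rk₁ rk₂ n fun x => sideWedge 𝒢 T (cfg x) s a b d)
    (h₂ : Dep rk₁ rk₂ n fun x => sideWedge 𝒢 T (cfg x) s b d a)
    (h₃ : Dep rk₁ rk₂ n fun x => sideWedge 𝒢 T (cfg x) s d a b)
    (hL : Lin rk₁ rk₂ μ₂ n π₂ fun x => wedgeX (cfg x).1 s a b)
    (c₂ : Dep rk₁ rk₂ n fun x => wedgeX (cfg x).1 s b d)
    (c₃ : Dep rk₁ rk₂ n fun x => wedgeX (cfg x).1 s d a) (h : Perm3 a b d i j k) :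
    Lin rk₁ rk₂ μ₂ n π₂ fun x => edgeWord 𝒢 T (cfg x) s i j k :=
  lin_hexagon_wedge (S := fun a b d x => sideWedge 𝒢 T (cfg x) s a b d)
    (X := fun a b x => wedgeX (cfg x).1 s a b) (fun _ _ _ _ => sideWedge_swap _ _ _ _ _ _ _)
    (fun _ _ _ => wedgeX_swap _ _ _ _) h₁ h₂ h₃ hL c₂ c₃ h

section FeynmanWords

variable {cfg : (ι₁ → G₁) × (ι₂ → G₂) → FeynmanConfig G₁ G₂ T}

lemma lin_wWord_side {s a b d i j k : Fin 6}
    (hL : Lin rk₁ rk₂ μ₂ n π₂ fun x => halfWedge 𝒢 (cfg x) s a b d)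
    (h₂ : Dep rk₁ rk₂ n fun x => halfWedge 𝒢 (cfg x) s b d a)
    (h₃ : Dep rk₁ rk₂ n fun x => halfWedge 𝒢 (cfg x) s d a b)
    (c₁ : Dep rk₁ rk₂ n fun x => wedgeX (cfg x).1 s a b)
    (c₂ : Dep rk₁ rk₂ n fun x => wedgeX (cfg x).1 s b d)
    (c₃ : Dep rk₁ rk₂ n fun x => wedgeX (cfg x).1 s d a) (h : Perm3 a b d i j k) :
    Lin rk₁ rk₂ μ₂ n π₂ fun x => wWord 𝒢 (cfg x) s i j k :=
  lin_hexagon_side (S := fun a b d x => halfWedge 𝒢 (cfg x) s a b d)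
    (X := fun a b x => wedgeX (cfg x).1 s a b) (fun _ _ _ _ => halfWedge_swap _ _ _ _)
    (fun _ _ _ => wedgeX_swap _ _ _ _) hL h₂ h₃ c₁ c₂ c₃ h

lemma lin_wWord_wedge {s a b d i j k : Fin 6}
    (h₁ : Dep rk₁ rk₂ n fun x => halfWedge 𝒢 (cfg x) s a b d)
    (h₂ : Dep rk₁ rk₂ n fun x => halfWedge 𝒢 (cfg x) s b d a)
    (h₃ : Dep rk₁ rk₂ n fun x => halfWedge 𝒢 (cfg x) s d a b)
    (hL : Lin rk₁ rk₂ μ₂ n π₂ fun x => wedgeX (cfg x).1 s a b)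
    (c₂ : Dep rk₁ rk₂ n fun x => wedgeX (cfg x).1 s b d)
    (c₃ : Dep rk₁ rk₂ n fun x => wedgeX (cfg x).1 s d a) (h : Perm3 a b d i j k) :
    Lin rk₁ rk₂ μ₂ n π₂ fun x => wWord 𝒢 (cfg x) s i j k :=
  lin_hexagon_wedge (S := fun a b d x => halfWedge 𝒢 (cfg x) s a b d)
    (X := fun a b x => wedgeX (cfg x).1 s a b) (fun _ _ _ _ => halfWedge_swap _ _ _ _)
    (fun _ _ _ => wedgeX_swap _ _ _ _) h₁ h₂ h₃ hL c₂ c₃ h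

lemma lin_lWord_link {s a b i j : Fin 6} (ht : Continuous 𝒢.t)
    (hL : Lin rk₁ rk₂ μ₁ n π₁ fun x => linkU (cfg x).2.2.1 s a b)
    (h₁ : Dep rk₁ rk₂ n fun x => linkU (cfg x).2.2.1 s b a)
    (h₂ : Dep rk₁ rk₂ n fun x => linkH (cfg x).2.1 s a)
    (h₃ : Dep rk₁ rk₂ n fun x => linkH (cfg x).2.1 s b)
    (c₁ : Dep rk₁ rk₂ n fun x => wedgeX (cfg x).1 s a b) (h : i = a ∧ j = b ∨ i = b ∧ j = a) :
    Lin rk₁ rk₂ μ₁ n π₁ fun x => lWord 𝒢 (cfg x) s i j := by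
  have c₁' : Dep rk₁ rk₂ n fun x => wedgeX (cfg x).1 s b a :=
    c₁.of_inv fun x => wedgeX_swap _ _ _ _
  rcases h with ⟨rfl, rfl⟩ | ⟨rfl, rfl⟩
  · exact ((Lin.mul_left ((c₁'.comp ht).mul h₂) hL).mul_right h₁.inv).mul_right h₃.inv
  · exact (Lin.mul_left (((c₁.comp ht).mul h₃).mul h₁) (hL.of_inv fun _ => rfl)).mul_right h₂.inv

lemma lin_lWord_half {s a b i j : Fin 6} (ht : Continuous 𝒢.t)
    (hL : Lin rk₁ rk₂ μ₁ n π₁ fun x => linkH (cfg x).2.1 s a)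
    (h₁ : Dep rk₁ rk₂ n fun x => linkU (cfg x).2.2.1 s b a)
    (h₂ : Dep rk₁ rk₂ n fun x => linkU (cfg x).2.2.1 s a b)
    (h₃ : Dep rk₁ rk₂ n fun x => linkH (cfg x).2.1 s b)
    (c₁ : Dep rk₁ rk₂ n fun x => wedgeX (cfg x).1 s a b) (h : i = a ∧ j = b ∨ i = b ∧ j = a) :
    Lin rk₁ rk₂ μ₁ n π₁ fun x => lWord 𝒢 (cfg x) s i j := by
  have c₁' : Dep rk₁ rk₂ n fun x => wedgeX (cfg x).1 s b a :=
    c₁.of_inv fun x => wedgeX_swap _ _ _ _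
  rcases h with ⟨rfl, rfl⟩ | ⟨rfl, rfl⟩
  · exact (((Lin.mul_left (c₁'.comp ht) hL).mul_right h₂).mul_right h₁.inv).mul_right h₃.inv
  · exact Lin.mul_left ((((c₁.comp ht).mul h₃).mul h₁).mul h₂.inv) (hL.of_inv fun _ => rfl)

end FeynmanWords

end Words

end Lin

/-! ### The configuration spaces as products of copies of the groups -/

section Spaces

lemma measurePreserving_prod_rotate {X D E : Type*} [MeasurableSpace X] [MeasurableSpace D]
    [MeasurableSpace E] (μ : Measure X) (ν : Measure D) (κ : Measure E) [SFinite μ] [SFinite ν]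
    [SFinite κ] : MeasurePreserving (fun p : X × D × E => (p.2.1, p.1, p.2.2))
      (μ.prod (ν.prod κ)) (ν.prod (μ.prod κ)) :=
  (measurePreserving_prodAssoc ν μ κ).comp
    ((Measure.measurePreserving_swap.prod (MeasurePreserving.id κ)).comp
      (measurePreserving_prodAssoc μ ν κ).symm)

lemma measurePreserving_sum_split {ι κ G : Type*} [Fintype ι] [Fintype κ] [MeasurableSpace G]
    (μ : Measure G) [SigmaFinite μ] :
    MeasurePreserving (fun x : ι ⊕ κ → G => ((fun i => x (.inl i), fun k => x (.inr k)) :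
      (ι → G) × (κ → G))) (Measure.pi fun _ => μ)
      ((Measure.pi fun _ => μ).prod (Measure.pi fun _ => μ)) :=
  measurePreserving_sumPiEquivProdPi (X := fun _ : ι ⊕ κ => G) fun _ => μ

variable (G₁ G₂ : Type*) [TopologicalSpace G₁] [TopologicalSpace G₂] (T : Finset (Fin 6))

/-- Labels of the variables of the reduced amplitude with values in `G₁`. -/
abbrev RedIx₁ : Type :=
  TetIx (bulkTets T) ⊕ TetIx (boundaryTets T) ⊕ TriIx (boundaryTets T)

/-- Labels of the variables of the reduced amplitude with values in `G₂`. -/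
abbrev RedIx₂ : Type := FaceIx T ⊕ EdgeIx (boundaryTets T)

/-- Labels of the variables of the Feynman integral with values in `G₁`. -/
abbrev FeynIx₁ : Type := TetIx (allTets T) ⊕ TriIx (allTets T)

/-- Labels of the variables of the Feynman integral with values in `G₂`. -/
abbrev FeynIx₂ : Type := FaceIx T ⊕ EdgeIx (allTets T)

/-- The variables of the reduced amplitude, sorted by the groups. -/
def redHomeo : ReducedConfig G₁ G₂ T ≃ₜ (RedIx₁ T → G₁) × (RedIx₂ T → G₂) where
  toFun c := (Sum.elim c.2.1 (Sum.elim c.2.2.1 c.2.2.2.1), Sum.elim c.1 c.2.2.2.2)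
  invFun x := (fun p => x.2 (.inl p), fun p => x.1 (.inl p), fun p => x.1 (.inr (.inl p)),
    fun p => x.1 (.inr (.inr p)), fun p => x.2 (.inr p))
  left_inv _ := rfl
  right_inv x := by ext p <;> rcases p with p | p | p <;> rfl
  continuous_toFun := by
    refine Continuous.prodMk (continuous_pi fun i => ?_) (continuous_pi fun i => ?_)
    · rcases i with i | i | i <;> simp only [Sum.elim_inl, Sum.elim_inr] <;> fun_prop
    · rcases i with i | i <;> simp only [Sum.elim_inl, Sum.elim_inr] <;> fun_prop
  continuous_invFun := by fun_prop

/-- The variables of the Feynman integral, sorted by the groups. -/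
def feynHomeo : FeynmanConfig G₁ G₂ T ≃ₜ (FeynIx₁ T → G₁) × (FeynIx₂ T → G₂) where
  toFun c := (Sum.elim c.2.1 c.2.2.1, Sum.elim c.1 c.2.2.2)
  invFun x := (fun p => x.2 (.inl p), fun p => x.1 (.inl p), fun p => x.1 (.inr p),
    fun p => x.2 (.inr p))
  left_inv _ := rfl
  right_inv x := by ext p <;> rcases p with p | p <;> rfl
  continuous_toFun := by
    refine Continuous.prodMk (continuous_pi fun i => ?_) (continuous_pi fun i => ?_)
    · rcases i with i | i <;> simp only [Sum.elim_inl, Sum.elim_inr] <;> fun_prop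
    · rcases i with i | i <;> simp only [Sum.elim_inl, Sum.elim_inr] <;> fun_prop
  continuous_invFun := by fun_prop

variable {G₁ G₂} [SecondCountableTopology G₁] [SecondCountableTopology G₂]
  [MeasurableSpace G₁] [BorelSpace G₁] [MeasurableSpace G₂] [BorelSpace G₂]
  (μ₁ : Measure G₁) [SigmaFinite μ₁] (μ₂ : Measure G₂) [SigmaFinite μ₂]

lemma borelSpace_prod_of_left {α β : Type*} [TopologicalSpace α] [TopologicalSpace β]
    [MeasurableSpace α] [MeasurableSpace β] [SecondCountableTopology α] [BorelSpace α]
    [BorelSpace β] : BorelSpace (α × β) :=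
  Prod.borelSpace

instance : BorelSpace ((RedIx₁ T → G₁) × (RedIx₂ T → G₂)) := borelSpace_prod_of_left

instance : BorelSpace ((FeynIx₁ T → G₁) × (FeynIx₂ T → G₂)) := borelSpace_prod_of_left

instance : BorelSpace (ReducedConfig G₁ G₂ T) :=
  haveI : BorelSpace ((TriIx (boundaryTets T) → G₁) × (EdgeIx (boundaryTets T) → G₂)) :=
    borelSpace_prod_of_left
  haveI : BorelSpace ((TetIx (boundaryTets T) → G₁) × (TriIx (boundaryTets T) → G₁) ×
    (EdgeIx (boundaryTets T) → G₂)) := borelSpace_prod_of_left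
  haveI : BorelSpace ((TetIx (bulkTets T) → G₁) × (TetIx (boundaryTets T) → G₁) ×
    (TriIx (boundaryTets T) → G₁) × (EdgeIx (boundaryTets T) → G₂)) := borelSpace_prod_of_left
  borelSpace_prod_of_left

instance : BorelSpace (FeynmanConfig G₁ G₂ T) :=
  haveI : BorelSpace ((TriIx (allTets T) → G₁) × (EdgeIx (allTets T) → G₂)) :=
    borelSpace_prod_of_left
  haveI : BorelSpace ((TetIx (allTets T) → G₁) × (TriIx (allTets T) → G₁) ×
    (EdgeIx (allTets T) → G₂)) := borelSpace_prod_of_left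
  borelSpace_prod_of_left

lemma measurePreserving_redHomeo : MeasurePreserving (redHomeo G₁ G₂ T) (reducedVolume μ₁ μ₂ T)
    ((Measure.pi fun _ => μ₁).prod (Measure.pi fun _ => μ₂)) := by
  refine MeasurePreserving.symm (redHomeo G₁ G₂ T).symm.toMeasurableEquiv ?_
  have h1 := ((measurePreserving_sum_split (ι := TetIx (bulkTets T))
    (κ := TetIx (boundaryTets T) ⊕ TriIx (boundaryTets T)) μ₁).prod
    (measurePreserving_sum_split (ι := FaceIx T) (κ := EdgeIx (boundaryTets T)) μ₂))
  have h2 := (measurePreserving_prod_rotate _ _ _).comp h1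
  have h3 := ((MeasurePreserving.id (Measure.pi fun _ : FaceIx T => μ₂)).prod
    (((MeasurePreserving.id (Measure.pi fun _ : TetIx (bulkTets T) => μ₁)).prod
      (measurePreserving_sum_split (ι := TetIx (boundaryTets T))
        (κ := TriIx (boundaryTets T)) μ₁)).prod
      (MeasurePreserving.id (Measure.pi fun _ : EdgeIx (boundaryTets T) => μ₂)))).comp h2
  have h4 := ((MeasurePreserving.id (Measure.pi fun _ : FaceIx T => μ₂)).prod
    (measurePreserving_prodAssoc (Measure.pi fun _ : TetIx (bulkTets T) => μ₁)
      ((Measure.pi fun _ : TetIx (boundaryTets T) => μ₁).prod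
        (Measure.pi fun _ : TriIx (boundaryTets T) => μ₁))
      (Measure.pi fun _ : EdgeIx (boundaryTets T) => μ₂))).comp h3
  exact ((MeasurePreserving.id (Measure.pi fun _ : FaceIx T => μ₂)).prod
    ((MeasurePreserving.id (Measure.pi fun _ : TetIx (bulkTets T) => μ₁)).prod
    (measurePreserving_prodAssoc (Measure.pi fun _ : TetIx (boundaryTets T) => μ₁)
      (Measure.pi fun _ : TriIx (boundaryTets T) => μ₁)
      (Measure.pi fun _ : EdgeIx (boundaryTets T) => μ₂)))).comp h4

lemma measurePreserving_feynHomeo : MeasurePreserving (feynHomeo G₁ G₂ T)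
    (feynmanVolume μ₁ μ₂ T) ((Measure.pi fun _ => μ₁).prod (Measure.pi fun _ => μ₂)) := by
  refine MeasurePreserving.symm (feynHomeo G₁ G₂ T).symm.toMeasurableEquiv ?_
  have h1 := ((measurePreserving_sum_split (ι := TetIx (allTets T))
    (κ := TriIx (allTets T)) μ₁).prod
    (measurePreserving_sum_split (ι := FaceIx T) (κ := EdgeIx (allTets T)) μ₂))
  have h2 := (measurePreserving_prod_rotate _ _ _).comp h1
  exact ((MeasurePreserving.id (Measure.pi fun _ : FaceIx T => μ₂)).prod
    (measurePreserving_prodAssoc (Measure.pi fun _ : TetIx (allTets T) => μ₁)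
      (Measure.pi fun _ : TriIx (allTets T) => μ₁)
      (Measure.pi fun _ : EdgeIx (allTets T) => μ₂))).comp h2

end Spaces

/-! ### Coordinates for the reduced amplitude -/

section Reduced

variable {G₁ G₂ : Type*} [Group G₁] [Group G₂] (𝒢 : CrossedModule G₁ G₂)
  (T : Finset (Fin 6)) (m : Fin 6) (c : ReducedConfig G₁ G₂ T)

/-- The variable `u_{s;r;q}` is determined by the triangle `{s, r, q}`. -/
def DelU (s r q : Fin 6) : Prop := (q ∈ T → s < q) ∧ (q ∉ T → r < q)

/-- The variable `Y_{s;r;q,p}` is determined by the edge `{s, r, q, p}`. -/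
def DelY (s r q p : Fin 6) : Prop := DelU T s r q ∧ DelU T s r p

/-- The variable `X_{s;r,q}` is determined by the edge `{m, s, r, q}`. -/
def DelX (s r q : Fin 6) : Prop :=
  r ∈ T ∧ q ∈ T ∧ s ≠ m ∧ r ≠ m ∧ q ≠ m ∧ s < r ∧ s < q

instance (s r q : Fin 6) : Decidable (DelU T s r q) := by unfold DelU; infer_instance

instance (s r q p : Fin 6) : Decidable (DelY T s r q p) := by unfold DelY; infer_instance

instance (s r q : Fin 6) : Decidable (DelX T m s r q) := by unfold DelX; infer_instance

/-- The word that replaces `X_{s;r,q}` as a coordinate. -/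
def xWord (s r q : Fin 6) : G₂ :=
  if DelX T m s r q then
    if m < s then edgeWord 𝒢 T c m (sorted s r q).1 (sorted s r q).2.1 (sorted s r q).2.2
    else edgeWord 𝒢 T c s (sorted m r q).1 (sorted m r q).2.1 (sorted m r q).2.2
  else if r ∈ T then
    if q ∉ T ∧ s < r then theta 𝒢 T c m q s r else wedgeX c.1 s r q
  else if q ∈ T then if s < q then theta 𝒢 T c m r s q else wedgeX c.1 s r q
  else gX 𝒢 T c m s r q

/-- The coordinates of the reduced amplitude with values in `G₁`. -/
def redCoord₁ : RedIx₁ T → G₁ :=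
  Sum.elim (fun p => if p.1.1 ≠ m ∧ p.1.2 ≠ m then
      triangleWord 𝒢 T c (sorted m p.1.1 p.1.2).1 (sorted m p.1.1 p.1.2).2.1
        (sorted m p.1.1 p.1.2).2.2
    else c.2.1 p)
    (Sum.elim (fun p => gaugeH T c m p.1.1 p.1.2)
      fun p => if DelU T p.1.1 p.1.2.1 p.1.2.2 then
          triangleWord 𝒢 T c (sorted p.1.1 p.1.2.1 p.1.2.2).1 (sorted p.1.1 p.1.2.1 p.1.2.2).2.1
            (sorted p.1.1 p.1.2.1 p.1.2.2).2.2
        else c.2.2.2.1 p)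

/-- The coordinates of the reduced amplitude with values in `G₂`. -/
def redCoord₂ : RedIx₂ T → G₂ :=
  Sum.elim (fun p => xWord 𝒢 T m c p.1.1 p.1.2.1 p.1.2.2)
    fun p => if DelY T p.1.1 p.1.2.1 p.1.2.2.1 p.1.2.2.2 then
        edgeWord 𝒢 T c p.1.1 (sorted p.1.2.1 p.1.2.2.1 p.1.2.2.2).1
          (sorted p.1.2.1 p.1.2.2.1 p.1.2.2.2).2.1 (sorted p.1.2.1 p.1.2.2.1 p.1.2.2.2).2.2
      else c.2.2.2.2 p

/-- The order in which the variables `X_{s;r,q}` are replaced. -/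
def rankX (s r q : Fin 6) : ℕ :=
  if r ∈ T then
    if q ∈ T then if DelX T m s r q then 2 else 0
    else if s < r then 1 else 0
  else if q ∈ T then if s < q then 1 else 0 else 1

/-- The order in which the variables with values in `G₁` are replaced. -/
def redRank₁ : RedIx₁ T → ℕ :=
  Sum.elim (fun p => if p.1.1 = m ∨ p.1.2 = m then 0 else 1)
    (Sum.elim (fun _ => 1) fun p => if DelU T p.1.1 p.1.2.1 p.1.2.2 then 3 else 0)

/-- The order in which the variables with values in `G₂` are replaced. -/
def redRank₂ : RedIx₂ T → ℕ :=
  Sum.elim (fun p => rankX T m p.1.1 p.1.2.1 p.1.2.2)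
    fun p => if DelY T p.1.1 p.1.2.1 p.1.2.2.1 p.1.2.2.2 then 3 else 0

/-- The wedges `X_{s;r,q}` and `X_{s;q,r}` are one variable up to inversion. -/
lemma rankX_swap (s r q : Fin 6) : rankX T m s q r = rankX T m s r q := by
  unfold rankX DelX
  by_cases hr : r ∈ T <;> by_cases hq : q ∈ T <;> grind

lemma rankX_lt (s r q : Fin 6) : rankX T m s r q < 3 := by
  unfold rankX; split_ifs <;> omega

end Reduced

/-! ### Triangularity of the reduced coordinates -/

section ReducedDep

variable {G₁ G₂ : Type*} [Group G₁] [TopologicalSpace G₁] [IsTopologicalGroup G₁]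
  [Group G₂] [TopologicalSpace G₂] [IsTopologicalGroup G₂] {𝒢 : CrossedModule G₁ G₂}
  {T : Finset (Fin 6)} {m : Fin 6} {n : ℕ}

section Generic

variable {ι₁ ι₂ : Type*} {rk₁ : ι₁ → ℕ} {rk₂ : ι₂ → ℕ}
  {cfg : (ι₁ → G₁) × (ι₂ → G₂) → ReducedConfig G₁ G₂ T}

lemma dep_cornerLink (ht : Continuous 𝒢.t) {s r q : Fin 6}
    (h : Dep rk₁ rk₂ n fun x => wedgeX (cfg x).1 s q r) :
    Dep rk₁ rk₂ n fun x => cornerLink 𝒢 T (cfg x) s r q := by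
  unfold cornerLink
  split_ifs
  · exact h.comp ht
  · exact dep_const 1

lemma dep_gX (hact : Continuous fun p : G₁ × G₂ => 𝒢.act p.1 p.2) {s r q : Fin 6} (hg : Dep rk₁ rk₂ n fun x => gauge T (cfg x) m s)
    (h : Dep rk₁ rk₂ n fun x => wedgeX (cfg x).1 s r q) :
    Dep rk₁ rk₂ n fun x => gX 𝒢 T (cfg x) m s r q :=
  Dep.comp₂ (f := fun a b => 𝒢.act a b) hact hg h

lemma dep_eta (hact : Continuous fun p : G₁ × G₂ => 𝒢.act p.1 p.2) {r q : Fin 6} (hg : ∀ s, Dep rk₁ rk₂ n fun x => gauge T (cfg x) m s)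
    (h₁ : Dep rk₁ rk₂ n fun x => wedgeX (cfg x).1 r q m)
    (h₂ : Dep rk₁ rk₂ n fun x => wedgeX (cfg x).1 m r q)
    (h₃ : Dep rk₁ rk₂ n fun x => wedgeX (cfg x).1 q m r) :
    Dep rk₁ rk₂ n fun x => eta 𝒢 T (cfg x) m r q :=
  ((dep_gX hact (hg _) h₁).mul (dep_gX hact (hg _) h₂)).mul (dep_gX hact (hg _) h₃)

variable [MeasurableSpace G₂] [BorelSpace G₂] {μ₂ : Measure G₂} [μ₂.IsMulLeftInvariant]
  [μ₂.IsMulRightInvariant] [μ₂.IsInvInvariant]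
  {π : (ι₁ → G₁) × (ι₂ → G₂) → G₂}

lemma lin_gX (hact : Continuous fun p : G₁ × G₂ => 𝒢.act p.1 p.2)
    (hμ₂ : ∀ g : G₁, MeasurePreserving (fun y => 𝒢.act g y) μ₂ μ₂) {s r q : Fin 6} (hg : Dep rk₁ rk₂ n fun x => gauge T (cfg x) m s)
    (h : Lin rk₁ rk₂ μ₂ n π fun x => wedgeX (cfg x).1 s r q) :
    Lin rk₁ rk₂ μ₂ n π fun x => gX 𝒢 T (cfg x) m s r q :=
  Lin.act hact hμ₂ hg h

end Generic

section Concrete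

lemma red_dep_wedgeX {s r q : Fin 6} (h : rankX T m s r q < n) :
    Dep (G₁ := G₁) (redRank₁ T m) (redRank₂ T m) n
      fun x => wedgeX ((redHomeo G₁ G₂ T).symm x).1 s r q := by
  refine dep_wedgeX (v := Sum.inl) fun p hp => ?_
  change rankX T m _ _ _ < n
  rcases hp with hp | hp <;> rw [hp]
  · exact h
  · rwa [rankX_swap]

lemma red_dep_bulkH {s r : Fin 6} (h : if s = m ∨ r = m then 0 < n else 1 < n) :
    Dep (G₂ := G₂) (redRank₁ T m) (redRank₂ T m) n
      fun x => bulkH ((redHomeo G₁ G₂ T).symm x).2.1 s r := by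
  refine (dep_linkH (v := Sum.inl) fun p hp => ?_).mul
    (dep_linkH (v := Sum.inl) fun p hp => ?_).inv <;>
  · change (if p.1.1 = m ∨ p.1.2 = m then 0 else 1) < n
    grind

lemma red_dep_linkH {s r : Fin 6} (h : 1 < n) :
    Dep (G₂ := G₂) (redRank₁ T m) (redRank₂ T m) n
      fun x => linkH ((redHomeo G₁ G₂ T).symm x).2.2.1 s r :=
  dep_linkH (v := fun p => Sum.inr (Sum.inl p)) fun _ _ => h

lemma red_dep_linkU {s r q : Fin 6} (h : ¬ DelU T s r q) (hn : 0 < n) :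
    Dep (G₂ := G₂) (redRank₁ T m) (redRank₂ T m) n
      fun x => linkU ((redHomeo G₁ G₂ T).symm x).2.2.2.1 s r q := by
  refine dep_linkU (v := fun p => Sum.inr (Sum.inr p)) fun p hp => ?_
  change (if DelU T p.1.1 p.1.2.1 p.1.2.2 then 3 else 0) < n
  rw [hp, if_neg h]
  exact hn

lemma red_dep_wedgeY {s r q p : Fin 6} (h : ¬ DelY T s r q p) (hn : 0 < n) :
    Dep (G₁ := G₁) (redRank₁ T m) (redRank₂ T m) n
      fun x => wedgeY ((redHomeo G₁ G₂ T).symm x).2.2.2.2 s r q p := by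
  refine dep_wedgeY (v := Sum.inr) fun i hi => ?_
  change (if DelY T i.1.1 i.1.2.1 i.1.2.2.1 i.1.2.2.2 then 3 else 0) < n
  rcases hi with hi | hi <;> rw [hi]
  · rw [if_neg h]
    exact hn
  · rw [if_neg fun h' => h ⟨h'.2, h'.1⟩]
    exact hn

lemma red_dep_crossLink {s r q : Fin 6} (h : 1 < n)
    (h₁ : s ∈ T → r ∉ T → ¬ DelU T s r q) (h₂ : r ∈ T → s ∉ T → ¬ DelU T r s q) :
    Dep (G₂ := G₂) (redRank₁ T m) (redRank₂ T m) n
      fun x => crossLink T ((redHomeo G₁ G₂ T).symm x) s r q := by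
  unfold crossLink
  split_ifs with h3 h4 h5
  · exact red_dep_bulkH (by split_ifs <;> omega)
  · exact (red_dep_linkH h).mul (red_dep_linkU (h₁ h4 fun h' => h3 ⟨h4, h'⟩) (by omega))
  · exact ((red_dep_linkH h).mul (red_dep_linkU (h₂ h5 h4) (by omega))).inv
  · exact dep_const 1

lemma red_dep_outerWedge (hact : Continuous fun p : G₁ × G₂ => 𝒢.act p.1 p.2)
    {s r q p : Fin 6} (h : r ∉ T → 1 < n ∧ ¬ DelY T s r q p) :
    Dep (redRank₁ T m) (redRank₂ T m) n
      fun x => outerWedge 𝒢 T ((redHomeo G₁ G₂ T).symm x) s r q p := by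
  unfold outerWedge
  split_ifs with hr
  · exact dep_const 1
  · exact Dep.comp₂ (f := fun a b => 𝒢.act a b) hact (red_dep_linkH (h hr).1)
      (red_dep_wedgeY (h hr).2 (by have := (h hr).1; omega))

lemma red_dep_sideWedge (hact : Continuous fun p : G₁ × G₂ => 𝒢.act p.1 p.2)
    {s r p q : Fin 6}
    (h₁ : r ∉ T → 1 < n ∧ ¬ DelY T s r p q)
    (hh : r ∈ T → if s = m ∨ r = m then 0 < n else 1 < n)
    (h₂ : r ∈ T → rankX T m r s p < n ∧ rankX T m r p q < n ∧ rankX T m r q s < n)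
    (h₃ : r ∈ T → p ∉ T → 1 < n ∧ ¬ DelY T r p s q)
    (h₄ : r ∈ T → q ∉ T → 1 < n ∧ ¬ DelY T r q p s) :
    Dep (redRank₁ T m) (redRank₂ T m) n
      fun x => sideWedge 𝒢 T ((redHomeo G₁ G₂ T).symm x) s r p q := by
  unfold sideWedge
  split_ifs with hr
  · obtain ⟨h5, h6, h7⟩ := h₂ hr
    exact Dep.comp₂ (f := fun a b => 𝒢.act a b) hact (red_dep_bulkH (hh hr))
      (((((red_dep_wedgeX h5).mul (red_dep_outerWedge hact (h₃ hr))).mul (red_dep_wedgeX h6)).mul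
        (red_dep_outerWedge hact (h₄ hr))).mul (red_dep_wedgeX h7))
  · exact red_dep_outerWedge hact h₁

lemma red_dep_gauge (h : 0 < n) (s : Fin 6) :
    Dep (G₂ := G₂) (redRank₁ T m) (redRank₂ T m) n
      fun x => gauge T ((redHomeo G₁ G₂ T).symm x) m s :=
  red_dep_bulkH (by simpa)

variable [MeasurableSpace G₁] [BorelSpace G₁] [MeasurableSpace G₂] [BorelSpace G₂]
  {μ₁ : Measure G₁} [μ₁.IsMulLeftInvariant] [μ₁.IsMulRightInvariant] [μ₁.IsInvInvariant]
  {μ₂ : Measure G₂} [μ₂.IsMulLeftInvariant] [μ₂.IsMulRightInvariant] [μ₂.IsInvInvariant]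

/-- The triangle `{m, s, r}` contains the link `h_{s,r}` once. Its other links meet `m`, and its
wedges have an index `m`; all of these have rank zero. -/
lemma red_lin_bulk (hm : m ∈ T) (ht : Continuous 𝒢.t) (p : TetIx (bulkTets T)) (h : p.1.1 ≠ m ∧ p.1.2 ≠ m) :
    Lin (redRank₁ T m) (redRank₂ T m) μ₁ 1
      (fun x : (RedIx₁ T → G₁) × (RedIx₂ T → G₂) => x.1 (.inl p))
      fun x => triangleWord 𝒢 T ((redHomeo G₁ G₂ T).symm x) (sorted m p.1.1 p.1.2).1
        (sorted m p.1.1 p.1.2).2.1 (sorted m p.1.1 p.1.2).2.2 := by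
  obtain ⟨⟨s, r⟩, hp⟩ := p
  obtain ⟨hs, hr, hsr⟩ : s ∈ T ∧ r ∈ T ∧ s < r := by simpa [bulkTets] using hp
  dsimp only at h ⊢
  have hX : ∀ a b d : Fin 6, a ∈ T → b ∈ T → d ∈ T → (a = m ∨ b = m ∨ d = m) →
      rankX T m a b d < 1 := by
    intro a b d ha hb hd h'
    unfold rankX DelX
    grind
  refine lin_triangleWord (s := s) (r := r) (q := m) ?_ ?_ ?_ ?_ ?_ ?_
    (perm3_sorted h.1.symm hsr.ne h.2.symm).rotate
  · unfold crossLink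
    simp only [hs, hr, and_self, if_true]
    -- Bulk links are variables only for increasing indices, so for `s < r` the second factor of
    -- `bulkH` has no label and is constant.
    refine Lin.mul_right ?_ (dep_linkH (v := Sum.inl) fun p hp => ?_).inv
    · have : ∀ x, linkH (A := bulkTets T) (fun p => x.1 (.inl p)) s r =
          (fun x : (RedIx₁ T → G₁) × (RedIx₂ T → G₂) => x.1 (.inl ⟨(s, r), hp⟩)) x :=
        fun x => dif_pos hp
      exact (funext this : _ = _) ▸ lin_self
    · have := p.2
      rw [hp] at this
      simp only [bulkTets, Finset.mem_filter_univ] at this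
      omega
  · unfold crossLink
    simp only [hm, hr, and_self, if_true]
    exact red_dep_bulkH (by simp)
  · unfold crossLink
    simp only [hm, hs, and_self, if_true]
    exact red_dep_bulkH (by simp)
  · exact dep_cornerLink ht (red_dep_wedgeX (hX _ _ _ hs hm hr (by simp)))
  · exact dep_cornerLink ht (red_dep_wedgeX (hX _ _ _ hr hs hm (by simp)))
  · exact dep_cornerLink ht (red_dep_wedgeX (hX _ _ _ hm hr hs (by simp)))

/-- The other `u` in the word of this triangle does not satisfy `DelU`: only the label with the
first index on each side does. It therefore has rank zero, while the links and wedges have rank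
below `3`. -/
lemma red_lin_tri (ht : Continuous 𝒢.t) (p : TriIx (boundaryTets T))
    (h : DelU T p.1.1 p.1.2.1 p.1.2.2) :
    Lin (redRank₁ T m) (redRank₂ T m) μ₁ 3
      (fun x : (RedIx₁ T → G₁) × (RedIx₂ T → G₂) => x.1 (.inr (.inr p)))
      fun x => triangleWord 𝒢 T ((redHomeo G₁ G₂ T).symm x) (sorted p.1.1 p.1.2.1 p.1.2.2).1
        (sorted p.1.1 p.1.2.1 p.1.2.2).2.1 (sorted p.1.1 p.1.2.1 p.1.2.2).2.2 := by
  obtain ⟨⟨s, r, q⟩, hp⟩ := p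
  obtain ⟨⟨hs, hr⟩, hqs, hqr⟩ : (s ∈ T ∧ r ∉ T) ∧ q ≠ s ∧ q ≠ r := by
    simpa [boundaryTets] using hp
  dsimp only at h ⊢
  have hsr : s ≠ r := fun h' => hr (h' ▸ hs)
  refine lin_triangleWord (s := s) (r := r) (q := q) ?_ ?_ ?_ ?_ ?_ ?_
    (perm3_sorted hsr hqr.symm hqs.symm)
  · unfold crossLink
    simp only [hs, hr, and_false, if_false, if_true]
    refine Lin.mul_left (red_dep_linkH (by omega)) ?_
    have : ∀ x, linkU (A := boundaryTets T) (fun p => x.1 (.inr (.inr p))) s r q =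
        (fun x : (RedIx₁ T → G₁) × (RedIx₂ T → G₂) => x.1 (.inr (.inr ⟨(s, r, q), hp⟩))) x :=
      fun x => dif_pos hp
    exact (funext this : _ = _) ▸ lin_self
  · refine red_dep_crossLink (by omega) ?_ ?_ <;> unfold DelU at * <;> grind
  · refine red_dep_crossLink (by omega) ?_ ?_ <;> unfold DelU at * <;> grind
  · exact dep_cornerLink ht (red_dep_wedgeX (rankX_lt _ _ _ _ _))
  · exact dep_cornerLink ht (red_dep_wedgeX (rankX_lt _ _ _ _ _))
  · exact dep_cornerLink ht (red_dep_wedgeX (rankX_lt _ _ _ _ _))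

/-- As for triangles: among the variables `Y` around an edge only one label has the first index on
each side, and all the others have rank zero. -/
lemma red_lin_edge (hact : Continuous fun p : G₁ × G₂ => 𝒢.act p.1 p.2)
    (hμ₂ : ∀ g : G₁, MeasurePreserving (fun y => 𝒢.act g y) μ₂ μ₂)
    (p : EdgeIx (boundaryTets T)) (h : DelY T p.1.1 p.1.2.1 p.1.2.2.1 p.1.2.2.2) :
    Lin (redRank₁ T m) (redRank₂ T m) μ₂ 3
      (fun x : (RedIx₁ T → G₁) × (RedIx₂ T → G₂) => x.2 (.inr p))
      fun x => edgeWord 𝒢 T ((redHomeo G₁ G₂ T).symm x) p.1.1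
        (sorted p.1.2.1 p.1.2.2.1 p.1.2.2.2).1 (sorted p.1.2.1 p.1.2.2.1 p.1.2.2.2).2.1
        (sorted p.1.2.1 p.1.2.2.1 p.1.2.2.2).2.2 := by
  obtain ⟨⟨s, r, q, p⟩, hp⟩ := p
  obtain ⟨⟨hs, hr⟩, hqs, hqr, hps, hpr, hqp⟩ :
      (s ∈ T ∧ r ∉ T) ∧ q ≠ s ∧ q ≠ r ∧ p ≠ s ∧ p ≠ r ∧ q < p := by
    simpa [boundaryTets] using hp
  dsimp only at h ⊢
  have hsr : s ≠ r := fun h' => hr (h' ▸ hs)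
  refine lin_edgeWord_side (s := s) (a := r) (b := q) (d := p) ?_ ?_ ?_ ?_ ?_ ?_
    (perm3_sorted hqr.symm hqp.ne hpr.symm)
  · unfold sideWedge outerWedge
    simp only [hr, if_false]
    refine Lin.act hact hμ₂ (red_dep_linkH (by omega)) ?_
    have : ∀ x, wedgeY (A := boundaryTets T) (fun p => x.2 (.inr p)) s r q p =
        (fun x : (RedIx₁ T → G₁) × (RedIx₂ T → G₂) => x.2 (.inr ⟨(s, r, q, p), hp⟩)) x :=
      fun x => dif_pos hp
    exact (funext this : _ = _) ▸ lin_self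
  · refine red_dep_sideWedge hact ?_ ?_ (fun _ => ⟨rankX_lt _ _ _ _ _, rankX_lt _ _ _ _ _,
      rankX_lt _ _ _ _ _⟩) ?_ ?_ <;> unfold DelY DelU at * <;> grind
  · refine red_dep_sideWedge hact ?_ ?_ (fun _ => ⟨rankX_lt _ _ _ _ _, rankX_lt _ _ _ _ _,
      rankX_lt _ _ _ _ _⟩) ?_ ?_ <;> unfold DelY DelU at * <;> grind
  · exact red_dep_wedgeX (rankX_lt _ _ _ _ _)
  · exact red_dep_wedgeX (rankX_lt _ _ _ _ _)
  · exact red_dep_wedgeX (rankX_lt _ _ _ _ _)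

lemma red_lin_wedge (hm : m ∈ T) (hact : Continuous fun p : G₁ × G₂ => 𝒢.act p.1 p.2)
    (hμ₂ : ∀ g : G₁, MeasurePreserving (fun y => 𝒢.act g y) μ₂ μ₂) (p : FaceIx T) :
    Lin (redRank₁ T m) (redRank₂ T m) μ₂ (rankX T m p.1.1 p.1.2.1 p.1.2.2)
      (fun x : (RedIx₁ T → G₁) × (RedIx₂ T → G₂) => x.2 (.inl p))
      fun x => xWord 𝒢 T m ((redHomeo G₁ G₂ T).symm x) p.1.1 p.1.2.1 p.1.2.2 := by
  have hx : ∀ (n : ℕ) (r q : Fin 6),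
      ((r = p.1.2.1 ∧ q = p.1.2.2) ∨ (r = p.1.2.2 ∧ q = p.1.2.1)) →
      Lin (redRank₁ T m) (redRank₂ T m) μ₂ n
      (fun x : (RedIx₁ T → G₁) × (RedIx₂ T → G₂) => x.2 (.inl p))
      fun x => wedgeX ((redHomeo G₁ G₂ T).symm x).1 p.1.1 r q :=
    fun n r q h => lin_wedgeX (v := Sum.inl) h
  obtain ⟨⟨s, r, q⟩, hp⟩ := p
  obtain ⟨hs, hrs, hqs, hrq⟩ := hp
  dsimp only at hs hrs hqs hrq hx ⊢
  unfold xWord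
  split_ifs with h1 h2 h3 h4 h5 h6
  -- Here `m < s`, so the edge is based at `m`, and `X_{s;r,q}` occurs inside the side wedge of `s`,
  -- next to wedges with an index `m`.
  · obtain ⟨hr, hq, hsm, hrm, hqm, hsr, hsq⟩ := h1
    have hrk : rankX T m s r q = 2 := by unfold rankX DelX; simp [*]
    rw [hrk]
    refine lin_edgeWord_side (s := m) (a := s) (b := r) (d := q) ?_ ?_ ?_ ?_ ?_ ?_
      (perm3_sorted hrs.symm hrq.ne hqs.symm)
    · unfold sideWedge outerWedge
      simp only [hs, hr, hq, if_true, mul_one]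
      refine Lin.act hact hμ₂ (red_dep_bulkH (by simp)) (((Lin.mul_left ?_ (hx _ _ _ ?_))).mul_right
        ?_)
      · exact red_dep_wedgeX (by unfold rankX DelX; grind)
      · simp
      · exact red_dep_wedgeX (by unfold rankX DelX; grind)
    · refine red_dep_sideWedge hact ?_ ?_ ?_ ?_ ?_ <;> (try unfold rankX DelX) <;> grind
    · refine red_dep_sideWedge hact ?_ ?_ ?_ ?_ ?_ <;> (try unfold rankX DelX) <;> grind
    · exact red_dep_wedgeX (by unfold rankX DelX; grind)
    · exact red_dep_wedgeX (by unfold rankX DelX; grind)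
    · exact red_dep_wedgeX (by unfold rankX DelX; grind)
  -- Here `s < m`, so the edge is based at `s`, and `X_{s;r,q}` is itself one of the factors of the
  -- word.
  · obtain ⟨hr, hq, hsm, hrm, hqm, hsr, hsq⟩ := h1
    have hrk : rankX T m s r q = 2 := by unfold rankX DelX; simp [*]
    rw [hrk]
    refine lin_edgeWord_wedge (s := s) (a := r) (b := q) (d := m) ?_ ?_ ?_ (hx _ _ _ (by simp)) ?_ ?_
      (perm3_sorted hrm.symm hrq.ne hqm.symm).rotate
    · refine red_dep_sideWedge hact ?_ ?_ ?_ ?_ ?_ <;> (try unfold rankX DelX) <;> grind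
    · refine red_dep_sideWedge hact ?_ ?_ ?_ ?_ ?_ <;> (try unfold rankX DelX) <;> grind
    · refine red_dep_sideWedge hact ?_ ?_ ?_ ?_ ?_ <;> (try unfold rankX DelX) <;> grind
    · exact red_dep_wedgeX (by unfold rankX DelX; grind)
    · exact red_dep_wedgeX (by unfold rankX DelX; grind)
  -- As `s < r`, the second wedge in `theta`, which belongs to the 4-simplex `r`, has rank zero, and
  -- so have the wedges in `eta`. The next mixed case is the same with `r` and `q` exchanged.
  · have hrk : rankX T m s r q = 1 := by unfold rankX DelX; simp [*]
    rw [hrk]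
    unfold theta
    simp only [h4, if_false]
    refine Lin.mul_right (Lin.mul_right (lin_gX hact hμ₂ (red_dep_gauge (by omega) _)
      (hx _ _ _ (by simp))) (dep_eta hact (red_dep_gauge (by omega)) ?_ ?_ ?_))
      (dep_gX hact (red_dep_gauge (by omega) _) ?_) <;>
    · refine red_dep_wedgeX ?_
      unfold rankX DelX
      grind
  · exact hx _ _ _ (by simp)
  · have hrk : rankX T m s r q = 1 := by unfold rankX DelX; simp [*]
    rw [hrk]
    unfold theta
    simp only [h3, if_false]
    refine Lin.mul_right (Lin.mul_right (lin_gX hact hμ₂ (red_dep_gauge (by omega) _)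
      (hx _ _ _ (by simp))) (dep_eta hact (red_dep_gauge (by omega)) ?_ ?_ ?_))
      (dep_gX hact (red_dep_gauge (by omega) _) ?_) <;>
    · refine red_dep_wedgeX ?_
      unfold rankX DelX
      grind
  · exact hx _ _ _ (by simp)
  · have hrk : rankX T m s r q = 1 := by unfold rankX DelX; simp [*]
    rw [hrk]
    exact lin_gX hact hμ₂ (red_dep_gauge (by omega) _) (hx _ _ _ (by simp))

variable (𝒢 T m) in
/-- The coordinates of the reduced amplitude. -/
def redTheta (x : (RedIx₁ T → G₁) × (RedIx₂ T → G₂)) : (RedIx₁ T → G₁) × (RedIx₂ T → G₂) :=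
  (redCoord₁ 𝒢 T m ((redHomeo G₁ G₂ T).symm x), redCoord₂ 𝒢 T m ((redHomeo G₁ G₂ T).symm x))

lemma isVolumeHomeo_redTheta [SecondCountableTopology G₁] [SecondCountableTopology G₂]
    [SigmaFinite μ₁] [SigmaFinite μ₂] (hm : m ∈ T) (ht : Continuous 𝒢.t)
    (hact : Continuous fun p : G₁ × G₂ => 𝒢.act p.1 p.2)
    (hμ₂ : ∀ g : G₁, MeasurePreserving (fun y => 𝒢.act g y) μ₂ μ₂) :
    IsVolumeHomeo μ₁ μ₂ (redTheta 𝒢 T m) := by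
  refine isVolumeHomeo_of_triangular (rk₁ := redRank₁ T m) (rk₂ := redRank₂ T m) ?_ ?_
  · rintro (p | p | p)
    · simp only [redTheta, redCoord₁, redRank₁, Sum.elim_inl]
      by_cases h : p.1.1 ≠ m ∧ p.1.2 ≠ m
      · simp only [if_pos h, if_neg (not_or.2 h)]
        exact red_lin_bulk hm ht p h
      · simp only [if_neg h]
        exact lin_self
    · simp only [redTheta, redCoord₁, redRank₁, Sum.elim_inl, Sum.elim_inr]
      refine Lin.mul_left (red_dep_gauge (by omega) _) ?_
      have : ∀ x, linkH (A := boundaryTets T) (fun p => x.1 (.inr (.inl p))) p.1.1 p.1.2 =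
          (fun x : (RedIx₁ T → G₁) × (RedIx₂ T → G₂) => x.1 (.inr (.inl p))) x :=
        fun x => dif_pos p.2
      exact (funext this : _ = _) ▸ lin_self
    · simp only [redTheta, redCoord₁, redRank₁, Sum.elim_inr]
      split_ifs with h
      · exact red_lin_tri ht p h
      · exact lin_self
  · rintro (p | p)
    · exact red_lin_wedge hm hact hμ₂ p
    · simp only [redTheta, redCoord₂, redRank₂, Sum.elim_inr]
      split_ifs with h
      · exact red_lin_edge hact hμ₂ p h
      · exact lin_self

end Concrete

end ReducedDep

lemma prod_filter_subtype {α M : Type*} [Fintype α] [CommMonoid M] {P Q : α → Prop}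
    [DecidablePred P] [DecidablePred Q] [Fintype {x // P x}] (f : {x // P x} → M) (g : α → M)
    (h : ∀ x : {x // P x}, Q x.1 → f x = g x.1) :
    ∏ x ∈ (Finset.univ : Finset {x // P x}).filter (fun x => Q x.1), f x =
      ∏ x ∈ Finset.univ.filter (fun x => P x ∧ Q x), g x := by
  refine Finset.prod_bij (fun x _ => x.1) ?_ ?_ ?_ ?_
  · intro x hx
    simpa [x.2] using hx
  · intro x _ y _ hxy
    exact Subtype.ext hxy
  · intro x hx
    simp only [Finset.mem_filter_univ] at hx
    exact ⟨⟨x, hx.1⟩, by simpa using hx.2, rfl⟩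
  · intro x hx
    exact h x (by simpa using hx)

open Classical in
lemma prod_kronecker {κ G : Type*} [Group G] (s : Finset κ) (w : κ → G) :
    ∏ i ∈ s, kronecker (w i) = if ∀ i ∈ s, w i = 1 then 1 else 0 := by
  have : ∀ i, kronecker (w i) = if w i = 1 then 1 else 0 := fun i => Set.indicator_apply _ _ _
  simp only [this]
  split_ifs with h
  · exact Finset.prod_eq_one fun i hi => if_pos (h i hi)
  · push Not at h
    obtain ⟨i, hi, hw⟩ := h
    exact Finset.prod_eq_zero hi (if_neg hw)

lemma prod_kronecker_ne_zero {κ G : Type*} [Group G] {s : Finset κ} {w : κ → G} :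
    ∏ i ∈ s, kronecker (w i) ≠ 0 ↔ ∀ i ∈ s, w i = 1 := by
  rw [prod_kronecker]; simp

/-! ### The delta functions of the amplitude as coordinates -/

section ReducedDelta

variable (T : Finset (Fin 6)) (m : Fin 6)

/-- The `G₁` coordinates of the reduced amplitude that are arguments of delta functions. -/
def redDelta₁ : Finset (RedIx₁ T) :=
  (Finset.univ.filter fun p : TetIx (bulkTets T) => p.1.1 ≠ m ∧ p.1.2 ≠ m).disjSum
    ((∅ : Finset (TetIx (boundaryTets T))).disjSum
      (Finset.univ.filter fun p : TriIx (boundaryTets T) => DelU T p.1.1 p.1.2.1 p.1.2.2))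

/-- The `G₂` coordinates of the reduced amplitude that are arguments of delta functions. -/
def redDelta₂ : Finset (RedIx₂ T) :=
  (Finset.univ.filter fun p : FaceIx T => DelX T m p.1.1 p.1.2.1 p.1.2.2).disjSum
    (Finset.univ.filter fun p : EdgeIx (boundaryTets T) =>
      DelY T p.1.1 p.1.2.1 p.1.2.2.1 p.1.2.2.2)

variable {T m} {G₁ G₂ : Type*} [Group G₁] [Group G₂] {𝒢 : CrossedModule G₁ G₂}

lemma reducedDensity_eq (hm : m ∈ T) (δ₁ : G₁ → ℝ) (δ₂ : G₂ → ℝ) (c : ReducedConfig G₁ G₂ T) :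
    reducedDensity 𝒢 T (some m) δ₁ δ₂ c = (∏ i ∈ redDelta₁ T m, δ₁ (redCoord₁ 𝒢 T m c i)) *
      ∏ i ∈ redDelta₂ T m, δ₂ (redCoord₂ 𝒢 T m c i) := by
  unfold reducedDensity redDelta₁ redDelta₂
  rw [Finset.prod_disjSum, Finset.prod_disjSum, Finset.prod_disjSum, Finset.prod_empty, one_mul,
    prod_keptTriangles hm fun p => δ₁ (triangleWord 𝒢 T c p.1 p.2.1 p.2.2),
    prod_keptEdges hm fun p => δ₂ (edgeWord 𝒢 T c p.1 p.2.1 p.2.2.1 p.2.2.2)]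
  congr 1
  · congr 1
    · rw [prod_filter_subtype (Q := fun p : Fin 6 × Fin 6 => p.1 ≠ m ∧ p.2 ≠ m) _
        fun p => δ₁ (triangleWord 𝒢 T c (sorted m p.1 p.2).1
          (sorted m p.1 p.2).2.1 (sorted m p.1 p.2).2.2)]
      · refine Finset.prod_congr ?_ fun _ _ => rfl
        ext; simp
      · intro p hp
        simp only [redCoord₁, Sum.elim_inl, if_pos hp]
    · rw [prod_filter_subtype (Q := fun p : Fin 6 × Fin 6 × Fin 6 => DelU T p.1 p.2.1 p.2.2) _
        fun p => δ₁ (triangleWord 𝒢 T c (sorted p.1 p.2.1 p.2.2).1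
          (sorted p.1 p.2.1 p.2.2).2.1 (sorted p.1 p.2.1 p.2.2).2.2)]
      · refine Finset.prod_congr ?_ fun _ _ => rfl
        ext p
        simp only [Finset.mem_filter_univ, DelU, boundaryTets, and_assoc]
      · intro p hp
        simp only [redCoord₁, Sum.elim_inr, if_pos hp]
  · congr 1
    · rw [prod_filter_subtype (Q := fun p : Fin 6 × Fin 6 × Fin 6 => DelX T m p.1 p.2.1 p.2.2) _
        fun p => δ₂ (if m < p.1 then edgeWord 𝒢 T c m (sorted p.1 p.2.1 p.2.2).1
          (sorted p.1 p.2.1 p.2.2).2.1 (sorted p.1 p.2.1 p.2.2).2.2 else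
          edgeWord 𝒢 T c p.1 (sorted m p.2.1 p.2.2).1 (sorted m p.2.1 p.2.2).2.1
          (sorted m p.2.1 p.2.2).2.2)]
      · refine Finset.prod_congr ?_ fun p _ => ?_
        · ext p
          simp only [Finset.mem_filter_univ, DelX]
          grind
        · split_ifs <;> rfl
      · intro p hp
        simp only [redCoord₂, Sum.elim_inl, xWord, if_pos hp]
    · rw [prod_filter_subtype (Q := fun p : Fin 6 × Fin 6 × Fin 6 × Fin 6 =>
          DelY T p.1 p.2.1 p.2.2.1 p.2.2.2) _
        fun p => δ₂ (edgeWord 𝒢 T c p.1 (sorted p.2.1 p.2.2.1 p.2.2.2).1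
          (sorted p.2.1 p.2.2.1 p.2.2.2).2.1 (sorted p.2.1 p.2.2.1 p.2.2.2).2.2)]
      · refine Finset.prod_congr ?_ fun _ _ => rfl
        ext p
        simp only [Finset.mem_filter_univ, DelY, DelU, boundaryTets]
        tauto
      · intro p hp
        simp only [redCoord₂, Sum.elim_inr, if_pos hp]

/-- The factorisation of the density holds for arbitrary functions in place of the delta functions.
Kronecker deltas in one group and the constant `1` in the other turn it into an equivalence of the
two lists of conditions. -/
lemma redCoord_eq_one_iff (hm : m ∈ T) {c : ReducedConfig G₁ G₂ T} :
    ((∀ i ∈ redDelta₁ T m, redCoord₁ 𝒢 T m c i = 1) ∧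
      ∀ i ∈ redDelta₂ T m, redCoord₂ 𝒢 T m c i = 1) ↔
      TriFlat 𝒢 T c (some m) ∧ EdgeFlat 𝒢 T c (some m) := by
  have h₁ := reducedDensity_eq (𝒢 := 𝒢) hm kronecker (fun _ => 1) c
  have h₂ := reducedDensity_eq (𝒢 := 𝒢) hm (fun _ => 1) kronecker c
  simp only [reducedDensity, Finset.prod_const_one, mul_one, one_mul] at h₁ h₂
  rw [triFlat_iff, edgeFlat_iff, ← prod_kronecker_ne_zero, ← prod_kronecker_ne_zero,
    ← prod_kronecker_ne_zero, ← prod_kronecker_ne_zero, h₁, h₂]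

end ReducedDelta

section RedChart

variable {G₁ G₂ : Type*} [Group G₁] [TopologicalSpace G₁] [IsTopologicalGroup G₁]
  [SecondCountableTopology G₁] [MeasurableSpace G₁] [BorelSpace G₁]
  [Group G₂] [TopologicalSpace G₂] [IsTopologicalGroup G₂]
  [SecondCountableTopology G₂] [MeasurableSpace G₂] [BorelSpace G₂] {𝒢 : CrossedModule G₁ G₂}
  {μ₁ : Measure G₁} [SigmaFinite μ₁] [μ₁.IsMulLeftInvariant] [μ₁.IsMulRightInvariant]
  [μ₁.IsInvInvariant]
  {μ₂ : Measure G₂} [SigmaFinite μ₂] [μ₂.IsMulLeftInvariant] [μ₂.IsMulRightInvariant]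
  [μ₂.IsInvInvariant]
  {T : Finset (Fin 6)} {m : Fin 6}

lemma exists_redChart (hm : m ∈ T) (ht : Continuous 𝒢.t)
    (hact : Continuous fun p : G₁ × G₂ => 𝒢.act p.1 p.2)
    (hμ₂ : ∀ g : G₁, MeasurePreserving (fun y => 𝒢.act g y) μ₂ μ₂) :
    ∃ E : ReducedConfig G₁ G₂ T ≃ₜ (RedIx₁ T → G₁) × (RedIx₂ T → G₂),
      MeasurePreserving E (reducedVolume μ₁ μ₂ T)
        ((Measure.pi fun _ => μ₁).prod (Measure.pi fun _ => μ₂)) ∧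
      ∀ c, E c = (redCoord₁ 𝒢 T m c, redCoord₂ 𝒢 T m c) := by
  obtain ⟨E, hE, hmp⟩ := isVolumeHomeo_redTheta (μ₁ := μ₁) (μ₂ := μ₂) hm ht hact hμ₂
  refine ⟨(redHomeo G₁ G₂ T).trans E, hmp.comp (measurePreserving_redHomeo T μ₁ μ₂), fun c => ?_⟩
  rw [Homeomorph.trans_apply, hE]
  unfold redTheta
  rw [Homeomorph.symm_apply_apply]

end RedChart

/-! ### The boundary data as a function of independent variables -/

section Cut

variable (S : Finset (Fin 6))

/-- Labels of the surfaces at the triangles that have vertices on both sides. -/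
abbrev CutIx : Type :=
  {p : Fin 6 × Fin 6 × Fin 6 // ¬ (p.1 ∈ S ↔ p.2.1 ∈ S) ∧ ¬ (p.1 ∈ S ↔ p.2.2 ∈ S) ∧ p.2.1 < p.2.2}

/-- Labels of the variables `u` on boundary tetrahedra that are not determined by the others. -/
abbrev FreeTriIx : Type :=
  {p : Fin 6 × Fin 6 × Fin 6 // p.1 ∈ S ∧ p.2.1 ∉ S ∧ p.2.2 ≠ p.1 ∧ p.2.2 ≠ p.2.1 ∧
    ¬ DelU S p.1 p.2.1 p.2.2}

/-- Labels of the variables `Y` on boundary tetrahedra that are not determined by the others. -/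
abbrev FreeEdgeIx : Type :=
  {p : Fin 6 × Fin 6 × Fin 6 × Fin 6 // p.1 ∈ S ∧ p.2.1 ∉ S ∧ p.2.2.1 ≠ p.1 ∧ p.2.2.1 ≠ p.2.1 ∧
    p.2.2.2 ≠ p.1 ∧ p.2.2.2 ≠ p.2.1 ∧ p.2.2.1 < p.2.2.2 ∧ ¬ DelY S p.1 p.2.1 p.2.2.1 p.2.2.2}

/-- Labels of the independent variables with values in `G₁`. -/
abbrev RimIx₁ : Type := TetIx (boundaryTets S) ⊕ FreeTriIx S

/-- Labels of the independent variables with values in `G₂`. -/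
abbrev RimIx₂ : Type := CutIx S ⊕ FreeEdgeIx S

variable {G₁ G₂ : Type*} [Group G₁] [Group G₂] (𝒢 : CrossedModule G₁ G₂)

section Access

variable {S} (y : (RimIx₁ S → G₁) × (RimIx₂ S → G₂))

/-- Extended by `1` to indices without a label. The next two definitions also encode inversion under
exchange of the last two indices. -/
def cutU (a b d : Fin 6) : G₁ :=
  if h : a ∈ S ∧ b ∉ S ∧ d ≠ a ∧ d ≠ b ∧ ¬ DelU S a b d then y.1 (.inr ⟨(a, b, d), h⟩) else 1

def cutTheta (a b d : Fin 6) : G₂ :=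
  if h : ¬ (a ∈ S ↔ b ∈ S) ∧ ¬ (a ∈ S ↔ d ∈ S) ∧ b < d then y.2 (.inl ⟨(a, b, d), h⟩)
  else if h : ¬ (a ∈ S ↔ d ∈ S) ∧ ¬ (a ∈ S ↔ b ∈ S) ∧ d < b then (y.2 (.inl ⟨(a, d, b), h⟩))⁻¹
  else 1

def cutY (a b d e : Fin 6) : G₂ :=
  if h : a ∈ S ∧ b ∉ S ∧ d ≠ a ∧ d ≠ b ∧ e ≠ a ∧ e ≠ b ∧ d < e ∧ ¬ DelY S a b d e then
    y.2 (.inr ⟨(a, b, d, e), h⟩)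
  else if h : a ∈ S ∧ b ∉ S ∧ e ≠ a ∧ e ≠ b ∧ d ≠ a ∧ d ≠ b ∧ e < d ∧ ¬ DelY S a b e d then
    (y.2 (.inr ⟨(a, b, e, d), h⟩))⁻¹
  else 1

end Access

section Solve

variable (H : Fin 6 → Fin 6 → G₁) (U : Fin 6 → Fin 6 → Fin 6 → G₁)
  (Θ : Fin 6 → Fin 6 → Fin 6 → G₂) (Y : Fin 6 → Fin 6 → Fin 6 → Fin 6 → G₂)

/-- The solution of the triangle equations. -/
def solveU (a b d : Fin 6) : G₁ :=
  if DelU S a b d then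
    if d ∈ S then (H a b)⁻¹ * (𝒢.t (Θ b a d) * (H d b * U d b a))
    else (H a b)⁻¹ * (𝒢.t (Θ a b d) * (H a d * U a d b))
  else U a b d

/-- The solution of the edge equations. -/
def solveY (a b d e : Fin 6) : G₂ :=
  if DelY S a b d e then 𝒢.act (H a b)⁻¹
    (if d ∈ S then
      if e ∈ S then Θ b a d * 𝒢.act (H d b) (Y d b a e) * Θ b d e * 𝒢.act (H e b) (Y e b d a) *
        Θ b e a
      else Θ b a d * 𝒢.act (H d b) (Y d b a e) * Θ d b e * 𝒢.act (H d e) (Y d e b a) * Θ e d a *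
        𝒢.act (H a e) (Y a e d b) * Θ a e b
    else
      if e ∈ S then (Θ b a e * 𝒢.act (H e b) (Y e b a d) * Θ e b d * 𝒢.act (H e d) (Y e d b a) *
        Θ d e a * 𝒢.act (H a d) (Y a d e b) * Θ a d b)⁻¹
      else Θ a b d * 𝒢.act (H a d) (Y a d b e) * Θ a d e * 𝒢.act (H a e) (Y a e d b) *
        Θ a e b)
  else Y a b d e

/-- The equations of the triangles and the edges of the boundary. -/
structure RimFlat : Prop where
  theta_swap : ∀ a b d, Θ a d b = (Θ a b d)⁻¹
  swap : ∀ a b d e, Y a b e d = (Y a b d e)⁻¹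
  tri_out : ∀ a b d, a ∈ S → b ∉ S → d ∉ S → b ≠ d → H a b * U a b d = 𝒢.t (Θ a b d) * (H a d * U a d b)
  tri_in : ∀ a b d, a ∈ S → b ∉ S → d ∈ S → a ≠ d → H a b * U a b d = 𝒢.t (Θ b a d) * (H d b * U d b a)
  edge_out : ∀ a b d e, a ∈ S → b ∉ S → d ∉ S → e ∉ S → b ≠ d → d ≠ e → b ≠ e →
    𝒢.act (H a b) (Y a b e d) * Θ a b d * 𝒢.act (H a d) (Y a d b e) * Θ a d e *
      𝒢.act (H a e) (Y a e d b) * Θ a e b = 1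
  edge_in : ∀ a b d e, a ∈ S → b ∉ S → d ∈ S → e ∈ S → a ≠ d → d ≠ e → a ≠ e →
    𝒢.act (H a b) (Y a b e d) * Θ b a d * 𝒢.act (H d b) (Y d b a e) * Θ b d e *
      𝒢.act (H e b) (Y e b d a) * Θ b e a = 1
  edge_two : ∀ a b d e, a ∈ S → b ∉ S → d ∈ S → e ∉ S → a ≠ d → b ≠ e →
    Θ b a d * 𝒢.act (H d b) (Y d b a e) * Θ d b e * 𝒢.act (H d e) (Y d e b a) * Θ e d a *
        𝒢.act (H a e) (Y a e d b) * Θ a e b * 𝒢.act (H a b) (Y a b e d) = 1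

variable {𝒢 S H U Θ Y}

lemma RimFlat.solveU_eq (h : RimFlat S 𝒢 H U Θ Y) {a b d : Fin 6} (ha : a ∈ S) (hb : b ∉ S)
    (had : d ≠ a) (hbd : d ≠ b) : solveU S 𝒢 H U Θ a b d = U a b d := by
  unfold solveU
  split_ifs with h1 h2
  · rw [← h.tri_in a b d ha hb h2 had.symm, inv_mul_cancel_left]
  · rw [← h.tri_out a b d ha hb h2 hbd.symm, inv_mul_cancel_left]
  · rfl

/-- The dependent `Y` occurs once in the relation of its edge. The four cases are the positions of
`d` and `e` relative to the cut; the two mixed ones are the same relation with `d` and `e`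
exchanged, which explains the inverse in `solveY`. -/
lemma RimFlat.solveY_eq (h : RimFlat S 𝒢 H U Θ Y) {a b d e : Fin 6} (ha : a ∈ S) (hb : b ∉ S)
    (had : d ≠ a) (hbd : d ≠ b) (hae : e ≠ a) (hbe : e ≠ b) (hde : d ≠ e) :
    solveY S 𝒢 H Θ Y a b d e = Y a b d e := by
  unfold solveY
  split_ifs with h1 h2 h3 h4
  · rw [map_inv 𝒢.act, MulAut.inv_apply, MulEquiv.symm_apply_eq]
    have := h.edge_in a b d e ha hb h2 h3 had.symm hde hae.symm
    rw [h.swap a b d e, map_inv] at this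
    simp only [mul_assoc, inv_mul_eq_one] at this ⊢
    exact this.symm
  · rw [map_inv 𝒢.act, MulAut.inv_apply, MulEquiv.symm_apply_eq]
    have := h.edge_two a b d e ha hb h2 h3 had.symm hbe.symm
    rw [h.swap a b d e, map_inv, mul_inv_eq_one] at this
    exact this
  · rw [map_inv 𝒢.act, MulAut.inv_apply, MulEquiv.symm_apply_eq]
    have := h.edge_two a b e d ha hb h4 h2 hae.symm hbd.symm
    exact (eq_inv_of_mul_eq_one_right this).symm
  · rw [map_inv 𝒢.act, MulAut.inv_apply, MulEquiv.symm_apply_eq]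
    have := h.edge_out a b d e ha hb h2 h4 hbd.symm hde hbe.symm
    rw [h.swap a b d e, map_inv] at this
    simp only [mul_assoc, inv_mul_eq_one] at this ⊢
    exact this.symm
  · rfl

/-- The solution depends only on the independent variables. -/
lemma RimFlat.cutTheta_eq (h : RimFlat S 𝒢 H U Θ Y) {y : (RimIx₁ S → G₁) × (RimIx₂ S → G₂)}
    (hy : ∀ p : CutIx S, y.2 (.inl p) = Θ p.1.1 p.1.2.1 p.1.2.2) {a b d : Fin 6}
    (hab : ¬ (a ∈ S ↔ b ∈ S)) (had : ¬ (a ∈ S ↔ d ∈ S)) (hbd : b ≠ d) :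
    cutTheta y a b d = Θ a b d := by
  unfold cutTheta
  split_ifs with h1 h2
  · exact hy _
  · rw [hy, h.theta_swap, inv_inv]
  · rcases lt_or_gt_of_ne hbd with h3 | h3 <;> tauto

lemma RimFlat.cutY_eq (h : RimFlat S 𝒢 H U Θ Y) {y : (RimIx₁ S → G₁) × (RimIx₂ S → G₂)}
    (hy : ∀ p : FreeEdgeIx S, y.2 (.inr p) = Y p.1.1 p.1.2.1 p.1.2.2.1 p.1.2.2.2)
    {a b d e : Fin 6} (ha : a ∈ S) (hb : b ∉ S)
    (had : d ≠ a) (hbd : d ≠ b) (hae : e ≠ a) (hbe : e ≠ b) (hde : d ≠ e) (h' : ¬ DelY S a b d e) :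
    cutY y a b d e = Y a b d e := by
  unfold cutY
  split_ifs with h1 h2
  · exact hy _
  · rw [hy, h.swap, inv_inv]
  · have : ¬ DelY S a b e d := fun h3 => h' ⟨h3.2, h3.1⟩
    rcases lt_or_gt_of_ne hde with h3 | h3 <;> tauto

lemma cutU_eq {y : (RimIx₁ S → G₁) × (RimIx₂ S → G₂)}
    (hy : ∀ p : FreeTriIx S, y.1 (.inr p) = U p.1.1 p.1.2.1 p.1.2.2)
    {a b d : Fin 6} (ha : a ∈ S) (hb : b ∉ S)
    (had : d ≠ a) (hbd : d ≠ b) (h' : ¬ DelU S a b d) : cutU y a b d = U a b d := by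
  unfold cutU
  rw [dif_pos ⟨ha, hb, had, hbd, h'⟩]
  exact hy _

variable (𝒢) in
/-- The boundary data as a function of the independent variables. -/
def rimBoundary (y : (RimIx₁ S → G₁) × (RimIx₂ S → G₂)) : BoundaryData G₁ G₂ :=
  restrictBoundary S
    (linkU fun p : TriIx (boundaryTets S) => solveU S 𝒢 (linkH fun p => y.1 (.inl p)) (cutU y)
      (cutTheta y) p.1.1 p.1.2.1 p.1.2.2)
    (wedgeY fun p : EdgeIx (boundaryTets S) => solveY S 𝒢 (linkH fun p => y.1 (.inl p)) (cutTheta y)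
      (cutY y) p.1.1 p.1.2.1 p.1.2.2.1 p.1.2.2.2)

/-- The formulas for a dependent variable involve only independent ones, because just one label
around each triangle or edge satisfies `DelU` or `DelY`. So a single substitution recovers all
boundary data. -/
lemma RimFlat.rimBoundary_eq (h : RimFlat S 𝒢 H U Θ Y) {y : (RimIx₁ S → G₁) × (RimIx₂ S → G₂)}
    (hH : ∀ p : TetIx (boundaryTets S), y.1 (.inl p) = H p.1.1 p.1.2)
    (hU : ∀ p : FreeTriIx S, y.1 (.inr p) = U p.1.1 p.1.2.1 p.1.2.2)
    (hΘ : ∀ p : CutIx S, y.2 (.inl p) = Θ p.1.1 p.1.2.1 p.1.2.2)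
    (hY : ∀ p : FreeEdgeIx S, y.2 (.inr p) = Y p.1.1 p.1.2.1 p.1.2.2.1 p.1.2.2.2) :
    rimBoundary 𝒢 y = restrictBoundary S
      (linkU fun p : TriIx (boundaryTets S) => U p.1.1 p.1.2.1 p.1.2.2)
      (wedgeY fun p : EdgeIx (boundaryTets S) => Y p.1.1 p.1.2.1 p.1.2.2.1 p.1.2.2.2) := by
  have hH' : ∀ a b, a ∈ S → b ∉ S →
      linkH (fun p : TetIx (boundaryTets S) => y.1 (.inl p)) a b = H a b := by
    intro a b ha hb
    unfold linkH
    rw [dif_pos (by simp [boundaryTets, ha, hb])]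
    exact hH _
  unfold rimBoundary
  congr 2
  · funext ⟨⟨a, b, d⟩, hp⟩
    obtain ⟨⟨ha, hb⟩, hda, hdb⟩ : (a ∈ S ∧ b ∉ S) ∧ d ≠ a ∧ d ≠ b := by
      simpa [boundaryTets] using hp
    dsimp only
    have hba : b ≠ a := by rintro rfl; exact hb ha
    rw [← h.solveU_eq ha hb hda hdb]
    unfold solveU
    split_ifs with h1 h2
    · rw [hH' _ _ ha hb, hH' _ _ h2 hb, h.cutTheta_eq hΘ (by tauto) (by tauto) hda.symm,
        cutU_eq hU h2 hb hda.symm hba.symm (by unfold DelU at *; grind)]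
    · rw [hH' _ _ ha hb, hH' _ _ ha h2, h.cutTheta_eq hΘ (by tauto) (by tauto) hdb.symm,
        cutU_eq hU ha h2 hba hdb.symm (by unfold DelU at *; grind)]
    · exact cutU_eq hU ha hb hda hdb h1
  · funext ⟨⟨a, b, d, e⟩, hp⟩
    obtain ⟨⟨ha, hb⟩, hda, hdb, hea, heb, hde⟩ :
        (a ∈ S ∧ b ∉ S) ∧ d ≠ a ∧ d ≠ b ∧ e ≠ a ∧ e ≠ b ∧ d < e := by
      simpa [boundaryTets] using hp
    dsimp only
    have hde := hde.ne
    have hba : b ≠ a := by rintro rfl; exact hb ha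
    rw [← h.solveY_eq ha hb hda hdb hea heb hde]
    unfold solveY
    split_ifs with h1 h2 h3 h4
    · rw [hH' _ _ ha hb, hH' _ _ h2 hb, hH' _ _ h3 hb,
        h.cutTheta_eq hΘ (a := b) (b := a) (d := d) (by tauto) (by tauto) hda.symm,
        h.cutTheta_eq hΘ (a := b) (b := d) (d := e) (by tauto) (by tauto) hde,
        h.cutTheta_eq hΘ (a := b) (b := e) (d := a) (by tauto) (by tauto) hea,
        h.cutY_eq hY (a := d) (b := b) (d := a) (e := e) h2 hb hda.symm hba.symm hde.symm heb
          hea.symm (by unfold DelY DelU at *; grind),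
        h.cutY_eq hY (a := e) (b := b) (d := d) (e := a) h3 hb hde hdb hea.symm hba.symm
          hda (by unfold DelY DelU at *; grind)]
    · rw [hH' _ _ ha hb, hH' _ _ h2 hb, hH' _ _ h2 h3, hH' _ _ ha h3,
        h.cutTheta_eq hΘ (a := b) (b := a) (d := d) (by tauto) (by tauto) hda.symm,
        h.cutTheta_eq hΘ (a := d) (b := b) (d := e) (by tauto) (by tauto) heb.symm,
        h.cutTheta_eq hΘ (a := e) (b := d) (d := a) (by tauto) (by tauto) hda,
        h.cutTheta_eq hΘ (a := a) (b := e) (d := b) (by tauto) (by tauto) heb,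
        h.cutY_eq hY (a := d) (b := b) (d := a) (e := e) h2 hb hda.symm hba.symm hde.symm heb
          hea.symm (by unfold DelY DelU at *; grind),
        h.cutY_eq hY (a := d) (b := e) (d := b) (e := a) h2 h3 hdb.symm heb.symm hda.symm hea.symm
          hba (by unfold DelY DelU at *; grind),
        h.cutY_eq hY (a := a) (b := e) (d := d) (e := b) ha h3 hda hde hba heb.symm
          hdb (by unfold DelY DelU at *; grind)]
    · rw [hH' _ _ ha hb, hH' _ _ h4 hb, hH' _ _ h4 h2, hH' _ _ ha h2,
        h.cutTheta_eq hΘ (a := b) (b := a) (d := e) (by tauto) (by tauto) hea.symm,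
        h.cutTheta_eq hΘ (a := e) (b := b) (d := d) (by tauto) (by tauto) hdb.symm,
        h.cutTheta_eq hΘ (a := d) (b := e) (d := a) (by tauto) (by tauto) hea,
        h.cutTheta_eq hΘ (a := a) (b := d) (d := b) (by tauto) (by tauto) hdb,
        h.cutY_eq hY (a := e) (b := b) (d := a) (e := d) h4 hb hea.symm hba.symm hde hdb
          hda.symm (by unfold DelY DelU at *; grind),
        h.cutY_eq hY (a := e) (b := d) (d := b) (e := a) h4 h2 heb.symm hdb.symm hea.symm hda.symm
          hba (by unfold DelY DelU at *; grind),
        h.cutY_eq hY (a := a) (b := d) (d := e) (e := b) ha h2 hea hde.symm hba hdb.symm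
          heb (by unfold DelY DelU at *; grind)]
    · rw [hH' _ _ ha hb, hH' _ _ ha h2, hH' _ _ ha h4,
        h.cutTheta_eq hΘ (a := a) (b := b) (d := d) (by tauto) (by tauto) hdb.symm,
        h.cutTheta_eq hΘ (a := a) (b := d) (d := e) (by tauto) (by tauto) hde,
        h.cutTheta_eq hΘ (a := a) (b := e) (d := b) (by tauto) (by tauto) heb,
        h.cutY_eq hY (a := a) (b := d) (d := b) (e := e) ha h2 hba hdb.symm hea hde.symm
          heb.symm (by unfold DelY DelU at *; grind),
        h.cutY_eq hY (a := a) (b := e) (d := d) (e := b) ha h4 hda hde hba heb.symm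
          hdb (by unfold DelY DelU at *; grind)]
    · exact h.cutY_eq hY ha hb hda hdb hea heb hde h1

variable (𝒢) in
lemma measurable_rimBoundary [TopologicalSpace G₁] [IsTopologicalGroup G₁]
    [SecondCountableTopology G₁] [MeasurableSpace G₁] [BorelSpace G₁]
    [TopologicalSpace G₂] [IsTopologicalGroup G₂]
    [SecondCountableTopology G₂] [MeasurableSpace G₂] [BorelSpace G₂]
    (ht : Continuous 𝒢.t) (hact : Continuous fun p : G₁ × G₂ => 𝒢.act p.1 p.2) :
    Measurable (rimBoundary (S := S) 𝒢) := by
  haveI : BorelSpace ((RimIx₁ S → G₁) × (RimIx₂ S → G₂)) := borelSpace_prod_of_left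
  have hH : ∀ a b, Continuous fun y : (RimIx₁ S → G₁) × (RimIx₂ S → G₂) =>
      linkH (fun p : TetIx (boundaryTets S) => y.1 (.inl p)) a b := by
    intro a b; unfold linkH; split_ifs <;> fun_prop
  have hU : ∀ a b d, Continuous fun y : (RimIx₁ S → G₁) × (RimIx₂ S → G₂) => cutU y a b d := by
    intro a b d; unfold cutU; split_ifs <;> fun_prop
  have hΘ : ∀ a b d, Continuous fun y : (RimIx₁ S → G₁) × (RimIx₂ S → G₂) =>
      cutTheta y a b d := by
    intro a b d; unfold cutTheta; split_ifs <;> fun_prop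
  have hY : ∀ a b d e, Continuous fun y : (RimIx₁ S → G₁) × (RimIx₂ S → G₂) =>
      cutY y a b d e := by
    intro a b d e; unfold cutY; split_ifs <;> fun_prop
  have hZ : ∀ a b a' b' d e, Continuous fun y : (RimIx₁ S → G₁) × (RimIx₂ S → G₂) =>
      𝒢.act (linkH (fun p : TetIx (boundaryTets S) => y.1 (.inl p)) a b) (cutY y a' b' d e) :=
    fun a b a' b' d e => hact.comp ((hH a b).prodMk (hY a' b' d e))
  have hA : ∀ a b, ∀ w : (RimIx₁ S → G₁) × (RimIx₂ S → G₂) → G₂, Continuous w →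
      Continuous fun y => 𝒢.act (linkH (fun p : TetIx (boundaryTets S) => y.1 (.inl p)) a b)⁻¹
        (w y) :=
    fun a b w hw => hact.comp ((hH a b).inv.prodMk hw)
  have hsU : ∀ a b d, Continuous fun y : (RimIx₁ S → G₁) × (RimIx₂ S → G₂) =>
      solveU S 𝒢 (linkH fun p : TetIx (boundaryTets S) => y.1 (.inl p)) (cutU y) (cutTheta y)
        a b d := by
    intro a b d
    unfold solveU
    split_ifs <;> fun_prop
  have hsY : ∀ a b d e, Continuous fun y : (RimIx₁ S → G₁) × (RimIx₂ S → G₂) =>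
      solveY S 𝒢 (linkH fun p : TetIx (boundaryTets S) => y.1 (.inl p)) (cutTheta y) (cutY y)
        a b d e := by
    intro a b d e
    unfold solveY
    split_ifs
    all_goals try exact hY ..
    all_goals
      refine hA _ _ _ ?_
      fun_prop
  refine Measurable.prodMk ?_ ?_
  · refine measurable_pi_iff.2 fun a => measurable_pi_iff.2 fun b => measurable_pi_iff.2 fun d =>
      Continuous.measurable ?_
    split_ifs
    all_goals try exact continuous_const
    all_goals
      unfold linkU
      split_ifs
    all_goals first | exact continuous_const | exact hsU ..
  · refine measurable_pi_iff.2 fun a => measurable_pi_iff.2 fun b => measurable_pi_iff.2 fun d =>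
      measurable_pi_iff.2 fun e => Continuous.measurable ?_
    split_ifs
    all_goals try exact continuous_const
    all_goals
      unfold wedgeY
      split_ifs
    all_goals first | exact continuous_const | exact hsY .. | exact (hsY ..).inv

end Solve

section OfFlat

variable {S} {T : Finset (Fin 6)} {c : ReducedConfig G₁ G₂ T} {m : Fin 6}

/-- Transport from the boundary tetrahedron `{a, b}` to the reference 4-simplex. -/
def rimH (T : Finset (Fin 6)) (c : ReducedConfig G₁ G₂ T) (m a b : Fin 6) : G₁ :=
  if a ∈ T then gaugeH T c m a b else gaugeH T c m b a

lemma rimH_mul {a b : Fin 6} (h : ¬ (a ∈ T ↔ b ∈ T)) (d : Fin 6) :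
    rimH T c m a b * (reducedBoundary c).1 a b d = rimU T c m a b d := by
  unfold rimH rimU reducedBoundary restrictBoundary
  by_cases ha : a ∈ T
  · have hb : b ∉ T := by tauto
    simp only [ha, hb, not_false_eq_true, and_self, if_true]
  · have hb : b ∈ T := by tauto
    simp only [ha, hb, not_false_eq_true, and_self, if_true, if_false, not_true_eq_false]

lemma rimH_act {a b : Fin 6} (h : ¬ (a ∈ T ↔ b ∈ T)) (d e : Fin 6) :
    𝒢.act (rimH T c m a b) ((reducedBoundary c).2 a b d e) = rimY 𝒢 T c m a b d e := by
  unfold rimH rimY gY reducedBoundary restrictBoundary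
  by_cases ha : a ∈ T
  · have hb : b ∉ T := by tauto
    simp only [ha, hb, not_false_eq_true, and_self, if_true]
  · have hb : b ∈ T := by tauto
    simp only [ha, hb, not_false_eq_true, and_self, if_true, if_false, not_true_eq_false]

lemma reducedBoundary_comm {a b : Fin 6} (h : ¬ (a ∈ T ↔ b ∈ T)) :
    (reducedBoundary c).1 b a = (reducedBoundary c).1 a b ∧
      (reducedBoundary c).2 b a = (reducedBoundary c).2 a b := by
  unfold reducedBoundary restrictBoundary
  by_cases ha : a ∈ T
  · have hb : b ∉ T := by tauto
    constructor <;> · funext; simp [ha, hb]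
  · have hb : b ∈ T := by tauto
    constructor <;> · funext; simp [ha, hb]

lemma reducedBoundary_eq_one {a b : Fin 6} (h : a ∈ T ↔ b ∈ T) :
    (reducedBoundary c).1 a b = 1 ∧ (reducedBoundary c).2 a b = 1 := by
  unfold reducedBoundary restrictBoundary
  by_cases ha : a ∈ T
  · have hb : b ∈ T := by tauto
    constructor <;> · funext; simp [ha, hb]
  · have hb : b ∉ T := by tauto
    constructor <;> · funext; simp [ha, hb]

lemma reducedBoundary_fst_self (a b d : Fin 6) (h : d = a ∨ d = b) :
    (reducedBoundary c).1 a b d = 1 := by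
  unfold reducedBoundary restrictBoundary linkU
  rcases h with rfl | rfl <;> simp

lemma reducedBoundary_snd_swap (a b d e : Fin 6) :
    (reducedBoundary c).2 a b e d = ((reducedBoundary c).2 a b d e)⁻¹ := by
  unfold reducedBoundary restrictBoundary
  dsimp only
  split_ifs
  · exact wedgeY_swap ..
  · exact wedgeY_swap ..
  · simp

lemma reducedBoundary_snd_self (a b d e : Fin 6) (h : d = a ∨ d = b ∨ e = a ∨ e = b ∨ d = e) :
    (reducedBoundary c).2 a b d e = 1 := by
  unfold reducedBoundary restrictBoundary wedgeY
  rcases h with rfl | rfl | rfl | rfl | rfl <;> simp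

/-- The boundary data depend on the pairs of indices from different sides. -/
lemma restrictBoundary_reducedBoundary (hcut : ∀ a b, (a ∈ T ↔ b ∈ T) ↔ (a ∈ S ↔ b ∈ S)) :
    restrictBoundary S
      (linkU fun p : TriIx (boundaryTets S) => (reducedBoundary c).1 p.1.1 p.1.2.1 p.1.2.2)
      (wedgeY fun p : EdgeIx (boundaryTets S) =>
        (reducedBoundary c).2 p.1.1 p.1.2.1 p.1.2.2.1 p.1.2.2.2) = reducedBoundary c := by
  have hU : ∀ a b d, a ∈ S → b ∉ S → linkU (fun p : TriIx (boundaryTets S) =>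
      (reducedBoundary c).1 p.1.1 p.1.2.1 p.1.2.2) a b d = (reducedBoundary c).1 a b d := by
    intro a b d ha hb
    unfold linkU
    split_ifs with h
    · rfl
    · refine (reducedBoundary_fst_self _ _ _ ?_).symm
      by_contra h'
      exact h ⟨by simp [boundaryTets, ha, hb], by tauto, by tauto⟩
  have hY : ∀ a b d e, a ∈ S → b ∉ S → wedgeY (fun p : EdgeIx (boundaryTets S) =>
      (reducedBoundary c).2 p.1.1 p.1.2.1 p.1.2.2.1 p.1.2.2.2) a b d e =
        (reducedBoundary c).2 a b d e := by
    intro a b d e ha hb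
    have hab : (a, b) ∈ boundaryTets S := by simp [boundaryTets, ha, hb]
    unfold wedgeY
    split_ifs with h h'
    · rfl
    · rw [← reducedBoundary_snd_swap]
    · refine (reducedBoundary_snd_self _ _ _ _ ?_).symm
      rcases lt_trichotomy d e with h1 | h1 | h1 <;> tauto
  refine Prod.ext ?_ ?_
  · funext a b d
    simp only [restrictBoundary]
    split_ifs with h1 h2
    · exact hU _ _ _ h1.1 h1.2
    · rw [hU _ _ _ h2.1 h2.2, (reducedBoundary_comm _).1]
      rw [hcut]; tauto
    · rw [(reducedBoundary_eq_one _).1]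
      · rfl
      · rw [hcut]; tauto
  · funext a b d e
    simp only [restrictBoundary]
    split_ifs with h1 h2
    · exact hY _ _ _ _ h1.1 h1.2
    · rw [hY _ _ _ _ h2.1 h2.2, (reducedBoundary_comm _).2]
      rw [hcut]; tauto
    · rw [(reducedBoundary_eq_one _).2]
      · rfl
      · rw [hcut]; tauto

/-- The hypothesis `hcut` says that `S` and `T` define the same unordered partition of the indices:
`S` is `T` or its complement. The boundary relations derived from `T` only distinguish equal from
different sides, hence hold with respect to `S` as well. This is the point where the two sides of a
Pachner move meet. -/
lemma Flat.rimFlat (hF : Flat 𝒢 T c m) (hcut : ∀ a b, (a ∈ T ↔ b ∈ T) ↔ (a ∈ S ↔ b ∈ S))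
    (h₁ : TriFlat 𝒢 T c none) (h₂ : EdgeFlat 𝒢 T c none) :
    RimFlat S 𝒢 (rimH T c m) (reducedBoundary c).1 (theta 𝒢 T c m) (reducedBoundary c).2 where
  theta_swap := theta_swap _ _ _ _
  swap := reducedBoundary_snd_swap
  tri_out a b d ha hb hd hbd := by
    have hab : ¬ (a ∈ T ↔ b ∈ T) := by rw [hcut]; tauto
    have had : ¬ (a ∈ T ↔ d ∈ T) := by rw [hcut]; tauto
    rw [rimH_mul hab, rimH_mul had]
    exact hF.rimU_eq hab had hbd h₁
  tri_in a b d ha hb hd had := by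
    have hab : ¬ (b ∈ T ↔ a ∈ T) := by rw [hcut]; tauto
    have hbd : ¬ (b ∈ T ↔ d ∈ T) := by rw [hcut]; tauto
    rw [rimH_mul (by tauto), rimH_mul (by tauto), rimU_comm _ _ _ hab, rimU_comm _ _ _ hbd]
    exact hF.rimU_eq hab hbd had h₁
  edge_out a b d e ha hb hd he hbd hde hbe := by
    have hab : ¬ (a ∈ T ↔ b ∈ T) := by rw [hcut]; tauto
    have had : ¬ (a ∈ T ↔ d ∈ T) := by rw [hcut]; tauto
    have hae : ¬ (a ∈ T ↔ e ∈ T) := by rw [hcut]; tauto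
    rw [rimH_act _ hab, rimH_act _ had, rimH_act _ hae]
    exact hF.edge_three hab had hae hbd hde hbe h₂
  edge_in a b d e ha hb hd he had hde hae := by
    have hab : ¬ (b ∈ T ↔ a ∈ T) := by rw [hcut]; tauto
    have hbd : ¬ (b ∈ T ↔ d ∈ T) := by rw [hcut]; tauto
    have hbe : ¬ (b ∈ T ↔ e ∈ T) := by rw [hcut]; tauto
    rw [rimH_act _ (by tauto), rimH_act _ (by tauto), rimH_act _ (by tauto), rimY_comm _ _ _ _ hab,
      rimY_comm _ _ _ _ hbd, rimY_comm _ _ _ _ hbe]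
    exact hF.edge_three hab hbd hbe had hde hae h₂
  edge_two a b d e ha hb hd he had hbe := by
    have hab : ¬ (a ∈ T ↔ b ∈ T) := by rw [hcut]; tauto
    have hae : ¬ (a ∈ T ↔ e ∈ T) := by rw [hcut]; tauto
    have hdb : ¬ (d ∈ T ↔ b ∈ T) := by rw [hcut]; tauto
    have hde : ¬ (d ∈ T ↔ e ∈ T) := by rw [hcut]; tauto
    rw [rimH_act _ hab, rimH_act _ hae, rimH_act _ hdb, rimH_act _ hde]
    exact hF.edge_two (by tauto) (by tauto) (by tauto) had hbe.symm h₂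

end OfFlat

end Cut

/-! ### The independent variables among the reduced coordinates -/

section RimIndex

variable {S T : Finset (Fin 6)} (hcut : ∀ a b, (a ∈ T ↔ b ∈ T) ↔ (a ∈ S ↔ b ∈ S))

/-- The position of the independent variables among the coordinates of the reduced amplitude. -/
def rimIx₁ : RimIx₁ S → RedIx₁ T :=
  Sum.elim
    (fun p => .inr (.inl ⟨if p.1.1 ∈ T then p.1 else p.1.swap, by
      obtain ⟨⟨a, b⟩, hp⟩ := p
      have := hcut a b
      simp only [boundaryTets, Finset.mem_filter_univ] at hp ⊢
      split_ifs <;> simp only [Prod.swap] <;> tauto⟩))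
    fun p => .inr (.inr ⟨if p.1.1 ∈ T then p.1 else (p.1.2.1, p.1.1, p.1.2.2), by
      obtain ⟨⟨a, b, d⟩, hp⟩ := p
      have := hcut a b
      simp only [boundaryTets, Finset.mem_filter_univ] at hp ⊢
      split_ifs <;> tauto⟩)

/-- The position of the independent variables among the coordinates of the reduced amplitude. -/
def rimIx₂ : RimIx₂ S → RedIx₂ T :=
  Sum.elim
    (fun p => .inl ⟨if p.1.1 ∈ T then p.1 else if p.1.1 < p.1.2.2 then
        (p.1.2.1, p.1.1, p.1.2.2) else (p.1.2.1, p.1.2.2, p.1.1), by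
      obtain ⟨⟨a, b, d⟩, hp⟩ := p
      have h1 := hcut a b
      have h2 := hcut a d
      dsimp only at hp ⊢
      split_ifs <;> grind⟩)
    fun p => .inr ⟨if p.1.1 ∈ T then p.1 else (p.1.2.1, p.1.1, p.1.2.2), by
      obtain ⟨⟨a, b, d, e⟩, hp⟩ := p
      have := hcut a b
      simp only [boundaryTets, Finset.mem_filter_univ] at hp ⊢
      split_ifs <;> tauto⟩

lemma rimIx₁_injective : Function.Injective (rimIx₁ hcut) := by
  rintro (⟨⟨a, b⟩, hp⟩ | ⟨⟨a, b, d⟩, hp⟩) (⟨⟨a', b'⟩, hp'⟩ | ⟨⟨a', b', d'⟩, hp'⟩) h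
  · simp only [rimIx₁, Sum.elim_inl, Sum.inr.injEq, Sum.inl.injEq, Subtype.mk.injEq] at h ⊢
    simp only [boundaryTets, Finset.mem_filter_univ] at hp hp'
    have h1 := hcut a b
    have h2 := hcut a' b'
    have h3 := hcut a a'
    split_ifs at h <;> simp only [Prod.swap, Prod.mk.injEq] at h ⊢ <;> grind
  · simp [rimIx₁] at h
  · simp [rimIx₁] at h
  · simp only [rimIx₁, Sum.elim_inr, Sum.inr.injEq, Subtype.mk.injEq] at h ⊢
    have h1 := hcut a b
    have h2 := hcut a' b'
    have h3 := hcut a a'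
    split_ifs at h <;> simp only [Prod.mk.injEq] at h ⊢ <;> grind

lemma rimIx₂_injective : Function.Injective (rimIx₂ hcut) := by
  rintro (⟨⟨a, b, d⟩, hp⟩ | ⟨⟨a, b, d, e⟩, hp⟩) (⟨⟨a', b', d'⟩, hp'⟩ | ⟨⟨a', b', d', e'⟩, hp'⟩) h
  · simp only [rimIx₂, Sum.elim_inl, Sum.inl.injEq, Subtype.mk.injEq] at h ⊢
    have h1 := hcut a b
    have h2 := hcut a d
    have h4 := hcut a' b'
    have h5 := hcut a' d'
    dsimp only at hp hp'
    split_ifs at h <;> simp only [Prod.mk.injEq] at h ⊢ <;> grind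
  · simp [rimIx₂] at h
  · simp [rimIx₂] at h
  · simp only [rimIx₂, Sum.elim_inr, Sum.inr.injEq, Subtype.mk.injEq] at h ⊢
    have h1 := hcut a b
    have h2 := hcut a' b'
    have h3 := hcut a a'
    dsimp only at hp hp'
    split_ifs at h <;> simp only [Prod.mk.injEq] at h ⊢ <;> grind

/-- The unused free coordinates are the bulk links at `m`: they only serve to transport everything
to `m` and drop out of the boundary data. -/
lemma rimIx₁_range (m : Fin 6) (i : RedIx₁ T) :
    (i ∉ redDelta₁ T m ∧ i ∉ Set.range (rimIx₁ hcut)) ↔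
      i ∈ (Finset.univ.filter fun p : TetIx (bulkTets T) =>
        p.1.1 = m ∨ p.1.2 = m).disjSum (∅ : Finset (TetIx (boundaryTets T) ⊕ TriIx _)) := by
  unfold redDelta₁
  rcases i with ⟨⟨a, b⟩, hp⟩ | ⟨⟨a, b⟩, hp⟩ | ⟨⟨a, b, d⟩, hp⟩
  · simp only [Finset.inl_mem_disjSum, Finset.mem_filter_univ]
    have : (Sum.inl ⟨(a, b), hp⟩ : RedIx₁ T) ∉ Set.range (rimIx₁ hcut) := by
      rintro ⟨p | p, h⟩ <;> simp [rimIx₁] at h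
    tauto
  · have : (Sum.inr (Sum.inl ⟨(a, b), hp⟩) : RedIx₁ T) ∈ Set.range (rimIx₁ hcut) := by
      simp only [boundaryTets, Finset.mem_filter_univ] at hp
      have h1 := hcut a b
      by_cases ha : a ∈ S
      · refine ⟨.inl ⟨(a, b), by simp only [boundaryTets, Finset.mem_filter_univ]; tauto⟩, ?_⟩
        simp [rimIx₁, hp]
      · refine ⟨.inl ⟨(b, a), by simp only [boundaryTets, Finset.mem_filter_univ]; tauto⟩, ?_⟩
        simp [rimIx₁, hp]
    simp [this]
  · simp only [Finset.inr_mem_disjSum, Finset.mem_filter_univ, Finset.notMem_empty, iff_false,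
      not_and, not_not]
    intro h2
    simp only [boundaryTets, Finset.mem_filter_univ] at hp
    have h1 := hcut a b
    have h3 := hcut a d
    by_cases ha : a ∈ S
    · refine ⟨.inr ⟨(a, b, d), by unfold DelU at *; grind⟩, ?_⟩
      simp [rimIx₁, hp]
    · refine ⟨.inr ⟨(b, a, d), by unfold DelU at *; grind⟩, ?_⟩
      simp [rimIx₁, hp]

/-- The wedges of rank `2` are constrained and those of rank `1` have been replaced by `theta`,
which is used by the boundary data; rank zero remains. -/
lemma rimIx₂_range (m : Fin 6) (i : RedIx₂ T) :
    (i ∉ redDelta₂ T m ∧ i ∉ Set.range (rimIx₂ hcut)) ↔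
      i ∈ (Finset.univ.filter fun p : FaceIx T =>
        rankX T m p.1.1 p.1.2.1 p.1.2.2 = 0).disjSum (∅ : Finset (EdgeIx (boundaryTets T))) := by
  unfold redDelta₂
  rcases i with ⟨⟨a, b, d⟩, hp⟩ | ⟨⟨a, b, d, e⟩, hp⟩
  · simp only [Finset.inl_mem_disjSum, Finset.mem_filter_univ]
    have h1 := hcut a b
    have h3 := hcut a d
    have h4 := hcut b d
    dsimp only at hp
    have : (Sum.inl ⟨(a, b, d), hp⟩ : RedIx₂ T) ∈ Set.range (rimIx₂ hcut) ↔
        rankX T m a b d = 1 := by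
      constructor
      · rintro ⟨⟨⟨a', b', d'⟩, hp'⟩ | p, h⟩
        · simp only [rimIx₂, Sum.elim_inl, Sum.inl.injEq, Subtype.mk.injEq] at h
          have h1 := hcut a' b'
          have h3 := hcut a' d'
          dsimp only at hp'
          unfold rankX
          split_ifs at h <;> simp only [Prod.mk.injEq] at h <;> grind
        · simp [rimIx₂] at h
      · intro h
        unfold rankX at h
        split_ifs at h with h5 h6 h7 h8 h9 h10
        any_goals omega
        · exact ⟨.inl ⟨(d, a, b), by dsimp only; grind⟩, by simp [rimIx₂]; grind⟩
        · exact ⟨.inl ⟨(b, a, d), by dsimp only; grind⟩, by simp [rimIx₂]; grind⟩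
        · exact ⟨.inl ⟨(a, b, d), by dsimp only; grind⟩, by simp [rimIx₂]; grind⟩
    rw [this]
    unfold rankX
    have : DelX T m a b d → b ∈ T ∧ d ∈ T := fun h => ⟨h.1, h.2.1⟩
    split_ifs <;> simp <;> tauto
  · simp only [Finset.inr_mem_disjSum, Finset.mem_filter_univ, Finset.notMem_empty, iff_false,
      not_and, not_not]
    intro h2
    simp only [boundaryTets, Finset.mem_filter_univ] at hp
    have h1 := hcut a b
    have h3 := hcut a d
    have h4 := hcut a e
    by_cases ha : a ∈ S
    · refine ⟨.inr ⟨(a, b, d, e), by unfold DelY DelU at *; grind⟩, ?_⟩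
      simp [rimIx₂, hp]
    · refine ⟨.inr ⟨(b, a, d, e), by unfold DelY DelU at *; grind⟩, ?_⟩
      simp [rimIx₂, hp]

end RimIndex

lemma card_filter_subtype {α : Type*} [Fintype α] {P Q : α → Prop}
    [DecidablePred P] [DecidablePred Q] [Fintype {x // P x}] :
    ((Finset.univ : Finset {x // P x}).filter fun x => Q x.1).card =
      (Finset.univ.filter fun x => P x ∧ Q x).card := by
  rw [← Finset.card_map (Function.Embedding.subtype P)]
  congr 1
  ext x
  simp [and_comm]

/-- One bulk tetrahedron joins `m` to each other 4-simplex of `T`; the kernel checks the finitely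
many diagrams. -/
lemma card_bulkTets_ref : ∀ (T : Finset (Fin 6)) (m : Fin 6), m ∈ T →
    (Finset.univ.filter fun p : Fin 6 × Fin 6 =>
      p ∈ bulkTets T ∧ (p.1 = m ∨ p.2 = m)).card = T.card - 1 := by
  decide +kernel

/-- The number of the variables `X` on which the boundary data do not depend. -/
lemma card_rankX : ∀ (T : Finset (Fin 6)) (m : Fin 6), m ∈ T →
    (Finset.univ.filter fun p : Fin 6 × Fin 6 × Fin 6 =>
      (p.1 ∈ T ∧ p.2.1 ≠ p.1 ∧ p.2.2 ≠ p.1 ∧ p.2.1 < p.2.2) ∧ rankX T m p.1 p.2.1 p.2.2 = 0).card =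
      T.card.choose 2 * (6 - T.card) + 3 * T.card.choose 3 - (T.card - 1).choose 3 := by
  decide +kernel

lemma linkU_mk {G : Type*} [Group G] {A : Finset (Fin 6 × Fin 6)} (u : TriIx A → G) {a b d : Fin 6}
    (H : (a, b) ∈ A ∧ d ≠ a ∧ d ≠ b) : linkU u a b d = u ⟨(a, b, d), H⟩ :=
  dif_pos H

lemma wedgeY_mk {G : Type*} [Group G] {A : Finset (Fin 6 × Fin 6)} (y : EdgeIx A → G)
    {a b d e : Fin 6} (H : (a, b) ∈ A ∧ d ≠ a ∧ d ≠ b ∧ e ≠ a ∧ e ≠ b ∧ d < e) :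
    wedgeY y a b d e = y ⟨(a, b, d, e), H⟩ :=
  dif_pos H

/-! ### The amplitude as an integral over independent boundary variables -/

section Limit

lemma secondCountableTopology_prod {α β : Type*} [TopologicalSpace α] [TopologicalSpace β]
    [SecondCountableTopology α] [SecondCountableTopology β] : SecondCountableTopology (α × β) :=
  inferInstance

instance {G₁ G₂ : Type*} [TopologicalSpace G₁] [TopologicalSpace G₂] [SecondCountableTopology G₁]
    [SecondCountableTopology G₂] (T : Finset (Fin 6)) :
    SecondCountableTopology (ReducedConfig G₁ G₂ T) :=
  haveI := secondCountableTopology_prod (α := RedIx₁ T → G₁) (β := RedIx₂ T → G₂)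
  (redHomeo G₁ G₂ T).isEmbedding.secondCountableTopology

instance {G₁ G₂ : Type*} [TopologicalSpace G₁] [TopologicalSpace G₂] [SecondCountableTopology G₁]
    [SecondCountableTopology G₂] (T : Finset (Fin 6)) :
    SecondCountableTopology (FeynmanConfig G₁ G₂ T) :=
  haveI := secondCountableTopology_prod (α := FeynIx₁ T → G₁) (β := FeynIx₂ T → G₂)
  (feynHomeo G₁ G₂ T).isEmbedding.secondCountableTopology

variable {G₁ G₂ : Type*} [Group G₁] [TopologicalSpace G₁] [IsTopologicalGroup G₁] [T2Space G₁]
  [LocallyCompactSpace G₁] [SecondCountableTopology G₁] [MeasurableSpace G₁] [BorelSpace G₁]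
  [Group G₂] [TopologicalSpace G₂] [IsTopologicalGroup G₂] [T2Space G₂]
  [LocallyCompactSpace G₂] [SecondCountableTopology G₂] [MeasurableSpace G₂] [BorelSpace G₂]
  {μ₁ : Measure G₁} [μ₁.IsHaarMeasure] [μ₁.IsMulRightInvariant]
  {μ₂ : Measure G₂} [μ₂.IsHaarMeasure] [μ₂.IsMulRightInvariant]
  {𝒢 : CrossedModule G₁ G₂} {T S : Finset (Fin 6)} {m : Fin 6}

lemma IsDeltaMeasure.deltaMeasure_eq {M : Type*} [TopologicalSpace M] [T2Space M]
    [LocallyCompactSpace M] [SecondCountableTopology M] [MeasurableSpace M] [BorelSpace M]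
    {vol : Measure M} {ρ : (G₁ → ℝ) → (G₂ → ℝ) → M → ℝ} {ν : Measure M}
    (h : IsDeltaMeasure μ₁ μ₂ vol ρ ν) : deltaMeasure μ₁ μ₂ vol ρ = ν := by
  have h' : ∃ ν, IsDeltaMeasure μ₁ μ₂ vol ρ ν := ⟨ν, h⟩
  unfold deltaMeasure
  rw [dif_pos h']
  exact h'.choose_spec.unique μ₁ μ₂ h

/-- The condition `DelU` asks for the first index on each side of the cut, so it is the same for `T`
and its complement once the first two indices are exchanged. What is free for `S` is free for `T`.
-/
lemma rimIx₁_mem (hcut : ∀ a b, (a ∈ T ↔ b ∈ T) ↔ (a ∈ S ↔ b ∈ S)) :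
    ∀ k, rimIx₁ hcut k ∈ redDelta₁ T m ↔ k ∈ (∅ : Finset (RimIx₁ S)) := by
  intro k
  simp only [Finset.notMem_empty, iff_false]
  obtain ⟨⟨a, b⟩, hp⟩ | ⟨⟨a, b, d⟩, hp⟩ := k
  · simp [rimIx₁, redDelta₁]
  · have h1 := hcut a b
    have h2 := hcut a d
    dsimp only at hp
    simp only [rimIx₁, redDelta₁, Sum.elim_inr, Finset.inr_mem_disjSum, Finset.mem_filter_univ]
    split_ifs <;> unfold DelU at * <;> grind

lemma rimIx₂_mem (hcut : ∀ a b, (a ∈ T ↔ b ∈ T) ↔ (a ∈ S ↔ b ∈ S)) :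
    ∀ k, rimIx₂ hcut k ∈ redDelta₂ T m ↔ k ∈ (∅ : Finset (RimIx₂ S)) := by
  intro k
  simp only [Finset.notMem_empty, iff_false]
  obtain ⟨⟨a, b, d⟩, hp⟩ | ⟨⟨a, b, d, e⟩, hp⟩ := k
  · have h1 := hcut a b
    have h2 := hcut a d
    dsimp only at hp
    simp only [rimIx₂, redDelta₂, Sum.elim_inl, Finset.inl_mem_disjSum, Finset.mem_filter_univ]
    split_ifs <;> unfold DelX at * <;> grind
  · have h1 := hcut a b
    have h2 := hcut a d
    have h3 := hcut a e
    dsimp only at hp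
    simp only [rimIx₂, redDelta₂, Sum.elim_inr, Finset.inr_mem_disjSum, Finset.mem_filter_univ]
    split_ifs <;> unfold DelY DelU at * <;> grind

lemma redCoord₂_rimIx (hcut : ∀ a b, (a ∈ T ↔ b ∈ T) ↔ (a ∈ S ↔ b ∈ S))
    {c : ReducedConfig G₁ G₂ T} (p : CutIx S) :
    redCoord₂ 𝒢 T m c (rimIx₂ hcut (.inl p)) = theta 𝒢 T c m p.1.1 p.1.2.1 p.1.2.2 := by
  obtain ⟨⟨a, b, d⟩, hp⟩ := p
  have h1 := (hcut a b).not.2 hp.1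
  have h2 := (hcut a d).not.2 hp.2.1
  have h4 := hp.2.2
  dsimp only at h1 h2 h4
  by_cases ha : a ∈ T
  · have hb : b ∉ T := fun h => h1 (iff_of_true ha h)
    have hd : d ∉ T := fun h => h2 (iff_of_true ha h)
    have hX : ¬ DelX T m a b d := fun h => hb h.1
    simp only [rimIx₂, redCoord₂, Sum.elim_inl, if_pos ha]
    rw [xWord, if_neg hX, if_neg hb, if_neg hd, theta, if_pos ha]
  · have hb : b ∈ T := by_contra fun h => h1 (iff_of_false ha h)
    have hd : d ∈ T := by_contra fun h => h2 (iff_of_false ha h)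
    simp only [rimIx₂, redCoord₂, Sum.elim_inl, if_neg ha]
    split_ifs with h3
    · have hX : ¬ DelX T m b a d := fun h => ha h.1
      rw [xWord, if_neg hX, if_neg ha, if_pos hd, if_pos h4]
    · have hX : ¬ DelX T m b d a := fun h => ha h.2.1
      rw [xWord, if_neg hX, if_pos hd, if_pos ⟨ha, h4⟩]

/-- Where the kept conditions hold, flatness gives the omitted ones and then the boundary relations,
whose solution is determined by the independent coordinates. -/
lemma rimBoundary_redCoord (hm : m ∈ T) (hcut : ∀ a b, (a ∈ T ↔ b ∈ T) ↔ (a ∈ S ↔ b ∈ S))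
    {c : ReducedConfig G₁ G₂ T} (h₁ : ∀ i ∈ redDelta₁ T m, redCoord₁ 𝒢 T m c i = 1)
    (h₂ : ∀ i ∈ redDelta₂ T m, redCoord₂ 𝒢 T m c i = 1) :
    rimBoundary 𝒢 (redCoord₁ 𝒢 T m c ∘ rimIx₁ hcut, redCoord₂ 𝒢 T m c ∘ rimIx₂ hcut) =
      reducedBoundary c := by
  obtain ⟨hT, hE⟩ := (redCoord_eq_one_iff hm).1 ⟨h₁, h₂⟩
  have hflat := flat_of_triFlat hm hT hE
  have hrf := hflat.rimFlat 𝒢 hcut (hflat.triFlat_none hT) (hflat.edgeFlat_none hE)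
  rw [← restrictBoundary_reducedBoundary hcut]
  refine hrf.rimBoundary_eq ?_ ?_ ?_ ?_
  · rintro ⟨⟨a, b⟩, hp⟩
    simp only [Function.comp, rimIx₁, redCoord₁, Sum.elim_inl, Sum.elim_inr, rimH]
    split_ifs <;> rfl
  · rintro ⟨⟨a, b, d⟩, hp⟩
    have hab := hcut a b
    have hf := rimIx₁_mem (m := m) hcut (.inr ⟨(a, b, d), hp⟩)
    dsimp only at hp
    simp only [rimIx₁, redDelta₁, Sum.elim_inr, Finset.inr_mem_disjSum,
      Finset.mem_filter_univ, Finset.notMem_empty, iff_false] at hf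
    simp only [Function.comp, rimIx₁, redCoord₁, Sum.elim_inr, if_neg hf]
    simp only [reducedBoundary, restrictBoundary]
    by_cases ha : a ∈ T
    · have hb : b ∉ T := by tauto
      simp only [ha, hb, if_true, not_false_eq_true, and_self]
      exact (linkU_mk _ _).symm
    · have hb : b ∈ T := by tauto
      simp only [ha, hb, if_true, if_false, not_false_eq_true, and_self, not_true_eq_false]
      exact (linkU_mk _ _).symm
  · exact redCoord₂_rimIx hcut
  · rintro ⟨⟨a, b, d, e⟩, hp⟩
    have hab := hcut a b
    have hf := rimIx₂_mem (m := m) hcut (.inr ⟨(a, b, d, e), hp⟩)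
    dsimp only at hp
    simp only [rimIx₂, redDelta₂, Sum.elim_inr, Finset.inr_mem_disjSum,
      Finset.mem_filter_univ, Finset.notMem_empty, iff_false] at hf
    simp only [Function.comp, rimIx₂, redCoord₂, Sum.elim_inr, if_neg hf]
    simp only [reducedBoundary, restrictBoundary]
    by_cases ha : a ∈ T
    · have hb : b ∉ T := by tauto
      simp only [ha, hb, if_true, not_false_eq_true, and_self]
      exact (wedgeY_mk _ _).symm
    · have hb : b ∈ T := by tauto
      simp only [ha, hb, if_true, if_false, not_false_eq_true, and_self, not_true_eq_false]
      exact (wedgeY_mk _ _).symm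

lemma lintegral_rim (hm : m ∈ T) (ht : Continuous 𝒢.t)
    (hact : Continuous fun p : G₁ × G₂ => 𝒢.act p.1 p.2)
    (hμ₂ : ∀ g : G₁, MeasurePreserving (fun y => 𝒢.act g y) μ₂ μ₂)
    (hcut : ∀ a b, (a ∈ T ↔ b ∈ T) ↔ (a ∈ S ↔ b ∈ S))
    (F : BoundaryData G₁ G₂ → ENNReal) (hF : Measurable F) :
    amplitude μ₁ μ₂ 𝒢 T (some m) F =
      μ₁ Set.univ ^ (T.card - 1) *
      μ₂ Set.univ ^ (T.card.choose 2 * (6 - T.card) + 3 * T.card.choose 3 -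
        (T.card - 1).choose 3) *
      ∫⁻ y, F (rimBoundary 𝒢 y) ∂(Measure.pi fun _ : RimIx₁ S => μ₁).prod
        (Measure.pi fun _ : RimIx₂ S => μ₂) := by
  haveI := regular_of_secondCountable μ₁
  haveI := regular_of_secondCountable μ₂
  haveI := isInvInvariant_of_unimodular μ₁
  haveI := isInvInvariant_of_unimodular μ₂
  haveI : BorelSpace ((RimIx₁ S → G₁) × (RimIx₂ S → G₂)) := borelSpace_prod_of_left
  obtain ⟨E, hE, hEc⟩ := exists_redChart (μ₁ := μ₁) (μ₂ := μ₂) hm ht hact hμ₂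
  have hdelta := isDeltaMeasure_of_chart μ₁ μ₂ (redDelta₁ T m) (redDelta₂ T m)
    (ρ := reducedDensity 𝒢 T (some m)) E hE fun δ₁ δ₂ c => by
      rw [reducedDensity_eq hm, hEc]
  have hfree₁ := rimIx₁_mem (m := m) hcut
  have hfree₂ := rimIx₂_mem (m := m) hcut
  have hrim : ∀ c, (∀ i ∈ redDelta₁ T m, (E c).1 i = 1) → (∀ i ∈ redDelta₂ T m, (E c).2 i = 1) →
      rimBoundary 𝒢 ((E c).1 ∘ rimIx₁ hcut, (E c).2 ∘ rimIx₂ hcut) = reducedBoundary c := by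
    intro c h₁ h₂
    rw [hEc] at h₁ h₂ ⊢
    exact rimBoundary_redCoord hm hcut h₁ h₂
  unfold amplitude
  rw [hdelta.deltaMeasure_eq]
  -- The target is the space of independent variables itself, with the identity as chart and no
  -- constraints.
  rw [lintegral_chart_eq μ₁ μ₂ (redDelta₁ T m) (redDelta₂ T m) ∅ ∅ E (Homeomorph.refl _)
    (rimIx₁ hcut) (rimIx₂ hcut) (rimIx₁_injective hcut) (rimIx₂_injective hcut) hfree₁ hfree₂
    (rimIx₁_range hcut m) (rimIx₂_range hcut m) (fun c => ((E c).1 ∘ rimIx₁ hcut, (E c).2 ∘ rimIx₂ hcut)) (fun _ _ _ => rfl)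
    reducedBoundary (rimBoundary 𝒢) (measurable_rimBoundary 𝒢 ht hact) hrim F hF]
  congr 1
  · rw [Finset.card_disjSum, Finset.card_disjSum, Finset.card_empty,
      Finset.card_empty, add_zero, add_zero, ← card_rankX T m hm, ← card_bulkTets_ref T m hm]
    exact congrArg₂ (fun a b => μ₁ Set.univ ^ a * μ₂ Set.univ ^ b)
      (card_filter_subtype (P := fun p => p ∈ bulkTets T)
        (Q := fun p : Fin 6 × Fin 6 => p.1 = m ∨ p.2 = m))
      (card_filter_subtype (P := fun p : Fin 6 × Fin 6 × Fin 6 =>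
          p.1 ∈ T ∧ p.2.1 ≠ p.1 ∧ p.2.2 ≠ p.1 ∧ p.2.1 < p.2.2)
        (Q := fun p : Fin 6 × Fin 6 × Fin 6 => rankX T m p.1 p.2.1 p.2.2 = 0))
  · have h1 : coordMeasure μ₁ (∅ : Finset (RimIx₁ S)) = fun _ => μ₁ :=
      funext fun i => coordMeasure_of_notMem _ _ (Finset.notMem_empty i)
    have h2 : coordMeasure μ₂ (∅ : Finset (RimIx₂ S)) = fun _ => μ₂ :=
      funext fun i => coordMeasure_of_notMem _ _ (Finset.notMem_empty i)
    rw [h1, h2]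
    congr 1
    exact Measure.map_id

end Limit

/-! ### Coordinates for the Feynman integral -/

section Feynman

variable {G₁ G₂ : Type*} [Group G₁] [Group G₂] (𝒢 : CrossedModule G₁ G₂)
  (T : Finset (Fin 6)) (m : Fin 6) (c : FeynmanConfig G₁ G₂ T)

/-- The half link `h_{s;r}` is determined by the triangle `{m, s, r}`. -/
def DelH (s r : Fin 6) : Prop := r ∈ T ∧ s ≠ m ∧ r ≠ m ∧ s < r

instance (s r : Fin 6) : Decidable (DelH T m s r) := by unfold DelH; infer_instance

/-- The word that replaces `h_{s;r}` as a coordinate. -/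
def hWord (s r : Fin 6) : G₁ :=
  if DelH T m s r then lWord 𝒢 c s (min m r) (max m r)
  else if r ∈ T then
    if (s = m ∨ r = m) ∧ s < r then linkH c.2.1 s r * (linkH c.2.1 r s)⁻¹ else linkH c.2.1 s r
  else gaugeH T (fuse c) m s r

/-- The word that replaces `u_{s;a;b}` as a coordinate. -/
def uWord (s a b : Fin 6) : G₁ :=
  if KinU T m s a b then
    (linkU c.2.2.1 (min s a) (max s a) b)⁻¹ * linkU c.2.2.1 (max s a) (min s a) b
  else if VertU T m s a b then lWord 𝒢 c s (min a b) (max a b)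
  else linkU c.2.2.1 s a b

/-- The word that replaces `Y_{s;a;b,d}` as a coordinate. -/
def yWord (s a b d : Fin 6) : G₂ :=
  if KinY T m s a b d then
    (wedgeY c.2.2.2 (min s a) (max s a) b d)⁻¹ * wedgeY c.2.2.2 (max s a) (min s a) b d
  else if VertY T m s a b d then
    wWord 𝒢 c s (sorted a b d).1 (sorted a b d).2.1 (sorted a b d).2.2
  else wedgeY c.2.2.2 s a b d

/-- The coordinates of the Feynman integral with values in `G₁`. -/
def feynCoord₁ : FeynIx₁ T → G₁ :=
  Sum.elim (fun p => hWord 𝒢 T m c p.1.1 p.1.2) fun p => uWord 𝒢 T m c p.1.1 p.1.2.1 p.1.2.2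

/-- The coordinates of the Feynman integral with values in `G₂`. -/
def feynCoord₂ : FeynIx₂ T → G₂ :=
  Sum.elim (fun p => if DelX T m p.1.1 p.1.2.1 p.1.2.2 then
      wWord 𝒢 c p.1.1 (sorted m p.1.2.1 p.1.2.2).1 (sorted m p.1.2.1 p.1.2.2).2.1
        (sorted m p.1.2.1 p.1.2.2).2.2
    else xWord 𝒢 T m (fuse c) p.1.1 p.1.2.1 p.1.2.2)
    fun p => yWord 𝒢 T m c p.1.1 p.1.2.1 p.1.2.2.1 p.1.2.2.2

/-- The order in which the half links are replaced. -/
def rankH (s r : Fin 6) : ℕ :=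
  if DelH T m s r then 7 else if r ∈ T then if (s = m ∨ r = m) ∧ s < r then 1 else 0 else 2

/-- The order in which the links `u_{s;a;b}` are replaced. -/
def rankU (s a b : Fin 6) : ℕ :=
  (if a ∈ T ∧ b ∈ T ∧ (s = m ∨ a = m ∨ b = m) then 2 else 12) +
    if Base3 T m s a b then if a ∈ T then 3 else if VertU T m s a b then 4 else 0
    else if Base3 T m a s b then 2 else if a ∉ T ∨ s < a then 0 else 1

/-- The order in which the wedges `X_{s;r,q}` are replaced. -/
def rankW (s r q : Fin 6) : ℕ := if DelX T m s r q then 13 else 2 * rankX T m s r q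

/-- The order in which the wedges `Y_{s;a;b,d}` are replaced. -/
def rankY (s a b d : Fin 6) : ℕ :=
  (if a ∈ T ∧ b ∈ T ∧ d ∈ T ∧ (s = m ∨ a = m ∨ b = m ∨ d = m) then 8 else 14) +
    if Base4 T m s a b d then if a ∈ T then 3 else if VertY T m s a b d then 4 else 0
    else if Base4 T m a s b d then 2 else if a ∉ T ∨ s < a then 0 else 1

/-- The order in which the variables with values in `G₁` are replaced. -/
def feynRank₁ : FeynIx₁ T → ℕ :=
  Sum.elim (fun p => rankH T m p.1.1 p.1.2) fun p => rankU T m p.1.1 p.1.2.1 p.1.2.2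

/-- The order in which the variables with values in `G₂` are replaced. -/
def feynRank₂ : FeynIx₂ T → ℕ :=
  Sum.elim (fun p => rankW T m p.1.1 p.1.2.1 p.1.2.2)
    fun p => rankY T m p.1.1 p.1.2.1 p.1.2.2.1 p.1.2.2.2

variable {T m}

lemma rankW_swap (s r q : Fin 6) : rankW T m s q r = rankW T m s r q := by
  have : DelX T m s q r ↔ DelX T m s r q := by unfold DelX; tauto
  simp only [rankW, rankX_swap, this]

lemma base4_swap {s a b d : Fin 6} : Base4 T m s a d b ↔ Base4 T m s a b d := by
  unfold Base4; tauto

lemma vertY_swap {s a b d : Fin 6} : VertY T m s a d b ↔ VertY T m s a b d := by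
  unfold VertY; rw [base4_swap (s := a), base4_swap (s := s)]; tauto

lemma rankY_swap (s a b d : Fin 6) : rankY T m s a d b = rankY T m s a b d := by
  simp only [rankY, base4_swap, vertY_swap]
  congr 2
  simp only [eq_iff_iff]; tauto

lemma rankW_of_notDelX {s r q : Fin 6} (h : ¬ DelX T m s r q) :
    rankW T m s r q = 2 * rankX T m s r q := if_neg h

/-- The ranks realise the following order. Ranks up to `2`: free half links, gauge links, boundary
links, and the wedges `X` not determined by an edge through `m`. Ranks `2` to `5`: the `u` on bulk
triangles through `m`. Rank `7`: the half links determined by these triangles. Ranks `8` to `11`: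
the `Y` on bulk edges through `m`. Rank `13`: the `X` determined by these edges. The remaining `u`
start at `12` and the remaining `Y` at `14`. Around a fixed triangle or edge, variables away from
the base come first, then those facing the base, then those of the base. -/
lemma rankH_delH {s r : Fin 6} (h : DelH T m s r) (hm : m ∈ T) (hs : s ∈ T) :
    rankU T m s r m < 7 ∧ rankU T m s m r < 7 ∧ rankH T m s m < 7 ∧ rankW T m s r m < 7 := by
  unfold rankW rankX
  simp only [DelX, DelH, rankU, rankH, Base3, VertU] at *
  grind

lemma rankU_kinU {s a b : Fin 6} (h : KinU T m s a b) (hs : s ∈ T) (hsa : a ≠ s) :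
    rankU T m a s b < rankU T m s a b := by
  simp only [rankU, KinU, Base3, VertU] at *
  grind

lemma rankU_vertU {s a b : Fin 6} (h : VertU T m s a b) (hs : s ∈ T) (hbs : b ≠ s) : rankU T m s b a < rankU T m s a b ∧ rankH T m s a < rankU T m s a b ∧
      rankH T m s b < rankU T m s a b ∧ rankW T m s a b < rankU T m s a b := by
  unfold rankW rankX
  by_cases ha : a ∈ T <;> by_cases hb : b ∈ T <;>
  simp only [DelX, DelH, rankU, rankH, Base3, VertU, ha, hb, hs, true_and, and_true, true_imp_iff,
    not_true_eq_false, false_and, if_false, false_or, or_false, not_false_eq_true, false_imp_iff,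
    and_false, if_true] at h ⊢ <;>
  refine ⟨?_, ?_, ?_, ?_⟩ <;> grind

lemma rankY_kinY {s a b d : Fin 6} (h : KinY T m s a b d) (hs : s ∈ T) (hsa : a ≠ s) :
    rankY T m a s b d < rankY T m s a b d := by
  simp only [rankY, KinY, Base4, VertY] at *
  grind

lemma rankY_vertY {s a b d : Fin 6} (h : VertY T m s a b d) (hs : s ∈ T)
    (hbs : b ≠ s) (hds : d ≠ s) (hbd : b ≠ d) :
    rankY T m s b d a < rankY T m s a b d ∧ rankY T m s d a b < rankY T m s a b d := by
  by_cases ha : a ∈ T <;> by_cases hb : b ∈ T <;> by_cases hd : d ∈ T <;>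
  simp only [rankY, Base4, VertY, ha, hb, hd, hs, true_and, and_true, true_imp_iff,
    not_true_eq_false, false_and, if_false, false_or, or_false, not_false_eq_true, false_imp_iff,
    and_false, if_true] at h ⊢ <;>
  refine ⟨?_, ?_⟩ <;> grind

/-- A `Y` of a bulk edge through `m` may have rank below `13`; its vertex condition sits away from
the base and contains no wedge of rank `13`. -/
lemma rankW_lt_rankY {s a b d i j : Fin 6} (h : VertY T m s a b d) (hs : s ∈ T)
    (hij : i = a ∧ j = b ∨ i = b ∧ j = d ∨ i = d ∧ j = a) :
    rankW T m s i j < rankY T m s a b d := by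
  unfold rankW rankX
  by_cases ha : a ∈ T <;> by_cases hb : b ∈ T <;> by_cases hd : d ∈ T <;>
  simp only [DelX, rankY, Base4, VertY, ha, hb, hd, hs, true_and, and_true, true_imp_iff,
    not_true_eq_false, false_and, if_false, false_or, or_false, not_false_eq_true, false_imp_iff,
    and_false, if_true] at h ⊢ <;>
  grind

lemma rankH_lt (s r : Fin 6) : rankH T m s r < 8 := by
  unfold rankH; split_ifs <;> omega

lemma le_rankY (s a b d : Fin 6) : 8 ≤ rankY T m s a b d := by
  unfold rankY; split_ifs <;> omega

lemma rankY_delX {s a b d : Fin 6} (ha : a ∈ T) (hb : b ∈ T) (hd : d ∈ T)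
    (h : a = m ∨ b = m ∨ d = m) : rankY T m s a b d < 13 := by
  unfold rankY; split_ifs <;> grind

end Feynman

/-! ### Triangularity of the Feynman coordinates -/

section FeynmanLin

variable {G₁ G₂ : Type*} [Group G₁] [TopologicalSpace G₁] [IsTopologicalGroup G₁]
  [Group G₂] [TopologicalSpace G₂] [IsTopologicalGroup G₂] {𝒢 : CrossedModule G₁ G₂}
  {T : Finset (Fin 6)} {m : Fin 6} {n : ℕ}

lemma feyn_dep_wedgeX {s r q : Fin 6} (h : rankW T m s r q < n) :
    Dep (G₁ := G₁) (feynRank₁ T m) (feynRank₂ T m) n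
      fun x => wedgeX ((feynHomeo G₁ G₂ T).symm x).1 s r q := by
  refine dep_wedgeX (v := Sum.inl) fun p hp => ?_
  change rankW T m _ _ _ < n
  rcases hp with hp | hp <;> rw [hp]
  · exact h
  · rwa [rankW_swap]

lemma feyn_dep_linkH {s r : Fin 6} (h : rankH T m s r < n) :
    Dep (G₂ := G₂) (feynRank₁ T m) (feynRank₂ T m) n
      fun x => linkH ((feynHomeo G₁ G₂ T).symm x).2.1 s r := by
  refine dep_linkH (v := Sum.inl) fun p hp => ?_
  change rankH T m _ _ < n
  rwa [hp]

lemma feyn_dep_linkU {s a b : Fin 6} (h : rankU T m s a b < n) :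
    Dep (G₂ := G₂) (feynRank₁ T m) (feynRank₂ T m) n
      fun x => linkU ((feynHomeo G₁ G₂ T).symm x).2.2.1 s a b := by
  refine dep_linkU (v := Sum.inr) fun p hp => ?_
  change rankU T m _ _ _ < n
  rwa [hp]

lemma feyn_dep_wedgeY {s a b d : Fin 6} (h : rankY T m s a b d < n) :
    Dep (G₁ := G₁) (feynRank₁ T m) (feynRank₂ T m) n
      fun x => wedgeY ((feynHomeo G₁ G₂ T).symm x).2.2.2 s a b d := by
  refine dep_wedgeY (v := Sum.inr) fun p hp => ?_
  change rankY T m _ _ _ _ < n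
  rcases hp with hp | hp <;> rw [hp]
  · exact h
  · rwa [rankY_swap]

lemma feyn_dep_halfWedge (hact : Continuous fun p : G₁ × G₂ => 𝒢.act p.1 p.2) {s a b d : Fin 6}
    (h : rankY T m s a b d < n) :
    Dep (feynRank₁ T m) (feynRank₂ T m) n
      fun x => halfWedge 𝒢 ((feynHomeo G₁ G₂ T).symm x) s a b d :=
  Dep.comp₂ (f := fun a b => 𝒢.act a b) hact
    (feyn_dep_linkH ((rankH_lt _ _).trans_le ((le_rankY _ _ _ _).trans h.le)))
    (feyn_dep_wedgeY h)

/-- The transport to `m` involves only half links on tetrahedra at `m`, whose ranks are `0` and `1`.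
-/
lemma feyn_dep_gauge (h : 1 < n) (s : Fin 6) :
    Dep (G₂ := G₂) (feynRank₁ T m) (feynRank₂ T m) n
      fun x => gauge T (fuse ((feynHomeo G₁ G₂ T).symm x)) m s := by
  have key : ∀ a b : Fin 6, a = m ∨ b = m → Dep (G₂ := G₂) (feynRank₁ T m) (feynRank₂ T m) n
      fun x => linkH (fuse ((feynHomeo G₁ G₂ T).symm x)).2.1 a b := by
    intro a b hab
    by_cases H : (a, b) ∈ bulkTets T
    · have : ∀ x : (FeynIx₁ T → G₁) × (FeynIx₂ T → G₂),
          linkH (fuse ((feynHomeo G₁ G₂ T).symm x)).2.1 a b =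
          linkH ((feynHomeo G₁ G₂ T).symm x).2.1 a b *
            (linkH ((feynHomeo G₁ G₂ T).symm x).2.1 b a)⁻¹ := fun x => dif_pos H
      simp only [this]
      simp only [bulkTets, Finset.mem_filter_univ] at H
      refine (feyn_dep_linkH ?_).mul (feyn_dep_linkH ?_).inv <;>
      · unfold rankH DelH
        grind
    · have : ∀ x : (FeynIx₁ T → G₁) × (FeynIx₂ T → G₂),
          linkH (fuse ((feynHomeo G₁ G₂ T).symm x)).2.1 a b = 1 := fun x => dif_neg H
      simp only [this]
      exact dep_const 1
  exact (key m s (Or.inl rfl)).mul (key s m (Or.inr rfl)).inv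

variable [MeasurableSpace G₁] [BorelSpace G₁] [MeasurableSpace G₂] [BorelSpace G₂]
  {μ₁ : Measure G₁} [μ₁.IsMulLeftInvariant] [μ₁.IsMulRightInvariant] [μ₁.IsInvInvariant]
  {μ₂ : Measure G₂} [μ₂.IsMulLeftInvariant] [μ₂.IsMulRightInvariant] [μ₂.IsInvInvariant]

lemma feyn_lin_linkH (p : TetIx (allTets T)) :
    Lin (feynRank₁ T m) (feynRank₂ T m) μ₁ n
      (fun x : (FeynIx₁ T → G₁) × (FeynIx₂ T → G₂) => x.1 (.inl p))
      fun x => linkH ((feynHomeo G₁ G₂ T).symm x).2.1 p.1.1 p.1.2 := by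
  have : ∀ x : (FeynIx₁ T → G₁) × (FeynIx₂ T → G₂),
      linkH ((feynHomeo G₁ G₂ T).symm x).2.1 p.1.1 p.1.2 = x.1 (.inl p) := fun x => dif_pos p.2
  exact (funext this : _ = _) ▸ lin_self

lemma feyn_lin_linkU (p : TriIx (allTets T)) :
    Lin (feynRank₁ T m) (feynRank₂ T m) μ₁ n
      (fun x : (FeynIx₁ T → G₁) × (FeynIx₂ T → G₂) => x.1 (.inr p))
      fun x => linkU ((feynHomeo G₁ G₂ T).symm x).2.2.1 p.1.1 p.1.2.1 p.1.2.2 := by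
  have : ∀ x : (FeynIx₁ T → G₁) × (FeynIx₂ T → G₂),
      linkU ((feynHomeo G₁ G₂ T).symm x).2.2.1 p.1.1 p.1.2.1 p.1.2.2 = x.1 (.inr p) :=
    fun x => dif_pos p.2
  exact (funext this : _ = _) ▸ lin_self

lemma feyn_lin_wedgeY (p : EdgeIx (allTets T)) :
    Lin (feynRank₁ T m) (feynRank₂ T m) μ₂ n
      (fun x : (FeynIx₁ T → G₁) × (FeynIx₂ T → G₂) => x.2 (.inr p))
      fun x => wedgeY ((feynHomeo G₁ G₂ T).symm x).2.2.2 p.1.1 p.1.2.1 p.1.2.2.1 p.1.2.2.2 := by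
  have : ∀ x : (FeynIx₁ T → G₁) × (FeynIx₂ T → G₂),
      wedgeY ((feynHomeo G₁ G₂ T).symm x).2.2.2 p.1.1 p.1.2.1 p.1.2.2.1 p.1.2.2.2 =
        x.2 (.inr p) := fun x => dif_pos p.2
  exact (funext this : _ = _) ▸ lin_self

/-- A half link is determined by a triangle through `m`, or fused with its partner on a tetrahedron
at `m`, or kept as the free half of a bulk tetrahedron, or transported to `m` from the boundary.
Each replacement involves it once. -/
lemma feyn_lin_hWord (hm : m ∈ T) (ht : Continuous 𝒢.t) (p : TetIx (allTets T)) :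
    Lin (feynRank₁ T m) (feynRank₂ T m) μ₁ (rankH T m p.1.1 p.1.2)
      (fun x : (FeynIx₁ T → G₁) × (FeynIx₂ T → G₂) => x.1 (.inl p))
      fun x => hWord 𝒢 T m ((feynHomeo G₁ G₂ T).symm x) p.1.1 p.1.2 := by
  have hself : ∀ n, Lin (feynRank₁ T m) (feynRank₂ T m) μ₁ n
      (fun x : (FeynIx₁ T → G₁) × (FeynIx₂ T → G₂) => x.1 (.inl p))
      fun x => linkH ((feynHomeo G₁ G₂ T).symm x).2.1 p.1.1 p.1.2 := fun n => feyn_lin_linkH p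
  obtain ⟨⟨s, r⟩, hp⟩ := p
  obtain ⟨hs, hrs⟩ : s ∈ T ∧ r ≠ s := by simpa [allTets] using hp
  dsimp only at hself ⊢
  unfold hWord
  split_ifs with h1 h2 h3
  · obtain ⟨h4, h5, h6, h7⟩ := rankH_delH h1 hm hs
    have hrk : rankH T m s r = 7 := if_pos h1
    rw [hrk]
    refine lin_lWord_half (a := r) (b := m) ht (hself 7) (feyn_dep_linkU h5) (feyn_dep_linkU h4)
      (feyn_dep_linkH h6) (feyn_dep_wedgeX h7) ?_
    rcases lt_or_gt_of_ne h1.2.2.1 with h | h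
    · rw [min_eq_right h.le, max_eq_left h.le]; exact Or.inl ⟨rfl, rfl⟩
    · rw [min_eq_left h.le, max_eq_right h.le]; exact Or.inr ⟨rfl, rfl⟩
  · have hrk : rankH T m s r = 1 := by unfold rankH; rw [if_neg h1, if_pos h2, if_pos h3]
    rw [hrk]
    refine (hself 1).mul_right (feyn_dep_linkH ?_).inv
    unfold rankH DelH
    grind
  · exact hself _
  · have hrk : rankH T m s r = 2 := by unfold rankH; rw [if_neg h1, if_neg h2]
    rw [hrk]
    unfold gaugeH
    simp only [linkH_fuse _ hs h2]
    exact Lin.mul_left (feyn_dep_gauge (by omega) s) (hself 2)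

lemma feyn_lin_uWord (ht : Continuous 𝒢.t) (p : TriIx (allTets T)) :
    Lin (feynRank₁ T m) (feynRank₂ T m) μ₁ (rankU T m p.1.1 p.1.2.1 p.1.2.2)
      (fun x : (FeynIx₁ T → G₁) × (FeynIx₂ T → G₂) => x.1 (.inr p))
      fun x => uWord 𝒢 T m ((feynHomeo G₁ G₂ T).symm x) p.1.1 p.1.2.1 p.1.2.2 := by
  have hself : ∀ n, Lin (feynRank₁ T m) (feynRank₂ T m) μ₁ n
      (fun x : (FeynIx₁ T → G₁) × (FeynIx₂ T → G₂) => x.1 (.inr p))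
      fun x => linkU ((feynHomeo G₁ G₂ T).symm x).2.2.1 p.1.1 p.1.2.1 p.1.2.2 :=
    fun n => feyn_lin_linkU p
  obtain ⟨⟨s, a, b⟩, hp⟩ := p
  obtain ⟨⟨hs, has⟩, hbs, hba⟩ : (s ∈ T ∧ a ≠ s) ∧ b ≠ s ∧ b ≠ a := by simpa [allTets] using hp
  dsimp only at hself hs has hbs hba ⊢
  unfold uWord
  split_ifs with h1 h2
  · have h3 := rankU_kinU h1 hs has
    rcases lt_or_gt_of_ne has with h | h
    · rw [min_eq_right h.le, max_eq_left h.le]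
      exact Lin.mul_left (feyn_dep_linkU h3).inv (hself _)
    · rw [min_eq_left h.le, max_eq_right h.le]
      exact ((hself _).of_inv fun _ => rfl).mul_right (feyn_dep_linkU h3)
  · obtain ⟨h4, h5, h6, h7⟩ := rankU_vertU h2 hs hbs
    refine lin_lWord_link ht (hself _) (feyn_dep_linkU h4) (feyn_dep_linkH h5) (feyn_dep_linkH h6)
      (feyn_dep_wedgeX h7) ?_
    rcases lt_or_gt_of_ne hba with h | h
    · rw [min_eq_right h.le, max_eq_left h.le]; exact Or.inr ⟨rfl, rfl⟩
    · rw [min_eq_left h.le, max_eq_right h.le]; exact Or.inl ⟨rfl, rfl⟩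
  · exact hself _

lemma feyn_lin_yWord (hact : Continuous fun p : G₁ × G₂ => 𝒢.act p.1 p.2)
    (hμ₂ : ∀ g : G₁, MeasurePreserving (fun y => 𝒢.act g y) μ₂ μ₂) (p : EdgeIx (allTets T)) :
    Lin (feynRank₁ T m) (feynRank₂ T m) μ₂ (rankY T m p.1.1 p.1.2.1 p.1.2.2.1 p.1.2.2.2)
      (fun x : (FeynIx₁ T → G₁) × (FeynIx₂ T → G₂) => x.2 (.inr p))
      fun x => yWord 𝒢 T m ((feynHomeo G₁ G₂ T).symm x) p.1.1 p.1.2.1 p.1.2.2.1 p.1.2.2.2 := by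
  have hself : ∀ n, Lin (feynRank₁ T m) (feynRank₂ T m) μ₂ n
      (fun x : (FeynIx₁ T → G₁) × (FeynIx₂ T → G₂) => x.2 (.inr p))
      fun x => wedgeY ((feynHomeo G₁ G₂ T).symm x).2.2.2 p.1.1 p.1.2.1 p.1.2.2.1 p.1.2.2.2 :=
    fun n => feyn_lin_wedgeY p
  obtain ⟨⟨s, a, b, d⟩, hp⟩ := p
  obtain ⟨⟨hs, has⟩, hbs, hba, hds, hda, hbd⟩ :
      (s ∈ T ∧ a ≠ s) ∧ b ≠ s ∧ b ≠ a ∧ d ≠ s ∧ d ≠ a ∧ b < d := by simpa [allTets] using hp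
  dsimp only at hself hs has hbs hba hds hda hbd ⊢
  unfold yWord
  split_ifs with h1 h2
  · have h3 := rankY_kinY h1 hs has
    rcases lt_or_gt_of_ne has with h | h
    · rw [min_eq_right h.le, max_eq_left h.le]
      exact Lin.mul_left (feyn_dep_wedgeY h3).inv (hself _)
    · rw [min_eq_left h.le, max_eq_right h.le]
      exact ((hself _).of_inv fun _ => rfl).mul_right (feyn_dep_wedgeY h3)
  · obtain ⟨h4, h5⟩ := rankY_vertY h2 hs hbs hds hbd.ne
    have hX := fun i j => rankW_lt_rankY (i := i) (j := j) h2 hs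
    exact lin_wWord_side (a := a) (b := b) (d := d) (Lin.act hact hμ₂
      (feyn_dep_linkH ((rankH_lt _ _).trans_le (le_rankY _ _ _ _))) (hself _))
      (feyn_dep_halfWedge hact h4) (feyn_dep_halfWedge hact h5)
      (feyn_dep_wedgeX (hX _ _ (by simp))) (feyn_dep_wedgeX (hX _ _ (by simp)))
      (feyn_dep_wedgeX (hX _ _ (by simp))) (perm3_sorted hba.symm hbd.ne hda.symm)
  · exact hself _

lemma feyn_lin_wedge (hm : m ∈ T) (hact : Continuous fun p : G₁ × G₂ => 𝒢.act p.1 p.2)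
    (hμ₂ : ∀ g : G₁, MeasurePreserving (fun y => 𝒢.act g y) μ₂ μ₂) (p : FaceIx T) :
    Lin (feynRank₁ T m) (feynRank₂ T m) μ₂ (rankW T m p.1.1 p.1.2.1 p.1.2.2)
      (fun x : (FeynIx₁ T → G₁) × (FeynIx₂ T → G₂) => x.2 (.inl p))
      fun x => if DelX T m p.1.1 p.1.2.1 p.1.2.2 then
          wWord 𝒢 ((feynHomeo G₁ G₂ T).symm x) p.1.1 (sorted m p.1.2.1 p.1.2.2).1
            (sorted m p.1.2.1 p.1.2.2).2.1 (sorted m p.1.2.1 p.1.2.2).2.2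
        else xWord 𝒢 T m (fuse ((feynHomeo G₁ G₂ T).symm x)) p.1.1 p.1.2.1 p.1.2.2 := by
  have hx : ∀ (n : ℕ) (r q : Fin 6),
      ((r = p.1.2.1 ∧ q = p.1.2.2) ∨ (r = p.1.2.2 ∧ q = p.1.2.1)) →
      Lin (feynRank₁ T m) (feynRank₂ T m) μ₂ n
      (fun x : (FeynIx₁ T → G₁) × (FeynIx₂ T → G₂) => x.2 (.inl p))
      fun x => wedgeX (fuse ((feynHomeo G₁ G₂ T).symm x)).1 p.1.1 r q :=
    fun n r q h => lin_wedgeX (v := Sum.inl) h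
  obtain ⟨⟨s, r, q⟩, hp⟩ := p
  obtain ⟨hs, hrs, hqs, hrq⟩ := hp
  dsimp only at hs hrs hqs hrq hx ⊢
  by_cases h1 : DelX T m s r q
  · simp only [if_pos h1]
    rw [show rankW T m s r q = 13 from if_pos h1]
    obtain ⟨hr, hq, hsm, hrm, hqm, hsr, hsq⟩ := h1
    refine lin_wWord_wedge (s := s) (a := r) (b := q) (d := m)
      (feyn_dep_halfWedge hact (rankY_delX hr hq hm (by simp)))
      (feyn_dep_halfWedge hact (rankY_delX hq hm hr (by simp)))
      (feyn_dep_halfWedge hact (rankY_delX hm hr hq (by simp)))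
      (hx _ _ _ (by simp)) (feyn_dep_wedgeX ?_) (feyn_dep_wedgeX ?_)
      (perm3_sorted hrm.symm hrq.ne hqm.symm).rotate <;>
    · unfold rankW rankX DelX
      grind
  · simp only [if_neg h1]
    rw [rankW_of_notDelX h1]
    -- Covers both positions of the boundary index: `X` belongs to the smaller of the two
    -- 4-simplices of `T` around the triangle, and the wedge of the larger one has rank zero.
    have hθ : ∀ a b d : Fin 6, a ∉ T → s = b ∧ (d = r ∧ a = q ∨ d = q ∧ a = r) → b ∈ T → d ∈ T →
        b < d → Lin (feynRank₁ T m) (feynRank₂ T m) μ₂ 2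
        (fun x : (FeynIx₁ T → G₁) × (FeynIx₂ T → G₂) => x.2 (.inl ⟨(s, r, q), hs, hrs, hqs, hrq⟩))
        fun x => theta 𝒢 T (fuse ((feynHomeo G₁ G₂ T).symm x)) m a b d := by
      rintro a b d ha ⟨rfl, had⟩ hb hd hbd
      unfold theta
      simp only [ha, if_false]
      refine Lin.mul_right (Lin.mul_right (lin_gX hact hμ₂ (feyn_dep_gauge (by omega) _)
        (hx _ _ _ (by omega))) (dep_eta hact (feyn_dep_gauge (by omega)) ?_ ?_ ?_))
        (dep_gX hact (feyn_dep_gauge (by omega) _) ?_) <;>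
      · refine feyn_dep_wedgeX ?_
        unfold rankW rankX DelX
        grind
    have hrk : ∀ k, rankX T m s r q = k → 2 * rankX T m s r q = 2 * k := fun k h => by rw [h]
    unfold xWord
    simp only [if_neg h1]
    split_ifs with h3 h4 h5 h6
    · rw [hrk 1 (by unfold rankX; simp [*])]
      exact hθ q s r h4.1 ⟨rfl, Or.inl ⟨rfl, rfl⟩⟩ hs h3 h4.2
    · exact hx _ _ _ (by simp)
    · rw [hrk 1 (by unfold rankX; simp [*])]
      exact hθ r s q h3 ⟨rfl, Or.inr ⟨rfl, rfl⟩⟩ hs h5 h6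
    · exact hx _ _ _ (by simp)
    · rw [hrk 1 (by unfold rankX; simp [*])]
      exact lin_gX hact hμ₂ (feyn_dep_gauge (by omega) _) (hx _ _ _ (by simp))

variable (𝒢 T m) in
/-- The coordinates of the Feynman integral. -/
def feynTheta (x : (FeynIx₁ T → G₁) × (FeynIx₂ T → G₂)) : (FeynIx₁ T → G₁) × (FeynIx₂ T → G₂) :=
  (feynCoord₁ 𝒢 T m ((feynHomeo G₁ G₂ T).symm x), feynCoord₂ 𝒢 T m ((feynHomeo G₁ G₂ T).symm x))

variable [SecondCountableTopology G₁] [SecondCountableTopology G₂] [SigmaFinite μ₁]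
  [SigmaFinite μ₂]

lemma isVolumeHomeo_feynTheta (hm : m ∈ T) (ht : Continuous 𝒢.t)
    (hact : Continuous fun p : G₁ × G₂ => 𝒢.act p.1 p.2)
    (hμ₂ : ∀ g : G₁, MeasurePreserving (fun y => 𝒢.act g y) μ₂ μ₂) :
    IsVolumeHomeo μ₁ μ₂ (feynTheta 𝒢 T m) := by
  refine isVolumeHomeo_of_triangular (rk₁ := feynRank₁ T m) (rk₂ := feynRank₂ T m) ?_ ?_
  · rintro (p | p)
    · exact feyn_lin_hWord hm ht p
    · exact feyn_lin_uWord ht p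
  · rintro (p | p)
    · exact feyn_lin_wedge hm hact hμ₂ p
    · exact feyn_lin_yWord hact hμ₂ p

lemma exists_feynChart (hm : m ∈ T) (ht : Continuous 𝒢.t)
    (hact : Continuous fun p : G₁ × G₂ => 𝒢.act p.1 p.2)
    (hμ₂ : ∀ g : G₁, MeasurePreserving (fun y => 𝒢.act g y) μ₂ μ₂) :
    ∃ E : FeynmanConfig G₁ G₂ T ≃ₜ (FeynIx₁ T → G₁) × (FeynIx₂ T → G₂),
      MeasurePreserving E (feynmanVolume μ₁ μ₂ T)
        ((Measure.pi fun _ => μ₁).prod (Measure.pi fun _ => μ₂)) ∧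
      ∀ c, E c = (feynCoord₁ 𝒢 T m c, feynCoord₂ 𝒢 T m c) := by
  obtain ⟨E, hE, hmp⟩ := isVolumeHomeo_feynTheta (μ₁ := μ₁) (μ₂ := μ₂) hm ht hact hμ₂
  refine ⟨(feynHomeo G₁ G₂ T).trans E, hmp.comp (measurePreserving_feynHomeo T μ₁ μ₂), fun c => ?_⟩
  rw [Homeomorph.trans_apply, hE]
  unfold feynTheta
  rw [Homeomorph.symm_apply_apply]

end FeynmanLin

/-! ### The delta functions of the Feynman integral as coordinates -/

section FeynmanDelta

variable (T : Finset (Fin 6)) (m : Fin 6)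

/-- The `G₁` coordinates of the Feynman integral that are arguments of delta functions. -/
def feynDelta₁ : Finset (FeynIx₁ T) :=
  (Finset.univ.filter fun p : TetIx (allTets T) => DelH T m p.1.1 p.1.2).disjSum
    (Finset.univ.filter fun p : TriIx (allTets T) =>
      KinU T m p.1.1 p.1.2.1 p.1.2.2 ∨ VertU T m p.1.1 p.1.2.1 p.1.2.2)

/-- The `G₂` coordinates of the Feynman integral that are arguments of delta functions. -/
def feynDelta₂ : Finset (FeynIx₂ T) :=
  (Finset.univ.filter fun p : FaceIx T => DelX T m p.1.1 p.1.2.1 p.1.2.2).disjSum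
    (Finset.univ.filter fun p : EdgeIx (allTets T) =>
      KinY T m p.1.1 p.1.2.1 p.1.2.2.1 p.1.2.2.2 ∨ VertY T m p.1.1 p.1.2.1 p.1.2.2.1 p.1.2.2.2)

variable {T m}

lemma VertU.not_kinU {s a b : Fin 6} (h : VertU T m s a b) : ¬ KinU T m s a b := by
  unfold VertU KinU Base3 at *; grind

lemma VertY.not_kinY {s a b d : Fin 6} (h : VertY T m s a b d) : ¬ KinY T m s a b d := by
  unfold VertY KinY Base4 at *; grind

lemma prod_filter_or {α M : Type*} [Fintype α] [DecidableEq α] [CommMonoid M] {P Q : α → Prop}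
    [DecidablePred P] [DecidablePred Q] (h : ∀ x, Q x → ¬ P x) (f : α → M) :
    ∏ x ∈ Finset.univ.filter (fun x => P x ∨ Q x), f x =
      (∏ x ∈ Finset.univ.filter P, f x) * ∏ x ∈ Finset.univ.filter Q, f x := by
  rw [Finset.filter_or, Finset.prod_union]
  rw [Finset.disjoint_left]
  intro x hx hx'
  simp only [Finset.mem_filter_univ] at hx hx'
  exact h x hx' hx

variable {G₁ G₂ : Type*} [Group G₁] [Group G₂] {𝒢 : CrossedModule G₁ G₂}

/-- The four families of kernels have been relabelled by the variables they determine. Kinetic and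
vertex conditions never claim the same variable, so the products can be merged. -/
lemma feynmanDensity_eq (hm : m ∈ T) (δ₁ : G₁ → ℝ) (δ₂ : G₂ → ℝ) (c : FeynmanConfig G₁ G₂ T) :
    feynmanDensity 𝒢 T (some m) δ₁ δ₂ c = (∏ i ∈ feynDelta₁ T m, δ₁ (feynCoord₁ 𝒢 T m c i)) *
      ∏ i ∈ feynDelta₂ T m, δ₂ (feynCoord₂ 𝒢 T m c i) := by
  unfold feynmanDensity feynDelta₁ feynDelta₂ propagatorKernel vertexKernel
  rw [Finset.prod_disjSum, Finset.prod_disjSum, Finset.prod_mul_distrib, Finset.prod_mul_distrib,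
    prod_kinU m fun s a b => δ₁ ((linkU c.2.2.1 s a b)⁻¹ * linkU c.2.2.1 a s b),
    prod_kinY m fun s a b d => δ₂ ((wedgeY c.2.2.2 s a b d)⁻¹ * wedgeY c.2.2.2 a s b d),
    prod_vertexLinks hm fun s a b => δ₁ (lWord 𝒢 c s a b),
    prod_vertexWedges hm fun s p => δ₂ (wWord 𝒢 c s p.1 p.2.1 p.2.2),
    prod_filter_or fun p h => VertU.not_kinU h, prod_filter_or fun p h => VertY.not_kinY h]
  have hH : ∏ p ∈ (Finset.univ : Finset (TetIx (allTets T))).filter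
      (fun p => DelH T m p.1.1 p.1.2), δ₁ (feynCoord₁ 𝒢 T m c (.inl p)) =
      ∏ p ∈ Finset.univ.filter (fun p : Fin 6 × Fin 6 => p.1 ∈ T ∧ p.2 ∈ T ∧ p.1 ≠ m ∧ p.2 ≠ m ∧
        p.1 < p.2), δ₁ (lWord 𝒢 c p.1 (min m p.2) (max m p.2)) := by
    rw [prod_filter_subtype (P := fun p => p ∈ allTets T)
      (Q := fun p : Fin 6 × Fin 6 => DelH T m p.1 p.2) _
      fun p => δ₁ (lWord 𝒢 c p.1 (min m p.2) (max m p.2))]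
    · refine Finset.prod_congr ?_ fun _ _ => rfl
      ext p
      simp only [Finset.mem_filter_univ, DelH, allTets]
      grind
    · intro p hp
      simp only [feynCoord₁, Sum.elim_inl, hWord, if_pos hp]
  have hU : ∏ p ∈ (Finset.univ : Finset (TriIx (allTets T))).filter
      (fun p => KinU T m p.1.1 p.1.2.1 p.1.2.2), δ₁ (feynCoord₁ 𝒢 T m c (.inr p)) =
      ∏ p ∈ Finset.univ.filter (fun p : Fin 6 × Fin 6 × Fin 6 => p.1 ∈ T ∧ p.2.1 ≠ p.1 ∧
        p.2.2 ≠ p.1 ∧ p.2.2 ≠ p.2.1 ∧ KinU T m p.1 p.2.1 p.2.2),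
        δ₁ ((linkU c.2.2.1 (min p.1 p.2.1) (max p.1 p.2.1) p.2.2)⁻¹ *
          linkU c.2.2.1 (max p.1 p.2.1) (min p.1 p.2.1) p.2.2) := by
    rw [prod_filter_subtype (Q := fun p : Fin 6 × Fin 6 × Fin 6 => KinU T m p.1 p.2.1 p.2.2) _
      fun p => δ₁ ((linkU c.2.2.1 (min p.1 p.2.1) (max p.1 p.2.1) p.2.2)⁻¹ *
          linkU c.2.2.1 (max p.1 p.2.1) (min p.1 p.2.1) p.2.2)]
    · refine Finset.prod_congr ?_ fun _ _ => rfl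
      ext p
      simp only [Finset.mem_filter_univ, allTets, and_assoc]
    · intro p hp
      simp only [feynCoord₁, Sum.elim_inr, uWord, if_pos hp]
  have hV : ∏ p ∈ (Finset.univ : Finset (TriIx (allTets T))).filter
      (fun p => VertU T m p.1.1 p.1.2.1 p.1.2.2), δ₁ (feynCoord₁ 𝒢 T m c (.inr p)) =
      ∏ p ∈ Finset.univ.filter (fun p : Fin 6 × Fin 6 × Fin 6 => p.1 ∈ T ∧ p.2.1 ≠ p.1 ∧
        p.2.2 ≠ p.1 ∧ p.2.2 ≠ p.2.1 ∧ VertU T m p.1 p.2.1 p.2.2),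
        δ₁ (lWord 𝒢 c p.1 (min p.2.1 p.2.2) (max p.2.1 p.2.2)) := by
    rw [prod_filter_subtype (Q := fun p : Fin 6 × Fin 6 × Fin 6 => VertU T m p.1 p.2.1 p.2.2) _
      fun p => δ₁ (lWord 𝒢 c p.1 (min p.2.1 p.2.2) (max p.2.1 p.2.2))]
    · refine Finset.prod_congr ?_ fun _ _ => rfl
      ext p
      simp only [Finset.mem_filter_univ, allTets, and_assoc]
    · intro p hp
      simp only [feynCoord₁, Sum.elim_inr, uWord, if_neg hp.not_kinU, if_pos hp]
  have hX : ∏ p ∈ (Finset.univ : Finset (FaceIx T)).filter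
      (fun p => DelX T m p.1.1 p.1.2.1 p.1.2.2), δ₂ (feynCoord₂ 𝒢 T m c (.inl p)) =
      ∏ p ∈ Finset.univ.filter (fun p : Fin 6 × Fin 6 × Fin 6 => p.1 ∈ T ∧ p.2.1 ∈ T ∧
        p.2.2 ∈ T ∧ p.1 ≠ m ∧ p.2.1 ≠ m ∧ p.2.2 ≠ m ∧ p.1 < p.2.1 ∧ p.2.1 < p.2.2),
        δ₂ (wWord 𝒢 c p.1 (sorted m p.2.1 p.2.2).1 (sorted m p.2.1 p.2.2).2.1
          (sorted m p.2.1 p.2.2).2.2) := by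
    rw [prod_filter_subtype (Q := fun p : Fin 6 × Fin 6 × Fin 6 => DelX T m p.1 p.2.1 p.2.2) _
      fun p => δ₂ (wWord 𝒢 c p.1 (sorted m p.2.1 p.2.2).1 (sorted m p.2.1 p.2.2).2.1
          (sorted m p.2.1 p.2.2).2.2)]
    · refine Finset.prod_congr ?_ fun _ _ => rfl
      ext p
      simp only [Finset.mem_filter_univ, DelX]
      grind
    · intro p hp
      simp only [feynCoord₂, Sum.elim_inl, if_pos hp]
  have hY : ∏ p ∈ (Finset.univ : Finset (EdgeIx (allTets T))).filter
      (fun p => KinY T m p.1.1 p.1.2.1 p.1.2.2.1 p.1.2.2.2), δ₂ (feynCoord₂ 𝒢 T m c (.inr p)) =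
      ∏ p ∈ Finset.univ.filter (fun p : Fin 6 × Fin 6 × Fin 6 × Fin 6 => p.1 ∈ T ∧ p.2.1 ≠ p.1 ∧
        p.2.2.1 ≠ p.1 ∧ p.2.2.1 ≠ p.2.1 ∧ p.2.2.2 ≠ p.1 ∧ p.2.2.2 ≠ p.2.1 ∧ p.2.2.1 < p.2.2.2 ∧
        KinY T m p.1 p.2.1 p.2.2.1 p.2.2.2),
        δ₂ ((wedgeY c.2.2.2 (min p.1 p.2.1) (max p.1 p.2.1) p.2.2.1 p.2.2.2)⁻¹ *
          wedgeY c.2.2.2 (max p.1 p.2.1) (min p.1 p.2.1) p.2.2.1 p.2.2.2) := by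
    rw [prod_filter_subtype
      (Q := fun p : Fin 6 × Fin 6 × Fin 6 × Fin 6 => KinY T m p.1 p.2.1 p.2.2.1 p.2.2.2) _
      fun p => δ₂ ((wedgeY c.2.2.2 (min p.1 p.2.1) (max p.1 p.2.1) p.2.2.1 p.2.2.2)⁻¹ *
          wedgeY c.2.2.2 (max p.1 p.2.1) (min p.1 p.2.1) p.2.2.1 p.2.2.2)]
    · refine Finset.prod_congr ?_ fun _ _ => rfl
      ext p
      simp only [Finset.mem_filter_univ, allTets, and_assoc]
    · intro p hp
      simp only [feynCoord₂, Sum.elim_inr, yWord, if_pos hp]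
  have hZ : ∏ p ∈ (Finset.univ : Finset (EdgeIx (allTets T))).filter
      (fun p => VertY T m p.1.1 p.1.2.1 p.1.2.2.1 p.1.2.2.2), δ₂ (feynCoord₂ 𝒢 T m c (.inr p)) =
      ∏ p ∈ Finset.univ.filter (fun p : Fin 6 × Fin 6 × Fin 6 × Fin 6 => p.1 ∈ T ∧ p.2.1 ≠ p.1 ∧
        p.2.2.1 ≠ p.1 ∧ p.2.2.1 ≠ p.2.1 ∧ p.2.2.2 ≠ p.1 ∧ p.2.2.2 ≠ p.2.1 ∧ p.2.2.1 < p.2.2.2 ∧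
        VertY T m p.1 p.2.1 p.2.2.1 p.2.2.2),
        δ₂ (wWord 𝒢 c p.1 (sorted p.2.1 p.2.2.1 p.2.2.2).1 (sorted p.2.1 p.2.2.1 p.2.2.2).2.1
          (sorted p.2.1 p.2.2.1 p.2.2.2).2.2) := by
    rw [prod_filter_subtype
      (Q := fun p : Fin 6 × Fin 6 × Fin 6 × Fin 6 => VertY T m p.1 p.2.1 p.2.2.1 p.2.2.2) _
      fun p => δ₂ (wWord 𝒢 c p.1 (sorted p.2.1 p.2.2.1 p.2.2.2).1
          (sorted p.2.1 p.2.2.1 p.2.2.2).2.1 (sorted p.2.1 p.2.2.1 p.2.2.2).2.2)]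
    · refine Finset.prod_congr ?_ fun _ _ => rfl
      ext p
      simp only [Finset.mem_filter_univ, allTets, and_assoc]
    · intro p hp
      simp only [feynCoord₂, Sum.elim_inr, yWord, if_neg hp.not_kinY, if_pos hp]
  rw [hH, hU, hV, hX, hY, hZ]
  ring

lemma wWord_of_perm3 {c : FeynmanConfig G₁ G₂ T} {s a b d i j k : Fin 6} (h : Perm3 a b d i j k)
    (hw : wWord 𝒢 c s i j k = 1) : wWord 𝒢 c s a b d = 1 := by
  rcases h with ⟨rfl, rfl, rfl⟩ | ⟨rfl, rfl, rfl⟩ | ⟨rfl, rfl, rfl⟩ | ⟨rfl, rfl, rfl⟩ |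
    ⟨rfl, rfl, rfl⟩ | ⟨rfl, rfl, rfl⟩
  · exact hw
  · exact wWord_swap hw
  · exact wWord_swap (wWord_rotate hw)
  · exact wWord_rotate (wWord_rotate hw)
  · exact wWord_rotate hw
  · exact wWord_rotate (wWord_swap hw)

/-- The factors are indexed by increasing labels; the symmetries of the words under permutations and
of redundancy give the conditions for arbitrary orders. -/
lemma feynmanDensity_kronecker_ne_zero {m : Option (Fin 6)} {c : FeynmanConfig G₁ G₂ T} :
    feynmanDensity 𝒢 T m kronecker kronecker c ≠ 0 ↔ FeynFlat 𝒢 c m := by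
  simp only [feynmanDensity, propagatorKernel, vertexKernel, mul_ne_zero_iff,
    Finset.prod_mul_distrib, Finset.prod_ne_zero_iff (s := T), Finset.prod_ne_zero_iff (s := bulkTets T),
    prod_kronecker_ne_zero]
  constructor
  · rintro ⟨⟨hu, hy⟩, hl, hw⟩
    have hu' : ∀ s ∈ T, ∀ r ∈ T, s < r → ∀ q, q ≠ s → q ≠ r →
        linkU c.2.2.1 s r q = linkU c.2.2.1 r s q := fun s hs r hr hsr q hqs hqr =>
      inv_mul_eq_one.1 (hu (s, r) (by simp [bulkTets, *]) q (by simp [*]))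
    have hy₀ : ∀ s ∈ T, ∀ r ∈ T, s < r → ∀ q p, q ≠ s → q ≠ r → p ≠ s → p ≠ r → q < p →
        wedgeY c.2.2.2 s r q p = wedgeY c.2.2.2 r s q p :=
      fun s hs r hr hsr q p hqs hqr hps hpr hqp =>
        inv_mul_eq_one.1 (hy (s, r) (by simp [bulkTets, *]) (q, p) (by simp [*]))
    have hy' : ∀ s ∈ T, ∀ r ∈ T, s < r → ∀ q p, q ≠ s → q ≠ r → p ≠ s → p ≠ r →
        wedgeY c.2.2.2 s r q p = wedgeY c.2.2.2 r s q p := by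
      intro s hs r hr hsr q p hqs hqr hps hpr
      rcases lt_trichotomy q p with h | rfl | h
      · exact hy₀ s hs r hr hsr q p hqs hqr hps hpr h
      · simp [wedgeY]
      · rw [wedgeY_swap, hy₀ s hs r hr hsr p q hps hpr hqs hqr h, wedgeY_swap c.2.2.2 r s q p, inv_inv]
    refine ⟨⟨?_, ?_⟩, ?_, ?_⟩
    · intro s hs r hr hsr q hqs hqr
      rcases lt_or_gt_of_ne hsr with h | h
      · exact hu' s hs r hr h q hqs hqr
      · exact (hu' r hr s hs h q hqr hqs).symm
    · intro s hs r hr hsr q p hqs hqr hps hpr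
      rcases lt_or_gt_of_ne hsr with h | h
      · exact hy' s hs r hr h q p hqs hqr hps hpr
      · exact (hy' r hr s hs h q p hqr hqs hpr hps).symm
    · intro s hs a b has hbs hab hR
      rcases lt_or_gt_of_ne hab with h | h
      · refine hl s hs (a, b) ?_
        simp only [vertexLinks, Finset.mem_filter_univ]
        exact ⟨has, hbs, h, fun H => hR ⟨H.1, H.2, H.2.trans h⟩⟩
      · refine lWord_swap (hl s hs (b, a) ?_)
        simp only [vertexLinks, Finset.mem_filter_univ]
        refine ⟨hbs, has, h, fun H => hR ⟨?_, H.2.trans h, H.2⟩⟩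
        have := H.1
        rwa [show ({s, b, a} : Finset (Fin 6)) = {s, a, b} by grind] at this
    · intro s hs a b d has hbs hds hab hbd had hR
      obtain ⟨i, j, k, hij, hjk, hP, -⟩ := exists_sorted hab hbd had
      refine wWord_of_perm3 hP (hw s hs (i, j, k) ?_)
      simp only [vertexWedges, Finset.mem_filter_univ]
      refine ⟨?_, ?_, ?_, hij, hjk, fun H => hR ⟨?_, ?_⟩⟩
      · unfold Perm3 at hP; omega
      · unfold Perm3 at hP; omega
      · unfold Perm3 at hP; omega
      · have := H.1
        rwa [show ({s, i, j, k} : Finset (Fin 6)) = {s, a, b, d} by unfold Perm3 at hP; grind]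
          at this
      · have := H.2
        unfold Perm3 at hP; omega
  · intro h
    refine ⟨⟨?_, ?_⟩, ?_, ?_⟩
    · rintro ⟨s, r⟩ hp q hq
      simp only [bulkTets, Finset.mem_filter_univ] at hp hq
      exact inv_mul_eq_one.2 (h.glued.u s hp.1 r hp.2.1 hp.2.2.ne q hq.1 hq.2)
    · rintro ⟨s, r⟩ hp ⟨q, p⟩ hq
      simp only [bulkTets, Finset.mem_filter_univ] at hp hq
      exact inv_mul_eq_one.2 (h.glued.y s hp.1 r hp.2.1 hp.2.2.ne q p hq.1 hq.2.1 hq.2.2.1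
        hq.2.2.2.1)
    · rintro s hs ⟨a, b⟩ hp
      simp only [vertexLinks, Finset.mem_filter_univ] at hp
      exact h.link s hs a b hp.1 hp.2.1 hp.2.2.1.ne fun H => hp.2.2.2 ⟨H.1, H.2.1⟩
    · rintro s hs ⟨a, b, d⟩ hp
      simp only [vertexWedges, Finset.mem_filter_univ] at hp
      obtain ⟨h1, h2, h3, h4, h5, h6⟩ := hp
      exact h.wedge s hs a b d h1 h2 h3 h4.ne h5.ne (h4.trans h5).ne fun H => h6 ⟨H.1, H.2.1⟩

lemma feynCoord_eq_one_iff (hm : m ∈ T) {c : FeynmanConfig G₁ G₂ T} :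
    ((∀ i ∈ feynDelta₁ T m, feynCoord₁ 𝒢 T m c i = 1) ∧
      ∀ i ∈ feynDelta₂ T m, feynCoord₂ 𝒢 T m c i = 1) ↔ FeynFlat 𝒢 c (some m) := by
  rw [← feynmanDensity_kronecker_ne_zero, feynmanDensity_eq hm, mul_ne_zero_iff,
    prod_kronecker_ne_zero, prod_kronecker_ne_zero]

lemma reducedDensity_kronecker_ne_zero {m : Option (Fin 6)} {c : ReducedConfig G₁ G₂ T} :
    reducedDensity 𝒢 T m kronecker kronecker c ≠ 0 ↔ TriFlat 𝒢 T c m ∧ EdgeFlat 𝒢 T c m := by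
  rw [triFlat_iff, edgeFlat_iff, reducedDensity, mul_ne_zero_iff, prod_kronecker_ne_zero,
    prod_kronecker_ne_zero]

lemma kronecker_eq_zero_or_one {G : Type*} [Group G] (g : G) :
    kronecker g = 0 ∨ kronecker g = 1 := by
  classical
  simp only [kronecker, Set.indicator_apply]
  split_ifs <;> simp

lemma prod_eq_zero_or_one {κ : Type*} {s : Finset κ} {f : κ → ℝ}
    (h : ∀ i ∈ s, f i = 0 ∨ f i = 1) : ∏ i ∈ s, f i = 0 ∨ ∏ i ∈ s, f i = 1 :=
  Finset.prod_induction f (fun x => x = 0 ∨ x = 1)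
    (by rintro a b (rfl | rfl) (rfl | rfl) <;> simp) (by simp) h

lemma mul_eq_zero_or_one {a b : ℝ} (ha : a = 0 ∨ a = 1) (hb : b = 0 ∨ b = 1) :
    a * b = 0 ∨ a * b = 1 := by
  rcases ha with rfl | rfl <;> rcases hb with rfl | rfl <;> simp

lemma eq_of_ne_zero_iff {a b : ℝ} (ha : a = 0 ∨ a = 1) (hb : b = 0 ∨ b = 1)
    (h : a ≠ 0 ↔ b ≠ 0) : a = b := by
  rcases ha with rfl | rfl <;> rcases hb with rfl | rfl <;> simp at h ⊢

/-- Products of Kronecker deltas take only the values `0` and `1`, so equality of the supports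
suffices; that is the implication from the kept to the omitted conditions. -/
lemma feynmanDensity_kronecker (hm : m ∈ T) (c : FeynmanConfig G₁ G₂ T) :
    feynmanDensity 𝒢 T (some m) kronecker kronecker c =
      feynmanDensity 𝒢 T none kronecker kronecker c := by
  have h : ∀ m, feynmanDensity 𝒢 T m kronecker kronecker c = 0 ∨
      feynmanDensity 𝒢 T m kronecker kronecker c = 1 := by
    intro m
    unfold feynmanDensity propagatorKernel vertexKernel
    refine mul_eq_zero_or_one (prod_eq_zero_or_one fun _ _ => ?_)
      (prod_eq_zero_or_one fun _ _ => ?_) <;>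
    · exact mul_eq_zero_or_one (prod_eq_zero_or_one fun _ _ => kronecker_eq_zero_or_one _)
        (prod_eq_zero_or_one fun _ _ => kronecker_eq_zero_or_one _)
  refine eq_of_ne_zero_iff (h _) (h _) ?_
  rw [feynmanDensity_kronecker_ne_zero, feynmanDensity_kronecker_ne_zero]
  refine ⟨fun h => h.none hm, fun h => ⟨h.glued, fun s hs a b h1 h2 h3 _ => ?_,
    fun s hs a b d h1 h2 h3 h4 h5 h6 _ => ?_⟩⟩
  · exact h.link s hs a b h1 h2 h3 (by simp [Redundant])
  · exact h.wedge s hs a b d h1 h2 h3 h4 h5 h6 (by simp [Redundant])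

lemma reducedDensity_kronecker (hm : m ∈ T) (c : ReducedConfig G₁ G₂ T) :
    reducedDensity 𝒢 T (some m) kronecker kronecker c =
      reducedDensity 𝒢 T none kronecker kronecker c := by
  have h : ∀ m, reducedDensity 𝒢 T m kronecker kronecker c = 0 ∨
      reducedDensity 𝒢 T m kronecker kronecker c = 1 := fun m =>
    mul_eq_zero_or_one (prod_eq_zero_or_one fun _ _ => kronecker_eq_zero_or_one _)
      (prod_eq_zero_or_one fun _ _ => kronecker_eq_zero_or_one _)
  refine eq_of_ne_zero_iff (h _) (h _) ?_
  rw [reducedDensity_kronecker_ne_zero, reducedDensity_kronecker_ne_zero]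
  constructor
  · rintro ⟨hT, hE⟩
    have hflat := flat_of_triFlat hm hT hE
    exact ⟨hflat.triFlat_none hT, hflat.edgeFlat_none hE⟩
  · rintro ⟨hT, hE⟩
    exact ⟨fun s r q h1 h2 h3 h4 _ => hT s r q h1 h2 h3 h4 (by simp [Redundant]),
      fun s r q p h1 h2 h3 h4 h5 h6 h7 h8 h9 h10 _ =>
        hE s r q p h1 h2 h3 h4 h5 h6 h7 h8 h9 h10 (by simp [Redundant])⟩

end FeynmanDelta

/-! ### From the Feynman integral to the amplitude -/

section Compare

/-- Every bulk tetrahedron has one half link that remains free after fusing. -/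
lemma card_freeH : ∀ T : Finset (Fin 6), (Finset.univ.filter fun p : Fin 6 × Fin 6 =>
    p ∈ allTets T ∧ p.2 ∈ T ∧ p.2 < p.1).card = T.card.choose 2 := by
  decide +kernel

/-- A free `u` belongs to a bulk tetrahedron and a triangle whose base is neither of its two
4-simplices. This forces the triangle into the bulk, and leaves one pair away from the base. -/
lemma card_freeU : ∀ (T : Finset (Fin 6)) (m : Fin 6), m ∈ T →
    ((Finset.univ.filter fun p : Fin 6 × Fin 6 × Fin 6 =>
        p.1 < p.2.1 ∧ p.2.2 ≠ p.1 ∧ p.2.2 ≠ p.2.1).filter fun p =>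
      p.1 ∈ T ∧ p.2.1 ∈ T ∧ ¬ Base3 T m p.1 p.2.1 p.2.2 ∧ ¬ Base3 T m p.2.1 p.1 p.2.2).card =
      T.card.choose 3 := by
  decide +kernel

/-- Similarly, an edge with three indices in `T` has one pair of 4-simplices away from its base, and
an edge with four indices in `T` has three such pairs. -/
lemma card_freeY : ∀ (T : Finset (Fin 6)) (m : Fin 6), m ∈ T →
    ((Finset.univ.filter fun p : Fin 6 × Fin 6 × Fin 6 × Fin 6 => p.1 < p.2.1 ∧
        p.2.2.1 < p.2.2.2 ∧ p.2.2.1 ≠ p.1 ∧ p.2.2.1 ≠ p.2.1 ∧ p.2.2.2 ≠ p.1 ∧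
        p.2.2.2 ≠ p.2.1).filter fun p =>
      p.1 ∈ T ∧ p.2.1 ∈ T ∧ ¬ Base4 T m p.1 p.2.1 p.2.2.1 p.2.2.2 ∧
        ¬ Base4 T m p.2.1 p.1 p.2.2.1 p.2.2.2).card =
      T.card.choose 3 * (6 - T.card) + 3 * T.card.choose 4 := by
  decide +kernel

variable (T : Finset (Fin 6)) (m : Fin 6)

/-- The `G₁` coordinates of the Feynman integral on which the integrand does not depend. -/
def feynFree₁ : Finset (FeynIx₁ T) :=
  (Finset.univ.filter fun p : TetIx (allTets T) => p.1.2 ∈ T ∧ p.1.2 < p.1.1).disjSum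
    (Finset.univ.filter fun p : TriIx (allTets T) => p.1.1 < p.1.2.1 ∧ p.1.2.1 ∈ T ∧
      ¬ Base3 T m p.1.1 p.1.2.1 p.1.2.2 ∧ ¬ Base3 T m p.1.2.1 p.1.1 p.1.2.2)

/-- The `G₂` coordinates of the Feynman integral on which the integrand does not depend. -/
def feynFree₂ : Finset (FeynIx₂ T) :=
  (∅ : Finset (FaceIx T)).disjSum
    (Finset.univ.filter fun p : EdgeIx (allTets T) => p.1.1 < p.1.2.1 ∧ p.1.2.1 ∈ T ∧
      ¬ Base4 T m p.1.1 p.1.2.1 p.1.2.2.1 p.1.2.2.2 ∧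
      ¬ Base4 T m p.1.2.1 p.1.1 p.1.2.2.1 p.1.2.2.2)

variable {T m}

lemma card_feynFree₁ (hm : m ∈ T) :
    (feynFree₁ T m).card = T.card.choose 2 + T.card.choose 3 := by
  rw [feynFree₁, Finset.card_disjSum, ← card_freeH T, ← card_freeU T m hm, Finset.filter_filter]
  refine congrArg₂ (· + ·) (card_filter_subtype (P := fun p => p ∈ allTets T)
    (Q := fun p : Fin 6 × Fin 6 => p.2 ∈ T ∧ p.2 < p.1)) ((card_filter_subtype
    (P := fun p : Fin 6 × Fin 6 × Fin 6 => (p.1, p.2.1) ∈ allTets T ∧ p.2.2 ≠ p.1 ∧ p.2.2 ≠ p.2.1)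
    (Q := fun p => p.1 < p.2.1 ∧ p.2.1 ∈ T ∧ ¬ Base3 T m p.1 p.2.1 p.2.2 ∧
      ¬ Base3 T m p.2.1 p.1 p.2.2)).trans (congrArg Finset.card (Finset.filter_congr ?_)))
  rintro ⟨s, a, b⟩ -
  simp only [allTets, Finset.mem_filter_univ]
  have : s < a → a ≠ s := fun h => h.ne'
  tauto

lemma card_feynFree₂ (hm : m ∈ T) :
    (feynFree₂ T m).card = T.card.choose 3 * (6 - T.card) + 3 * T.card.choose 4 := by
  rw [feynFree₂, Finset.card_disjSum, Finset.card_empty, zero_add, ← card_freeY T m hm,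
    Finset.filter_filter]
  refine (card_filter_subtype
    (P := fun p : Fin 6 × Fin 6 × Fin 6 × Fin 6 => (p.1, p.2.1) ∈ allTets T ∧ p.2.2.1 ≠ p.1 ∧
      p.2.2.1 ≠ p.2.1 ∧ p.2.2.2 ≠ p.1 ∧ p.2.2.2 ≠ p.2.1 ∧ p.2.2.1 < p.2.2.2)
    (Q := fun p => p.1 < p.2.1 ∧ p.2.1 ∈ T ∧ ¬ Base4 T m p.1 p.2.1 p.2.2.1 p.2.2.2 ∧
      ¬ Base4 T m p.2.1 p.1 p.2.2.1 p.2.2.2)).trans (congrArg Finset.card (Finset.filter_congr ?_))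
  rintro ⟨s, a, b, d⟩ -
  simp only [allTets, Finset.mem_filter_univ]
  have : s < a → a ≠ s := fun h => h.ne'
  constructor
  · rintro ⟨⟨⟨h1, h2⟩, h3, h4, h5, h6, h7⟩, h8, h9, h10, h11⟩
    exact ⟨⟨h8, h7, h3, h4, h5, h6⟩, h1, h9, h10, h11⟩
  · rintro ⟨⟨h8, h7, h3, h4, h5, h6⟩, h1, h9, h10, h11⟩
    exact ⟨⟨⟨h1, h8.ne'⟩, h3, h4, h5, h6, h7⟩, h8, h9, h10, h11⟩

lemma bulkTets_subset_allTets : bulkTets T ⊆ allTets T := fun p hp => by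
  simp only [bulkTets, allTets, Finset.mem_filter_univ] at hp ⊢
  exact ⟨hp.1, hp.2.2.ne'⟩

lemma boundaryTets_subset_allTets : boundaryTets T ⊆ allTets T := fun p hp => by
  simp only [boundaryTets, allTets, Finset.mem_filter_univ] at hp ⊢
  exact ⟨hp.1, fun h => hp.2 (h ▸ hp.1)⟩

variable (T)

/-- The coordinates of the reduced amplitude among those of the Feynman integral. -/
def fuseIx₁ : RedIx₁ T → FeynIx₁ T :=
  Sum.elim (fun p => .inl ⟨p.1, bulkTets_subset_allTets p.2⟩)
    (Sum.elim (fun p => .inl ⟨p.1, boundaryTets_subset_allTets p.2⟩)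
      fun p => .inr ⟨p.1, boundaryTets_subset_allTets p.2.1, p.2.2⟩)

/-- The coordinates of the reduced amplitude among those of the Feynman integral. -/
def fuseIx₂ : RedIx₂ T → FeynIx₂ T :=
  Sum.elim .inl fun p => .inr ⟨p.1, boundaryTets_subset_allTets p.2.1, p.2.2⟩

variable {T}

lemma fuseIx₁_injective : Function.Injective (fuseIx₁ T) := by
  rintro (⟨p, hp⟩ | ⟨p, hp⟩ | ⟨p, hp⟩) (⟨q, hq⟩ | ⟨q, hq⟩ | ⟨q, hq⟩) h <;>
    simp only [fuseIx₁, Sum.elim_inl, Sum.elim_inr, Sum.inl.injEq, Sum.inr.injEq, Subtype.mk.injEq,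
      reduceCtorEq] at h <;> subst h <;> try rfl
  all_goals
    simp only [bulkTets, boundaryTets, Finset.mem_filter_univ] at hp hq
    tauto

lemma fuseIx₂_injective : Function.Injective (fuseIx₂ T) := by
  rintro (⟨p, hp⟩ | ⟨p, hp⟩) (⟨q, hq⟩ | ⟨q, hq⟩) h <;>
    simp only [fuseIx₂, Sum.elim_inl, Sum.elim_inr, Sum.inl.injEq, Sum.inr.injEq, Subtype.mk.injEq,
      reduceCtorEq] at h <;> subst h <;> rfl

/-- On a boundary tetrahedron both charts choose the same dependent `u`: no kinetic kernel is
present, and the base is the first index inside `T`. -/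
lemma kinU_or_vertU_iff {s a b : Fin 6} (hs : s ∈ T) (ha : a ∉ T) :
    KinU T m s a b ∨ VertU T m s a b ↔ DelU T s a b := by
  unfold KinU VertU DelU Base3; tauto

lemma kinY_or_vertY_iff {s a b d : Fin 6} (hs : s ∈ T) (ha : a ∉ T) :
    KinY T m s a b d ∨ VertY T m s a b d ↔ DelY T s a b d := by
  simp only [KinY, VertY, DelY, DelU, Base4, hs, ha]
  by_cases hb : b ∈ T <;> by_cases hd : d ∈ T <;> simp only [hb, hd] <;> grind

lemma fuseIx₁_mem (k : RedIx₁ T) : fuseIx₁ T k ∈ feynDelta₁ T m ↔ k ∈ redDelta₁ T m := by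
  obtain ⟨⟨s, r⟩, hp⟩ | ⟨⟨s, r⟩, hp⟩ | ⟨⟨s, a, b⟩, hp⟩ := k
  · simp only [bulkTets, Finset.mem_filter_univ] at hp
    simp only [fuseIx₁, Sum.elim_inl, feynDelta₁, redDelta₁, Finset.inl_mem_disjSum,
      Finset.mem_filter_univ]
    unfold DelH
    tauto
  · simp only [boundaryTets, Finset.mem_filter_univ] at hp
    simp only [fuseIx₁, Sum.elim_inl, Sum.elim_inr, feynDelta₁, redDelta₁, Finset.inl_mem_disjSum,
      Finset.inr_mem_disjSum, Finset.mem_filter_univ, Finset.notMem_empty]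
    unfold DelH
    tauto
  · simp only [boundaryTets, Finset.mem_filter_univ] at hp
    simp only [fuseIx₁, Sum.elim_inr, feynDelta₁, redDelta₁,
      Finset.inr_mem_disjSum, Finset.mem_filter_univ]
    exact kinU_or_vertU_iff hp.1.1 hp.1.2

lemma fuseIx₂_mem (k : RedIx₂ T) : fuseIx₂ T k ∈ feynDelta₂ T m ↔ k ∈ redDelta₂ T m := by
  obtain p | ⟨⟨s, a, b, d⟩, hp⟩ := k
  · simp only [fuseIx₂, Sum.elim_inl, feynDelta₂, redDelta₂, Finset.inl_mem_disjSum]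
  · simp only [boundaryTets, Finset.mem_filter_univ] at hp
    simp only [fuseIx₂, Sum.elim_inr, feynDelta₂, redDelta₂,
      Finset.inr_mem_disjSum, Finset.mem_filter_univ]
    exact kinY_or_vertY_iff hp.1.1 hp.1.2

lemma fuseIx₁_range (i : FeynIx₁ T) :
    (i ∉ feynDelta₁ T m ∧ i ∉ Set.range (fuseIx₁ T)) ↔ i ∈ feynFree₁ T m := by
  obtain ⟨⟨s, r⟩, hp⟩ | ⟨⟨s, a, b⟩, hp⟩ := i
  · have hr : (Sum.inl ⟨(s, r), hp⟩ : FeynIx₁ T) ∈ Set.range (fuseIx₁ T) ↔ r ∉ T ∨ s < r := by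
      have hp' := hp
      simp only [allTets, Finset.mem_filter_univ] at hp'
      constructor
      · rintro ⟨⟨q, hq⟩ | ⟨q, hq⟩ | ⟨q, hq⟩, h⟩ <;>
        simp only [fuseIx₁, Sum.elim_inl, Sum.elim_inr, Sum.inl.injEq, Subtype.mk.injEq,
          reduceCtorEq] at h <;> subst h <;>
        simp only [bulkTets, boundaryTets, Finset.mem_filter_univ] at hq <;> tauto
      · intro h
        by_cases hr : r ∈ T
        · exact ⟨.inl ⟨(s, r), by simp only [bulkTets, Finset.mem_filter_univ]; tauto⟩, rfl⟩
        · exact ⟨.inr (.inl ⟨(s, r), by simp only [boundaryTets, Finset.mem_filter_univ]; tauto⟩),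
            rfl⟩
    rw [hr]
    simp only [allTets, Finset.mem_filter_univ] at hp
    simp only [feynDelta₁, feynFree₁, Finset.inl_mem_disjSum, Finset.mem_filter_univ]
    unfold DelH
    grind
  · have hr : (Sum.inr ⟨(s, a, b), hp⟩ : FeynIx₁ T) ∈ Set.range (fuseIx₁ T) ↔ a ∉ T := by
      have hp' := hp
      simp only [allTets, Finset.mem_filter_univ] at hp'
      constructor
      · rintro ⟨⟨q, hq⟩ | ⟨q, hq⟩ | ⟨q, hq⟩, h⟩ <;>
        simp only [fuseIx₁, Sum.elim_inl, Sum.elim_inr, Sum.inr.injEq, Subtype.mk.injEq,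
          reduceCtorEq] at h
        subst h
        simp only [boundaryTets, Finset.mem_filter_univ] at hq
        tauto
      · intro h
        exact ⟨.inr (.inr ⟨(s, a, b), by simp only [boundaryTets, Finset.mem_filter_univ]; tauto⟩),
          rfl⟩
    rw [hr]
    simp only [allTets, Finset.mem_filter_univ] at hp
    simp only [feynDelta₁, feynFree₁, Finset.inr_mem_disjSum, Finset.mem_filter_univ]
    unfold KinU VertU
    grind

lemma fuseIx₂_range (i : FeynIx₂ T) :
    (i ∉ feynDelta₂ T m ∧ i ∉ Set.range (fuseIx₂ T)) ↔ i ∈ feynFree₂ T m := by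
  obtain p | ⟨⟨s, a, b, d⟩, hp⟩ := i
  · have : (Sum.inl p : FeynIx₂ T) ∈ Set.range (fuseIx₂ T) := ⟨.inl p, rfl⟩
    simp [this, feynFree₂]
  · have hr : (Sum.inr ⟨(s, a, b, d), hp⟩ : FeynIx₂ T) ∈ Set.range (fuseIx₂ T) ↔ a ∉ T := by
      have hp' := hp
      simp only [allTets, Finset.mem_filter_univ] at hp'
      constructor
      · rintro ⟨⟨q, hq⟩ | ⟨q, hq⟩, h⟩ <;>
        simp only [fuseIx₂, Sum.elim_inl, Sum.elim_inr, Sum.inr.injEq, Subtype.mk.injEq,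
          reduceCtorEq] at h
        subst h
        simp only [boundaryTets, Finset.mem_filter_univ] at hq
        exact hq.1.2
      · intro h
        exact ⟨.inr ⟨(s, a, b, d), by
          simp only [boundaryTets, Finset.mem_filter_univ]; exact ⟨⟨hp'.1.1, h⟩, hp'.2⟩⟩, rfl⟩
    rw [hr]
    simp only [allTets, Finset.mem_filter_univ] at hp
    simp only [feynDelta₂, feynFree₂, Finset.inr_mem_disjSum, Finset.mem_filter_univ]
    unfold KinY VertY
    grind

variable {G₁ G₂ : Type*} [Group G₁] [Group G₂] {𝒢 : CrossedModule G₁ G₂}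

/-- On the support the constrained coordinates of both charts are `1`, because flatness passes to
the fused configuration. The unconstrained ones were defined by the same formulas. -/
lemma redCoord_fuse (hm : m ∈ T) {c : FeynmanConfig G₁ G₂ T}
    (h₁ : ∀ i ∈ feynDelta₁ T m, feynCoord₁ 𝒢 T m c i = 1)
    (h₂ : ∀ i ∈ feynDelta₂ T m, feynCoord₂ 𝒢 T m c i = 1) :
    (redCoord₁ 𝒢 T m (fuse c), redCoord₂ 𝒢 T m (fuse c)) =
      (feynCoord₁ 𝒢 T m c ∘ fuseIx₁ T, feynCoord₂ 𝒢 T m c ∘ fuseIx₂ T) := by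
  have hF := (feynCoord_eq_one_iff hm).1 ⟨h₁, h₂⟩
  obtain ⟨hr₁, hr₂⟩ := (redCoord_eq_one_iff hm).2 ⟨hF.triFlat, hF.edgeFlat hm⟩
  congr 1
  · funext k
    by_cases hk : k ∈ redDelta₁ T m
    · rw [hr₁ k hk]
      exact (h₁ _ ((fuseIx₁_mem k).2 hk)).symm
    obtain ⟨⟨s, r⟩, hp⟩ | ⟨⟨s, r⟩, hp⟩ | ⟨⟨s, a, b⟩, hp⟩ := k
    · simp only [redDelta₁, Finset.inl_mem_disjSum, Finset.mem_filter_univ] at hk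
      obtain ⟨hs, hr, hsr⟩ : s ∈ T ∧ r ∈ T ∧ s < r := by
        simpa [bulkTets] using hp
      have h3 : ¬ DelH T m s r := fun h => hk ⟨h.2.1, h.2.2.1⟩
      have h4 : (s = m ∨ r = m) ∧ s < r := ⟨by tauto, hsr⟩
      simp only [redCoord₁, feynCoord₁, Function.comp, fuseIx₁, Sum.elim_inl, if_neg hk]
      rw [hWord, if_neg h3, if_pos hr, if_pos h4]
      rfl
    · obtain ⟨hs, hr⟩ : s ∈ T ∧ r ∉ T := by simpa [boundaryTets] using hp
      have h3 : ¬ DelH T m s r := fun h => hr h.1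
      simp only [redCoord₁, feynCoord₁, Function.comp, fuseIx₁, Sum.elim_inl, Sum.elim_inr]
      rw [hWord, if_neg h3, if_neg hr]
    · simp only [redDelta₁, Finset.inr_mem_disjSum, Finset.mem_filter_univ] at hk
      have hp' := hp
      simp only [boundaryTets, Finset.mem_filter_univ] at hp'
      have h3 := (kinU_or_vertU_iff (m := m) hp'.1.1 hp'.1.2).not.2 hk
      rw [not_or] at h3
      simp only [redCoord₁, feynCoord₁, Function.comp, fuseIx₁, Sum.elim_inr, if_neg hk]
      rw [uWord, if_neg h3.1, if_neg h3.2]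
      rfl
  · funext k
    by_cases hk : k ∈ redDelta₂ T m
    · rw [hr₂ k hk]
      exact (h₂ _ ((fuseIx₂_mem k).2 hk)).symm
    obtain p | ⟨⟨s, a, b, d⟩, hp⟩ := k
    · simp only [redDelta₂, Finset.inl_mem_disjSum, Finset.mem_filter_univ] at hk
      simp only [redCoord₂, feynCoord₂, Function.comp, fuseIx₂, Sum.elim_inl, if_neg hk]
    · simp only [redDelta₂, Finset.inr_mem_disjSum, Finset.mem_filter_univ] at hk
      have hp' := hp
      simp only [boundaryTets, Finset.mem_filter_univ] at hp'
      have h3 := (kinY_or_vertY_iff (m := m) hp'.1.1 hp'.1.2).not.2 hk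
      rw [not_or] at h3
      simp only [redCoord₂, feynCoord₂, Function.comp, fuseIx₂, Sum.elim_inr, if_neg hk]
      rw [yWord, if_neg h3.1, if_neg h3.2]
      rfl

end Compare

/-! ### The Feynman integral in terms of the amplitude -/

section Integral

variable {G₁ G₂ : Type*} [Group G₁] [TopologicalSpace G₁] [IsTopologicalGroup G₁] [T2Space G₁]
  [LocallyCompactSpace G₁] [SecondCountableTopology G₁] [MeasurableSpace G₁] [BorelSpace G₁]
  [Group G₂] [TopologicalSpace G₂] [IsTopologicalGroup G₂] [T2Space G₂]
  [LocallyCompactSpace G₂] [SecondCountableTopology G₂] [MeasurableSpace G₂] [BorelSpace G₂]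

lemma measurable_reducedBoundary {T : Finset (Fin 6)} :
    Measurable (reducedBoundary : ReducedConfig G₁ G₂ T → BoundaryData G₁ G₂) := by
  have hu : ∀ s r q, Measurable fun c : ReducedConfig G₁ G₂ T => linkU c.2.2.2.1 s r q := by
    intro s r q
    unfold linkU
    split_ifs <;> fun_prop
  have hy : ∀ s r q p, Measurable fun c : ReducedConfig G₁ G₂ T => wedgeY c.2.2.2.2 s r q p := by
    intro s r q p
    unfold wedgeY
    split_ifs <;> fun_prop
  unfold reducedBoundary restrictBoundary
  refine Measurable.prodMk ?_ ?_
  · refine measurable_pi_iff.2 fun s => measurable_pi_iff.2 fun r => measurable_pi_iff.2 fun q => ?_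
    split_ifs
    · exact hu _ _ _
    · exact hu _ _ _
    · exact measurable_const
  · refine measurable_pi_iff.2 fun s => measurable_pi_iff.2 fun r => measurable_pi_iff.2 fun q =>
      measurable_pi_iff.2 fun p => ?_
    split_ifs
    · exact hy _ _ _ _
    · exact hy _ _ _ _
    · exact measurable_const

variable {μ₁ : Measure G₁} [μ₁.IsHaarMeasure] [μ₁.IsMulRightInvariant]
  {μ₂ : Measure G₂} [μ₂.IsHaarMeasure] [μ₂.IsMulRightInvariant]
  {𝒢 : CrossedModule G₁ G₂} {T : Finset (Fin 6)} {m : Fin 6}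

theorem feynmanIntegral_some (hm : m ∈ T) (ht : Continuous 𝒢.t)
    (hact : Continuous fun p : G₁ × G₂ => 𝒢.act p.1 p.2)
    (hμ₂ : ∀ g : G₁, MeasurePreserving (fun y => 𝒢.act g y) μ₂ μ₂) :
    (∃ ν, IsDeltaMeasure μ₁ μ₂ (feynmanVolume μ₁ μ₂ T) (feynmanDensity 𝒢 T (some m)) ν) ∧
    (∃ ν, IsDeltaMeasure μ₁ μ₂ (reducedVolume μ₁ μ₂ T) (reducedDensity 𝒢 T (some m)) ν) ∧
    ∀ F : BoundaryData G₁ G₂ → ENNReal, Measurable F →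
      feynmanIntegral μ₁ μ₂ 𝒢 T (some m) F =
        μ₁ Set.univ ^ (T.card.choose 2 + T.card.choose 3) *
          μ₂ Set.univ ^ (T.card.choose 3 * (6 - T.card) + 3 * T.card.choose 4) *
          amplitude μ₁ μ₂ 𝒢 T (some m) F := by
  haveI := regular_of_secondCountable μ₁
  haveI := regular_of_secondCountable μ₂
  haveI := isInvInvariant_of_unimodular μ₁
  haveI := isInvInvariant_of_unimodular μ₂
  obtain ⟨E, hE, hEc⟩ := exists_feynChart (μ₁ := μ₁) (μ₂ := μ₂) hm ht hact hμ₂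
  obtain ⟨E', hE', hEc'⟩ := exists_redChart (μ₁ := μ₁) (μ₂ := μ₂) hm ht hact hμ₂
  have hdelta := isDeltaMeasure_of_chart μ₁ μ₂ (feynDelta₁ T m) (feynDelta₂ T m)
    (ρ := feynmanDensity 𝒢 T (some m)) E hE fun δ₁ δ₂ c => by
      rw [feynmanDensity_eq hm, hEc]
  have hdelta' := isDeltaMeasure_of_chart μ₁ μ₂ (redDelta₁ T m) (redDelta₂ T m)
    (ρ := reducedDensity 𝒢 T (some m)) E' hE' fun δ₁ δ₂ c => by
      rw [reducedDensity_eq hm, hEc']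
  refine ⟨⟨_, hdelta⟩, ⟨_, hdelta'⟩, fun F hF => ?_⟩
  unfold feynmanIntegral amplitude
  rw [hdelta.deltaMeasure_eq, hdelta'.deltaMeasure_eq, ← card_feynFree₁ hm, ← card_feynFree₂ hm]
  -- Fusing the half links is the map between the two configuration spaces; it preserves the
  -- boundary data everywhere and matches the charts on the support.
  refine lintegral_chart_eq μ₁ μ₂ (feynDelta₁ T m) (feynDelta₂ T m) (redDelta₁ T m)
    (redDelta₂ T m) E E' (fuseIx₁ T) (fuseIx₂ T) fuseIx₁_injective fuseIx₂_injective fuseIx₁_mem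
    fuseIx₂_mem fuseIx₁_range fuseIx₂_range fuse ?_ feynmanBoundary reducedBoundary
    measurable_reducedBoundary (fun c _ _ => reducedBoundary_fuse c) F hF
  intro c h₁ h₂
  rw [hEc] at h₁ h₂ ⊢
  rw [hEc']
  exact redCoord_fuse hm h₁ h₂

end Integral

/-! ### Finite groups -/

section Finite

/-- In a discrete group `{1}` is a neighbourhood of `1`, so the neighbourhoods eventually are `{1}`.
-/
lemma eventually_nascentDelta_count {G : Type*} [Group G] [TopologicalSpace G]
    [DiscreteTopology G] [MeasurableSpace G] [BorelSpace G] :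
    ∀ᶠ U in shrinking G, nascentDelta Measure.count U = kronecker := by
  filter_upwards [eventually_shrinking (show ({1} : Set G) ∈ 𝓝 1 by simp)] with U hU
  have : U = {1} := hU.1.antisymm (Set.singleton_subset_iff.2 (mem_of_mem_nhds hU.2.1))
  subst this
  funext g
  simp [nascentDelta, kronecker]

lemma pi_count {ι G : Type*} [Fintype ι] [MeasurableSpace G] [MeasurableSingletonClass G]
    [Finite G] : (Measure.pi fun _ : ι => (Measure.count : Measure G)) = Measure.count := by
  rw [Measure.ext_iff_singleton]
  intro x
  rw [Measure.pi_singleton]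
  simp

lemma measurableSingletonClass_and_count_prod_count {α β : Type*} [MeasurableSpace α] [MeasurableSpace β]
    [MeasurableSingletonClass α] [MeasurableSingletonClass β] [Finite α] [Finite β] :
    MeasurableSingletonClass (α × β) ∧
      (Measure.count : Measure α).prod (Measure.count : Measure β) = Measure.count := by
  refine ⟨inferInstance, ?_⟩
  rw [Measure.ext_iff_singleton]
  rintro ⟨x, y⟩
  rw [← Set.singleton_prod_singleton, Measure.prod_prod, Set.singleton_prod_singleton]
  simp

variable {G₁ G₂ : Type*} [Group G₁] [TopologicalSpace G₁] [MeasurableSpace G₁] [BorelSpace G₁]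
  [T2Space G₁] [Group G₂] [TopologicalSpace G₂] [MeasurableSpace G₂] [BorelSpace G₂]
  [T2Space G₂] [Finite G₁] [Finite G₂]

lemma eventually_density_count {M : Type*} (ρ : (G₁ → ℝ) → (G₂ → ℝ) → M → ℝ) :
    ∀ᶠ U in shrinking G₁ ×ˢ shrinking G₂,
      ρ (nascentDelta Measure.count U.1) (nascentDelta Measure.count U.2) =
        ρ kronecker kronecker := by
  have h := (eventually_nascentDelta_count (G := G₁)).prod_mk
    (eventually_nascentDelta_count (G := G₂))
  filter_upwards [h] with U hU
  rw [hU.1, hU.2]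

/-- The net in the definition of the limit is eventually constant, so only the value of the density
at the Kronecker deltas counts. -/
lemma isDeltaMeasure_count_congr {M : Type*} [TopologicalSpace M] [MeasurableSpace M]
    {vol : Measure M} {ρ ρ' : (G₁ → ℝ) → (G₂ → ℝ) → M → ℝ}
    (h : ρ kronecker kronecker = ρ' kronecker kronecker) :
    IsDeltaMeasure (G₁ := G₁) (G₂ := G₂) Measure.count Measure.count vol ρ =
      IsDeltaMeasure Measure.count Measure.count vol ρ' := by
  funext ν
  refine propext (and_congr_right fun _ => forall_congr' fun φ => forall_congr' fun _ =>
    forall_congr' fun _ => tendsto_congr' ?_)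
  filter_upwards [eventually_density_count ρ, eventually_density_count ρ'] with U h₁ h₂
  rw [h₁, h₂, h]

lemma isDeltaMeasure_count {M : Type*} [TopologicalSpace M] [MeasurableSpace M] [Finite M]
    [MeasurableSingletonClass M] {ρ : (G₁ → ℝ) → (G₂ → ℝ) → M → ℝ}
    (h : ∀ x, 0 ≤ ρ kronecker kronecker x) :
    IsDeltaMeasure (G₁ := G₁) (G₂ := G₂) Measure.count Measure.count Measure.count ρ
      (Measure.count.withDensity fun x => ENNReal.ofReal (ρ kronecker kronecker x)) := by
  haveI : IsFiniteMeasure ((Measure.count : Measure M).withDensity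
      fun x => ENNReal.ofReal (ρ kronecker kronecker x)) :=
    isFiniteMeasure_withDensity_ofReal Integrable.of_finite.2
  refine ⟨inferInstance, fun φ _ _ => ?_⟩
  refine (tendsto_congr' ?_).2 tendsto_const_nhds
  filter_upwards [eventually_density_count ρ] with U hU
  rw [hU]
  have := integral_withDensity_eq_integral_smul (μ := (Measure.count : Measure M))
    (f := fun x => (ρ kronecker kronecker x).toNNReal) (measurable_of_finite _) φ
  refine Eq.trans (integral_congr_ae (Eventually.of_forall fun x => ?_)) this.symm
  simp only [NNReal.smul_def, smul_eq_mul, Real.coe_toNNReal _ (h x)]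
  ring

lemma kronecker_nonneg {G : Type*} [Group G] (g : G) : 0 ≤ kronecker g :=
  Set.indicator_nonneg (fun _ _ => zero_le_one) g

variable [IsTopologicalGroup G₁] [IsTopologicalGroup G₂]

lemma feynmanVolume_count (T : Finset (Fin 6)) : feynmanVolume (G₁ := G₁) (G₂ := G₂)
    Measure.count Measure.count T = Measure.count := by
  unfold feynmanVolume
  rw [pi_count, pi_count, pi_count, pi_count]
  obtain ⟨h₁, e₁⟩ := measurableSingletonClass_and_count_prod_count
    (α := TriIx (allTets T) → G₁) (β := EdgeIx (allTets T) → G₂)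
  obtain ⟨h₂, e₂⟩ := measurableSingletonClass_and_count_prod_count
    (α := TetIx (allTets T) → G₁) (β := (TriIx (allTets T) → G₁) × (EdgeIx (allTets T) → G₂))
  rw [e₁, e₂, (measurableSingletonClass_and_count_prod_count).2]

lemma reducedVolume_count (T : Finset (Fin 6)) : reducedVolume (G₁ := G₁) (G₂ := G₂)
    Measure.count Measure.count T = Measure.count := by
  unfold reducedVolume
  rw [pi_count, pi_count, pi_count, pi_count, pi_count]
  obtain ⟨h₁, e₁⟩ := measurableSingletonClass_and_count_prod_count
    (α := TriIx (boundaryTets T) → G₁) (β := EdgeIx (boundaryTets T) → G₂)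
  obtain ⟨h₂, e₂⟩ := measurableSingletonClass_and_count_prod_count
    (α := TetIx (boundaryTets T) → G₁)
    (β := (TriIx (boundaryTets T) → G₁) × (EdgeIx (boundaryTets T) → G₂))
  obtain ⟨h₃, e₃⟩ := measurableSingletonClass_and_count_prod_count
    (α := TetIx (bulkTets T) → G₁) (β := (TetIx (boundaryTets T) → G₁) ×
      (TriIx (boundaryTets T) → G₁) × (EdgeIx (boundaryTets T) → G₂))
  rw [e₁, e₂, e₃, (measurableSingletonClass_and_count_prod_count).2]

lemma lintegral_deltaMeasure_count {M : Type*} [TopologicalSpace M] [DiscreteTopology M]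
    [MeasurableSpace M] [BorelSpace M] [Finite M] {ρ : (G₁ → ℝ) → (G₂ → ℝ) → M → ℝ}
    [SecondCountableTopology G₁] [LocallyCompactSpace G₁] [SecondCountableTopology G₂]
    [LocallyCompactSpace G₂]
    [(Measure.count : Measure G₁).IsHaarMeasure] [(Measure.count : Measure G₂).IsHaarMeasure]
    [(Measure.count : Measure G₁).IsMulRightInvariant]
    [(Measure.count : Measure G₂).IsMulRightInvariant]
    (h : ∀ x, 0 ≤ ρ kronecker kronecker x) (F : M → ENNReal) :
    ∫⁻ x, F x ∂(deltaMeasure (G₁ := G₁) (G₂ := G₂) Measure.count Measure.count Measure.count ρ) =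
      ∑' x, ENNReal.ofReal (ρ kronecker kronecker x) * F x := by
  rw [(isDeltaMeasure_count h).deltaMeasure_eq, lintegral_withDensity_eq_lintegral_mul _
    (measurable_of_finite _) (measurable_of_finite _), lintegral_count]
  rfl

end Finite

/-! ### Independence of the choices and of the side of the cut -/

section Main

variable {G₁ G₂ : Type*} [Group G₁] [TopologicalSpace G₁] [IsTopologicalGroup G₁] [T2Space G₁]
  [LocallyCompactSpace G₁] [SecondCountableTopology G₁] [MeasurableSpace G₁] [BorelSpace G₁]
  [Group G₂] [TopologicalSpace G₂] [IsTopologicalGroup G₂] [T2Space G₂]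
  [LocallyCompactSpace G₂] [SecondCountableTopology G₂] [MeasurableSpace G₂] [BorelSpace G₂]
  {μ₁ : Measure G₁} [μ₁.IsHaarMeasure] [μ₁.IsMulRightInvariant]
  {μ₂ : Measure G₂} [μ₂.IsHaarMeasure] [μ₂.IsMulRightInvariant]
  (𝒢 : CrossedModule G₁ G₂) {T : Finset (Fin 6)} {m : Option (Fin 6)}

/-- For finite groups, omitting nothing gives the same Kronecker density, hence the same limit, as
omitting the delta functions that are redundant with respect to any 4-simplex of `T`. -/
lemma Admissible.exists_some (h : Admissible μ₁ μ₂ T m) (hT : T.Nonempty) : ∃ i ∈ T,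
    IsDeltaMeasure μ₁ μ₂ (feynmanVolume μ₁ μ₂ T) (feynmanDensity 𝒢 T m) =
      IsDeltaMeasure μ₁ μ₂ (feynmanVolume μ₁ μ₂ T) (feynmanDensity 𝒢 T (some i)) ∧
    IsDeltaMeasure μ₁ μ₂ (reducedVolume μ₁ μ₂ T) (reducedDensity 𝒢 T m) =
      IsDeltaMeasure μ₁ μ₂ (reducedVolume μ₁ μ₂ T) (reducedDensity 𝒢 T (some i)) := by
  rcases m with _ | i
  · obtain ⟨i, hi⟩ := hT
    obtain ⟨_, _, rfl, rfl⟩ := h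
    exact ⟨i, hi, isDeltaMeasure_count_congr (funext fun c => (feynmanDensity_kronecker hi c).symm),
      isDeltaMeasure_count_congr (funext fun c => (reducedDensity_kronecker hi c).symm)⟩
  · exact ⟨i, h, rfl, rfl⟩

lemma deltaMeasure_congr {M : Type*} [TopologicalSpace M] [MeasurableSpace M] {vol : Measure M}
    {ρ ρ' : (G₁ → ℝ) → (G₂ → ℝ) → M → ℝ}
    (h : IsDeltaMeasure μ₁ μ₂ vol ρ = IsDeltaMeasure μ₁ μ₂ vol ρ') :
    deltaMeasure μ₁ μ₂ vol ρ = deltaMeasure μ₁ μ₂ vol ρ' := by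
  unfold deltaMeasure
  rw [h]

variable {𝒢}

/-- The right-hand side depends on `T` only through its cardinality, and on the cut through `S`. The
reference 4-simplex has disappeared. -/
theorem amplitude_eq_rim {S : Finset (Fin 6)} (h : Admissible μ₁ μ₂ T m) (hT : T.Nonempty)
    (ht : Continuous 𝒢.t) (hact : Continuous fun p : G₁ × G₂ => 𝒢.act p.1 p.2)
    (hμ₂ : ∀ g : G₁, MeasurePreserving (fun y => 𝒢.act g y) μ₂ μ₂)
    (hcut : ∀ a b, (a ∈ T ↔ b ∈ T) ↔ (a ∈ S ↔ b ∈ S))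
    (F : BoundaryData G₁ G₂ → ENNReal) (hF : Measurable F) :
    amplitude μ₁ μ₂ 𝒢 T m F =
      μ₁ Set.univ ^ (T.card - 1) *
      μ₂ Set.univ ^ (T.card.choose 2 * (6 - T.card) + 3 * T.card.choose 3 -
        (T.card - 1).choose 3) *
      ∫⁻ y, F (rimBoundary 𝒢 y) ∂(Measure.pi fun _ : RimIx₁ S => μ₁).prod
        (Measure.pi fun _ : RimIx₂ S => μ₂) := by
  obtain ⟨i, hi, -, h₂⟩ := h.exists_some 𝒢 hT
  rw [← lintegral_rim hi ht hact hμ₂ hcut F hF]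
  unfold amplitude
  rw [deltaMeasure_congr h₂]

end Main

end TwoGFT

end

theorem mainTheorem1 {G₁ G₂ : Type*}
    [Group G₁] [TopologicalSpace G₁] [IsTopologicalGroup G₁] [T2Space G₁]
    [LocallyCompactSpace G₁] [SecondCountableTopology G₁] [MeasurableSpace G₁] [BorelSpace G₁]
    [Group G₂] [TopologicalSpace G₂] [IsTopologicalGroup G₂] [T2Space G₂]
    [LocallyCompactSpace G₂] [SecondCountableTopology G₂] [MeasurableSpace G₂] [BorelSpace G₂]
    (𝒢 : TwoGFT.CrossedModule G₁ G₂)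
    (ht : Continuous 𝒢.t) (hact : Continuous fun p : G₁ × G₂ => 𝒢.act p.1 p.2)
    (μ₁ : Measure G₁) [μ₁.IsHaarMeasure] [μ₁.IsMulRightInvariant]
    (μ₂ : Measure G₂) [μ₂.IsHaarMeasure] [μ₂.IsMulRightInvariant]
    (hμ₂ : ∀ g : G₁, MeasurePreserving (fun y => 𝒢.act g y) μ₂ μ₂) :
    -- the integrals are well defined, and the Feynman integrals of the field theory are the
    -- amplitudes, times the volume of the variables that drop out of the integrand
    (∀ (T : Finset (Fin 6)) (m : Option (Fin 6)), T.Nonempty → T ≠ Finset.univ →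
      TwoGFT.Admissible μ₁ μ₂ T m →
      (∃! ν, TwoGFT.IsDeltaMeasure μ₁ μ₂ (TwoGFT.feynmanVolume μ₁ μ₂ T)
        (TwoGFT.feynmanDensity 𝒢 T m) ν) ∧
      (∃! ν, TwoGFT.IsDeltaMeasure μ₁ μ₂ (TwoGFT.reducedVolume μ₁ μ₂ T)
        (TwoGFT.reducedDensity 𝒢 T m) ν) ∧
      ∀ F : TwoGFT.BoundaryData G₁ G₂ → ENNReal, Measurable F →
        TwoGFT.feynmanIntegral μ₁ μ₂ 𝒢 T m F =
          μ₁ Set.univ ^ (T.card.choose 2 + T.card.choose 3) *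
            μ₂ Set.univ ^ (T.card.choose 3 * (6 - T.card) + 3 * T.card.choose 4) *
            TwoGFT.amplitude μ₁ μ₂ 𝒢 T m F) ∧
    -- the omitted delta functions are `δ(1)` where the other ones are supported
    (∀ (T : Finset (Fin 6)) (i : Fin 6), i ∈ T → T ≠ Finset.univ →
      (∀ c, TwoGFT.feynmanDensity 𝒢 T (some i) TwoGFT.kronecker TwoGFT.kronecker c =
        TwoGFT.feynmanDensity 𝒢 T none TwoGFT.kronecker TwoGFT.kronecker c) ∧
      (∀ c, TwoGFT.reducedDensity 𝒢 T (some i) TwoGFT.kronecker TwoGFT.kronecker c =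
        TwoGFT.reducedDensity 𝒢 T none TwoGFT.kronecker TwoGFT.kronecker c)) ∧
    -- for finite groups with counting measures the integrals are sums with Kronecker deltas
    (∀ T : Finset (Fin 6), T.Nonempty → T ≠ Finset.univ → TwoGFT.Admissible μ₁ μ₂ T none →
      ∀ F : TwoGFT.BoundaryData G₁ G₂ → ENNReal, Measurable F →
        TwoGFT.feynmanIntegral μ₁ μ₂ 𝒢 T none F =
          ∑' c, ENNReal.ofReal
            (TwoGFT.feynmanDensity 𝒢 T none TwoGFT.kronecker TwoGFT.kronecker c) *
              F (TwoGFT.feynmanBoundary c) ∧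
        TwoGFT.amplitude μ₁ μ₂ 𝒢 T none F =
          ∑' c, ENNReal.ofReal
            (TwoGFT.reducedDensity 𝒢 T none TwoGFT.kronecker TwoGFT.kronecker c) *
              F (TwoGFT.reducedBoundary c)) ∧
    -- the Pachner moves (1,5), (2,4) and (3,3)
    (∀ (T : Finset (Fin 6)) (m m' : Option (Fin 6)),
      TwoGFT.Admissible μ₁ μ₂ T m → TwoGFT.Admissible μ₁ μ₂ Tᶜ m' →
      ∀ F : TwoGFT.BoundaryData G₁ G₂ → ENNReal, Measurable F →
        (T.card = 5 → TwoGFT.amplitude μ₁ μ₂ 𝒢 T m F =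
          μ₁ Set.univ ^ 4 * μ₂ Set.univ ^ 36 * TwoGFT.amplitude μ₁ μ₂ 𝒢 Tᶜ m' F) ∧
        (T.card = 4 → TwoGFT.amplitude μ₁ μ₂ 𝒢 T m F =
          μ₁ Set.univ ^ 2 * μ₂ Set.univ ^ 19 * TwoGFT.amplitude μ₁ μ₂ 𝒢 Tᶜ m' F) ∧
        (T.card = 3 → TwoGFT.amplitude μ₁ μ₂ 𝒢 T m F =
          TwoGFT.amplitude μ₁ μ₂ 𝒢 Tᶜ m' F)) := by
  refine ⟨?_, ?_, ?_, ?_⟩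
  · intro T m hT _ hm
    obtain ⟨i, hi, h₁, h₂⟩ := hm.exists_some 𝒢 hT
    obtain ⟨⟨ν₁, hν₁⟩, ⟨ν₂, hν₂⟩, hZ⟩ := TwoGFT.feynmanIntegral_some (μ₁ := μ₁) hi ht hact hμ₂
    rw [h₁, h₂]
    refine ⟨⟨ν₁, hν₁, fun ν hν => hν.unique μ₁ μ₂ hν₁⟩, ⟨ν₂, hν₂, fun ν hν => hν.unique μ₁ μ₂ hν₂⟩,
      fun F hF => ?_⟩
    have h := hZ F hF
    unfold TwoGFT.feynmanIntegral TwoGFT.amplitude at h ⊢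
    rwa [TwoGFT.deltaMeasure_congr h₁, TwoGFT.deltaMeasure_congr h₂]
  · exact fun T i hi _ => ⟨TwoGFT.feynmanDensity_kronecker hi, TwoGFT.reducedDensity_kronecker hi⟩
  · rintro T - - ⟨_, _, rfl, rfl⟩ F -
    constructor
    · unfold TwoGFT.feynmanIntegral
      rw [TwoGFT.feynmanVolume_count]
      refine TwoGFT.lintegral_deltaMeasure_count (fun c => ?_) _
      refine mul_nonneg (Finset.prod_nonneg fun _ _ => ?_) (Finset.prod_nonneg fun _ _ => ?_) <;>
      exact mul_nonneg (Finset.prod_nonneg fun _ _ => TwoGFT.kronecker_nonneg _)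
        (Finset.prod_nonneg fun _ _ => TwoGFT.kronecker_nonneg _)
    · unfold TwoGFT.amplitude
      rw [TwoGFT.reducedVolume_count]
      refine TwoGFT.lintegral_deltaMeasure_count (fun c => ?_) _
      exact mul_nonneg (Finset.prod_nonneg fun _ _ => TwoGFT.kronecker_nonneg _)
        (Finset.prod_nonneg fun _ _ => TwoGFT.kronecker_nonneg _)
  · intro T m m' hm hm' F hF
    -- Both amplitudes are expressed by the integral for the cut of `T`, so that they differ only in
    -- the powers of the volumes.
    have key : ∀ k, T.card = k → 0 < k → k < 6 →
        TwoGFT.amplitude μ₁ μ₂ 𝒢 T m F = μ₁ Set.univ ^ (k - 1) *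
          μ₂ Set.univ ^ (k.choose 2 * (6 - k) + 3 * k.choose 3 - (k - 1).choose 3) *
          ∫⁻ y, F (TwoGFT.rimBoundary 𝒢 y) ∂(Measure.pi fun _ : TwoGFT.RimIx₁ T => μ₁).prod
            (Measure.pi fun _ : TwoGFT.RimIx₂ T => μ₂) ∧
        TwoGFT.amplitude μ₁ μ₂ 𝒢 Tᶜ m' F = μ₁ Set.univ ^ (6 - k - 1) *
          μ₂ Set.univ ^ ((6 - k).choose 2 * (6 - (6 - k)) + 3 * (6 - k).choose 3 -
            (6 - k - 1).choose 3) *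
          ∫⁻ y, F (TwoGFT.rimBoundary 𝒢 y) ∂(Measure.pi fun _ : TwoGFT.RimIx₁ T => μ₁).prod
            (Measure.pi fun _ : TwoGFT.RimIx₂ T => μ₂) := by
      rintro k rfl h0 h6
      have hc : Tᶜ.card = 6 - T.card := by rw [Finset.card_compl, Fintype.card_fin]
      refine ⟨TwoGFT.amplitude_eq_rim hm (Finset.card_pos.1 h0) ht hact hμ₂ (fun _ _ => Iff.rfl)
        F hF, ?_⟩
      rw [← hc]
      refine TwoGFT.amplitude_eq_rim hm' (Finset.card_pos.1 (by omega)) ht hact hμ₂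
        (fun a b => ?_) F hF
      -- The complement induces the same partition of the indices.
      rw [Finset.mem_compl, Finset.mem_compl, not_iff_not]
    -- For `k = 1, 2, 3, 4, 5` the exponents of the `G₂` volume are `0, 4, 12, 23, 36`, and those of
    -- the `G₁` volume are `k - 1`. The factors are stated as products, not quotients, as the
    -- volumes may be infinite.
    refine ⟨fun h => ?_, fun h => ?_, fun h => ?_⟩
    · rw [(key _ h (by norm_num) (by norm_num)).1, (key _ h (by norm_num) (by norm_num)).2]
      simp [Nat.choose]
    · rw [(key _ h (by norm_num) (by norm_num)).1, (key _ h (by norm_num) (by norm_num)).2]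
      simp only [Nat.choose]
      norm_num
      ring
    · rw [(key _ h (by norm_num) (by norm_num)).1, (key _ h (by norm_num) (by norm_num)).2]
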